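/- Let $k$ be a field and $\mathrm{Vect}$ the category of $k$-vector spaces. For a small category $C$ and a functor $F\colon C\to \mathrm{Vect}$ let $H_j(C,F)$ be the $j$-th left derived functor of $\varinjlim_C$, evaluated at $F$. A fat graph is a finite connected graph with a cyclic order on the set of flags (germs of edges) at each vertex; it has no vertices of valence one, and at least one edge. Thickening it gives an oriented surface with boundary, which defines its genus and its number of boundary components. Let $\mathbb{TM}'^{3}_0$ be the category whose objects are the fat graphs of genus $0$ with three boundary components, numbered $1,2,3$ (two-valent vertices are allowed). Its morphisms are composites of isomorphisms of fat graphs, shrinkings of edges which are not loops, and insertions of two-valent vertices on edges, all respecting the numbering of the boundary components; two composites $\Gamma\to\Gamma'$ are identified if the induced maps of CW complexes are homotopic relative to the vertices of $\Gamma$. Let $\Lambda$ be Connes' cyclic category, the category of polygons $[n]$ with $n\ge 1$ vertices; a morphism is a map of vertices with a total order on each fibre, such that reading the fibres in turn around the target is going once around the source. For $i=1,2,3$ let $\partial_i\colon\mathbb{TM}'^{3}_0\to\Lambda$ be the boundary functor: the vertices of the polygon $\partial_i\Gamma$ are the corners (pairs of consecutive flags at a vertex of $\Gamma$) on the $i$-th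 boundary component, and its edges run along the edges of $\Gamma$ from one corner to the next. Let $\Delta_2$ be the category of finite linearly ordered sets with at least two elements and nondecreasing maps which preserve the least and the greatest element. Let $[1]\backslash \mathrm{Id}_\Lambda$ be the category of polygons $X$ with a morphism $[1]\to X$ (that is, a labelled vertex), $p_i\colon[1]\backslash \mathrm{Id}_\Lambda\to\Lambda$ the functor forgetting the label, and $i_i\colon\Delta_2\to[1]\backslash \mathrm{Id}_\Lambda$ the functor which glues the least element of a linearly ordered set to the greatest one and labels the resulting vertex of the polygon so obtained ($i=1,2,3$). (1) For every functor $G\colon\Lambda\times\Lambda\times\Lambda\to \mathrm{Vect}$ and every $j\ge 0$ there is an isomorphism $$H_j\bigl(\mathbb{TM}'^{3}_0,(\partial_1\times\partial_2\times\partial_3)^*G\bigr)\cong H_j\bigl(\Delta_2\times\Delta_2\times\Delta_2,(p_1i_1\times p_2i_2\times p_3i_3)^*G\bigr).$$ (2) For an associative unital $k$-algebra $A$ let $A^{\#}\colon\Lambda\to \mathrm{Vect}$ be the functor which sends a polygon to the tensor power of $A$ with one factor for each vertex, and a morphism to the map which multiplies the factors over each vertex in the order of the fibre and puts $1$ at the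 vertices with empty fibre. For three such algebras put $H^0_j(A_1,A_2,A_3)=H_j\bigl(\mathbb{TM}'^{3}_0,\;A_1^{\#}\circ\partial_1\otimes A_2^{\#}\circ\partial_2\otimes A_3^{\#}\circ\partial_3\bigr)$. Then for every $j\ge0$ $$H^0_j(A_1,A_2,A_3)\cong\bigoplus_{a+b+c=j}H_a(A_1)\otimes_k H_b(A_2)\otimes_k H_c(A_3)$$ as $k$-vector spaces, where $H_*(A)$ is the Hochschild homology of $A$, the homology of the complex with terms $A^{\otimes (m+1)}$ and the Hochschild differential. -/

import Mathlib

open CategoryTheory CategoryTheory.Limits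

universe u
namespace GraphHomology

/-! ### Homology of small categories -/

section
variable (k : Type u) [Field k] (C : Type) [SmallCategory C]

/-- The category of functors from a small category to vector spaces has enough projectives. -/
instance functorCategory_enoughProjectives : EnoughProjectives (C ⥤ ModuleCat.{u} k) where
  presentation F := by
    let L : C → (C ⥤ ModuleCat.{u} k) := fun c =>
      (evaluationLeftAdjoint (ModuleCat.{u} k) c).obj (Projective.over (F.obj c))
    have hL : ∀ c, Projective (L c) := fun c =>
      (evaluationAdjunctionRight (ModuleCat.{u} k) c).map_projective _ inferInstance
    let f : ∀ c, L c ⟶ F := fun c =>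
      ((evaluationAdjunctionRight (ModuleCat.{u} k) c).homEquiv _ _).symm (Projective.π (F.obj c))
    have hf : ∀ c, Epi ((f c).app c) := fun c => by
      have h : (evaluationAdjunctionRight (ModuleCat.{u} k) c).unit.app _ ≫ (f c).app c =
          Projective.π (F.obj c) :=
        ((evaluationAdjunctionRight (ModuleCat.{u} k) c).homEquiv _ _).apply_symm_apply _
      exact epi_of_epi_fac h
    have hP : Projective (∐ L) := by
      constructor
      intro E X g e he
      refine ⟨Sigma.desc fun c => Projective.factorThru (Sigma.ι L c ≫ g) e, ?_⟩
      apply Sigma.hom_ext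
      intro c
      rw [← Category.assoc, Sigma.ι_desc, Projective.factorThru_comp]
    refine ⟨{ p := ∐ L, projective := hP, f := Sigma.desc f, epi := ?_ }⟩
    rw [NatTrans.epi_iff_epi_app]
    intro c
    have h : (Sigma.ι L c).app c ≫ (Sigma.desc f).app c = (f c).app c := by
      rw [← NatTrans.comp_app, Sigma.ι_desc]
    have := hf c
    exact epi_of_epi_fac h

variable {k C} in
/-- The homology `H_j(C, F)` of a small category `C` with coefficients in a functor `F` to vector
spaces: the `j`-th left derived functor of the colimit functor, evaluated at `F`. -/
noncomputable def catHomology (F : C ⥤ ModuleCat.{u} k) (j : ℕ) : ModuleCat.{u} k :=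
  ((colim (J := C) (C := ModuleCat.{u} k)).leftDerived j).obj F

end


/-! ### Paths for a self-map -/

/-- `IsPath φ a l b`: the list `l` consists of the successive points `a, φ a, φ (φ a), …`, and `b` is
the point following the last of them (`b = a` if `l` is empty). -/
def IsPath {X : Type} (φ : X → X) : X → List X → X → Prop
  | a, [], b => a = b
  | a, x :: l, b => x = a ∧ IsPath φ (φ a) l b

theorem IsPath.append {X : Type} {φ : X → X} {a b c : X} {l m : List X}
    (h : IsPath φ a l b) (h' : IsPath φ b m c) : IsPath φ a (l ++ m) c := by
  induction l generalizing a with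
  | nil => cases h; exact h'
  | cons x l ih => exact ⟨h.1, ih h.2⟩

theorem IsPath.eq_map {X : Type} {φ : X → X} {a b : X} {l : List X} (h : IsPath φ a l b) :
    l = (List.range l.length).map (fun j => φ^[j] a) := by
  induction l generalizing a with
  | nil => rfl
  | cons x l ih =>
    obtain ⟨rfl, h⟩ := h
    rw [List.length_cons, List.range_succ_eq_map, List.map_cons, List.map_map]
    congr 1
    exact ih h

theorem IsPath.flatMap {X Y : Type} {φ : X → X} {ψ : Y → Y} {r : Y → List X} {s : Y → X}
    (hr : ∀ y, IsPath φ (s y) (r y) (s (ψ y))) {a b : Y} {l : List Y} (h : IsPath ψ a l b) :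
    IsPath φ (s a) (l.flatMap r) (s b) := by
  induction l generalizing a with
  | nil => cases h; rfl
  | cons x l ih =>
    obtain ⟨rfl, h⟩ := h
    exact (hr x).append (ih h)

theorem isPath_range {X : Type} (φ : X → X) (a : X) (n : ℕ) :
    IsPath φ a ((List.range n).map fun j => φ^[j] a) (φ^[n] a) := by
  induction n generalizing a with
  | zero => rfl
  | succ n ih =>
    rw [List.range_succ_eq_map, List.map_cons, List.map_map]
    exact ⟨rfl, ih (φ a)⟩

/-! ### The fibre lists of a map with ordered fibres -/

/-- `r : Y → List X` is the family of fibres of a map `X → Y`, each with a total order: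
every `x` occurs in exactly one of the lists, and there exactly once. -/
def IsFibering {X Y : Type} (r : Y → List X) : Prop :=
  (∀ y, (r y).Nodup) ∧ ∀ x, ∃! y, x ∈ r y

theorem IsFibering.id (X : Type) : IsFibering fun x : X => [x] :=
  ⟨fun _ => List.nodup_singleton _, fun x => ⟨x, by simp, fun y h => (List.mem_singleton.1 h).symm⟩⟩

theorem IsFibering.comp {X Y Z : Type} {r : Y → List X} {t : Z → List Y} (hr : IsFibering r)
    (ht : IsFibering t) : IsFibering fun z => (t z).flatMap r := by
  refine ⟨fun z => List.nodup_flatMap.2 ⟨fun y _ => hr.1 y, ?_⟩, fun x => ?_⟩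
  · refine (ht.1 z).imp fun {y y'} hne x hx hx' => hne ?_
    exact (hr.2 x).unique hx hx'
  · obtain ⟨y, hy, hy'⟩ := hr.2 x
    obtain ⟨z, hz, hz'⟩ := ht.2 y
    refine ⟨z, List.mem_flatMap.2 ⟨y, hz, hy⟩, fun z₁ h => ?_⟩
    obtain ⟨y₁, h₁, h₂⟩ := List.mem_flatMap.1 h
    obtain rfl := hy' _ h₂
    exact hz' _ h₁

/-- An ordered product over a list without repetitions is affine in each single entry. -/
theorem IsFibering.prod_map_update {X M : Type*} [DecidableEq X] [Monoid M] (l : List X)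
    (hl : l.Nodup) (a : X → M) {x : X} (hx : x ∈ l) :
    ∃ P Q : M, ∀ v, (l.map (Function.update a x v)).prod = P * v * Q := by
  obtain ⟨l₁, l₂, rfl⟩ := List.append_of_mem hx
  have hd := List.nodup_append.1 hl
  have h₁ : x ∉ l₁ := fun h => hd.2.2 x h x (by simp) rfl
  have h₂ : x ∉ l₂ := (List.nodup_cons.1 hd.2.1).1
  refine ⟨(l₁.map a).prod, (l₂.map a).prod, fun v => ?_⟩
  have e : ∀ l : List X, x ∉ l → l.map (Function.update a x v) = l.map a := fun l h =>
    List.map_congr_left fun z hz => Function.update_of_ne (fun e : z = x => h (e ▸ hz)) _ _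
  simp [e _ h₁, e _ h₂, mul_assoc]

section Mul
variable (k : Type u) [Field k] (A : Type u) [Ring A] [Algebra k A]

open scoped TensorProduct

/-- The multilinear map `a ↦ ⨂_y ∏_{x ∈ r y} a x`. -/
noncomputable def fiberMulAux {X Y : Type} {r : Y → List X} (hr : IsFibering r) :
    MultilinearMap k (fun _ : X => A) (⨂[k] _ : Y, A) := by
  classical
  have key : ∀ (a : X → A) (x : X), ∃ (y₀ : Y) (P Q : A), ∀ v : A,
      (fun y => ((r y).map (Function.update a x v)).prod) =
        Function.update (fun y => ((r y).map a).prod) y₀ (P * v * Q) := fun a x => by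
    obtain ⟨y₀, hy₀, huniq⟩ := hr.2 x
    obtain ⟨P, Q, h⟩ := IsFibering.prod_map_update (r y₀) (hr.1 y₀) a hy₀
    refine ⟨y₀, P, Q, fun v => funext fun y => ?_⟩
    by_cases hy : y = y₀
    · subst hy; simp [h]
    · rw [Function.update_of_ne hy]
      congr 1
      exact List.map_congr_left fun z hz =>
        Function.update_of_ne (fun e : z = x => hy (huniq y (e ▸ hz))) _ _
  exact MultilinearMap.mk' (fun a => PiTensorProduct.tprod k fun y => ((r y).map a).prod)
    (fun a x v w => by
      obtain ⟨y₀, P, Q, h⟩ := key a x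
      simp only [h, mul_add, add_mul, MultilinearMap.map_update_add])
    (fun a x c v => by
      obtain ⟨y₀, P, Q, h⟩ := key a x
      simp only [h, mul_smul_comm, smul_mul_assoc, MultilinearMap.map_update_smul])

/-- The linear map `⨂_x a x ↦ ⨂_y ∏_{x ∈ r y} a x`, the products being taken in the order of the
fibres (an empty product is `1`). -/
noncomputable def fiberMul {X Y : Type} {r : Y → List X} (hr : IsFibering r) :
    (⨂[k] _ : X, A) →ₗ[k] (⨂[k] _ : Y, A) :=
  PiTensorProduct.lift (fiberMulAux k A hr)

@[simp]
theorem fiberMul_tprod {X Y : Type} {r : Y → List X} (hr : IsFibering r) (a : X → A) :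
    fiberMul k A hr (PiTensorProduct.tprod k a) =
      PiTensorProduct.tprod k fun y => ((r y).map a).prod := by
  simp only [fiberMul, PiTensorProduct.lift.tprod]
  rfl

theorem fiberMul_id (X : Type) : fiberMul k A (IsFibering.id X) = LinearMap.id := by
  ext a
  simp

theorem fiberMul_comp {X Y Z : Type} {r : Y → List X} {t : Z → List Y} (hr : IsFibering r)
    (ht : IsFibering t) :
    fiberMul k A (hr.comp ht) = fiberMul k A ht ∘ₗ fiberMul k A hr := by
  ext a
  have h : ∀ l : List Y, ((l.flatMap r).map a).prod =
      (l.map fun y => ((r y).map a).prod).prod := fun l => by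
    induction l with
    | nil => rfl
    | cons y l ih => simp [ih]
  simp [h]

end Mul

/-! ### Connes' cyclic category -/

/-- An object of Connes' cyclic category `Λ`: a polygon (cyclic graph), i.e. a nonempty finite set
of vertices with a successor permutation which is a single cycle. The directed edges of the polygon
are `x → next x`. -/
structure Polygon where
  /-- the vertices -/
  V : Type
  [fintype : Fintype V]
  [nonempty : Nonempty V]
  /-- the next vertex in the cyclic order -/
  next : Equiv.Perm V
  cyclic : ∀ x y : V, ∃ j : ℕ, next^[j] x = y

attribute [instance] Polygon.fintype Polygon.nonempty

namespace Polygon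

/-- The vertices in the order in which they are met going once around from `x`. -/
def turn (X : Polygon) (x : X.V) : List X.V :=
  (List.range (Fintype.card X.V)).map fun j => X.next^[j] x

/-- A morphism `X → Y` of the cyclic category: a map from the vertices of `X` to the vertices of
`Y` together with a total order on each of its fibres, such that reading the fibres one after
another while going once around `Y` amounts to going once around `X`. The map is recorded through
its ordered fibres `fiber y`, listed in increasing order. -/
@[ext]
structure Hom (X Y : Polygon) where
  /-- the vertices of `X` over `y`, in their order -/
  fiber : Y.V → List X.V
  isFibering : IsFibering fiber
  cyclic : ∀ y, ∃ x, (Y.turn y).flatMap fiber = X.turn x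

/-- Connes' cyclic category `Λ`. -/
instance : Category Polygon where
  Hom := Hom
  id X := ⟨fun x => [x], IsFibering.id _, fun y => ⟨y, by simp [turn]⟩⟩
  comp {X Y Z} f g := ⟨fun z => (g.fiber z).flatMap f.fiber, f.isFibering.comp g.isFibering,
    fun z => by
      obtain ⟨y, hy⟩ := g.cyclic z
      obtain ⟨x, hx⟩ := f.cyclic y
      exact ⟨x, by rw [← hx, ← hy, List.flatMap_assoc]⟩⟩
  id_comp f := Hom.ext (by funext y; simp)
  comp_id f := Hom.ext (by funext y; simp)
  assoc f g h := Hom.ext (by funext y; simp [List.flatMap_assoc])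

theorem nodup_turn (X : Polygon) (x : X.V) : (X.turn x).Nodup ∧ ∀ z, z ∈ X.turn x := by
  have hs : ∀ z, z ∈ X.turn x := by
    have hp : Function.IsPeriodicPt X.next (Function.minimalPeriod X.next x) x :=
      Function.isPeriodicPt_minimalPeriod _ _
    have hle : Function.minimalPeriod X.next x ≤ Fintype.card X.V := by
      have := (Function.nodup_periodicOrbit (f := X.next) (x := x))
      have h2 := Cycle.nodup_coe_iff.1 this
      simpa using h2.length_le_card
    have hpos : 0 < Function.minimalPeriod X.next x := by
      apply Function.minimalPeriod_pos_of_mem_periodicPts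
      exact (Function.Injective.mem_periodicPts X.next.injective x)
    intro z
    obtain ⟨j, rfl⟩ := X.cyclic x z
    refine List.mem_map.2 ⟨j % Function.minimalPeriod X.next x, ?_, ?_⟩
    · exact List.mem_range.2 ((Nat.mod_lt _ hpos).trans_le hle)
    · exact (Function.iterate_mod_minimalPeriod_eq)
  refine ⟨?_, hs⟩
  classical
  rw [← Multiset.coe_nodup, ← Multiset.toFinset_card_eq_card_iff_nodup]
  have : (X.turn x : Multiset X.V).toFinset = Finset.univ := by ext z; simp [hs]
  rw [this]; simp [turn]

/-- A fibering whose fibres are consecutive arcs is a morphism of polygons. -/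
def homOfPath {X Y : Polygon} (r : Y.V → List X.V) (hr : IsFibering r) (s : Y.V → X.V)
    (hs : ∀ y, IsPath X.next (s y) (r y) (s (Y.next y))) : X ⟶ Y where
  fiber := r
  isFibering := hr
  cyclic y := by
    refine ⟨s y, ?_⟩
    have h := (IsPath.flatMap hs (isPath_range Y.next y (Fintype.card Y.V))).eq_map
    have hn : ((Y.turn y).flatMap r).Nodup := by
      refine List.nodup_flatMap.2 ⟨fun y _ => hr.1 y, ?_⟩
      refine (Y.nodup_turn y).1.imp fun {y y'} hne x hx hx' => hne ?_
      exact (hr.2 x).unique hx hx'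
    have hm : ∀ x, x ∈ (Y.turn y).flatMap r := fun x => by
      obtain ⟨y', h, -⟩ := hr.2 x
      exact List.mem_flatMap.2 ⟨y', (Y.nodup_turn y).2 y', h⟩
    have hl : ((Y.turn y).flatMap r).length = Fintype.card X.V := by
      classical
      rw [← List.toFinset_card_of_nodup hn]
      have : ((Y.turn y).flatMap r).toFinset = Finset.univ := by
        ext z; simpa using hm z
      rw [this]; simp
    change (Y.turn y).flatMap r = _ at h
    rw [h]
    change List.map _ (List.range ((Y.turn y).flatMap r).length) = _
    rw [hl]; rfl

@[ext]
theorem hom_ext {X Y : Polygon} {f g : X ⟶ Y} (h : ∀ y, Hom.fiber f y = Hom.fiber g y) : f = g :=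
  Hom.ext (funext h)

end Polygon

section
variable (k : Type u) [Field k] (A : Type u) [Ring A] [Algebra k A]
open scoped TensorProduct
/-- The functor `A^♯ : Λ → Vect`: a polygon is sent to the tensor power of `A` with one factor for
each vertex, and a morphism multiplies the factors over each vertex in the order of the fibre,
putting the unit where the fibre is empty. -/
noncomputable def sharp : Polygon ⥤ ModuleCat.{u} k where
  obj X := ModuleCat.of k (⨂[k] _ : X.V, A)
  map f := ModuleCat.ofHom (fiberMul k A (Polygon.Hom.isFibering f))
  map_id X := by
    rw [← ModuleCat.ofHom_id, ← fiberMul_id k A]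
  map_comp f g := by
    rw [← ModuleCat.ofHom_comp, ← fiberMul_comp k A]
end

/-! ### The category Δ₂ -/

/-- The objects of `Δ₂` are the linearly ordered sets with at least two elements; `⟨n⟩` stands for
the set with `n + 2` elements, `Fin (n + 2)`. -/
structure DeltaTwo where
  /-- the number of elements, minus two -/
  n : ℕ

namespace DeltaTwo

/-- A morphism of `Δ₂`: a nondecreasing map preserving the least and the greatest element. -/
@[ext]
structure Hom (a b : DeltaTwo) where
  /-- the underlying map -/
  toFun : Fin (a.n + 2) → Fin (b.n + 2)
  monotone : Monotone toFun
  map_zero : toFun 0 = 0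
  map_last : toFun (Fin.last _) = Fin.last _

/-- The category `Δ₂`. -/
instance : SmallCategory DeltaTwo where
  Hom := Hom
  id a := ⟨fun x => x, monotone_id, rfl, rfl⟩
  comp f g := ⟨fun x => g.toFun (f.toFun x), g.monotone.comp f.monotone,
    by rw [f.map_zero, g.map_zero], by rw [f.map_last, g.map_last]⟩

/-- The polygon obtained from the linearly ordered set `0 < 1 < ⋯ < n + 1` by identifying the least
and the greatest element; its vertices are `0, …, n`. -/
def polygon (a : DeltaTwo) : Polygon where
  V := Fin (a.n + 1)
  next := finRotate (a.n + 1)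
  cyclic x y := by
    have h : ∀ (j : ℕ) (x : Fin (a.n + 1)), (finRotate (a.n + 1))^[j] x = x + Fin.ofNat (a.n+1) j := by
      intro j
      induction j with
      | zero => intro x; simp
      | succ j ih =>
        intro x
        rw [Function.iterate_succ_apply, ih, finRotate_apply]
        ext
        simp only [Fin.val_add, Fin.val_ofNat, Fin.val_one', Nat.mod_add_mod, Nat.add_mod_mod]
        congr 1
        omega
    refine ⟨(y - x).val, ?_⟩
    rw [h]
    simp

/-- The vertices `x` of the source polygon with `f x = j`, in increasing order. -/
def interior {a b : DeltaTwo} (f : Hom a b) (j : Fin (b.n + 2)) : List (Fin (a.n + 1)) :=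
  (List.finRange (a.n + 1)).filter fun x => f.toFun x.castSucc = j

/-- The ordered fibres of the map of polygons induced by `f`. Over the vertex `0`, at which the
greatest and the least element are glued, one first meets the elements sent to the greatest element
and then those sent to the least one. -/
def fiber {a b : DeltaTwo} (f : Hom a b) (y : Fin (b.n + 1)) : List (Fin (a.n + 1)) :=
  if y = 0 then interior f (Fin.last _) ++ interior f 0 else interior f y.castSucc

theorem mem_interior {a b : DeltaTwo} (f : Hom a b) (j : Fin (b.n + 2)) (x : Fin (a.n + 1)) :
    x ∈ interior f j ↔ f.toFun x.castSucc = j := by simp [interior]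

theorem mem_fiber {a b : DeltaTwo} (f : Hom a b) (y : Fin (b.n + 1)) (x : Fin (a.n + 1)) :
    x ∈ fiber f y ↔ f.toFun x.castSucc = y.castSucc ∨ (y = 0 ∧ f.toFun x.castSucc = Fin.last _) := by
  unfold fiber
  split_ifs with h
  · subst h; simp [mem_interior, or_comm]
  · simp [mem_interior, h]

theorem interior_sorted {a b : DeltaTwo} (f : Hom a b) (j : Fin (b.n + 2)) :
    (interior f j).Pairwise (· < ·) :=
  (List.pairwise_lt_finRange _).filter _

theorem fiber_isFibering {a b : DeltaTwo} (f : Hom a b) : IsFibering (fiber f) := by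
  refine ⟨fun y => ?_, fun x => ?_⟩
  · have hn : ∀ j, (interior f j).Nodup := fun j => (List.nodup_finRange _).filter _
    unfold fiber
    split_ifs
    · refine List.nodup_append.2 ⟨hn _, hn _, fun x hx z hz e => ?_⟩
      subst e
      rw [mem_interior] at hx hz
      rw [hx] at hz
      simp [Fin.ext_iff] at hz
    · exact hn _
  · simp only [mem_fiber]
    rcases Fin.eq_castSucc_or_eq_last (f.toFun x.castSucc) with ⟨y, hy⟩ | hl
    · refine ⟨y, Or.inl hy, ?_⟩
      rintro z (hz | ⟨-, hz⟩)
      · exact Fin.castSucc_injective _ (hz.symm.trans hy)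
      · rw [hy] at hz; exact absurd hz (Fin.castSucc_ne_last _)
    · refine ⟨0, Or.inr ⟨rfl, hl⟩, ?_⟩
      rintro z (hz | ⟨hz, -⟩)
      · rw [hl] at hz; exact absurd hz.symm (Fin.castSucc_ne_last _)
      · exact hz

theorem exists_ge {a b : DeltaTwo} (f : Hom a b) (j : Fin (b.n + 2)) :
    ∃ x : ℕ, ∃ h : x < a.n + 2, j ≤ f.toFun ⟨x, h⟩ :=
  ⟨a.n + 1, by omega, by
    have : (⟨a.n + 1, by omega⟩ : Fin (a.n + 2)) = Fin.last _ := rfl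
    rw [this, f.map_last]; exact Fin.le_last _⟩

open Classical in
/-- The least `x` with `j ≤ f x`. -/
noncomputable def cut {a b : DeltaTwo} (f : Hom a b) (j : Fin (b.n + 2)) : ℕ := Nat.find (exists_ge f j)

theorem cut_le {a b : DeltaTwo} (f : Hom a b) (j : Fin (b.n + 2)) : cut f j ≤ a.n + 1 := by
  classical
  obtain ⟨h, -⟩ := Nat.find_spec (exists_ge f j)
  exact Nat.lt_succ_iff.1 h

theorem lt_cut {a b : DeltaTwo} (f : Hom a b) (j : Fin (b.n + 2)) (x : Fin (a.n + 2)) :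
    x.val < cut f j ↔ f.toFun x < j := by
  classical
  constructor
  · intro h
    by_contra hc
    exact Nat.find_min (exists_ge f j) h ⟨x.2, not_lt.1 hc⟩
  · intro h
    by_contra hc
    obtain ⟨h1, h2⟩ := Nat.find_spec (exists_ge f j)
    have : f.toFun ⟨_, h1⟩ ≤ f.toFun x := f.monotone (not_lt.1 hc)
    exact absurd (h2.trans this) (not_le.2 h)

theorem isPath_of_range {n : ℕ} (m : ℕ) : ∀ (c : ℕ) (l : List (Fin (n + 1))), c + m ≤ n + 1 →
    l.map Fin.val = List.range' c m →
    IsPath (finRotate (n + 1)) (Fin.ofNat (n + 1) c) l (Fin.ofNat (n + 1) (c + m)) := by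
  induction m with
  | zero =>
    intro c l _ h
    obtain rfl : l = [] := by simpa using h
    rfl
  | succ m ih =>
    intro c l hc h
    cases l with
    | nil => simp [List.range'_succ] at h
    | cons x l =>
      rw [List.range'_succ, List.map_cons, List.cons.injEq] at h
      have hx : x = Fin.ofNat (n + 1) c := by
        ext; rw [h.1]; simp [Nat.mod_eq_of_lt (show c < n + 1 by omega)]
      refine ⟨hx, ?_⟩
      have := ih (c + 1) l (by omega) h.2
      have e : finRotate (n + 1) (Fin.ofNat (n + 1) c) = Fin.ofNat (n + 1) (c + 1) := by
        rw [finRotate_apply]; ext; simp [Fin.val_add]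
      rw [e, show c + (m + 1) = c + 1 + m by omega]
      exact this

theorem interior_path {a b : DeltaTwo} (f : Hom a b) (j : Fin (b.n + 2)) (d : ℕ) (hd : d ≤ a.n + 1)
    (hcd : cut f j ≤ d) (h : ∀ x : Fin (a.n + 1), x.val < d ↔ f.toFun x.castSucc ≤ j) :
    IsPath (finRotate (a.n + 1)) (Fin.ofNat (a.n + 1) (cut f j)) (interior f j)
      (Fin.ofNat (a.n + 1) d) := by
  have := isPath_of_range (n := a.n) (d - cut f j) (cut f j) (interior f j) (by omega) (by
    refine List.Perm.eq_of_pairwise (le := (· < ·)) ?_ ?_ ?_ ?_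
    · intro x y _ _ h1 h2; omega
    · exact List.pairwise_map.2 ((interior_sorted f j))
    · exact List.pairwise_lt_range'
    · refine (List.perm_ext_iff_of_nodup ?_ ?_).2 fun x => ?_
      · exact (((List.nodup_finRange _).filter _)).map Fin.val_injective
      · exact List.nodup_range'
      · simp only [List.mem_map, mem_interior, List.mem_range'_1]
        constructor
        · rintro ⟨z, hz, rfl⟩
          have h1 := (lt_cut f j z.castSucc)
          have h2 := (h z)
          rw [hz] at h1 h2
          simp at h1 h2
          omega
        · rintro ⟨h1, h2⟩
          refine ⟨⟨x, by omega⟩, ?_, rfl⟩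
          refine le_antisymm ((h _).1 (by simp; omega)) ?_
          have := (lt_cut f j (Fin.castSucc ⟨x, by omega⟩)).not.1 (by simpa using h1)
          exact not_lt.1 this)
  rwa [Nat.add_sub_cancel' hcd] at this

/-- The vertex of the source polygon at which the fibre over `y` starts. -/
noncomputable def start {a b : DeltaTwo} (f : Hom a b) (y : Fin (b.n + 1)) : Fin (a.n + 1) :=
  Fin.ofNat _ (cut f (if y = 0 then Fin.last _ else y.castSucc))

theorem fiber_path {a b : DeltaTwo} (f : Hom a b) (y : Fin (b.n + 1)) :
    IsPath (finRotate (a.n + 1)) (start f y) (fiber f y) (start f (finRotate _ y)) := by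
  have hnext : start f (finRotate _ y) = Fin.ofNat _ (cut f y.succ) := by
    unfold start
    rcases eq_or_ne y (Fin.last _) with rfl | hy
    · simp
    · have hlt : y.val < b.n := by
        have := Fin.val_lt_last hy; simpa using this
      have h0 : finRotate (b.n + 1) y ≠ 0 := by
        intro e
        have := coe_finRotate_of_ne_last hy
        rw [e] at this; simp at this
      rw [if_neg h0]
      congr 2
      ext
      rw [Fin.val_castSucc, coe_finRotate_of_ne_last hy, Fin.val_succ]
  have hstep : ∀ z : Fin (b.n + 1), IsPath (finRotate (a.n + 1))
      (Fin.ofNat (a.n + 1) (cut f z.castSucc)) (interior f z.castSucc)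
      (Fin.ofNat (a.n + 1) (cut f z.succ)) := fun z => by
    refine interior_path f _ _ (cut_le f _) ?_ fun x => ?_
    · by_contra hc
      push Not at hc
      have h1 := cut_le f z.castSucc
      have h2 := (lt_cut f z.castSucc ⟨cut f z.succ, by omega⟩).1 hc
      have h3 := (lt_cut f z.succ ⟨cut f z.succ, by omega⟩).2 (h2.trans Fin.castSucc_lt_succ)
      simp at h3
    · have := lt_cut f z.succ x.castSucc
      rw [Fin.val_castSucc] at this
      rw [this, Fin.le_castSucc_iff]
  rw [hnext]
  unfold start fiber
  by_cases hy : y = 0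
  · subst hy
    rw [if_pos rfl, if_pos rfl]
    refine IsPath.append (b := 0) ?_ ?_
    · have := interior_path f (Fin.last _) (a.n + 1) le_rfl (cut_le _ _) (fun x => by
        have := x.2
        simp only [Fin.le_last, iff_true]; exact this)
      have e : Fin.ofNat (a.n + 1) (a.n + 1) = 0 := by ext; simp
      rwa [e] at this
    · have := hstep 0
      have e : cut f (Fin.castSucc 0) = 0 := by
        by_contra hc
        have := (lt_cut f (Fin.castSucc 0) 0).1 (Nat.pos_of_ne_zero hc)
        simp at this
      rw [e] at this
      exact this
  · rw [if_neg hy, if_neg hy]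
    exact hstep y

theorem flatMap_interior {a b : DeltaTwo} (f : Hom a b) (p : Fin (b.n + 1) → Prop)
    [DecidablePred p] :
    ((List.finRange (b.n + 1)).filter p).flatMap (fun y => interior f y.castSucc) =
      (List.finRange (a.n + 1)).filter fun x => ∃ y, p y ∧ f.toFun x.castSucc = y.castSucc := by
  have h1 : (((List.finRange (b.n + 1)).filter p).flatMap
      (fun y => interior f y.castSucc)).Pairwise (· < ·) := by
    refine List.pairwise_flatMap.2 ⟨fun y _ => interior_sorted f _, ?_⟩
    refine ((List.pairwise_lt_finRange _).filter _).imp fun {y z} hyz x hx w hw => ?_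
    rw [mem_interior] at hx hw
    by_contra hc
    have := f.monotone (Fin.castSucc_le_castSucc_iff.2 (not_lt.1 hc))
    rw [hx, hw, Fin.castSucc_le_castSucc_iff] at this
    exact absurd hyz (not_lt.2 this)
  have h2 := (List.pairwise_lt_finRange (a.n + 1)).filter
    fun x => decide (∃ y, p y ∧ f.toFun x.castSucc = y.castSucc)
  refine List.Perm.eq_of_pairwise (fun x y _ _ h h' => absurd h (not_lt.2 h'.le)) h1 h2
    ((List.perm_ext_iff_of_nodup (h1.imp ne_of_lt) (h2.imp ne_of_lt)).2 fun x => ?_)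
  simp [mem_interior]

theorem fiber_id (a : DeltaTwo) (y : Fin (a.n + 1)) :
    fiber (a := a) (b := a) (𝟙 a : a ⟶ a) y = [y] := by
  have h : ∀ y : Fin (a.n + 1), interior (a := a) (b := a) (𝟙 a : a ⟶ a) y.castSucc = [y] := by
    intro y
    have : interior (a := a) (b := a) (𝟙 a : a ⟶ a) y.castSucc =
        (List.finRange (a.n + 1)).filter (fun x => x = y) := by
      refine List.filter_congr fun x _ => ?_
      exact decide_eq_decide.2 Fin.castSucc_inj
    rw [this]
    have h2 := List.filter_eq (l := List.finRange (a.n + 1)) y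
    simpa [List.count_finRange] using h2
  unfold fiber
  split_ifs with hy
  · subst hy
    have h0 : interior (a := a) (b := a) (𝟙 a : a ⟶ a) (Fin.last _) = [] := by
      refine List.filter_eq_nil_iff.2 fun x _ => ?_
      have : Hom.toFun (𝟙 a : a ⟶ a) x.castSucc = x.castSucc := rfl
      rw [this]
      simp
    rw [h0]
    exact h 0
  · exact h y

theorem fiber_comp {a b c : DeltaTwo} (f : a ⟶ b) (g : b ⟶ c) (z : Fin (c.n + 1)) :
    fiber (f ≫ g : a ⟶ c) z = (fiber g z).flatMap (fiber f) := by
  have hfg : ∀ x, Hom.toFun (f ≫ g : a ⟶ c) x = Hom.toFun g (Hom.toFun f x) := fun x => rfl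
  have hpos : ∀ j : Fin (c.n + 2), j ≠ 0 →
      (interior g j).flatMap (fiber f) =
        (List.finRange (a.n + 1)).filter fun x => ∃ y : Fin (b.n + 1),
          Hom.toFun g y.castSucc = j ∧ Hom.toFun f x.castSucc = y.castSucc := by
    intro j hj
    rw [← flatMap_interior f fun y => Hom.toFun g y.castSucc = j]
    refine List.flatMap_congr fun y hy => ?_
    rw [mem_interior] at hy
    have : y ≠ 0 := by
      rintro rfl
      rw [Fin.castSucc_zero, Hom.map_zero] at hy
      exact hj hy.symm
    rw [fiber, if_neg this]
  have hint : ∀ k : Fin (c.n + 1), interior (f ≫ g : a ⟶ c) k.castSucc =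
      (List.finRange (a.n + 1)).filter fun x => ∃ y : Fin (b.n + 1),
          Hom.toFun g y.castSucc = k.castSucc ∧ Hom.toFun f x.castSucc = y.castSucc := by
    intro k
    refine List.filter_congr fun x _ => decide_eq_decide.2 ?_
    rw [hfg]
    constructor
    · intro h
      rcases Fin.eq_castSucc_or_eq_last (Hom.toFun f x.castSucc) with ⟨y, hy⟩ | hl
      · exact ⟨y, by rw [← hy, h], hy⟩
      · rw [hl, Hom.map_last] at h
        exact absurd h.symm (Fin.castSucc_ne_last _)
    · rintro ⟨y, h1, h2⟩
      rw [h2, h1]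
  by_cases hz : z = 0
  · subst hz
    have e0 : interior g 0 = 0 :: ((List.finRange b.n).map Fin.succ).filter
        (fun y => Hom.toFun g y.castSucc = 0) := by
      unfold interior
      rw [List.finRange_succ, List.filter_cons_of_pos]
      simp [Hom.map_zero]
    have e1 : (((List.finRange b.n).map Fin.succ).filter
        (fun y => Hom.toFun g y.castSucc = 0)).flatMap (fiber f) =
        (((List.finRange b.n).map Fin.succ).filter
        (fun y => Hom.toFun g y.castSucc = 0)).flatMap fun y => interior f y.castSucc := by
      refine List.flatMap_congr fun y hy => ?_
      have : y ≠ 0 := by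
        obtain ⟨h, -⟩ := List.mem_filter.1 hy
        obtain ⟨w, -, rfl⟩ := List.mem_map.1 h
        exact Fin.succ_ne_zero w
      rw [fiber, if_neg this]
    have e2 : interior f 0 ++ (((List.finRange b.n).map Fin.succ).filter
        (fun y => Hom.toFun g y.castSucc = 0)).flatMap (fun y => interior f y.castSucc) =
        interior (f ≫ g : a ⟶ c) 0 := by
      have h1 := hint 0
      rw [← flatMap_interior f fun y => Hom.toFun g y.castSucc = (0 : Fin (c.n + 1)).castSucc] at h1
      refine Eq.trans ?_ h1.symm
      change _ = (interior g 0).flatMap _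
      rw [e0, List.flatMap_cons]
      rfl
    have e3 : (interior g (Fin.last _)).flatMap (fiber f) ++ interior f (Fin.last _) =
        interior (f ≫ g : a ⟶ c) (Fin.last _) := by
      rw [hpos _ (by simp [Fin.ext_iff])]
      have h1 : ((List.finRange (a.n + 1)).filter (fun x => ∃ y : Fin (b.n + 1),
          Hom.toFun g y.castSucc = Fin.last _ ∧ Hom.toFun f x.castSucc = y.castSucc) ++
          interior f (Fin.last _)).Pairwise (· < ·) := by
        refine List.pairwise_append.2 ⟨(List.pairwise_lt_finRange _).filter _,
          interior_sorted _ _, fun x hx w hw => ?_⟩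
        rw [mem_interior] at hw
        obtain ⟨y, -, hy⟩ := of_decide_eq_true (List.mem_filter.1 hx).2
        by_contra hc
        have := Hom.monotone f (Fin.castSucc_le_castSucc_iff.2 (not_lt.1 hc))
        rw [hw, hy] at this
        exact absurd (Fin.last_le_iff.1 this) (Fin.castSucc_ne_last y)
      have h2 := interior_sorted (f ≫ g : a ⟶ c) (Fin.last _)
      refine List.Perm.eq_of_pairwise (fun x y _ _ h h' => absurd h (not_lt.2 h'.le)) h1 h2
        ((List.perm_ext_iff_of_nodup (h1.imp ne_of_lt) (h2.imp ne_of_lt)).2 fun x => ?_)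
      rw [List.mem_append, mem_interior, mem_interior, hfg, List.mem_filter, decide_eq_true_iff]
      constructor
      · rintro (⟨-, y, h, h'⟩ | h)
        · rw [h', h]
        · rw [h, Hom.map_last]
      · intro h
        rcases Fin.eq_castSucc_or_eq_last (Hom.toFun f x.castSucc) with ⟨y, hy⟩ | hl
        · exact Or.inl ⟨List.mem_finRange _, y, by rw [← hy, h], hy⟩
        · exact Or.inr hl
    have f0 : fiber f 0 = interior f (Fin.last _) ++ interior f 0 := if_pos rfl
    have g0 : fiber g 0 = interior g (Fin.last _) ++ interior g 0 := if_pos rfl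
    have fg0 : fiber (f ≫ g : a ⟶ c) 0 =
      interior (f ≫ g : a ⟶ c) (Fin.last _) ++ interior (f ≫ g : a ⟶ c) 0 := if_pos rfl
    rw [fg0, g0, List.flatMap_append, e0, List.flatMap_cons, e1, f0, List.append_assoc, e2,
      ← List.append_assoc, e3]
  · have g0 : fiber g z = interior g z.castSucc := if_neg hz
    have fg0 : fiber (f ≫ g : a ⟶ c) z = interior (f ≫ g : a ⟶ c) z.castSucc := if_neg hz
    rw [fg0, g0, hint, hpos]
    exact fun h => hz (Fin.castSucc_eq_zero_iff.1 h)

/-- The functor `Δ₂ → Λ` identifying the least and the greatest element. -/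
noncomputable def toPolygon : DeltaTwo ⥤ Polygon where
  obj := polygon
  map f := Polygon.homOfPath (X := polygon _) (Y := polygon _) (fiber f) (fiber_isFibering f)
    (start f) (fiber_path f)
  map_id a := Polygon.hom_ext (fiber_id a)
  map_comp f g := Polygon.hom_ext (fiber_comp f g)

end DeltaTwo

/-- The polygon `[1]` with one vertex. -/
def oneGon : Polygon where
  V := Unit
  next := Equiv.refl _
  cyclic _ _ := ⟨0, rfl⟩

/-- The vertex of the one-gon. -/
def oneGon.vertex : oneGon.V := ()

instance : Subsingleton oneGon.V := inferInstanceAs (Subsingleton Unit)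

namespace Polygon

open Classical in
/-- The morphism from the one-gon sending its vertex to `v`. -/
noncomputable def label (X : Polygon) (v : X.V) : oneGon ⟶ X :=
  homOfPath (X := oneGon) (fun y => if y = v then [oneGon.vertex] else [])
    ⟨fun y => by by_cases h : y = v <;> simp [h], fun x => ⟨v, by
      simpa using (Subsingleton.elim x oneGon.vertex : _), fun y h => by
      by_contra hy
      simp [hy] at h⟩⟩ (fun _ => oneGon.vertex)
    fun y => by
      by_cases h : y = v
      · simp only [h, if_true]; exact ⟨rfl, rfl⟩
      · simp only [h, if_false]; exact rfl

theorem label_comp {X Y : Polygon} (f : X ⟶ Y) (v : X.V) (w : Y.V) (h : v ∈ Hom.fiber f w) :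
    label X v ≫ f = label Y w := by
  classical
  apply Polygon.hom_ext
  intro y
  have key : ∀ l : List X.V, l.Nodup →
      (l.flatMap fun x => if x = v then [oneGon.vertex] else []) =
        if v ∈ l then [oneGon.vertex] else [] := fun l => by
    induction l with
    | nil => intro _; rfl
    | cons x l ih =>
      intro hl
      rw [List.flatMap_cons, ih (List.nodup_cons.1 hl).2]
      by_cases hx : x = v
      · subst hx
        simp [(List.nodup_cons.1 hl).1]
      · simp [hx, Ne.symm hx]
  have h1 := key (Hom.fiber f y) ((Hom.isFibering f).1 y)
  have h2 : (v ∈ Hom.fiber f y) ↔ y = w :=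
    ⟨fun h' => ((Hom.isFibering f).2 v).unique h' h, fun e => e ▸ h⟩
  simp only [h2] at h1
  exact h1

end Polygon

/-- The identification `i` of `Δ₂` with the category `([1] \ Id_Λ)` of polygons with a labelled
vertex: a linearly ordered set goes to the polygon obtained by gluing its least and greatest
element, labelled at the glued vertex. -/
noncomputable def DeltaTwo.toUnder : DeltaTwo ⥤ Under oneGon where
  obj a := Under.mk (Y := polygon a) (Polygon.label (polygon a) (0 : Fin (a.n + 1)))
  map {a b} f := Under.homMk (DeltaTwo.toPolygon.map f)
    (Polygon.label_comp (Y := polygon b) (DeltaTwo.toPolygon.map f) (0 : Fin (a.n + 1))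
      (0 : Fin (b.n + 1)) ((mem_fiber f 0 0).2 (Or.inl (by simp [Hom.map_zero]))))
  map_id a := by ext : 1; exact DeltaTwo.toPolygon.map_id a
  map_comp f g := by ext : 1; exact DeltaTwo.toPolygon.map_comp f g

/-! ### Fat graphs -/

/-- The objects of `TM'_g^n`: connected finite fat graphs of genus `g` with `n` numbered boundary
components, without univalent vertices (two-valent vertices are allowed).

A fat graph is given by its set of flags, the permutation `σ` whose cycles are the vertices with the
cyclic order of the flags at them, and the involution `τ` which exchanges the two flags of each edge.
The pair of consecutive flags `(σ⁻¹ x, x)` at a vertex is a corner, which we name by `x`. Going along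
the boundary, the corner `x` is followed by the corner `σ (τ x)` at the other end of the edge of `x`;
so the boundary components are the cycles of `σ * τ`. The genus is determined by the Euler
characteristic `V - E + n = 2 - 2 g` of the closed surface. -/
structure FatGraph (g n : ℕ) where
  /-- the number of flags -/
  flags : ℕ
  pos : 0 < flags
  /-- the next flag in the cyclic order at the vertex -/
  σ : Equiv.Perm (Fin flags)
  /-- the opposite flag of the same edge -/
  τ : Equiv.Perm (Fin flags)
  τ_τ : ∀ x, τ (τ x) = x
  τ_ne : ∀ x, τ x ≠ x
  σ_ne : ∀ x, σ x ≠ x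
  connected : ∀ x y, ∃ w ∈ Subgroup.closure {σ, τ}, w x = y
  /-- the number of the boundary component passing through the corner `x` -/
  mark : Fin flags → Fin n
  mark_surjective : Function.Surjective mark
  mark_eq_iff : ∀ x y, mark x = mark y ↔ (σ * τ).SameCycle x y
  euler : (Nat.card (Quotient (Equiv.Perm.SameCycle.setoid σ)) : ℤ)
    - Nat.card (Quotient (Equiv.Perm.SameCycle.setoid τ)) + n = 2 - 2 * g

namespace FatGraph

variable {g n : ℕ}

/-- The flags of a fat graph. -/
abbrev Flag (Γ : FatGraph g n) : Type := Fin Γ.flags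

/-- The next corner along the boundary. -/
def φ (Γ : FatGraph g n) : Equiv.Perm Γ.Flag := Γ.σ * Γ.τ

theorem φ_apply (Γ : FatGraph g n) (x : Γ.Flag) : Γ.φ x = Γ.σ (Γ.τ x) := rfl

theorem mark_φ (Γ : FatGraph g n) (x : Γ.Flag) : Γ.mark (Γ.φ x) = Γ.mark x :=
  ((Γ.mark_eq_iff _ _).2 ⟨1, rfl⟩).symm

/-! The generating morphisms. A morphism `Γ → Γ'` induces a map of CW complexes `|Γ| → |Γ'|`, under
which the edge entered at the flag `x` traverses the sequence `path x` of edges of `Γ'` (each given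
by the flag at which it is entered; the sequence is empty if the edge is contracted). It also maps
the corners of `Γ` to corners of `Γ'`; `fiber y` lists the corners of `Γ` going to the corner `y`
in the order in which they are met along the boundary. -/

/-- An isomorphism `e` of fat graphs, with its edge paths and corner fibres. -/
structure IsIso (Γ Γ' : FatGraph g n) (e : Γ.Flag ≃ Γ'.Flag)
    (path : Γ.Flag → List Γ'.Flag) (fiber : Γ'.Flag → List Γ.Flag) : Prop where
  σ_eq : ∀ x, Γ'.σ (e x) = e (Γ.σ x)
  τ_eq : ∀ x, Γ'.τ (e x) = e (Γ.τ x)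
  path_eq : ∀ x, path x = [e x]
  fiber_eq : ∀ y, fiber y = [e.symm y]

/-- `Γ'` is obtained from `Γ` by shrinking the edge `{a, τ a}`, which is not a loop: the flags of
`Γ'` are, through `ι`, those of `Γ` other than `a` and `τ a`, and the cyclic orders at the two ends
are joined into one, the flags following `τ a` taking the place of `a` and vice versa. The corner `a`
is merged with the corner `σ (τ a)`, and the corner `τ a` with the corner `σ a`. -/
structure IsShrinking (Γ Γ' : FatGraph g n) (a : Γ.Flag) (ι : Γ'.Flag → Γ.Flag)
    (path : Γ.Flag → List Γ'.Flag) (fiber : Γ'.Flag → List Γ.Flag) : Prop where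
  not_loop : ¬ Γ.σ.SameCycle a (Γ.τ a)
  injective : Function.Injective ι
  mem_range : ∀ x, x ∈ Set.range ι ↔ x ≠ a ∧ x ≠ Γ.τ a
  τ_eq : ∀ y, ι (Γ'.τ y) = Γ.τ (ι y)
  σ_eq : ∀ y, ι (Γ'.σ y) =
    if Γ.σ (ι y) = a then Γ.σ (Γ.τ a)
    else if Γ.σ (ι y) = Γ.τ a then Γ.σ a
    else Γ.σ (ι y)
  path_left : path a = []
  path_right : path (Γ.τ a) = []
  path_eq : ∀ y, path (ι y) = [y]
  fiber_eq : ∀ y, fiber y =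
    if ι y = Γ.σ (Γ.τ a) then [a, ι y]
    else if ι y = Γ.σ a then [Γ.τ a, ι y]
    else [ι y]

/-- `Γ'` is obtained from `Γ` by inserting a two-valent vertex, with flags `u` and `v`, on the edge
`{a, τ a}`: the new edges are `{a, u}` and `{v, τ a}`. -/
structure IsInsertion (Γ Γ' : FatGraph g n) (a : Γ.Flag) (u v : Γ'.Flag) (ι : Γ.Flag → Γ'.Flag)
    (path : Γ.Flag → List Γ'.Flag) (fiber : Γ'.Flag → List Γ.Flag) : Prop where
  injective : Function.Injective ι
  mem_range : ∀ y, y ∈ Set.range ι ↔ y ≠ u ∧ y ≠ v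
  σ_eq : ∀ x, Γ'.σ (ι x) = ι (Γ.σ x)
  σ_left : Γ'.σ u = v
  σ_right : Γ'.σ v = u
  τ_left : Γ'.τ (ι a) = u
  τ_right : Γ'.τ (ι (Γ.τ a)) = v
  τ_eq : ∀ x, x ≠ a → x ≠ Γ.τ a → Γ'.τ (ι x) = ι (Γ.τ x)
  path_left : path a = [ι a, v]
  path_right : path (Γ.τ a) = [ι (Γ.τ a), u]
  path_eq : ∀ x, x ≠ a → x ≠ Γ.τ a → path x = [ι x]
  fiber_eq : ∀ x, fiber (ι x) = [x]
  fiber_left : fiber u = []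
  fiber_right : fiber v = []

/-- The (edge path, corner fibre) data of the morphisms of `TM'_g^n`: composites of isomorphisms,
shrinkings of edges and insertions of vertices, all of them respecting the numbering of the
boundary components. -/
inductive IsMor : (Γ Γ' : FatGraph g n) → (Γ.Flag → List Γ'.Flag) → (Γ'.Flag → List Γ.Flag) → Prop
  | iso {Γ Γ' : FatGraph g n} {path fiber} (e : Γ.Flag ≃ Γ'.Flag)
      (h : IsIso Γ Γ' e path fiber) (hm : ∀ y, ∀ x ∈ fiber y, Γ.mark x = Γ'.mark y) :
      IsMor Γ Γ' path fiber
  | shrink {Γ Γ' : FatGraph g n} {path fiber} (a : Γ.Flag) (ι : Γ'.Flag → Γ.Flag)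
      (h : IsShrinking Γ Γ' a ι path fiber) (hm : ∀ y, ∀ x ∈ fiber y, Γ.mark x = Γ'.mark y) :
      IsMor Γ Γ' path fiber
  | insert {Γ Γ' : FatGraph g n} {path fiber} (a : Γ.Flag) (u v : Γ'.Flag) (ι : Γ.Flag → Γ'.Flag)
      (h : IsInsertion Γ Γ' a u v ι path fiber) (hm : ∀ y, ∀ x ∈ fiber y, Γ.mark x = Γ'.mark y) :
      IsMor Γ Γ' path fiber
  | comp {Γ Γ' Γ'' : FatGraph g n} {path fiber path' fiber'} (h : IsMor Γ Γ' path fiber)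
      (h' : IsMor Γ' Γ'' path' fiber') :
      IsMor Γ Γ'' (fun x => (path x).flatMap path') (fun z => (fiber' z).flatMap fiber)

theorem IsMor.mark {Γ Γ' : FatGraph g n} {path fiber} (h : IsMor Γ Γ' path fiber) :
    ∀ y, ∀ x ∈ fiber y, Γ.mark x = Γ'.mark y := by
  induction h with
  | iso e h hm => exact hm
  | shrink a ι h hm => exact hm
  | insert a u v ι h hm => exact hm
  | comp h h' ih ih' =>
    intro z x hx
    obtain ⟨y, hy, hxy⟩ := List.mem_flatMap.1 hx
    exact (ih y x hxy).trans (ih' z y hy)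

theorem IsMor.isFibering {Γ Γ' : FatGraph g n} {path fiber} (h : IsMor Γ Γ' path fiber) :
    IsFibering fiber := by
  induction h with
  | comp h h' ih ih' => exact ih.comp ih'
  | iso e h hm =>
    refine ⟨fun y => by simp [h.fiber_eq], fun x => ⟨e x, by simp [h.fiber_eq], fun y hy => ?_⟩⟩
    replace hy : x ∈ _ := hy
    rw [h.fiber_eq, List.mem_singleton] at hy
    rw [hy, e.apply_symm_apply]
  | insert a u v ι h hm =>
    have hc : ∀ y, y = u ∨ y = v ∨ ∃ x, ι x = y := fun y => by
      have := h.mem_range y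
      by_cases h1 : y = u
      · exact Or.inl h1
      · by_cases h2 : y = v
        · exact Or.inr (Or.inl h2)
        · exact Or.inr (Or.inr (this.2 ⟨h1, h2⟩))
    constructor
    · intro y
      rcases hc y with rfl | rfl | ⟨x, rfl⟩
      · rw [h.fiber_left]; exact List.nodup_nil
      · rw [h.fiber_right]; exact List.nodup_nil
      · rw [h.fiber_eq]; exact List.nodup_singleton _
    · intro x
      refine ⟨ι x, by simp [h.fiber_eq], fun y hy => ?_⟩
      replace hy : x ∈ _ := hy
      rcases hc y with rfl | rfl | ⟨x', rfl⟩
      · rw [h.fiber_left] at hy; simp at hy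
      · rw [h.fiber_right] at hy; simp at hy
      · rw [h.fiber_eq, List.mem_singleton] at hy; rw [hy]
  | @shrink Γ Γ' path fiber a ι h hm =>
    have hne : ∀ y, ι y ≠ a ∧ ι y ≠ Γ.τ a := fun y => (h.mem_range _).1 ⟨y, rfl⟩
    have hab : Γ.σ (Γ.τ a) ≠ Γ.σ a := fun e => Γ.τ_ne a (Γ.σ.injective e)
    obtain ⟨y₁, hy₁⟩ := (h.mem_range (Γ.σ (Γ.τ a))).2
      ⟨fun e => h.not_loop (Equiv.Perm.SameCycle.symm ⟨1, by simpa using e⟩), Γ.σ_ne _⟩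
    obtain ⟨y₂, hy₂⟩ := (h.mem_range (Γ.σ a)).2
      ⟨Γ.σ_ne _, fun e => h.not_loop ⟨1, by simpa using e⟩⟩
    have hm1 : ∀ y x, x ∈ fiber y ↔ x = ι y ∨ (x = a ∧ y = y₁) ∨ (x = Γ.τ a ∧ y = y₂) := by
      intro y x
      have e1 : ι y = Γ.σ (Γ.τ a) ↔ y = y₁ := by rw [← hy₁]; exact h.injective.eq_iff
      have e2 : ι y = Γ.σ a ↔ y = y₂ := by rw [← hy₂]; exact h.injective.eq_iff
      have e3 : y₁ ≠ y₂ := fun e => hab (by rw [← hy₁, ← hy₂, e])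
      rw [h.fiber_eq]
      simp only [e1, e2]
      split_ifs with c1 c2
      · subst c1; simp [e3, or_comm]
      · subst c2; simp [Ne.symm e3, or_comm]
      · simp [c1, c2]
    constructor
    · intro y
      rw [h.fiber_eq]
      split_ifs
      · simpa using (hne y).1.symm
      · simpa using (hne y).2.symm
      · exact List.nodup_singleton _
    · intro x
      simp only [hm1]
      by_cases hx : x = a
      · subst hx
        refine ⟨y₁, Or.inr (Or.inl ⟨rfl, rfl⟩), ?_⟩
        rintro y (e | ⟨-, e⟩ | ⟨e, -⟩)
        · exact absurd e.symm (hne y).1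
        · exact e
        · exact absurd e.symm (Γ.τ_ne _)
      · by_cases hx' : x = Γ.τ a
        · subst hx'
          refine ⟨y₂, Or.inr (Or.inr ⟨rfl, rfl⟩), ?_⟩
          rintro y (e | ⟨e, -⟩ | ⟨-, e⟩)
          · exact absurd e.symm (hne y).2
          · exact absurd e (Γ.τ_ne _)
          · exact e
        · obtain ⟨y, rfl⟩ := (h.mem_range x).2 ⟨hx, hx'⟩
          refine ⟨y, Or.inl rfl, ?_⟩
          rintro y' (e | ⟨e, -⟩ | ⟨e, -⟩)
          · exact (h.injective e).symm
          · exact absurd e hx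
          · exact absurd e hx'

theorem IsMor.exists_path {Γ Γ' : FatGraph g n} {path fiber} (h : IsMor Γ Γ' path fiber) :
    ∃ s : Γ'.Flag → Γ.Flag, (∀ y, Γ.mark (s y) = Γ'.mark y) ∧
      ∀ y, IsPath Γ.φ (s y) (fiber y) (s (Γ'.φ y)) := by
  induction h with
  | comp h h' ih ih' =>
    obtain ⟨s, hm, hs⟩ := ih
    obtain ⟨s', hm', hs'⟩ := ih'
    exact ⟨fun z => s (s' z), fun z => (hm _).trans (hm' _), fun z => IsPath.flatMap hs (hs' z)⟩
  | @iso Γ Γ' path fiber e h hm =>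
    refine ⟨e.symm, fun y => hm y _ (by simp [h.fiber_eq]), fun y => ?_⟩
    rw [h.fiber_eq]
    refine ⟨rfl, ?_⟩
    change Γ.φ (e.symm y) = e.symm (Γ'.φ y)
    obtain ⟨x, rfl⟩ := e.surjective y
    simp [φ_apply, h.σ_eq, h.τ_eq]
  | @insert Γ Γ' path fiber a u v ι h hm =>
    classical
    have hτu : Γ'.τ u = ι a := by rw [← h.τ_left, Γ'.τ_τ]
    have hτv : Γ'.τ v = ι (Γ.τ a) := by rw [← h.τ_right, Γ'.τ_τ]
    have huv : u ≠ v := fun e => Γ'.σ_ne u (by rw [h.σ_left, ← e])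
    have hιu : ∀ x, ι x ≠ u := fun x => ((h.mem_range _).1 ⟨x, rfl⟩).1
    have hιv : ∀ x, ι x ≠ v := fun x => ((h.mem_range _).1 ⟨x, rfl⟩).2
    have hc : ∀ y, y = u ∨ y = v ∨ ∃ x, ι x = y := fun y => by
      have := h.mem_range y
      by_cases h1 : y = u
      · exact Or.inl h1
      · by_cases h2 : y = v
        · exact Or.inr (Or.inl h2)
        · exact Or.inr (Or.inr (this.2 ⟨h1, h2⟩))
    let s : Γ'.Flag → Γ.Flag := fun y =>
      if y = u then Γ.φ (Γ.τ a) else if y = v then Γ.φ a else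
        if hy : ∃ x, ι x = y then hy.choose else a
    have su : s u = Γ.φ (Γ.τ a) := if_pos rfl
    have sv : s v = Γ.φ a := by simp [s, huv.symm]
    have sι : ∀ x, s (ι x) = x := fun x => by
      have hx : ∃ x', ι x' = ι x := ⟨x, rfl⟩
      simp only [s, hιu, hιv, if_false, dif_pos hx]
      exact h.injective hx.choose_spec
    have hp : ∀ y, IsPath Γ.φ (s y) (fiber y) (s (Γ'.φ y)) := by
      intro y
      rcases hc y with rfl | rfl | ⟨x, rfl⟩
      · rw [h.fiber_left, φ_apply, hτu, h.σ_eq, sι, su, φ_apply, Γ.τ_τ]; exact rfl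
      · rw [h.fiber_right, φ_apply, hτv, h.σ_eq, sι, sv, φ_apply]; exact rfl
      · rw [h.fiber_eq, sι]
        refine ⟨rfl, ?_⟩
        change Γ.φ x = _
        rw [Γ'.φ_apply]
        by_cases h1 : x = a
        · subst h1; rw [h.τ_left, h.σ_left, sv]
        · by_cases h2 : x = Γ.τ a
          · subst h2; rw [h.τ_right, h.σ_right, su]
          · rw [h.τ_eq x h1 h2, h.σ_eq, sι]; rfl
    have hmι : ∀ x, Γ.mark x = Γ'.mark (ι x) := fun x => hm _ _ (by simp [h.fiber_eq])
    refine ⟨s, fun y => ?_, hp⟩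
    rcases hc y with rfl | rfl | ⟨x, rfl⟩
    · rw [su, mark_φ, hmι, ← Γ'.mark_φ, φ_apply, h.τ_right, h.σ_right]
    · rw [sv, mark_φ, hmι, ← Γ'.mark_φ, φ_apply, h.τ_left, h.σ_left]
    · rw [sι, hmι]
  | @shrink Γ Γ' path fiber a ι h hm =>
    classical
    have hne : ∀ y, ι y ≠ a ∧ ι y ≠ Γ.τ a := fun y => (h.mem_range _).1 ⟨y, rfl⟩
    have hab : Γ.σ (Γ.τ a) ≠ Γ.σ a := fun e => Γ.τ_ne a (Γ.σ.injective e)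
    let s : Γ'.Flag → Γ.Flag := fun y =>
      if ι y = Γ.σ (Γ.τ a) then a else if ι y = Γ.σ a then Γ.τ a else ι y
    have hs : ∀ y, s (Γ'.φ y) = Γ.φ (ι y) := by
      intro y
      have e : ι (Γ'.φ y) = _ := h.σ_eq (Γ'.τ y)
      rw [h.τ_eq] at e
      simp only [s]
      rw [e, φ_apply]
      by_cases c1 : Γ.σ (Γ.τ (ι y)) = a
      · simp [c1]
      · by_cases c2 : Γ.σ (Γ.τ (ι y)) = Γ.τ a
        · simp [c2, hab.symm, Γ.τ_ne]
        · have d1 : Γ.σ (Γ.τ (ι y)) ≠ Γ.σ (Γ.τ a) := fun e =>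
            (hne y).1 (Γ.τ.injective (Γ.σ.injective e))
          have d2 : Γ.σ (Γ.τ (ι y)) ≠ Γ.σ a := fun e =>
            (hne y).2 (by rw [← Γ.σ.injective e, Γ.τ_τ])
          simp [c1, c2, d1, d2]
    have hsm : ∀ y, s y ∈ fiber y := by
      intro y
      rw [h.fiber_eq]
      simp only [s]
      split_ifs <;> simp
    refine ⟨s, fun y => hm _ _ (hsm y), fun y => ?_⟩
    rw [hs, h.fiber_eq]
    simp only [s]
    split_ifs with c1 c2
    · exact ⟨rfl, c1, congrArg Γ.φ c1.symm⟩
    · refine ⟨rfl, ?_, ?_⟩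
      · rw [φ_apply, Γ.τ_τ, c2]
      · rw [φ_apply Γ (Γ.τ a), Γ.τ_τ, c2]; exact rfl
    · exact ⟨rfl, rfl⟩

/-! Edge paths determine the fibres. -/

theorem suffix_flatMap {X Y : Type} (r : Y → List X) (x : X) (l₂ : List X) :
    ∀ l : List Y, x :: l₂ <:+ l.flatMap r →
      ∃ y m n, y :: m <:+ l ∧ x :: n <:+ r y ∧ l₂ = n ++ m.flatMap r := by
  intro l
  induction l with
  | nil => intro h; simp at h
  | cons y l ih =>
    rintro ⟨l₁, h⟩
    have step : x :: l₂ <:+ l.flatMap r →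
        ∃ y' m n, y' :: m <:+ y :: l ∧ x :: n <:+ r y' ∧ l₂ = n ++ m.flatMap r := fun h => by
      obtain ⟨y', m, n, h1, h2, h3⟩ := ih h
      exact ⟨y', m, n, h1.trans (List.suffix_cons _ _), h2, h3⟩
    rw [List.flatMap_cons, List.append_eq_append_iff] at h
    rcases h with ⟨c, h1, h2⟩ | ⟨c, h1, h2⟩
    · cases c with
      | nil => exact step ⟨[], by simpa using h2⟩
      | cons z c =>
        rw [List.cons_append, List.cons.injEq] at h2
        obtain ⟨rfl, h2⟩ := h2
        exact ⟨y, l, c, List.suffix_rfl, ⟨l₁, h1.symm⟩, h2⟩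
    · exact step ⟨c, h2.symm⟩

/-- Local relation between the fibres and the edge paths. -/
def Linked {X Y : Type} (φ : X → X) (φ' : Y → Y) (path : X → List Y) (fiber : Y → List X) : Prop :=
  (∀ y x l, x :: l <:+ fiber y →
    (l = [] → ∃ t, path x = y :: t) ∧ ∀ z t, l = z :: t → path x = [] ∧ z = φ x) ∧
  (∀ x y l, y :: l <:+ path x →
    (l = [] → ∃ t, fiber (φ' y) = φ x :: t) ∧ ∀ z t, l = z :: t → fiber (φ' y) = [] ∧ z = φ' y)

theorem suffix_singleton {X : Type} {x z : X} {l : List X} (h : x :: l <:+ [z]) :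
    x = z ∧ l = [] := by
  have := h.length_le
  have hl : l = [] := by
    cases l with
    | nil => rfl
    | cons _ _ => simp at this
  subst hl
  obtain ⟨t, ht⟩ := h
  cases t with
  | nil => simpa using ht
  | cons _ t => simp at ht

theorem suffix_pair {X : Type} {x z w : X} {l : List X} (h : x :: l <:+ [z, w]) :
    (x = z ∧ l = [w]) ∨ (x = w ∧ l = []) := by
  rcases List.suffix_cons_iff.1 h with h | h
  · exact Or.inl (by simpa using h)
  · exact Or.inr (suffix_singleton h)

theorem Linked.comp {X Y Z : Type} {φ : X → X} {φ' : Y → Y} {φ'' : Z → Z} {path : X → List Y}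
    {fiber : Y → List X} {path' : Y → List Z} {fiber' : Z → List Y}
    (h : Linked φ φ' path fiber) (h' : Linked φ' φ'' path' fiber') :
    Linked φ φ'' (fun x => (path x).flatMap path') (fun z => (fiber' z).flatMap fiber) := by
  constructor
  · intro z x l hl
    obtain ⟨y, m, n, hy, hx, rfl⟩ := suffix_flatMap _ _ _ _ hl
    cases n with
    | cons w n =>
      have := (h.1 y x _ hx).2 w n rfl
      refine ⟨fun e => by simp at e, fun z' t e => ?_⟩
      simp only [List.cons_append, List.cons.injEq] at e
      simp [this.1, ← e.1, this.2]
    | nil =>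
      have key : ∀ (m : List Y) (y : Y) (k : List Y), y :: m <:+ fiber' z → y :: k <:+ path x →
          (m.flatMap fiber = [] → ∃ t, (y :: k).flatMap path' = z :: t) ∧
          ∀ z' t, m.flatMap fiber = z' :: t → (y :: k).flatMap path' = [] ∧ z' = φ x := by
        intro m
        induction m with
        | nil =>
          intro y k hm hk
          refine ⟨fun _ => ?_, fun _ _ e => by simp at e⟩
          obtain ⟨t, ht⟩ := (h'.1 z y _ hm).1 rfl
          exact ⟨t ++ k.flatMap path', by simp [ht]⟩
        | cons y₂ m ih =>
          intro y k hm hk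
          obtain ⟨e1, e2⟩ := (h'.1 z y _ hm).2 _ _ rfl
          cases k with
          | nil =>
            obtain ⟨t, ht⟩ := (h.2 x y _ hk).1 rfl
            rw [← e2] at ht
            refine ⟨fun e => by simp [ht] at e, fun z' t' e => ?_⟩
            simp only [List.flatMap_cons, ht, List.cons_append, List.cons.injEq] at e
            simp [e1, e.1]
          | cons y₃ k =>
            obtain ⟨e3, e4⟩ := (h.2 x y _ hk).2 _ _ rfl
            rw [← e2] at e3 e4
            subst e4
            have := ih y₃ k ((List.suffix_cons _ _).trans hm) ((List.suffix_cons _ _).trans hk)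
            rw [List.flatMap_cons, e3, List.nil_append, List.flatMap_cons, e1, List.nil_append]
            exact this
      obtain ⟨t, ht⟩ := (h.1 y x _ hx).1 rfl
      have := key m y t hy (by rw [ht])
      rw [← ht] at this
      simpa using this
  · intro x z l hl
    obtain ⟨y, m, n, hy, hz, rfl⟩ := suffix_flatMap _ _ _ _ hl
    cases n with
    | cons w n =>
      have := (h'.2 y z _ hz).2 w n rfl
      refine ⟨fun e => by simp at e, fun z' t e => ?_⟩
      simp only [List.cons_append, List.cons.injEq] at e
      simp [this.1, ← e.1, this.2]
    | nil =>
      have key : ∀ (m : List Y) (y : Y) (k : List Y), y :: m <:+ path x →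
          φ' y :: k <:+ fiber' (φ'' z) →
          (m.flatMap path' = [] → ∃ t, (φ' y :: k).flatMap fiber = φ x :: t) ∧
          ∀ z' t, m.flatMap path' = z' :: t → (φ' y :: k).flatMap fiber = [] ∧ z' = φ'' z := by
        intro m
        induction m with
        | nil =>
          intro y k hm hk
          refine ⟨fun _ => ?_, fun _ _ e => by simp at e⟩
          obtain ⟨t, ht⟩ := (h.2 x y _ hm).1 rfl
          exact ⟨t ++ k.flatMap fiber, by simp [ht]⟩
        | cons y₂ m ih =>
          intro y k hm hk
          obtain ⟨e1, e2⟩ := (h.2 x y _ hm).2 _ _ rfl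
          subst e2
          cases k with
          | nil =>
            obtain ⟨t, ht⟩ := (h'.1 _ _ _ hk).1 rfl
            refine ⟨fun e => by simp [ht] at e, fun z' t' e => ?_⟩
            simp only [List.flatMap_cons, ht, List.cons_append, List.cons.injEq] at e
            simp [e1, e.1]
          | cons y₃ k =>
            obtain ⟨e3, e4⟩ := (h'.1 _ _ _ hk).2 _ _ rfl
            subst e4
            have := ih (φ' y) k ((List.suffix_cons _ _).trans hm)
              ((List.suffix_cons _ _).trans hk)
            rw [List.flatMap_cons, e3, List.nil_append, List.flatMap_cons, e1, List.nil_append]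
            exact this
      obtain ⟨t, ht⟩ := (h'.2 y z _ hz).1 rfl
      have := key m y t hy (by rw [ht])
      rw [← ht] at this
      simpa using this

theorem Linked.fiber_unique {X Y : Type} {φ : X → X} {φ' : Y → Y} {path : X → List Y}
    {fiber fiber' : Y → List X} (h : Linked φ φ' path fiber) (h' : Linked φ φ' path fiber')
    (hf : IsFibering fiber) (hf' : IsFibering fiber') : fiber = fiber' := by
  have main : ∀ {r r' : Y → List X}, Linked φ φ' path r → Linked φ φ' path r' → IsFibering r →
      IsFibering r' → ∀ y l, l <:+ r y → l <:+ r' y := by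
    intro r r' h h' hf hf' y l
    induction l with
    | nil => intro _; exact List.nil_suffix
    | cons x l ih =>
      intro hl
      obtain ⟨y', hy', -⟩ := hf'.2 x
      obtain ⟨l₁, l₂, hl₂⟩ := List.append_of_mem hy'
      have hs : x :: l₂ <:+ r' y' := ⟨l₁, hl₂.symm⟩
      have a1 := h.1 y x l hl
      have a2 := h'.1 y' x l₂ hs
      cases l with
      | nil =>
        obtain ⟨t, ht⟩ := a1.1 rfl
        cases l₂ with
        | nil =>
          obtain ⟨t', ht'⟩ := a2.1 rfl
          rw [ht, List.cons.injEq] at ht'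
          rw [ht'.1]; exact hs
        | cons z l₂ =>
          have := (a2.2 _ _ rfl).1
          rw [ht] at this; simp at this
      | cons z l =>
        obtain ⟨b1, b2⟩ := a1.2 _ _ rfl
        cases l₂ with
        | nil =>
          obtain ⟨t', ht'⟩ := a2.1 rfl
          rw [b1] at ht'; simp at ht'
        | cons z' l₂ =>
          obtain ⟨-, b3⟩ := a2.2 _ _ rfl
          rw [← b2] at b3
          subst b3
          have hz := ih ((List.suffix_cons _ _).trans hl)
          have hz' := (List.suffix_cons _ _).trans hs
          obtain rfl : y' = y := (hf'.2 z').unique (hz'.subset (by simp)) (hz.subset (by simp))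
          obtain ⟨p, hp⟩ := hz
          obtain ⟨q, hq⟩ := hz'
          have hn := hf'.1 y'
          have e : l = l₂ := by
            have e1 : p ++ z' :: l = q ++ z' :: l₂ := hp.trans hq.symm
            have n1 : z' ∉ p := fun hm => by
              rw [← hp] at hn
              exact (List.nodup_append.1 hn).2.2 z' hm z' (by simp) rfl
            have n2 : z' ∉ q := fun hm => by
              rw [← hq] at hn
              exact (List.nodup_append.1 hn).2.2 z' hm z' (by simp) rfl
            rcases List.append_eq_append_iff.1 e1 with ⟨c, c1, c2⟩ | ⟨c, c1, c2⟩
            · cases c with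
              | nil => simpa using c2
              | cons w c =>
                rw [List.cons_append, List.cons.injEq] at c2
                exact absurd (by rw [c1]; simp [c2.1]) n2
            · cases c with
              | nil => simpa using c2.symm
              | cons w c =>
                rw [List.cons_append, List.cons.injEq] at c2
                exact absurd (by rw [c1]; simp [c2.1]) n1
          rw [e]; exact hs
  funext y
  have s1 := main h h' hf hf' y _ List.suffix_rfl
  have s2 := main h' h hf' hf y _ List.suffix_rfl
  exact s1.eq_of_length (le_antisymm s1.length_le s2.length_le)

theorem IsMor.linked {Γ Γ' : FatGraph g n} {path fiber} (h : IsMor Γ Γ' path fiber) :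
    Linked Γ.φ Γ'.φ path fiber := by
  induction h with
  | comp h h' ih ih' => exact ih.comp ih'
  | @iso Γ Γ' path fiber e h hm =>
    constructor
    · intro y x l hl
      rw [h.fiber_eq] at hl
      obtain ⟨rfl, rfl⟩ := suffix_singleton hl
      exact ⟨fun _ => ⟨[], by simp [h.path_eq]⟩, fun _ _ e => by simp at e⟩
    · intro x y l hl
      rw [h.path_eq] at hl
      obtain ⟨rfl, rfl⟩ := suffix_singleton hl
      exact ⟨fun _ => ⟨[], by simp [h.fiber_eq, φ_apply, h.σ_eq, h.τ_eq]⟩,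
        fun _ _ e => by simp at e⟩
  | @insert Γ Γ' path fiber a u v ι h hm =>
    have hτu : Γ'.τ u = ι a := by rw [← h.τ_left, Γ'.τ_τ]
    have hτv : Γ'.τ v = ι (Γ.τ a) := by rw [← h.τ_right, Γ'.τ_τ]
    have hc : ∀ y, y = u ∨ y = v ∨ ∃ x, ι x = y := fun y => by
      have := h.mem_range y
      by_cases h1 : y = u
      · exact Or.inl h1
      · by_cases h2 : y = v
        · exact Or.inr (Or.inl h2)
        · exact Or.inr (Or.inr (this.2 ⟨h1, h2⟩))
    constructor
    · intro y x l hl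
      rcases hc y with rfl | rfl | ⟨x', rfl⟩
      · rw [h.fiber_left] at hl; simp at hl
      · rw [h.fiber_right] at hl; simp at hl
      · rw [h.fiber_eq] at hl
        obtain ⟨rfl, rfl⟩ := suffix_singleton hl
        refine ⟨fun _ => ?_, fun _ _ e => by simp at e⟩
        by_cases h1 : x = a
        · subst h1; exact ⟨_, h.path_left⟩
        · by_cases h2 : x = Γ.τ a
          · subst h2; exact ⟨_, h.path_right⟩
          · exact ⟨_, h.path_eq x h1 h2⟩
    · intro x y l hl
      by_cases h1 : x = a
      · subst h1
        rw [h.path_left] at hl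
        rcases suffix_pair hl with ⟨rfl, rfl⟩ | ⟨rfl, rfl⟩
        · refine ⟨fun e => by simp at e, fun z t e => ?_⟩
          rw [List.cons.injEq] at e
          rw [φ_apply, h.τ_left, h.σ_left]
          exact ⟨h.fiber_right, e.1.symm⟩
        · refine ⟨fun _ => ⟨[], ?_⟩, fun _ _ e => by simp at e⟩
          rw [φ_apply, hτv, h.σ_eq, h.fiber_eq]; rfl
      · by_cases h2 : x = Γ.τ a
        · subst h2
          rw [h.path_right] at hl
          rcases suffix_pair hl with ⟨rfl, rfl⟩ | ⟨rfl, rfl⟩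
          · refine ⟨fun e => by simp at e, fun z t e => ?_⟩
            rw [List.cons.injEq] at e
            rw [φ_apply, h.τ_right, h.σ_right]
            exact ⟨h.fiber_left, e.1.symm⟩
          · refine ⟨fun _ => ⟨[], ?_⟩, fun _ _ e => by simp at e⟩
            rw [φ_apply, hτu, h.σ_eq, h.fiber_eq, φ_apply, Γ.τ_τ]
        · rw [h.path_eq x h1 h2] at hl
          obtain ⟨rfl, rfl⟩ := suffix_singleton hl
          refine ⟨fun _ => ⟨[], ?_⟩, fun _ _ e => by simp at e⟩
          rw [φ_apply, h.τ_eq x h1 h2, h.σ_eq, h.fiber_eq]; rfl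
  | @shrink Γ Γ' path fiber a ι h hm =>
    have hne : ∀ y, ι y ≠ a ∧ ι y ≠ Γ.τ a := fun y => (h.mem_range _).1 ⟨y, rfl⟩
    have hab : Γ.σ (Γ.τ a) ≠ Γ.σ a := fun e => Γ.τ_ne a (Γ.σ.injective e)
    constructor
    · intro y x l hl
      have hy : ∀ {y x l}, x :: l <:+ [ι y] → (l = [] → ∃ t, path x = y :: t) ∧
          ∀ z t, l = z :: t → path x = [] ∧ z = Γ.φ x := fun {y x l} hl => by
        obtain ⟨rfl, rfl⟩ := suffix_singleton hl
        exact ⟨fun _ => ⟨[], h.path_eq _⟩, fun _ _ e => by simp at e⟩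
      rw [h.fiber_eq] at hl
      split_ifs at hl with c1 c2
      · rcases List.suffix_cons_iff.1 hl with e | hl
        · obtain ⟨rfl, rfl⟩ := List.cons.inj e
          refine ⟨fun e => by simp at e, fun z t e => ?_⟩
          rw [List.cons.injEq] at e
          exact ⟨h.path_left, by rw [← e.1, c1]; rfl⟩
        · exact hy hl
      · rcases List.suffix_cons_iff.1 hl with e | hl
        · obtain ⟨rfl, rfl⟩ := List.cons.inj e
          refine ⟨fun e => by simp at e, fun z t e => ?_⟩
          rw [List.cons.injEq] at e
          exact ⟨h.path_right, by rw [← e.1, c2, φ_apply, Γ.τ_τ]⟩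
        · exact hy hl
      · exact hy hl
    · intro x y l hl
      by_cases h1 : x = a
      · subst h1; rw [h.path_left] at hl; simp at hl
      · by_cases h2 : x = Γ.τ a
        · subst h2; rw [h.path_right] at hl; simp at hl
        · obtain ⟨y', rfl⟩ := (h.mem_range x).2 ⟨h1, h2⟩
          rw [h.path_eq] at hl
          obtain ⟨rfl, rfl⟩ := suffix_singleton hl
          refine ⟨fun _ => ?_, fun _ _ e => by simp at e⟩
          have e : ι (Γ'.φ y) = _ := h.σ_eq (Γ'.τ y)
          rw [h.τ_eq] at e
          rw [h.fiber_eq, e, Γ.φ_apply]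
          by_cases c1 : Γ.σ (Γ.τ (ι y)) = a
          · simp [c1]
          · by_cases c2 : Γ.σ (Γ.τ (ι y)) = Γ.τ a
            · simp [c2, hab.symm, Γ.τ_ne]
            · have d1 : Γ.σ (Γ.τ (ι y)) ≠ Γ.σ (Γ.τ a) := fun e =>
                (hne y).1 (Γ.τ.injective (Γ.σ.injective e))
              have d2 : Γ.σ (Γ.τ (ι y)) ≠ Γ.σ a := fun e =>
                (hne y).2 (by rw [← Γ.σ.injective e, Γ.τ_τ])
              simp [c1, c2, d1, d2]

/-- The edge paths have no backtracking: they are reduced. -/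
theorem IsMor.path_reduced {Γ Γ' : FatGraph g n} {path fiber} (h : IsMor Γ Γ' path fiber)
    (x : Γ.Flag) (y z : Γ'.Flag) (l : List Γ'.Flag) (hl : y :: z :: l <:+ path x) :
    z = Γ'.σ (Γ'.τ y) ∧ z ≠ Γ'.τ y := by
  have e := ((h.linked.2 x y _ hl).2 z l rfl).2
  exact ⟨e, fun e' => Γ'.σ_ne _ (e.symm.trans e')⟩

/-- The corner fibres of a morphism are determined by its edge paths. -/
theorem IsMor.fiber_unique {Γ Γ' : FatGraph g n} {path fiber fiber'} (h : IsMor Γ Γ' path fiber)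
    (h' : IsMor Γ Γ' path fiber') : fiber = fiber' :=
  h.linked.fiber_unique h'.linked h.isFibering h'.isFibering

end FatGraph

/-- The morphisms of `TM'_g^n`: composites of isomorphisms, shrinkings and insertions, two composites
being identified if the maps of CW complexes are homotopic relative to the vertices. Since the edge
paths are reduced words (`IsMor.path_reduced`), this means that the edge paths coincide; the corner
fibres are carried along for convenience, being determined by the edge paths (`TMHom.ext_path`). -/
@[ext]
structure TMHom {g n : ℕ} (Γ Γ' : FatGraph g n) where
  /-- the edge paths -/
  path : Γ.Flag → List Γ'.Flag
  /-- the ordered corner fibres -/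
  fiber : Γ'.Flag → List Γ.Flag
  isMor : FatGraph.IsMor Γ Γ' path fiber

theorem TMHom.ext_path {g n : ℕ} {Γ Γ' : FatGraph g n} {f f' : TMHom Γ Γ'}
    (h : f.path = f'.path) : f = f' := by
  obtain ⟨p, r, hr⟩ := f
  obtain ⟨p', r', hr'⟩ := f'
  obtain rfl : p = p' := h
  obtain rfl : r = r' := hr.fiber_unique hr'
  rfl

namespace FatGraph
variable {g n : ℕ}

/-- The category `TM'_g^n`. -/
instance : SmallCategory (FatGraph g n) where
  Hom := TMHom
  id Γ := ⟨fun x => [x], fun x => [x],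
    .iso (Equiv.refl _) ⟨fun _ => rfl, fun _ => rfl, fun _ => rfl, fun _ => rfl⟩
      fun y x hx => by rw [List.mem_singleton.1 hx]⟩
  comp f h := ⟨_, _, f.isMor.comp h.isMor⟩
  id_comp f := TMHom.ext (by funext x; simp) (by funext x; simp)
  comp_id f := TMHom.ext (by funext x; simp) (by funext x; simp)
  assoc f h k := TMHom.ext (by funext x; simp [List.flatMap_assoc])
    (by funext x; simp [List.flatMap_assoc])

/-- The polygon `∂_i Γ`: its vertices are the corners on the `i`-th boundary component, and each
edge runs along an edge of `Γ` from one corner to the next. -/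
def boundaryPolygon (Γ : FatGraph g n) (i : Fin n) : Polygon where
  V := {x : Γ.Flag // Γ.mark x = i}
  fintype := inferInstance
  nonempty := let ⟨x, hx⟩ := Γ.mark_surjective i; ⟨⟨x, hx⟩⟩
  next := Γ.φ.subtypePerm fun x => by rw [mark_φ]
  cyclic x y := by
    obtain ⟨j, hj⟩ := ((Γ.mark_eq_iff x.1 y.1).1 (x.2.trans y.2.symm)).exists_nat_pow_eq
    refine ⟨j, Subtype.ext ?_⟩
    have : ∀ (j : ℕ) (z : {x : Γ.Flag // Γ.mark x = i}),
        ((Γ.φ.subtypePerm fun x => by rw [mark_φ] : Equiv.Perm {x : Γ.Flag // Γ.mark x = i})^[j] z).1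
          = (Γ.φ ^ j) z.1 := by
      intro j
      induction j with
      | zero => intro z; rfl
      | succ j ih => intro z; rw [Function.iterate_succ_apply, ih, pow_succ]; rfl
    rw [this]
    exact hj

/-- The corner fibres, restricted to the `i`-th boundary component. -/
def boundaryFiber {Γ Γ' : FatGraph g n} (f : Γ ⟶ Γ') (i : Fin n)
    (y : {y : Γ'.Flag // Γ'.mark y = i}) : List {x : Γ.Flag // Γ.mark x = i} :=
  (TMHom.fiber f y.1).pmap Subtype.mk fun x hx => (f.isMor.mark y.1 x hx).trans y.2

theorem map_val_boundaryFiber {Γ Γ' : FatGraph g n} (f : Γ ⟶ Γ') (i : Fin n)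
    (y : {y : Γ'.Flag // Γ'.mark y = i}) :
    (boundaryFiber f i y).map Subtype.val = TMHom.fiber f y.1 := by
  simp [boundaryFiber, List.map_pmap]

theorem mem_boundaryFiber {Γ Γ' : FatGraph g n} (f : Γ ⟶ Γ') (i : Fin n)
    (y : {y : Γ'.Flag // Γ'.mark y = i}) (x : {x : Γ.Flag // Γ.mark x = i}) :
    x ∈ boundaryFiber f i y ↔ x.1 ∈ TMHom.fiber f y.1 := by
  rw [← map_val_boundaryFiber f i y, List.mem_map_of_injective Subtype.val_injective]

/-- The map of boundary polygons induced by a morphism of fat graphs. -/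
noncomputable def boundaryMap {Γ Γ' : FatGraph g n} (f : Γ ⟶ Γ') (i : Fin n) :
    Γ.boundaryPolygon i ⟶ Γ'.boundaryPolygon i :=
  Polygon.homOfPath (X := Γ.boundaryPolygon i) (Y := Γ'.boundaryPolygon i) (boundaryFiber f i)
    ⟨fun y => List.Nodup.of_map Subtype.val (by
        refine (map_val_boundaryFiber f i y).symm ▸ ?_; exact f.isMor.isFibering.1 _),
      fun x => by
        obtain ⟨y, hy, hu⟩ := f.isMor.isFibering.2 x.1
        refine ⟨⟨y, (f.isMor.mark y _ hy).symm.trans x.2⟩, (mem_boundaryFiber ..).2 hy,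
          fun z hz => Subtype.ext (hu _ ((mem_boundaryFiber ..).1 hz))⟩⟩
    (fun y => ⟨f.isMor.exists_path.choose y.1,
      (f.isMor.exists_path.choose_spec.1 y.1).trans y.2⟩)
    (fun y => by
      have h := f.isMor.exists_path.choose_spec.2 y.1
      rw [← map_val_boundaryFiber f i y] at h
      have key : ∀ (l : List {x : Γ.Flag // Γ.mark x = i}) (a b : {x : Γ.Flag // Γ.mark x = i}),
          IsPath Γ.φ a.1 (l.map Subtype.val) b.1 → IsPath (Γ.boundaryPolygon i).next a l b := by
        intro l
        induction l with
        | nil => intro a b h; exact Subtype.ext h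
        | cons x l ih =>
          intro a b h
          exact ⟨Subtype.ext h.1, ih _ _ h.2⟩
      exact key _ _ _ h)

/-- The boundary functor `∂_i : TM'_g^n → Λ`. -/
noncomputable def boundary (g : ℕ) {n : ℕ} (i : Fin n) : FatGraph g n ⥤ Polygon where
  obj Γ := Γ.boundaryPolygon i
  map f := boundaryMap f i
  map_id Γ := Polygon.hom_ext fun y => by
    refine (List.map_injective_iff.2 Subtype.val_injective) ?_
    exact map_val_boundaryFiber (𝟙 Γ) i y
  map_comp {Γ Γ' Γ''} f h := Polygon.hom_ext fun z => by
    refine (List.map_injective_iff.2 Subtype.val_injective) ?_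
    refine (map_val_boundaryFiber (f ≫ h) i z).trans ?_
    change (TMHom.fiber h z.1).flatMap (TMHom.fiber f) =
      ((boundaryFiber h i z).flatMap (boundaryFiber f i)).map Subtype.val
    rw [List.map_flatMap, ← map_val_boundaryFiber h i z, List.flatMap_map]
    refine List.flatMap_congr fun y _ => (map_val_boundaryFiber f i y).symm

end FatGraph

/-! ### Hochschild homology -/

/-- The tensor factors multiplied together by the `i`-th Hochschild face map
`A^{⊗ (m+2)} → A^{⊗ (m+1)}`: for `i ≤ m` it multiplies the neighbouring factors `i` and `i + 1`, and
for `i = m + 1` it multiplies the last factor with the factor `0`. -/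
def faceFiber (m : ℕ) (i : Fin (m + 2)) (j : Fin (m + 1)) : List (Fin (m + 2)) :=
  if i = Fin.last _ then
    if j = 0 then [Fin.last _, 0] else [j.castSucc]
  else
    if j.castSucc < i then [j.castSucc]
    else if j.castSucc = i then [j.castSucc, j.succ]
    else [j.succ]

theorem face_face (m : ℕ) (i j : Fin (m + 2)) (h : i ≤ j) (y : Fin (m + 1)) :
    (faceFiber m i y).flatMap (faceFiber (m + 1) j.succ) =
      (faceFiber m j y).flatMap (faceFiber (m + 1) i.castSucc) := by
  obtain ⟨i, hi⟩ := i
  obtain ⟨j, hj⟩ := j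
  obtain ⟨y, hy⟩ := y
  simp only [Fin.mk_le_mk] at h
  simp only [faceFiber, Fin.ext_iff, Fin.val_last, Fin.val_castSucc, Fin.lt_def, Fin.val_zero]
  split_ifs <;> simp only [List.flatMap_cons, List.flatMap_nil, List.append_nil] <;>
    (try (exfalso; omega)) <;>
    simp only [faceFiber, Fin.ext_iff, Fin.val_last, Fin.val_castSucc, Fin.lt_def,
      Fin.val_zero, Fin.castSucc_mk, Fin.succ_mk] <;>
    split_ifs <;> first | (exfalso; omega) | (simp [Fin.ext_iff]; done) | (simp [Fin.ext_iff]; omega)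

theorem mem_faceFiber (m : ℕ) (i : Fin (m + 2)) (j : Fin (m + 1)) (x : Fin (m + 2)) :
    x ∈ faceFiber m i j ↔ j.val = if i.val = m + 1 then (if x.val = m + 1 then 0 else x.val)
      else if x.val ≤ i.val then x.val else x.val - 1 := by
  obtain ⟨i, hi⟩ := i
  obtain ⟨j, hj⟩ := j
  obtain ⟨x, hx⟩ := x
  simp only [faceFiber, Fin.ext_iff, Fin.val_last, Fin.val_castSucc, Fin.lt_def, Fin.val_zero]
  split_ifs <;> simp [Fin.ext_iff] <;> omega

theorem faceFiber_isFibering (m : ℕ) (i : Fin (m + 2)) : IsFibering (faceFiber m i) := by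
  refine ⟨fun j => ?_, fun x => ?_⟩
  · unfold faceFiber
    split_ifs <;> simp [Fin.ext_iff]
  · have hx := x.2
    have hi := i.2
    simp only [mem_faceFiber]
    refine ⟨⟨if i.val = m + 1 then (if x.val = m + 1 then 0 else x.val)
      else if x.val ≤ i.val then x.val else x.val - 1, ?_⟩, rfl, fun y hy => Fin.ext hy⟩
    split_ifs <;> omega

section Hochschild

variable (k : Type u) [Field k] (A : Type u) [Ring A] [Algebra k A]

open scoped TensorProduct

/-- The `i`-th Hochschild face map `d_i`. -/
noncomputable def face (m : ℕ) (i : Fin (m + 2)) :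
    (⨂[k] _ : Fin (m + 2), A) →ₗ[k] (⨂[k] _ : Fin (m + 1), A) :=
  fiberMul k A (faceFiber_isFibering m i)

theorem face_comp_face (m : ℕ) (i j : Fin (m + 2)) (h : i ≤ j) :
    face k A m i ∘ₗ face k A (m + 1) j.succ = face k A m j ∘ₗ face k A (m + 1) i.castSucc := by
  unfold face
  rw [← fiberMul_comp, ← fiberMul_comp]
  ext a
  simp only [LinearMap.compMultilinearMap_apply, fiberMul_tprod, face_face m i j h]

/-- The Hochschild differential `b = ∑ (-1)^i d_i`. -/
noncomputable def hochschildD (m : ℕ) :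
    (⨂[k] _ : Fin (m + 2), A) →ₗ[k] (⨂[k] _ : Fin (m + 1), A) :=
  ∑ i : Fin (m + 2), (-1 : k) ^ (i : ℕ) • face k A m i

theorem hochschildD_comp (m : ℕ) : hochschildD k A m ∘ₗ hochschildD k A (m + 1) = 0 := by
  let T : Fin (m + 2) × Fin (m + 3) → ((⨂[k] _ : Fin (m + 3), A) →ₗ[k] (⨂[k] _ : Fin (m + 1), A)) :=
    fun p => ((-1 : k) ^ (p.1 : ℕ) * (-1 : k) ^ (p.2 : ℕ)) • (face k A m p.1 ∘ₗ face k A (m + 1) p.2)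
  have hT : hochschildD k A m ∘ₗ hochschildD k A (m + 1) = ∑ p, T p := by
    rw [Fintype.sum_prod_type]
    ext a
    simp [hochschildD, T, Finset.smul_sum, smul_smul, LinearMap.sum_apply, map_sum]
  rw [hT]
  let S : Finset (Fin (m + 2) × Fin (m + 3)) := {p | (p.2 : ℕ) ≤ (p.1 : ℕ)}
  rw [← Finset.sum_add_sum_compl S, ← eq_neg_iff_add_eq_zero, ← Finset.sum_neg_distrib]
  refine Finset.sum_bij (fun p hp => (Fin.castLT p.2
    (lt_of_le_of_lt (Finset.mem_filter.mp hp).right (Fin.is_lt p.1)), p.1.succ)) ?_ ?_ ?_ ?_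
  · intro p hp
    simp_rw [S, Finset.compl_filter, Finset.mem_filter_univ, Fin.val_succ, Fin.val_castLT] at hp ⊢
    omega
  · rintro ⟨i, j⟩ hp ⟨i', j'⟩ hp' h
    simp only [Prod.mk.injEq, Fin.ext_iff, Fin.val_castLT, Fin.val_succ] at h ⊢
    omega
  · rintro ⟨i', j'⟩ hp
    simp_rw [S, Finset.compl_filter, Finset.mem_filter_univ, not_le] at hp
    have := j'.2
    have hlt : (i' : ℕ) < (j' : ℕ) := hp
    refine ⟨(⟨j'.val - 1, by omega⟩, Fin.castSucc i'), ?_, ?_⟩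
    · simp only [S, Finset.mem_filter_univ, Fin.val_castSucc]
      omega
    · simp only [Prod.mk.injEq, Fin.ext_iff, Fin.val_castLT, Fin.val_succ, Fin.val_castSucc,
        true_and]
      exact Nat.sub_add_cancel (by omega)
  · rintro ⟨i, j⟩ hp
    have hle : (j : ℕ) ≤ (i : ℕ) := (Finset.mem_filter.mp hp).right
    have hlt : (j : ℕ) < m + 2 := lt_of_le_of_lt hle i.2
    have := face_comp_face k A m (Fin.castLT j hlt) i hle
    simp only [T]
    rw [this, Fin.castSucc_castLT]
    have hc : (-1 : k) ^ (i : ℕ) * (-1 : k) ^ (j : ℕ) =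
        -((-1 : k) ^ ((Fin.castLT j hlt : Fin (m + 2)) : ℕ) * (-1 : k) ^ (i.succ : ℕ)) := by
      simp only [Fin.val_castLT, Fin.val_succ, pow_succ]
      ring
    rw [hc, eq_neg_iff_add_eq_zero, ← add_smul, neg_add_cancel, zero_smul]

/-- The Hochschild complex `⋯ → A ⊗ A ⊗ A → A ⊗ A → A` of an algebra over the field `k`. -/
noncomputable def hochschildComplex : ChainComplex (ModuleCat.{u} k) ℕ :=
  ChainComplex.of (fun m => ModuleCat.of k (⨂[k] _ : Fin (m + 1), A))
    (fun m => ModuleCat.ofHom (hochschildD k A m)) fun m => by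
      rw [← ModuleCat.ofHom_comp, hochschildD_comp]; rfl

/-- Hochschild homology `H_j(A)`. -/
noncomputable def hochschildHomology (j : ℕ) : ModuleCat.{u} k :=
  (hochschildComplex k A).homology j

end Hochschild

/-! ### The functors and homology groups of the theorem -/

/-- `∂₁ × ∂₂ × ∂₃ : TM'_g^3 → Λ × Λ × Λ`. -/
noncomputable def boundaryTriple (g : ℕ) : FatGraph g 3 ⥤ Polygon × Polygon × Polygon :=
  (FatGraph.boundary g 0).prod' ((FatGraph.boundary g 1).prod' (FatGraph.boundary g 2))

/-- The projection `p : ([1] \ Id_Λ) → Λ` forgetting the label. -/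
abbrev underProj : Under oneGon ⥤ Polygon := Under.forget oneGon

/-- `p₁ i₁ × p₂ i₂ × p₃ i₃ : Δ₂ × Δ₂ × Δ₂ → Λ × Λ × Λ`. -/
noncomputable def deltaTriple : DeltaTwo × DeltaTwo × DeltaTwo ⥤ Polygon × Polygon × Polygon :=
  (DeltaTwo.toUnder ⋙ underProj).prod
    ((DeltaTwo.toUnder ⋙ underProj).prod (DeltaTwo.toUnder ⋙ underProj))

section

open scoped MonoidalCategory TensorProduct

variable (k : Type u) [Field k] (A₁ A₂ A₃ : Type u) [Ring A₁] [Algebra k A₁] [Ring A₂]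
  [Algebra k A₂] [Ring A₃] [Algebra k A₃]

/-- The graph homology `H_j^g(A₁, A₂, A₃)`: the homology of `TM'_g^3` with coefficients in
`A₁^♯ ∘ ∂₁ ⊗ A₂^♯ ∘ ∂₂ ⊗ A₃^♯ ∘ ∂₃`. -/
noncomputable def graphHomology (g j : ℕ) : ModuleCat.{u} k :=
  catHomology ((FatGraph.boundary g (0 : Fin 3) ⋙ sharp k A₁) ⊗
    ((FatGraph.boundary g (1 : Fin 3) ⋙ sharp k A₂) ⊗
      (FatGraph.boundary g (2 : Fin 3) ⋙ sharp k A₃))) j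

/-- The degree `j` part of the graded tensor product `H_*(A₁) ⊗ H_*(A₂) ⊗ H_*(A₃)` of Hochschild
homologies. -/
abbrev hochschildTensor (j : ℕ) : Type u :=
  DirectSum {t : ℕ × ℕ × ℕ // t.1 + t.2.1 + t.2.2 = j} fun t =>
    hochschildHomology k A₁ t.1.1 ⊗[k]
      (hochschildHomology k A₂ t.1.2.1 ⊗[k] hochschildHomology k A₃ t.1.2.2)

end

end GraphHomology

open GraphHomology

/-! The category of graphs is compared with `Δ₂ × Δ₂ × Δ₂` through a small combinatorial category,
`Theta`. In genus zero an edge with the same boundary component on both sides is a bridge, and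
contracting all bridges of a graph with three boundary components leaves a subdivided theta graph or
a figure eight. Such a graph consists of three chains of edges, the chain `i` separating the
boundary components `i` and `i + 1`. The numbering of the components and the orientation distinguish
the two trivalent vertices, so the graph has no automorphisms and is recorded by three lengths, at
most one of which is zero (in a figure eight the two special vertices coincide). Its morphisms are
triples of monotone maps of intervals which preserve the ends.

Graphs to model. The functor `Theta.toGraph` has a left adjoint. A morphism preserves the components
on both sides of each edge it traverses, so every morphism to a bridgeless graph contracts the
bridges and factors uniquely through their contraction (`exists_isReflection`). The graphs without
bridges are recognised by contracting edges down to a figure eight and rebuilding them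
(`exists_isModel`). Precomposition with a right adjoint preserves projectives, since it is left
adjoint to an exact functor, and right adjoints are final; hence homology does not change
(`catHomology_comp_of_isRightAdjoint`).

Model to intervals. Cutting each boundary component open at the first trivalent vertex gives
`Theta.cutAll` with values in `Δ₂ × Δ₂ × Δ₂`, and gluing the ends again recovers the boundary
functors (`toGraphBoundaryTriple`). Let `extend a` be `a` with one new edge at the beginning of each
chain. An arrow `x ⟶ cutAll a` lifts, naturally in `a`, to `cutAll (extend a)` so that the interior
points of `x` avoid the new edges. Shrinking the new edges gives back the arrow, and shrinking the
old ones gives an arrow which depends on `x` only. Thus `cutAll` is final, and the same natural lift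
shows that projective functors restrict to acyclic ones (`exists_section_of_projective`,
`catHomology_isZero_of_section`). Dimension shifting turns these two facts into an isomorphism in
all degrees (`catHomology_comp_of_final`). This proves (1).

For (2), the homology of `Δ₂` is computed by the complex with the alternating sums of the maps
merging neighbouring elements (`catHomology_iso_altComplex`): adding a new least element gives an
extra degeneracy on projectives. For `A^♯` this complex is the Hochschild complex, the last face
being the cyclic one because the merged end is the glued vertex (`fiber_merge`). The coefficients on
the triple product are an external tensor product, and over a field the Künneth formula
`catHomology_extTensor` applies. -/

open CategoryTheory CategoryTheory.Limits

namespace GraphHomology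

/-! ### Dimension shifting for left derived functors -/

section DimensionShift

universe v₁ v₂ u₁ u₂

variable {A : Type u₁} [Category.{v₁} A] [Abelian A]

/-- A chain complex `K` with an augmentation to `Y` which is exact. -/
structure Resolution (Y : A) where
  /-- the complex -/
  K : ChainComplex A ℕ
  /-- the augmentation -/
  p : K.X 0 ⟶ Y
  w : K.d 1 0 ≫ p = 0
  exact : ∀ n, (ShortComplex.mk _ _ (K.d_comp_d (n + 2) (n + 1) n)).Exact
  exact₀ : (ShortComplex.mk _ _ w).Exact
  epi : Epi p

attribute [instance] Resolution.epi

theorem Resolution.exactAt {Y : A} (R : Resolution Y) (n : ℕ) : R.K.ExactAt (n + 1) := by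
  rw [HomologicalComplex.exactAt_iff' _ (n + 1 + 1) (n + 1) n (by simp) (by simp)]
  exact R.exact n

/-- A resolution by projective objects, as a `ProjectiveResolution`. -/
noncomputable def Resolution.toProjectiveResolution {Y : A} (R : Resolution Y)
    (hR : ∀ n, Projective (R.K.X n)) : ProjectiveResolution Y where
  complex := R.K
  projective := hR
  π := (ChainComplex.toSingle₀Equiv _ _).symm ⟨R.p, R.w⟩
  quasiIso := ⟨fun n => by
    cases n with
    | zero =>
      have e : ((ChainComplex.toSingle₀Equiv _ _).symm ⟨R.p, R.w⟩).f 0 = R.p := by simp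
      rw [ChainComplex.quasiIsoAt₀_iff, ShortComplex.quasiIso_iff_of_zeros']
      · refine (ShortComplex.exact_and_epi_g_iff_of_iso ?_).2 ⟨R.exact₀, R.epi⟩
        exact ShortComplex.isoMk (Iso.refl _) (Iso.refl _) (Iso.refl _)
            ((Category.id_comp _).trans (Category.comp_id _).symm)
            ((Category.id_comp _).trans (e.symm.trans (Category.comp_id _).symm))
      · exact R.K.shape _ _ (by simp)
      all_goals rfl
    | succ n =>
      rw [quasiIsoAt_iff_exactAt']
      · exact R.exactAt n
      · apply ChainComplex.exactAt_succ_single_obj⟩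

/-- The resolution underlying a projective resolution. -/
noncomputable def Resolution.ofProjectiveResolution {Y : A} (P : ProjectiveResolution Y) :
    Resolution Y where
  K := P.complex
  p := P.π.f 0
  w := P.complex_d_comp_π_f_zero
  exact := P.exact_succ
  exact₀ := P.exact₀
  epi := inferInstanceAs (Epi (P.π.f 0))

/-- Splicing a resolution of `X₁` into a short exact sequence. -/
noncomputable def Resolution.splice (S : ShortComplex A) (hS : S.ShortExact)
    (R : Resolution S.X₁) : Resolution S.X₃ where
  K := ChainComplex.augment R.K (R.p ≫ S.f) (by rw [← Category.assoc, R.w, zero_comp])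
  p := S.g
  w := by
    change (R.p ≫ S.f) ≫ S.g = 0
    rw [Category.assoc, S.zero, comp_zero]
  exact := by
    have := hS.mono_f
    rintro (_ | n)
    · have h := R.exact₀
      -- The joint of the splice: composing the augmentation with the monomorphism `S.f` does not
      -- change its kernel.
      let φ : ShortComplex.mk _ _ R.w ⟶ ShortComplex.mk (R.K.d 1 0) (R.p ≫ S.f)
          (by rw [← Category.assoc, R.w, zero_comp]) :=
        { τ₁ := 𝟙 _, τ₂ := 𝟙 _, τ₃ := S.f }
      have : Epi φ.τ₁ := inferInstanceAs (Epi (𝟙 _))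
      have : CategoryTheory.IsIso φ.τ₂ := inferInstanceAs (CategoryTheory.IsIso (𝟙 _))
      have : Mono φ.τ₃ := hS.mono_f
      exact (ShortComplex.exact_iff_of_epi_of_isIso_of_mono φ).1 h
    · exact R.exact n
  exact₀ := by
    let φ : ShortComplex.mk (R.p ≫ S.f) S.g (by rw [Category.assoc, S.zero, comp_zero]) ⟶ S :=
      { τ₁ := R.p, τ₂ := 𝟙 _, τ₃ := 𝟙 _ }
    have : Epi φ.τ₁ := R.epi
    have : CategoryTheory.IsIso φ.τ₂ := inferInstanceAs (CategoryTheory.IsIso (𝟙 _))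
    have : Mono φ.τ₃ := inferInstanceAs (Mono (𝟙 _))
    exact (ShortComplex.exact_iff_of_epi_of_isIso_of_mono φ).2 hS.exact
  epi := hS.epi_g

theorem Resolution.splice_projective (S : ShortComplex A) (hS : S.ShortExact)
    (R : Resolution S.X₁) (hP : Projective S.X₂) (hR : ∀ n, Projective (R.K.X n)) :
    ∀ n, Projective ((R.splice S hS).K.X n)
  | 0 => hP
  | n + 1 => hR n

variable {B : Type u₂} [Category.{v₂} B] [Abelian B]

/-- The homology in the middle of `X₁ ⟶ X₂ ⟶ X₃` is the kernel of the map from the cokernel of the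
first map to `X₃`. -/
theorem homology_iso_kernel {X₁ X₂ X₃ Q : B} (f : X₁ ⟶ X₂) (g : X₂ ⟶ X₃) (w : f ≫ g = 0)
    (p : X₂ ⟶ Q) (wp : f ≫ p = 0) (hp : (ShortComplex.mk _ _ wp).Exact) [Epi p] (q : Q ⟶ X₃)
    (hq : p ≫ q = g) :
    Nonempty ((ShortComplex.mk f g w).homology ≅ kernel q) := by
  have hc : IsColimit (CokernelCofork.ofπ p wp) := hp.gIsCokernel
  have e : hc.desc (CokernelCofork.ofπ g w) = q := by
    rw [← cancel_epi p]
    exact (hc.fac _ WalkingParallelPair.one).trans hq.symm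
  -- Exactness at `X₂` together with `p` epi makes `Q` the cokernel of `f`, which is what right
  -- homology data requires.
  let h : (ShortComplex.mk f g w).RightHomologyData :=
    { Q := Q, H := kernel q, p := p, ι := kernel.ι q, wp := wp, hp := hc
      wι := by rw [e]; exact kernel.condition q
      hι := by
        refine IsLimit.ofIsoLimit
          (isKernelCompMono (kernelIsKernel q) (𝟙 _) (h := hc.desc (CokernelCofork.ofπ g w)) ?_)
          (Iso.refl _)
        rw [e]; exact (Category.comp_id q).symm }
  exact ⟨h.homologyIso⟩

/-- For `g` epi, exactness says that `g` is a cokernel of `f`, and right exact functors preserve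
cokernels. -/
theorem map_exact_of_epi (T : A ⥤ B) [T.Additive] [PreservesFiniteColimits T]
    {X Y Z : A} {f : X ⟶ Y} {g : Y ⟶ Z} (w : f ≫ g = 0)
    (h : (ShortComplex.mk f g w).Exact) [Epi g] :
    (ShortComplex.mk (T.map f) (T.map g) (by rw [← T.map_comp, w, T.map_zero])).Exact ∧
      Epi (T.map g) := by
  have h' := ((ShortComplex.mk f g w).exact_and_epi_g_iff_g_is_cokernel).1 ⟨h, by assumption⟩
  refine (ShortComplex.exact_and_epi_g_iff_g_is_cokernel _).2 ?_
  exact ⟨CokernelCofork.mapIsColimit _ h'.some T⟩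

variable [EnoughProjectives A] (T : A ⥤ B) [T.Additive]

theorem Resolution.nonempty_leftDerived_iso {Y : A} (R : Resolution Y)
    (hR : ∀ n, Projective (R.K.X n)) (n : ℕ) :
    Nonempty ((T.leftDerived n).obj Y ≅
      ((T.mapHomologicalComplex (ComplexShape.down ℕ)).obj R.K).homology n) :=
  ⟨(R.toProjectiveResolution hR).isoLeftDerivedObj T n⟩

theorem exists_projective_resolution (Y : A) :
    ∃ R : Resolution Y, ∀ n, Projective (R.K.X n) :=
  ⟨.ofProjectiveResolution (projectiveResolution Y), (projectiveResolution Y).projective⟩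

/-- A projective resolution of `X₁`, spliced with `X₂ ⟶ X₃`, is one of `X₃`. In these degrees the
two complexes agree definitionally up to the shift. -/
theorem leftDerived_succ_succ_iso (S : ShortComplex A) (hS : S.ShortExact) (hP : Projective S.X₂)
    (n : ℕ) :
    Nonempty ((T.leftDerived (n + 2)).obj S.X₃ ≅ (T.leftDerived (n + 1)).obj S.X₁) := by
  obtain ⟨R, hR⟩ := exists_projective_resolution S.X₁
  obtain ⟨i⟩ := R.nonempty_leftDerived_iso T hR (n + 1)
  obtain ⟨j⟩ := (R.splice S hS).nonempty_leftDerived_iso T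
    (Resolution.splice_projective S hS R hP hR) (n + 2)
  refine ⟨j ≪≫ HomologicalComplex.homologyIsoSc' _ (n + 3) (n + 2) (n + 1) (by simp) (by simp) ≪≫
    ?_ ≪≫ (HomologicalComplex.homologyIsoSc' _ (n + 2) (n + 1) n (by simp) (by simp)).symm ≪≫
    i.symm⟩
  exact Iso.refl _

variable [PreservesFiniteColimits T]

/-- In the spliced resolution the first homology is that of `T R₁ ⟶ T R₀ ⟶ T X₂`, and by right
exactness `T X₁` is the cokernel of the first of these maps. -/
theorem leftDerived_one_iso_kernel (S : ShortComplex A) (hS : S.ShortExact)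
    (hP : Projective S.X₂) :
    Nonempty ((T.leftDerived 1).obj S.X₃ ≅ kernel (T.map S.f)) := by
  obtain ⟨R, hR⟩ := exists_projective_resolution S.X₁
  obtain ⟨j⟩ := (R.splice S hS).nonempty_leftDerived_iso T
    (Resolution.splice_projective S hS R hP hR) 1
  obtain ⟨h1, h2⟩ := map_exact_of_epi T R.w R.exact₀
  obtain ⟨i⟩ := homology_iso_kernel (T.map (R.K.d 1 0)) (T.map (R.p ≫ S.f))
    (by rw [← T.map_comp, ← Category.assoc, R.w, zero_comp, T.map_zero]) (T.map R.p)
    (by rw [← T.map_comp, R.w, T.map_zero]) h1 (T.map S.f) (T.map_comp _ _).symm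
  refine ⟨j ≪≫ HomologicalComplex.homologyIsoSc' _ 2 1 0 (by simp) (by simp) ≪≫ ?_ ≪≫ i⟩
  exact Iso.refl _

/-- The snake input on a morphism of short complexes. -/
noncomputable def snakeInput {L₁ L₂ : ShortComplex A} (φ : L₁ ⟶ L₂) (h₁ : L₁.Exact) (e₁ : Epi L₁.g)
    (h₂ : L₂.Exact) (m₂ : Mono L₂.f) : ShortComplex.SnakeInput A where
  L₀ := kernel φ
  L₁ := L₁
  L₂ := L₂
  L₃ := cokernel φ
  v₀₁ := kernel.ι φ
  v₁₂ := φ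
  v₂₃ := cokernel.π φ
  w₀₂ := kernel.condition φ
  w₁₃ := cokernel.condition φ
  h₀ := kernelIsKernel φ
  h₃ := cokernelIsCokernel φ
  L₁_exact := h₁
  epi_L₁_g := e₁
  L₂_exact := h₂
  mono_L₂_f := m₂

/-- Compatible projective covers of the three terms of a short exact sequence. -/
theorem exists_cover_shortExact (S : ShortComplex A) (hS : S.ShortExact) :
    ∃ (K P : ShortComplex A) (i : K ⟶ P) (p : P ⟶ S), K.ShortExact ∧ Nonempty P.Splitting ∧
      Projective P.X₁ ∧ Projective P.X₂ ∧ Projective P.X₃ ∧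
      (∃ w, (ShortComplex.mk i.τ₁ p.τ₁ w).ShortExact) ∧
      (∃ w, (ShortComplex.mk i.τ₂ p.τ₂ w).ShortExact) ∧
      (∃ w, (ShortComplex.mk i.τ₃ p.τ₃ w).ShortExact) := by
  have := hS.mono_f
  have := hS.epi_g
  let P₁ := Projective.over S.X₁
  let P₃ := Projective.over S.X₃
  let P : ShortComplex A := ShortComplex.mk (biprod.inl : P₁ ⟶ P₁ ⊞ P₃) biprod.snd (by simp)
  let σ : P.Splitting := { r := biprod.fst, s := biprod.inr }
  -- As in the horseshoe lemma, the cover of `X₃` is lifted to `X₂` and gives the second component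
  -- of the cover of `X₂`.
  let c : P₃ ⟶ S.X₂ := Projective.factorThru (Projective.π S.X₃) S.g
  have hc : c ≫ S.g = Projective.π S.X₃ := Projective.factorThru_comp _ _
  let p : P ⟶ S :=
    { τ₁ := Projective.π _
      τ₂ := biprod.desc (Projective.π _ ≫ S.f) c
      τ₃ := Projective.π _
      comm₁₂ := by simp [P]
      comm₂₃ := by
        apply biprod.hom_ext' <;> simp [P, hc] }
  have e₁ : Epi p.τ₁ := inferInstanceAs (Epi (Projective.π _))
  have e₃ : Epi p.τ₃ := inferInstanceAs (Epi (Projective.π _))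
  have hP : P.ShortExact := σ.shortExact
  have e₂ : Epi p.τ₂ := by
    have := hP.mono_f
    have := hP.epi_g
    exact ShortComplex.epi_τ₂_of_exact_of_epi p hS.exact
  have m : Mono P.f := hP.mono_f
  have e : Epi P.g := hP.epi_g
  let N := snakeInput p hP.exact e hS.exact hS.mono_f
  have hN : N.L₀.ShortExact :=
    { exact := N.L₀_exact
      mono_f := have : Mono N.L₁.f := m; inferInstance
      epi_g := by
        have : Epi N.v₁₂.τ₁ := e₁
        -- The cover of `X₁` is epi, so the target of the connecting map vanishes and the row of
        -- kernels is exact on the right too.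
        have hz : IsZero N.L₃.X₁ := by
          have h := N.w₁₃_τ₁
          rw [← comp_zero, cancel_epi] at h
          exact (IsZero.iff_id_eq_zero _).2 (by rw [← cancel_epi N.v₂₃.τ₁, h]; simp)
        exact N.L₁'_exact.epi_f (hz.eq_of_tgt _ _) }
  refine ⟨N.L₀, P, N.v₀₁, p, hN, ⟨σ⟩, inferInstanceAs (Projective P₁),
    inferInstanceAs (Projective (P₁ ⊞ P₃)), inferInstanceAs (Projective P₃),
    ⟨N.w₀₂_τ₁, ?_⟩, ⟨N.w₀₂_τ₂, ?_⟩, ⟨N.w₀₂_τ₃, ?_⟩⟩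
  · exact { exact := N.exact_C₁_up, mono_f := N.mono_v₀₁_τ₁, epi_g := e₁ }
  · exact { exact := N.exact_C₂_up, mono_f := N.mono_v₀₁_τ₂, epi_g := e₂ }
  · exact { exact := N.exact_C₃_up, mono_f := N.mono_v₀₁_τ₃, epi_g := e₃ }

/-- The snake lemma for the kernels of projective covers. -/
theorem exists_cover_kernel (S : ShortComplex A) (hS : S.ShortExact)
    (h : IsZero ((T.leftDerived 1).obj S.X₂)) :
    ∃ (K P : ShortComplex A) (i : K ⟶ P) (p : P ⟶ S), K.ShortExact ∧ Nonempty P.Splitting ∧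
      Projective P.X₁ ∧ Projective P.X₂ ∧ Projective P.X₃ ∧
      (∃ w, (ShortComplex.mk i.τ₁ p.τ₁ w).ShortExact) ∧
      (∃ w, (ShortComplex.mk i.τ₂ p.τ₂ w).ShortExact) ∧
      (∃ w, (ShortComplex.mk i.τ₃ p.τ₃ w).ShortExact) ∧
      Mono (T.map i.τ₂) ∧ Nonempty (kernel (T.map i.τ₃) ≅ kernel (T.map S.f)) := by
  obtain ⟨K, P, i, p, hK, ⟨σ⟩, h₁, h₂, h₃, ⟨w₁, s₁⟩, ⟨w₂, s₂⟩, ⟨w₃, s₃⟩⟩ :=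
    exists_cover_shortExact S hS
  have := hK.epi_g
  have c₁ := map_exact_of_epi T K.zero hK.exact
  have σ' : (P.map T).Splitting := σ.map T
  have hm := σ'.shortExact.mono_f
  have w : i ≫ p = 0 := by ext <;> assumption
  have w' : T.mapShortComplex.map i ≫ T.mapShortComplex.map p = 0 := by
    rw [← Functor.map_comp, w]
    ext <;> exact T.map_zero _ _
  have q : ∀ {X Y Z : A} {f : X ⟶ Y} {g : Y ⟶ Z} (w : f ≫ g = 0)
      (h : (ShortComplex.mk f g w).ShortExact),
      Nonempty (IsColimit (CokernelCofork.ofπ (f := T.map f) (T.map g)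
        (by rw [← T.map_comp, w, T.map_zero]))) := fun w h => by
    have := h.epi_g
    have := map_exact_of_epi T w h.exact
    have := this.2
    exact ⟨(map_exact_of_epi T w h.exact).1.gIsCokernel⟩
  -- The columns are `T K ⟶ T P ⟶ T S`, where `T S` is the cokernel by right exactness and the row
  -- `T P` is split. Since the kernel of `T i₂` is `L₁T(X₂) = 0`, the connecting map identifies the
  -- kernel of `T i₃` with the kernel of `T S.f`.
  let N : ShortComplex.SnakeInput B :=
    { L₀ := kernel (T.mapShortComplex.map i)
      L₁ := T.mapShortComplex.obj K
      L₂ := T.mapShortComplex.obj P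
      L₃ := T.mapShortComplex.obj S
      v₀₁ := kernel.ι _
      v₁₂ := T.mapShortComplex.map i
      v₂₃ := T.mapShortComplex.map p
      w₀₂ := kernel.condition _
      w₁₃ := w'
      h₀ := kernelIsKernel _
      h₃ := ShortComplex.isColimitOfIsColimitπ _
        ((isColimitMapCoconeCoforkEquiv' ShortComplex.π₁ w').symm (q w₁ s₁).some)
        ((isColimitMapCoconeCoforkEquiv' ShortComplex.π₂ w').symm (q w₂ s₂).some)
        ((isColimitMapCoconeCoforkEquiv' ShortComplex.π₃ w').symm (q w₃ s₃).some)
      L₁_exact := c₁.1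
      epi_L₁_g := c₁.2
      L₂_exact := σ'.shortExact.exact
      mono_L₂_f := hm }
  obtain ⟨e₂⟩ := leftDerived_one_iso_kernel T _ s₂ h₂
  have hz : IsZero (kernel (T.map i.τ₂)) := h.of_iso e₂.symm
  have hz₀ : IsZero N.L₀.X₂ :=
    hz.of_iso (IsLimit.conePointUniqueUpToIso N.h₀τ₂ (limit.isLimit (parallelPair (T.map i.τ₂) 0)))
  have : Mono N.L₂'.f := N.mono_δ hz₀
  refine ⟨K, P, i, p, hK, ⟨σ⟩, h₁, h₂, h₃, ⟨w₁, s₁⟩, ⟨w₂, s₂⟩, ⟨w₃, s₃⟩,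
    Preadditive.mono_of_isZero_kernel _ hz, ⟨?_⟩⟩
  have hδ : IsLimit (KernelFork.ofι N.δ N.δ_L₃_f) := N.L₂'_exact.fIsKernel
  exact (IsLimit.conePointUniqueUpToIso N.h₀τ₃ (limit.isLimit (parallelPair (T.map i.τ₃) 0))).symm ≪≫
    (IsLimit.conePointUniqueUpToIso hδ (limit.isLimit (parallelPair (T.map S.f) 0)))

/-- The kernel formula survives when the middle term is only acyclic in degree one: `L₁T(X₃)` is a
kernel for the cover of `X₃`, and the snake lemma carries it to the kernel for `S`. -/
theorem leftDerived_one_iso_kernel_of_isZero (S : ShortComplex A) (hS : S.ShortExact)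
    (h : IsZero ((T.leftDerived 1).obj S.X₂)) :
    Nonempty ((T.leftDerived 1).obj S.X₃ ≅ kernel (T.map S.f)) := by
  obtain ⟨K, P, i, p, hK, -, h₁, h₂, h₃, ⟨w₁, s₁⟩, ⟨w₂, s₂⟩, ⟨w₃, s₃⟩, hm, ⟨e⟩⟩ :=
    exists_cover_kernel T S hS h
  obtain ⟨e'⟩ := leftDerived_one_iso_kernel T _ s₃ h₃
  exact ⟨e' ≪≫ e⟩

/-- Dimension shifting along a short exact sequence with acyclic middle term. -/
theorem leftDerived_succ_succ_iso_of_isZero (n : ℕ) (S : ShortComplex A) (hS : S.ShortExact)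
    (h : ∀ j, IsZero ((T.leftDerived (j + 1)).obj S.X₂)) :
    Nonempty ((T.leftDerived (n + 2)).obj S.X₃ ≅ (T.leftDerived (n + 1)).obj S.X₁) := by
  induction n generalizing S with
  | zero =>
    obtain ⟨K, P, i, p, hK, ⟨σ⟩, h₁, h₂, h₃, ⟨w₁, s₁⟩, ⟨w₂, s₂⟩, ⟨w₃, s₃⟩, hm, -⟩ :=
      exists_cover_kernel T S hS (h 0)
    -- Passing to kernels of covers lowers the degree by one, so `L₁T(K₂) = L₂T(X₂) = 0` and the
    -- kernel formula applies to the row `K`.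
    have hz : IsZero ((T.leftDerived 1).obj K.X₂) :=
      (h 1).of_iso (leftDerived_succ_succ_iso T _ s₂ h₂ 0).some.symm
    obtain ⟨a⟩ := leftDerived_succ_succ_iso T _ s₃ h₃ 0
    obtain ⟨b⟩ := leftDerived_one_iso_kernel_of_isZero T K hK hz
    obtain ⟨c⟩ := leftDerived_one_iso_kernel T _ s₁ h₁
    have hm' : Mono (T.map P.f) := (σ.map T).shortExact.mono_f
    have e : T.map K.f ≫ T.map i.τ₂ = T.map i.τ₁ ≫ T.map P.f := by
      rw [← T.map_comp, ← T.map_comp, i.comm₁₂]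
    -- Both kernels are kernels of the same map `T K₁ ⟶ T P₂`, because `T i₂` and `T P.f` are
    -- monomorphisms.
    have d : kernel (T.map K.f) ≅ kernel (T.map i.τ₁) :=
      (kernelCompMono (T.map K.f) (T.map i.τ₂)).symm ≪≫ kernelIsoOfEq e ≪≫
        kernelCompMono (T.map i.τ₁) (T.map P.f)
    exact ⟨a ≪≫ b ≪≫ d ≪≫ c.symm⟩
  | succ n ih =>
    obtain ⟨K, P, i, p, hK, -, h₁, h₂, h₃, ⟨w₁, s₁⟩, ⟨w₂, s₂⟩, ⟨w₃, s₃⟩, -⟩ :=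
      exists_cover_kernel T S hS (h 0)
    obtain ⟨a⟩ := leftDerived_succ_succ_iso T _ s₃ h₃ (n + 1)
    -- The middle kernel is acyclic again, its derived functors being those of `X₂` one degree
    -- higher.
    obtain ⟨b⟩ := ih K hK fun j =>
      (h (j + 1)).of_iso (leftDerived_succ_succ_iso T _ s₂ h₂ j).some.symm
    obtain ⟨c⟩ := leftDerived_succ_succ_iso T _ s₁ h₁ n
    exact ⟨a ≪≫ b ≪≫ c.symm⟩

end DimensionShift

/-! ### Comparison of resolutions -/

section

universe v₁ v₂ u₁ u₂

variable {A : Type u₁} [Category.{v₁} A] [Abelian A]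

/-- A chain complex of projective objects maps to every resolution, over a given morphism. -/
theorem Resolution.exists_lift {Y Z : A} (P : ChainComplex A ℕ) (hP : ∀ n, Projective (P.X n))
    (p : P.X 0 ⟶ Y) (w : P.d 1 0 ≫ p = 0) (R : Resolution Z) (f : Y ⟶ Z) :
    ∃ φ : P ⟶ R.K, φ.f 0 ≫ R.p = p ≫ f := by
  let a : P.X 0 ⟶ R.K.X 0 := Projective.factorThru (p ≫ f) R.p
  have ha : a ≫ R.p = p ≫ f := Projective.factorThru_comp _ _
  have hb₀ : (P.d 1 0 ≫ a) ≫ R.p = 0 := by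
    rw [Category.assoc, ha, ← Category.assoc, w, zero_comp]
  let b : P.X 1 ⟶ R.K.X 1 := R.exact₀.liftFromProjective (P.d 1 0 ≫ a) hb₀
  have hb : b ≫ R.K.d 1 0 = P.d 1 0 ≫ a := R.exact₀.liftFromProjective_comp _ hb₀
  refine ⟨ChainComplex.mkHom _ _ a b hb fun n q =>
    ⟨(R.exact n).liftFromProjective (P.d (n + 2) (n + 1) ≫ q.2.1) ?_, ?_⟩, ha⟩
  · change (P.d (n + 2) (n + 1) ≫ q.2.1) ≫ R.K.d (n + 1) n = 0
    rw [Category.assoc, q.2.2, ← Category.assoc, P.d_comp_d, zero_comp]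
  · exact (R.exact n).liftFromProjective_comp _ _

variable {B : Type u₂} [Category.{v₂} B] [Abelian B]

/-- The image of a resolution under an exact functor. -/
noncomputable def Resolution.map {Y : A} (R : Resolution Y) (G : A ⥤ B) [G.Additive]
    [PreservesFiniteLimits G] [PreservesFiniteColimits G] : Resolution (G.obj Y) where
  K := (G.mapHomologicalComplex _).obj R.K
  p := G.map R.p
  w := by
    change G.map _ ≫ G.map _ = 0
    rw [← G.map_comp, R.w, G.map_zero]
  exact n := (R.exact n).map G
  exact₀ := R.exact₀.map G
  epi := inferInstanceAs (Epi (G.map R.p))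

theorem Resolution.homology_map_isZero {Y : A} (R : Resolution Y) (G : A ⥤ B) [G.Additive]
    [PreservesFiniteLimits G] [PreservesFiniteColimits G] (n : ℕ) :
    IsZero (((G.mapHomologicalComplex (ComplexShape.down ℕ)).obj R.K).homology (n + 1)) :=
  ((R.map G).exactAt n).isZero_homology

end

/-! ### Acyclicity from a natural section -/

section Contraction

variable {k : Type u} [Field k] {D : Type} [SmallCategory D] {B : Type} [SmallCategory B]

instance : PreservesFiniteColimits (colim (J := D) (C := ModuleCat.{u} k)) where
  preservesFiniteColimits _ := inferInstance

/-- The section lifts to a projective resolution `Q` of `R`; followed by `S ⟶ 𝟭` it becomes an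
endomorphism of `Q` homotopic to the identity. After taking colimits this endomorphism factors
through the complex `Q(d₀)`, by means of `q`. Evaluation is exact, so `Q(d₀)` has no homology in
positive degrees, and there the identity of the homology of `R` is zero. -/
theorem catHomology_isZero_of_section (S : D ⥤ D) (p : S ⟶ 𝟭 D) (d₀ : D)
    (q : S ⟶ (Functor.const D).obj d₀) (R : D ⥤ ModuleCat.{u} k) (s : R ⟶ S ⋙ R)
    (hs : ∀ d, s.app d ≫ R.map (p.app d) = 𝟙 _) (n : ℕ) : IsZero (catHomology R (n + 1)) := by
  let P := projectiveResolution R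
  let Q := Resolution.ofProjectiveResolution P
  let W : (D ⥤ ModuleCat.{u} k) ⥤ D ⥤ ModuleCat.{u} k := (Functor.whiskeringLeft D D _).obj S
  -- Precomposition with `S` is exact, so it sends the resolution of `R` to a resolution of `S ⋙ R`.
  obtain ⟨σ, hσ⟩ := Resolution.exists_lift Q.K P.projective Q.p Q.w (Q.map W) s
  let π : W ⟶ 𝟭 _ := { app := fun F => Functor.whiskerRight p F }
  let a : W ⋙ colim ⟶ (evaluation D (ModuleCat.{u} k)).obj d₀ :=
    { app := fun F => colimit.desc (S ⋙ F)
        { pt := F.obj d₀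
          ι := { app := fun d => F.map (q.app d)
                 naturality := fun d d' f => by
                  change F.map (S.map f) ≫ F.map (q.app d') = F.map (q.app d) ≫ 𝟙 _
                  rw [← F.map_comp, q.naturality]
                  simp } }
      naturality := fun F G f => by
        apply colimit.hom_ext
        intro d
        simp [W] }
  let b : (evaluation D (ModuleCat.{u} k)).obj d₀ ⟶ colim :=
    { app := fun F => colimit.ι F d₀ }
  -- In the colimit of `F`, moving an element of `F (S d)` along `S d ⟶ d` or along `S d ⟶ d₀` gives
  -- the same class.
  have hab : ∀ F, a.app F ≫ b.app F = colim.map (π.app F) := fun F => by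
    apply colimit.hom_ext
    intro d
    simp [a, b, W, π]
  let σ' : ∀ i, Q.K.X i ⟶ W.obj (Q.K.X i) := fun i => σ.f i
  have hσ₀ : σ' 0 ≫ W.map Q.p = Q.p ≫ s := hσ
  have hσ' : ∀ i j, σ' i ≫ W.map (Q.K.d i j) = Q.K.d i j ≫ σ' j := fun i j => σ.comm i j
  let φ : Q.K ⟶ Q.K := σ ≫ (NatTrans.mapHomologicalComplex π (ComplexShape.down ℕ)).app Q.K
  have hφ : φ.f 0 ≫ Q.p = Q.p := by
    have e : π.app (Q.K.X 0) ≫ Q.p = W.map Q.p ≫ π.app R := (π.naturality Q.p).symm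
    change (σ' 0 ≫ π.app (Q.K.X 0)) ≫ Q.p = Q.p
    refine (Category.assoc _ _ _).trans ((congrArg (σ' 0 ≫ ·) e).trans ?_)
    refine (Category.assoc _ _ _).symm.trans ((congrArg (· ≫ π.app R) hσ₀).trans ?_)
    refine (Category.assoc _ _ _).trans (?_ : _ = Q.p)
    have : s ≫ π.app R = 𝟙 R := by
      ext1; funext d; exact hs d
    rw [this]; exact Category.comp_id _
  -- Both maps lie over the identity of `R`.
  have H : Homotopy φ (𝟙 Q.K) := by
    refine ProjectiveResolution.liftHomotopy (P := P) (Q := P) (𝟙 R) φ (𝟙 _) ?_ (by simp)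
    ext1 
    refine hφ.trans ?_
    simp [Q, Resolution.ofProjectiveResolution]
    rfl
  let T := colim (J := D) (C := ModuleCat.{u} k)
  let C := (T.mapHomologicalComplex (ComplexShape.down ℕ)).obj Q.K
  let E := (((evaluation D (ModuleCat.{u} k)).obj d₀).mapHomologicalComplex
    (ComplexShape.down ℕ)).obj Q.K
  let f : C ⟶ E :=
    { f := fun i => T.map (σ' i) ≫ a.app (Q.K.X i)
      comm' := fun i j _ => by
        change (T.map (σ' i) ≫ a.app (Q.K.X i)) ≫ (Q.K.d i j).app d₀ =
          T.map (Q.K.d i j) ≫ T.map (σ' j) ≫ a.app (Q.K.X j)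
        refine Eq.trans ?_ (Category.assoc _ _ _)
        rw [← T.map_comp, ← hσ', T.map_comp]
        refine (Category.assoc _ _ _).trans (Eq.trans ?_ (Category.assoc _ _ _).symm)
        exact congrArg (T.map (σ' i) ≫ ·) (a.naturality (Q.K.d i j)).symm }
  let g : E ⟶ C := (NatTrans.mapHomologicalComplex b (ComplexShape.down ℕ)).app Q.K
  have hfg : f ≫ g = (T.mapHomologicalComplex _).map φ := by
    ext1 i
    change (T.map (σ' i) ≫ a.app (Q.K.X i)) ≫ b.app (Q.K.X i) = T.map (σ' i ≫ π.app _)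
    rw [T.map_comp]
    exact (Category.assoc _ _ _).trans (congrArg (T.map (σ' i) ≫ ·) (hab _))
  have hid : HomologicalComplex.homologyMap (f ≫ g) (n + 1) = 𝟙 _ := by
    rw [hfg, (T.mapHomotopy H).homologyMap_eq (n + 1)]
    simp
    rfl
  have hz : IsZero (E.homology (n + 1)) := Q.homology_map_isZero _ n
  refine IsZero.of_iso ?_ (P.isoLeftDerivedObj T (n + 1))
  refine (IsZero.iff_id_eq_zero _).2 ?_
  refine hid.symm.trans ?_
  rw [HomologicalComplex.homologyMap_comp, hz.eq_of_tgt (HomologicalComplex.homologyMap f _) 0,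
    zero_comp]
  rfl

/-- Every projective functor is a retract of a coproduct of functors left adjoint to evaluation. -/
theorem exists_retract_of_projective (P : B ⥤ ModuleCat.{u} k) [Projective P] :
    ∃ (V : B → ModuleCat.{u} k) (i : P ⟶ ∐ fun c => (evaluationLeftAdjoint _ c).obj (V c))
      (r : (∐ fun c => (evaluationLeftAdjoint _ c).obj (V c)) ⟶ P), i ≫ r = 𝟙 P := by
  let f : ∀ c, (evaluationLeftAdjoint (ModuleCat.{u} k) c).obj (P.obj c) ⟶ P := fun c =>
      ((evaluationAdjunctionRight (ModuleCat.{u} k) c).homEquiv _ _).symm (𝟙 _)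
  have hf : ∀ c, Epi ((f c).app c) := fun c => by
    have h : (evaluationAdjunctionRight (ModuleCat.{u} k) c).unit.app _ ≫ (f c).app c = 𝟙 _ :=
      ((evaluationAdjunctionRight (ModuleCat.{u} k) c).homEquiv _ _).apply_symm_apply _
    exact epi_of_epi_fac h
  have : Epi (Sigma.desc f) := by
    rw [NatTrans.epi_iff_epi_app]
    intro c
    have h : (Sigma.ι (fun c => (evaluationLeftAdjoint (ModuleCat.{u} k) c).obj (P.obj c)) c).app c ≫ (Sigma.desc f).app c = (f c).app c := by
      rw [← NatTrans.comp_app, Sigma.ι_desc]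
    have := hf c
    exact epi_of_epi_fac h
  exact ⟨fun c => P.obj c, Projective.factorThru (𝟙 P) (Sigma.desc f), Sigma.desc f,
    Projective.factorThru_comp _ _⟩

/-- A natural lift of the arrows `c ⟶ Ψ d` along `Ψ S ⟶ Ψ` gives a section for every projective
functor. -/
theorem exists_section_of_projective (Ψ : D ⥤ B) (S : D ⥤ D) (p : S ⟶ 𝟭 D)
    (T : ∀ {c : B} {d : D}, (c ⟶ Ψ.obj d) → (c ⟶ Ψ.obj (S.obj d)))
    (hT : ∀ {c : B} {d d' : D} (α : c ⟶ Ψ.obj d) (f : d ⟶ d'),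
      T (α ≫ Ψ.map f) = T α ≫ Ψ.map (S.map f))
    (hp : ∀ {c : B} {d : D} (α : c ⟶ Ψ.obj d), T α ≫ Ψ.map (p.app d) = α)
    (P : B ⥤ ModuleCat.{u} k) [Projective P] :
    ∃ s : Ψ ⋙ P ⟶ S ⋙ Ψ ⋙ P, ∀ d, s.app d ≫ P.map (Ψ.map (p.app d)) = 𝟙 _ := by
  obtain ⟨V, i, r, hir⟩ := exists_retract_of_projective P
  let L : B → B ⥤ ModuleCat.{u} k := fun c => (evaluationLeftAdjoint _ c).obj (V c)
  -- `L c` is a coproduct of copies of `V c` indexed by the arrows out of `c`; the copy of `α` is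
  -- sent to the copy of `T α`. Naturality is `hT`, and the section property is `hp`.
  let s : ∀ c, Ψ ⋙ L c ⟶ S ⋙ Ψ ⋙ L c := fun c =>
    { app := fun d => Sigma.desc fun α => Sigma.ι (fun _ : c ⟶ Ψ.obj (S.obj d) => V c) (T α)
      naturality := fun d d' f => by
        apply Sigma.hom_ext
        intro α
        refine (Sigma.ι_desc_assoc _ _ _).trans ((Sigma.ι_desc _ _).trans ?_)
        refine Eq.symm ((Sigma.ι_desc_assoc _ _ _).trans ((Sigma.ι_desc _ _).trans ?_))
        refine Eq.symm ?_
        exact congrArg (Sigma.ι fun _ : c ⟶ Ψ.obj (S.obj d') => V c) (hT α f) }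
  have hs : ∀ c d, (s c).app d ≫ (L c).map (Ψ.map (p.app d)) = 𝟙 _ := fun c d => by
    apply Sigma.hom_ext
    intro α
    refine (Sigma.ι_desc_assoc _ _ _).trans ((Sigma.ι_desc _ _).trans ?_)
    refine Eq.trans ?_ (Category.comp_id _).symm
    exact congrArg (Sigma.ι fun _ : c ⟶ Ψ.obj d => V c) (hp α)
  let W : (B ⥤ ModuleCat.{u} k) ⥤ D ⥤ ModuleCat.{u} k := (Functor.whiskeringLeft D B _).obj Ψ
  let hc := isColimitOfPreserves W (coproductIsCoproduct L)
  -- The sections on the summands are assembled over the coproduct; conjugating with `i` and `r`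
  -- then passes to the retract `P`.
  let t : Ψ ⋙ ∐ L ⟶ S ⋙ Ψ ⋙ ∐ L := hc.desc
    { pt := S ⋙ Ψ ⋙ ∐ L
      ι := Discrete.natTrans fun c => s c.as ≫ S.whiskerLeft (Ψ.whiskerLeft (Sigma.ι L c.as)) }
  have ht : ∀ c d, (Sigma.ι L c).app (Ψ.obj d) ≫ t.app d =
      (s c).app d ≫ (Sigma.ι L c).app (Ψ.obj (S.obj d)) := fun c d =>
    NatTrans.congr_app (hc.fac _ ⟨c⟩) d
  have htp : ∀ d, t.app d ≫ (∐ L).map (Ψ.map (p.app d)) = 𝟙 _ := fun d => by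
    let hd := isColimitOfPreserves ((evaluation B (ModuleCat.{u} k)).obj (Ψ.obj d))
      (coproductIsCoproduct L)
    refine hd.hom_ext fun c => ?_
    change (Sigma.ι L c.as).app (Ψ.obj d) ≫ _ = (Sigma.ι L c.as).app (Ψ.obj d) ≫ _
    rw [← Category.assoc, ht, Category.assoc, ← NatTrans.naturality, ← Category.assoc]
    refine (congrArg (· ≫ (Sigma.ι L c.as).app (Ψ.obj d)) (hs c.as d)).trans ?_
    exact (Category.id_comp _).trans (Category.comp_id _).symm
  refine ⟨Ψ.whiskerLeft i ≫ t ≫ S.whiskerLeft (Ψ.whiskerLeft r), fun d => ?_⟩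
  change (i.app _ ≫ t.app d ≫ r.app _) ≫ P.map _ = _
  rw [Category.assoc, Category.assoc, ← NatTrans.naturality, reassoc_of% htp]
  exact NatTrans.congr_app hir _

end Contraction

/-! ### Final functors, right adjoints and homology -/

section Finality

variable {k : Type u} [Field k] {D : Type} [SmallCategory D] {B : Type} [SmallCategory B]

theorem catHomology_iso_of_iso {F G : D ⥤ ModuleCat.{u} k} (e : F ≅ G) (j : ℕ) :
    Nonempty (catHomology F j ≅ catHomology G j) :=
  ⟨(colim.leftDerived j).mapIso e⟩

/-- Finality is the case `j = 0`. Beyond it, both sides are shifted along a projective presentation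
of `F`: on `B` its middle term is projective, and on `D` its restriction is acyclic by `hΨ`. -/
theorem catHomology_comp_of_final (Ψ : D ⥤ B) [Ψ.Final]
    (hΨ : ∀ (P : B ⥤ ModuleCat.{u} k) [Projective P] (j : ℕ), IsZero (catHomology (Ψ ⋙ P) (j + 1)))
    (F : B ⥤ ModuleCat.{u} k) (j : ℕ) :
    Nonempty (catHomology (Ψ ⋙ F) j ≅ catHomology F j) := by
  let W : (B ⥤ ModuleCat.{u} k) ⥤ D ⥤ ModuleCat.{u} k := (Functor.whiskeringLeft D B _).obj Ψ
  let e : W ⋙ colim ≅ colim := Functor.Final.colimIso Ψ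
  have key : ∀ F : B ⥤ ModuleCat.{u} k, ∃ S : ShortComplex (B ⥤ ModuleCat.{u} k),
      S.X₃ = F ∧ S.ShortExact ∧ Projective S.X₂ := fun F =>
    ⟨ShortComplex.mk (kernel.ι (Projective.π F)) (Projective.π F) (kernel.condition _), rfl,
      { exact := ShortComplex.exact_of_f_is_kernel _ (kernelIsKernel _)
        mono_f := inferInstanceAs (Mono (kernel.ι _))
        epi_g := inferInstanceAs (Epi (Projective.π F)) }, inferInstanceAs (Projective (Projective.over F))⟩
  induction j using Nat.twoStepInduction generalizing F with
  | zero => 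
    exact ⟨colim.leftDerivedZeroIsoSelf.app (W.obj F) ≪≫ e.app F ≪≫
      (colim.leftDerivedZeroIsoSelf.app F).symm⟩
  | one =>
    obtain ⟨S, rfl, hS, hP⟩ := key F
    obtain ⟨a⟩ := leftDerived_one_iso_kernel_of_isZero colim _ (hS.map_of_exact W) (hΨ S.X₂ 0)
    obtain ⟨b⟩ := leftDerived_one_iso_kernel colim _ hS hP
    exact ⟨a ≪≫ kernel.mapIso _ _ (e.app S.X₁) (e.app S.X₂) (e.hom.naturality S.f) ≪≫ b.symm⟩
  | more j _ ih =>
    obtain ⟨S, rfl, hS, hP⟩ := key F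
    obtain ⟨a⟩ := leftDerived_succ_succ_iso_of_isZero colim j _ (hS.map_of_exact W) (hΨ S.X₂)
    obtain ⟨b⟩ := leftDerived_succ_succ_iso colim _ hS hP j
    obtain ⟨c⟩ := ih S.X₁
    exact ⟨a ≪≫ c ≪≫ b.symm⟩

/-- Precomposition with `E` is left adjoint to precomposition with the left adjoint of `E`. The
latter preserves epimorphisms, so the former preserves projectives, and projectives are acyclic. -/
theorem catHomology_comp_of_isRightAdjoint (E : D ⥤ B) [E.IsRightAdjoint]
    (F : B ⥤ ModuleCat.{u} k) (j : ℕ) :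
    Nonempty (catHomology (E ⋙ F) j ≅ catHomology F j) := by
  refine catHomology_comp_of_final E (fun P _ j => ?_) F j
  have adj := (Adjunction.ofIsRightAdjoint E).whiskerLeft (ModuleCat.{u} k)
  have : Projective (E ⋙ P) := adj.map_projective P inferInstance
  exact Functor.isZero_leftDerived_obj_projective_succ _ _ _

end Finality

/-! ### Alternating sums of faces -/

section Alternating

universe v w

variable {V : Type w} [Category.{v} V] [Preadditive V]

/-- The double sum cancels in pairs: the term of `(i, j)` with `j ≤ i` equals, by the simplicial
identity, the composite belonging to `(j, i + 1)`, and the signs are opposite. -/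
theorem alternating_sum_comp {X₀ X₁ X₂ : V} (m : ℕ) (d : Fin (m + 2) → (X₁ ⟶ X₀))
    (d' : Fin (m + 3) → (X₂ ⟶ X₁))
    (h : ∀ i j : Fin (m + 2), i ≤ j → d' j.succ ≫ d i = d' i.castSucc ≫ d j) :
    (∑ i : Fin (m + 3), (-1 : ℤ) ^ (i : ℕ) • d' i) ≫ ∑ i : Fin (m + 2), (-1 : ℤ) ^ (i : ℕ) • d i = 0 := by
  let T : Fin (m + 2) × Fin (m + 3) → (X₂ ⟶ X₀) :=
    fun p => ((-1 : ℤ) ^ (p.1 : ℕ) * (-1 : ℤ) ^ (p.2 : ℕ)) • (d' p.2 ≫ d p.1)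
  have hT : (∑ i : Fin (m + 3), (-1 : ℤ) ^ (i : ℕ) • d' i) ≫ ∑ i : Fin (m + 2), (-1 : ℤ) ^ (i : ℕ) • d i = ∑ p, T p := by
    rw [Fintype.sum_prod_type, Preadditive.comp_sum]
    refine Finset.sum_congr rfl fun i _ => ?_
    rw [Preadditive.sum_comp]
    refine Finset.sum_congr rfl fun j _ => ?_
    simp only [T, Preadditive.zsmul_comp, Preadditive.comp_zsmul, smul_smul]
  rw [hT]
  let S : Finset (Fin (m + 2) × Fin (m + 3)) := {p | (p.2 : ℕ) ≤ (p.1 : ℕ)}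
  rw [← Finset.sum_add_sum_compl S, ← eq_neg_iff_add_eq_zero, ← Finset.sum_neg_distrib]
  refine Finset.sum_bij (fun p hp => (Fin.castLT p.2
    (lt_of_le_of_lt (Finset.mem_filter.mp hp).right (Fin.is_lt p.1)), p.1.succ)) ?_ ?_ ?_ ?_
  · intro p hp
    simp_rw [S, Finset.compl_filter, Finset.mem_filter_univ, Fin.val_succ, Fin.val_castLT] at hp ⊢
    omega
  · rintro ⟨i, j⟩ hp ⟨i', j'⟩ hp' h
    simp only [Prod.mk.injEq, Fin.ext_iff, Fin.val_castLT, Fin.val_succ] at h ⊢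
    omega
  · rintro ⟨i', j'⟩ hp
    simp_rw [S, Finset.compl_filter, Finset.mem_filter_univ, not_le] at hp
    have := j'.2
    have hlt : (i' : ℕ) < (j' : ℕ) := hp
    refine ⟨(⟨j'.val - 1, by omega⟩, Fin.castSucc i'), ?_, ?_⟩
    · simp only [S, Finset.mem_filter_univ, Fin.val_castSucc]
      omega
    · simp only [Prod.mk.injEq, Fin.ext_iff, Fin.val_castLT, Fin.val_succ, Fin.val_castSucc,
        true_and]
      exact Nat.sub_add_cancel (by omega)
  · rintro ⟨i, j⟩ hp
    have hle : (j : ℕ) ≤ (i : ℕ) := (Finset.mem_filter.mp hp).right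
    have hlt : (j : ℕ) < m + 2 := lt_of_le_of_lt hle i.2
    have := h (Fin.castLT j hlt) i hle
    simp only [T]
    rw [this, Fin.castSucc_castLT, ← neg_smul]
    congr 1
    simp only [Fin.val_castLT, Fin.val_succ, pow_succ]
    ring

end Alternating

/-! ### Faces and cones in `Δ₂` -/

namespace DeltaTwo

/-- The map which identifies `i` and `i + 1`. -/
def mergeFun (n : ℕ) (i : Fin (n + 2)) (x : Fin (n + 3)) : Fin (n + 2) :=
  ⟨if x.val ≤ i.val then x.val else x.val - 1, by split_ifs <;> omega⟩

/-- The morphism which identifies `i` and `i + 1`. -/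
def merge (n : ℕ) (i : Fin (n + 2)) : (⟨n + 1⟩ : DeltaTwo) ⟶ ⟨n⟩ where
  toFun := mergeFun n i
  monotone x y h := by
    rw [Fin.le_def] at h ⊢
    simp only [mergeFun]
    split_ifs <;> omega
  map_zero := by ext; simp [mergeFun]
  map_last := by
    have e : mergeFun n i (Fin.last _) = Fin.last _ := by
      ext
      simp only [mergeFun, Fin.val_last]
      split_ifs <;> omega
    exact e

theorem merge_toFun (n : ℕ) (i : Fin (n + 2)) (x : Fin (n + 3)) :
    (Hom.toFun (merge n i) x).val = if x.val ≤ i.val then x.val else x.val - 1 := rfl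

theorem hom_ext {a b : DeltaTwo} {f g : a ⟶ b}
    (h : ∀ x, (Hom.toFun f x).val = (Hom.toFun g x).val) : f = g :=
  Hom.ext (funext fun x => Fin.ext (h x))

theorem comp_toFun {a b c : DeltaTwo} (f : a ⟶ b) (g : b ⟶ c) (x : Fin (a.n + 2)) :
    Hom.toFun (f ≫ g) x = Hom.toFun g (Hom.toFun f x) := rfl

theorem merge_merge (n : ℕ) (i j : Fin (n + 2)) (h : i ≤ j) :
    merge (n + 1) j.succ ≫ merge n i = merge (n + 1) i.castSucc ≫ merge n j := by
  refine hom_ext fun x => ?_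
  rw [Fin.le_def] at h
  simp only [comp_toFun, merge_toFun, Fin.val_succ, Fin.val_castSucc]
  split_ifs <;> omega

theorem toFun_pos {a b : DeltaTwo} (f : a ⟶ b) : (Hom.toFun f 0).val = 0 :=
  congrArg Fin.val (Hom.map_zero f)

/-- The extension of a map by a new least element. -/
def coneFun {n m : ℕ} (f : Fin n → Fin m) : Fin (n + 1) → Fin (m + 1) :=
  Fin.cases 0 fun x => (f x).succ

/-- The functor which adds a new least element. -/
def cone : DeltaTwo ⥤ DeltaTwo where
  obj a := ⟨a.n + 1⟩
  map {a b} f :=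
    { toFun := coneFun (Hom.toFun f)
      monotone := by
        intro x y h
        cases x using Fin.cases with
        | zero => exact Fin.zero_le _
        | succ x =>
          cases y using Fin.cases with
          | zero => exact absurd h (by simp)
          | succ y => exact Fin.succ_le_succ_iff.2 (Hom.monotone f (Fin.succ_le_succ_iff.1 h))
      map_zero := rfl
      map_last := by
        change coneFun (Hom.toFun f) (Fin.last (a.n + 1)).succ = _
        rw [coneFun, Fin.cases_succ, Hom.map_last]; rfl }
  map_id a := by
    refine hom_ext fun x => ?_
    cases x using Fin.cases <;> rfl
  map_comp f g := by
    refine hom_ext fun x => ?_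
    cases x using Fin.cases <;> rfl

/-- The projection identifying the new least element with the old one. -/
def coneProj : cone ⟶ 𝟭 DeltaTwo where
  app a := merge a.n 0
  naturality a b f := by
    refine hom_ext fun x => ?_
    cases x using Fin.cases with
    | zero => exact (toFun_pos f).symm
    | succ x => rfl

/-- The map underlying `coneLift`. -/
def coneLiftFun {n m : ℕ} (f : Fin (n + 1) → Fin m) (x : Fin (n + 1)) : Fin (m + 1) :=
  if x = 0 then 0 else (f x).succ

/-- The lift of `α` to the cone which sends everything but the least element to the old elements. -/
def coneLift {c d : DeltaTwo} (α : c ⟶ d) : c ⟶ cone.obj d where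
  toFun := coneLiftFun (Hom.toFun α)
  monotone x y h := by
    unfold coneLiftFun
    split_ifs with h1 h2 h2
    · exact le_rfl
    · exact Fin.zero_le _
    · subst h2; exact absurd (Fin.le_zero_iff.1 h) h1
    · exact Fin.succ_le_succ_iff.2 (Hom.monotone α h)
  map_zero := if_pos rfl
  map_last := by
    unfold coneLiftFun
    refine (if_neg Fin.last_pos.ne').trans ?_
    rw [Hom.map_last]; rfl

theorem coneLift_toFun {c d : DeltaTwo} (α : c ⟶ d) (x : Fin (c.n + 2)) :
    Hom.toFun (coneLift α) x = if x = 0 then 0 else (Hom.toFun α x).succ := rfl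

theorem coneLift_comp {c d d' : DeltaTwo} (α : c ⟶ d) (f : d ⟶ d') :
    coneLift (α ≫ f) = coneLift α ≫ cone.map f := by
  refine hom_ext fun x => ?_
  rw [comp_toFun, coneLift_toFun, coneLift_toFun]
  split_ifs <;> rfl

theorem coneLift_proj {c d : DeltaTwo} (α : c ⟶ d) : coneLift α ≫ coneProj.app d = α := by
  refine hom_ext fun x => ?_
  rw [comp_toFun, coneLift_toFun]
  split_ifs with h
  · subst h; exact (toFun_pos α).symm
  · rfl

theorem cone_merge (n : ℕ) (i : Fin (n + 2)) : cone.map (merge n i) = merge (n + 1) i.succ := by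
  refine hom_ext fun x => ?_
  cases x using Fin.cases with
  | zero => exact (toFun_pos (merge (n + 1) i.succ)).symm
  | succ x =>
    have h0 : (Hom.toFun (cone.map (merge n i)) x.succ).val =
      (if x.val ≤ i.val then x.val else x.val - 1) + 1 := rfl
    have h1 : (Hom.toFun (merge (n + 1) i.succ) x.succ).val =
      if x.val + 1 ≤ i.val + 1 then x.val + 1 else x.val + 1 - 1 := rfl
    rw [h0, h1]
    split_ifs <;> omega

theorem interior_eq_of_sorted {a b : DeltaTwo} (f : Hom a b) (j : Fin (b.n + 2))
    (l : List (Fin (a.n + 1))) (hl : l.Pairwise (· < ·)) (h : ∀ x, x ∈ l ↔ f.toFun x.castSucc = j) :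
    interior f j = l :=
  List.Perm.eq_of_pairwise (fun _ _ _ _ h h' => absurd h (not_lt.2 h'.le)) (interior_sorted f j) hl
    ((List.perm_ext_iff_of_nodup ((interior_sorted f j).imp ne_of_lt) (hl.imp ne_of_lt)).2
      fun x => by rw [mem_interior, h])

/-- This is what makes the Hochschild complex appear. For the last index the vertex `n + 1` is sent
to the greatest element, hence to the glued vertex, where it is met before the vertex `0`: the
cyclic face. -/
theorem fiber_merge (n : ℕ) (i : Fin (n + 2)) (y : Fin (n + 1)) :
    fiber (merge n i) y = faceFiber n i y := by
  have hi := i.2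
  have hy := y.2
  have e : ∀ (j : Fin (n + 2)) (v : ℕ) (l : List (Fin (n + 2))), j.val = v → l.Pairwise (· < ·) →
      (∀ x : Fin (n + 2), x ∈ l ↔ (if x.val ≤ i.val then x.val else x.val - 1) = v) →
      interior (merge n i) j = l := fun j v l hj hl h =>
    interior_eq_of_sorted _ _ _ hl fun x => (h x).trans (hj ▸
      (Fin.ext_iff (a := Hom.toFun (merge n i) x.castSucc) (b := j)).symm)
  have e2 : i ≠ Fin.last _ → interior (merge n i) y.castSucc = faceFiber n i y := fun h => by
    have h' : i.val < n + 1 := by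
      have := Fin.val_lt_last h; simpa using this
    unfold faceFiber
    rw [if_neg h]
    refine e _ y.val _ rfl ?_ fun x => ?_
    · split_ifs
      · exact List.pairwise_singleton _ _
      · exact List.pairwise_pair.2 Fin.castSucc_lt_succ
      · exact List.pairwise_singleton _ _
    · have := x.2
      simp only [Fin.ext_iff, Fin.lt_def, Fin.val_castSucc]
      split_ifs <;> simp [Fin.ext_iff] <;> omega
  have hz : ∀ x : Fin (n + 2), (x = 0 ↔ x.val = 0) ∧ (x = Fin.last _ ↔ x.val = n + 1) := fun x =>
    ⟨Fin.ext_iff, Fin.ext_iff⟩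
  unfold fiber
  by_cases hl : i = Fin.last _
  · have hl' : i.val = n + 1 := by rw [hl]; rfl
    unfold faceFiber
    rw [if_pos hl]
    split_ifs with h0
    · rw [e (Fin.last _) (n + 1) [Fin.last _] rfl (List.pairwise_singleton _ _) fun x => ?_,
        e 0 0 [0] rfl (List.pairwise_singleton _ _) fun x => ?_]
      · rfl
      · rw [List.mem_singleton, (hz x).1]
        split_ifs <;> omega
      · rw [List.mem_singleton, (hz x).2]
        split_ifs <;> omega
    · refine e _ y.val _ rfl (List.pairwise_singleton _ _) fun x => ?_
      rw [List.mem_singleton, Fin.ext_iff, Fin.val_castSucc]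
      split_ifs <;> omega
  · split_ifs with h0
    · rw [e (Fin.last _) (n + 1) [] rfl List.Pairwise.nil fun x => ?_]
      · rw [List.nil_append, ← e2 hl, h0]; rfl
      · have h' : i.val < n + 1 := by
          have := Fin.val_lt_last hl; simpa using this
        have := x.2
        refine iff_of_false (List.not_mem_nil) ?_
        split_ifs <;> omega
    · exact e2 hl

end DeltaTwo

/-! ### The alternating complex computes the homology of `Δ₂` -/

section AltComplex

variable {k : Type u} [Field k]

/-- The alternating sum of the faces of a functor on `Δ₂`. -/
noncomputable def altD (F : DeltaTwo ⥤ ModuleCat.{u} k) (n : ℕ) : F.obj ⟨n + 1⟩ ⟶ F.obj ⟨n⟩ :=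
  ∑ i : Fin (n + 2), (-1 : ℤ) ^ (i : ℕ) • F.map (DeltaTwo.merge n i)

theorem altD_comp (F : DeltaTwo ⥤ ModuleCat.{u} k) (n : ℕ) : altD F (n + 1) ≫ altD F n = 0 :=
  alternating_sum_comp n _ _ fun i j h => by
    rw [← F.map_comp, ← F.map_comp, DeltaTwo.merge_merge n i j h]

theorem altD_naturality {F G : DeltaTwo ⥤ ModuleCat.{u} k} (f : F ⟶ G) (n : ℕ) :
    f.app ⟨n + 1⟩ ≫ altD G n = altD F n ≫ f.app ⟨n⟩ := by
  simp only [altD, Preadditive.comp_sum, Preadditive.sum_comp, Preadditive.comp_zsmul,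
    Preadditive.zsmul_comp, f.naturality]

theorem of_d_eq (X : ℕ → ModuleCat.{u} k) (d : ∀ n, X (n + 1) ⟶ X n) (sq) (n : ℕ) :
    (ChainComplex.of X d sq).d (n + 1) n = d n := ChainComplex.of_d X d n

/-- The alternating complex of a functor on `Δ₂`. -/
noncomputable def altComplex : (DeltaTwo ⥤ ModuleCat.{u} k) ⥤ ChainComplex (ModuleCat.{u} k) ℕ where
  obj F := ChainComplex.of (fun n => F.obj ⟨n⟩) (altD F) (altD_comp F)
  map {F G} f := ChainComplex.ofHom (fun n => f.app ⟨n⟩) fun n => by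
    refine (congrArg (f.app _ ≫ ·) (of_d_eq (fun n => G.obj ⟨n⟩) (altD G) (altD_comp G) n)).trans ?_
    refine (altD_naturality f n).trans ?_
    exact (congrArg (· ≫ f.app _) (of_d_eq (fun n => F.obj ⟨n⟩) (altD F) (altD_comp F) n)).symm
  map_id F := rfl
  map_comp f g := rfl

theorem altComplex_d (F : DeltaTwo ⥤ ModuleCat.{u} k) (n : ℕ) :
    (altComplex.obj F).d (n + 1) n = altD F n := of_d_eq (fun n => F.obj ⟨n⟩) (altD F) (altD_comp F) n

/-- On a projective functor the lifts of arrows to the cone provide an extra degeneracy `h`. It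
splits the face `0`, and it turns the face `i + 1` into the face `i`, so it is a contracting
homotopy. -/
theorem altComplex_exactAt (P : DeltaTwo ⥤ ModuleCat.{u} k) [Projective P] (n : ℕ) :
    (altComplex.obj P).ExactAt (n + 1) := by
  obtain ⟨s, hs⟩ := exists_section_of_projective (𝟭 DeltaTwo) DeltaTwo.cone DeltaTwo.coneProj
    (fun α => DeltaTwo.coneLift α) (fun α f => DeltaTwo.coneLift_comp α f)
    (fun α => DeltaTwo.coneLift_proj α) P
  let h : ∀ n, P.obj ⟨n⟩ ⟶ P.obj ⟨n + 1⟩ := fun n => s.app ⟨n⟩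
  have h₀ : ∀ n, h n ≫ P.map (DeltaTwo.merge n 0) = 𝟙 _ := fun n => hs ⟨n⟩
  have h₁ : ∀ n i, h (n + 1) ≫ P.map (DeltaTwo.merge (n + 1) i.succ) =
      P.map (DeltaTwo.merge n i) ≫ h n := fun n i => by
    rw [← DeltaTwo.cone_merge]
    exact (s.naturality (DeltaTwo.merge n i)).symm
  -- The face `0` contributes the identity; the face `i + 1` after `h` cancels the face `i` before
  -- `h`.
  have key : ∀ n, h (n + 1) ≫ altD P (n + 1) + altD P n ≫ h n = 𝟙 _ := fun n => by
    rw [altD, Fin.sum_univ_succ, Preadditive.comp_add, Preadditive.comp_sum, altD,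
      Preadditive.sum_comp, add_assoc, ← Finset.sum_add_distrib, Finset.sum_eq_zero, add_zero]
    · simpa using h₀ (n + 1)
    · intro i _
      rw [Preadditive.comp_zsmul, Preadditive.zsmul_comp, h₁, Fin.val_succ, pow_succ, mul_neg_one,
        neg_smul, neg_add_cancel]
  rw [HomologicalComplex.exactAt_iff' _ (n + 1 + 1) (n + 1) n (by simp) (by simp),
    ShortComplex.moduleCat_exact_iff]
  intro (x : P.obj ⟨n + 1⟩) hx
  refine ⟨(h (n + 1)).hom x, ?_⟩
  have hx' : (altD P n).hom x = 0 := by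
    rw [← altComplex_d]; exact hx
  have e : (altD P (n + 1)).hom ((h (n + 1)).hom x) + (h n).hom ((altD P n).hom x) = x :=
    congrArg (fun f => f.hom x) (key n)
  rw [hx', map_zero, add_zero, ← altComplex_d] at e
  exact e

/-- The morphism to the set with two elements whose fibre over the least element is `{0, …, i}`. -/
def DeltaTwo.cutAt (n i : ℕ) (h : i ≤ n) : (⟨n⟩ : DeltaTwo) ⟶ ⟨0⟩ where
  toFun x := if x.val ≤ i then 0 else 1
  monotone x y hxy := by
    rw [Fin.le_def] at hxy
    dsimp only
    split_ifs
    · exact le_rfl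
    · exact Fin.zero_le _
    · omega
    · exact le_rfl
  map_zero := if_pos (Nat.zero_le _)
  map_last := if_neg (by simp; omega)

/-- The morphism to the set with three elements whose middle fibre is `{i + 1}`. -/
def DeltaTwo.cutAt₂ (n i : ℕ) (h : i + 1 ≤ n) : (⟨n⟩ : DeltaTwo) ⟶ ⟨1⟩ where
  toFun x := if x.val ≤ i then 0 else if x.val = i + 1 then 1 else 2
  monotone x y hxy := by
    rw [Fin.le_def] at hxy
    dsimp only
    split_ifs <;> first | exact le_rfl | exact Fin.zero_le _ | (exfalso; omega) | simp [Fin.le_def]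
  map_zero := if_pos (Nat.zero_le _)
  map_last := by
    have e : ¬ ((Fin.last (n + 1)).val ≤ i) := by simp; omega
    have e' : ¬ ((Fin.last (n + 1)).val = i + 1) := by simp; omega
    exact (if_neg e).trans (if_neg e')

theorem DeltaTwo.cutAt₂_merge_zero (n i : ℕ) (h : i + 1 ≤ n) :
    cutAt₂ n i h ≫ merge 0 0 = cutAt n (i + 1) h := by
  refine hom_ext fun x => ?_
  rw [comp_toFun, merge_toFun]
  simp only [cutAt₂, cutAt]
  split_ifs <;> simp_all <;> omega

theorem DeltaTwo.cutAt₂_merge_one (n i : ℕ) (h : i + 1 ≤ n) :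
    cutAt₂ n i h ≫ merge 0 1 = cutAt n i (Nat.le_of_succ_le h) := by
  refine hom_ext fun x => ?_
  rw [comp_toFun, merge_toFun]
  simp only [cutAt₂, cutAt]
  split_ifs <;> simp_all

theorem DeltaTwo.exists_eq_cutAt {n : ℕ} (f : (⟨n⟩ : DeltaTwo) ⟶ ⟨0⟩) :
    ∃ i h, f = cutAt n i h := by
  obtain ⟨c, h0, h1, h2⟩ : ∃ c, 0 < c ∧ c ≤ n + 1 ∧
      ∀ x : Fin (n + 2), x.val < c ↔ (Hom.toFun f x).val < 1 :=
    ⟨cut f (Fin.last _), (lt_cut f _ 0).2 (by rw [Hom.map_zero]; exact Fin.last_pos), cut_le f _,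
      fun x => lt_cut f (Fin.last _) x⟩
  -- `c` is the first point sent to the greatest element, whereas `cutAt` is indexed by the last
  -- point sent to the least one.
  refine ⟨c - 1, Nat.sub_le_of_le_add h1, hom_ext fun x => ?_⟩
  have h2 := h2 x
  have h3 : (Hom.toFun f x).val < 2 := (Hom.toFun f x).2
  simp only [cutAt]
  split_ifs with h
  · change _ = 0
    omega
  · change _ = 1
    omega

/-- The projection from degree zero to the homology in degree zero. -/
noncomputable def altπ (F : DeltaTwo ⥤ ModuleCat.{u} k) :
    F.obj ⟨0⟩ ⟶ (altComplex.obj F).opcycles 0 := (altComplex.obj F).pOpcycles 0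

instance (F : DeltaTwo ⥤ ModuleCat.{u} k) : Epi (altπ F) :=
  inferInstanceAs (Epi ((altComplex.obj F).pOpcycles 0))

theorem altD_altπ (F : DeltaTwo ⥤ ModuleCat.{u} k) : altD F 0 ≫ altπ F = 0 := by
  rw [← altComplex_d]; exact (altComplex.obj F).d_pOpcycles 1 0

theorem altπ_naturality {F G : DeltaTwo ⥤ ModuleCat.{u} k} (f : F ⟶ G) :
    altπ F ≫ HomologicalComplex.opcyclesMap (altComplex.map f) 0 = f.app ⟨0⟩ ≫ altπ G :=
  HomologicalComplex.p_opcyclesMap _ _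

/-- The morphism induced on the homology in degree zero. -/
noncomputable def altDesc (F : DeltaTwo ⥤ ModuleCat.{u} k) {X : ModuleCat.{u} k}
    (f : F.obj ⟨0⟩ ⟶ X) (h : altD F 0 ≫ f = 0) : (altComplex.obj F).opcycles 0 ⟶ X :=
  (altComplex.obj F).descOpcycles f 1 (by simp) (by rw [altComplex_d]; exact h)

theorem altπ_desc (F : DeltaTwo ⥤ ModuleCat.{u} k) {X : ModuleCat.{u} k}
    (f : F.obj ⟨0⟩ ⟶ X) (h : altD F 0 ≫ f = 0) : altπ F ≫ altDesc F f h = f :=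
  HomologicalComplex.p_descOpcycles _ _ _ _ _

/-- Two neighbouring cuts of an interval are the two faces of one map to the set with three
elements. A map which equalises these two faces therefore does not distinguish any of the arrows to
`⟨0⟩`. -/
theorem map_comp_eq_of_altD_comp (F : DeltaTwo ⥤ ModuleCat.{u} k) {n : ℕ}
    (f g : (⟨n⟩ : DeltaTwo) ⟶ ⟨0⟩) {X : ModuleCat.{u} k} (p : F.obj ⟨0⟩ ⟶ X)
    (hp : altD F 0 ≫ p = 0) : F.map f ≫ p = F.map g ≫ p := by
  have hp' : F.map (DeltaTwo.merge 0 0) ≫ p = F.map (DeltaTwo.merge 0 1) ≫ p := by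
    rw [altD, Fin.sum_univ_two] at hp
    simp only [Fin.val_zero, pow_zero, one_smul, Fin.val_one, pow_one, neg_smul,
      ← sub_eq_add_neg] at hp
    exact sub_eq_zero.1 ((Preadditive.sub_comp _ _ _).symm.trans hp)
  have key : ∀ i h, F.map (DeltaTwo.cutAt n i h) ≫ p = F.map (DeltaTwo.cutAt n 0 (Nat.zero_le _)) ≫ p := by
    intro i
    induction i with
    | zero => intro h; rfl
    | succ i ih =>
      intro h
      rw [← ih (Nat.le_of_succ_le h), ← DeltaTwo.cutAt₂_merge_zero, ← DeltaTwo.cutAt₂_merge_one n i h,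
        F.map_comp, F.map_comp, Category.assoc, hp', Category.assoc]
  obtain ⟨i, hi, rfl⟩ := DeltaTwo.exists_eq_cutAt f
  obtain ⟨j, hj, rfl⟩ := DeltaTwo.exists_eq_cutAt g
  rw [key i, key j]

/-- The homology in degree zero of the alternating complex is the colimit. -/
noncomputable def colimIsoAlt : colim (J := DeltaTwo) (C := ModuleCat.{u} k) ≅
    altComplex ⋙ HomologicalComplex.opcyclesFunctor _ _ 0 :=
  have hq : ∀ F : DeltaTwo ⥤ ModuleCat.{u} k, altD F 0 ≫ colimit.ι F ⟨0⟩ = 0 := fun F => by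
    have h : ∀ i, F.map (DeltaTwo.merge 0 i) ≫ colimit.ι F ⟨0⟩ = colimit.ι F ⟨1⟩ :=
      fun i => colimit.w F _
    rw [altD, Preadditive.sum_comp]
    simp only [Preadditive.zsmul_comp, Nat.reduceAdd, h]
    simp [Fin.sum_univ_two]
  NatIso.ofComponents (fun F =>
    { hom := colimit.desc F
        { pt := (altComplex.obj F).opcycles 0
          -- Any arrow `a ⟶ ⟨0⟩` would do; after `altπ` they all have the same effect, which is also
          -- the naturality.
          ι := { app := fun a => F.map (DeltaTwo.cutAt a.n 0 (Nat.zero_le _)) ≫ altπ F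
                 naturality := fun a b f => by
                  refine Eq.trans ?_ (Category.comp_id _).symm
                  refine (Category.assoc _ _ _).symm.trans ?_
                  rw [← F.map_comp]
                  exact map_comp_eq_of_altD_comp F _ _ _ (altD_altπ F) } }
      inv := altDesc F (colimit.ι F ⟨0⟩) (hq F)
      hom_inv_id := by
        apply colimit.hom_ext
        intro a
        refine (colimit.ι_desc_assoc _ _ _).trans ((Category.assoc _ _ _).trans ?_)
        rw [altπ_desc]
        exact (colimit.w F _).trans (Category.comp_id _).symm
      inv_hom_id := by
        refine (cancel_epi (altπ F)).1 ?_
        refine (Category.assoc _ _ _).symm.trans ?_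
        rw [altπ_desc]
        refine (colimit.ι_desc _ _).trans ?_
        refine (map_comp_eq_of_altD_comp F _ (𝟙 _) _ (altD_altπ F)).trans ?_
        rw [F.map_id, Category.id_comp]
        exact (Category.comp_id _).symm })
    fun {F G} f => by
      apply colimit.hom_ext
      intro a
      refine ((ι_colimMap_assoc _ _ _).trans ?_).trans (colimit.ι_desc_assoc _ _ _).symm
      refine (congrArg (f.app a ≫ ·) (colimit.ι_desc _ _)).trans ?_
      refine Eq.trans ?_ (Category.assoc _ _ _).symm
      refine Eq.trans ?_ (congrArg (F.map _ ≫ ·) (altπ_naturality f)).symm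
      exact (Category.assoc _ _ _).symm.trans
        ((congrArg (· ≫ altπ G) (f.naturality _).symm).trans (Category.assoc _ _ _))

theorem altComplex_shortExact (S : ShortComplex (DeltaTwo ⥤ ModuleCat.{u} k)) (hS : S.ShortExact)
    (w) : (ShortComplex.mk (altComplex.map S.f) (altComplex.map S.g) w).ShortExact := by
  refine HomologicalComplex.shortExact_of_degreewise_shortExact _ fun n => ?_
  exact hS.map_of_exact ((evaluation DeltaTwo (ModuleCat.{u} k)).obj ⟨n⟩)

/-- Both sides agree naturally in degree zero, vanish on projectives in positive degrees and shift
along short exact sequences; the alternating complex is exact in the functor, so it has a long exact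
sequence. -/
theorem catHomology_iso_altComplex (F : DeltaTwo ⥤ ModuleCat.{u} k) (j : ℕ) :
    Nonempty (catHomology F j ≅ (altComplex.obj F).homology j) := by
  have key : ∀ F : DeltaTwo ⥤ ModuleCat.{u} k, ∃ S : ShortComplex (DeltaTwo ⥤ ModuleCat.{u} k),
      S.X₃ = F ∧ S.ShortExact ∧ Projective S.X₂ := fun F =>
    ⟨ShortComplex.mk (kernel.ι (Projective.π F)) (Projective.π F) (kernel.condition _), rfl,
      { exact := ShortComplex.exact_of_f_is_kernel _ (kernelIsKernel _)
        mono_f := inferInstanceAs (Mono (kernel.ι _))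
        epi_g := inferInstanceAs (Epi (Projective.π F)) },
      inferInstanceAs (Projective (Projective.over F))⟩
  let e₀ : colim ≅ altComplex ⋙ HomologicalComplex.homologyFunctor (ModuleCat.{u} k) _ 0 :=
    colimIsoAlt ≪≫ NatIso.ofComponents (fun F => (ChainComplex.isoHomologyι₀ (altComplex.obj F)).symm)
      fun {F G} f => by
        have h := ChainComplex.isoHomologyι₀_inv_naturality (altComplex.map f)
        exact h.symm
  have hz : ∀ (P : DeltaTwo ⥤ ModuleCat.{u} k) [Projective P] (j : ℕ),
      IsZero ((altComplex.obj P).homology (j + 1)) := fun P _ j =>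
    (altComplex_exactAt P j).isZero_homology
  induction j using Nat.twoStepInduction generalizing F with
  | zero => exact ⟨colim.leftDerivedZeroIsoSelf.app F ≪≫ e₀.app F⟩
  | one =>
    obtain ⟨S, rfl, hS, hP⟩ := key F
    obtain ⟨b⟩ := leftDerived_one_iso_kernel colim _ hS hP
    have hA := altComplex_shortExact S hS (by rw [← altComplex.map_comp, S.zero]; rfl)
    have h₁₀ : (ComplexShape.down ℕ).Rel 1 0 := rfl
    have : Mono (ShortComplex.mk _ _ (hA.δ_comp 1 0 h₁₀)).f := hA.mono_δ 1 0 h₁₀ (hz S.X₂ 0)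
    -- Since the first homology of `X₂` vanishes, the connecting map exhibits the first homology of
    -- `X₃` as the kernel of `H₀(X₁) ⟶ H₀(X₂)`.
    have hk := (hA.homology_exact₁ 1 0 h₁₀).fIsKernel
    refine ⟨b ≪≫ kernel.mapIso _ _ (e₀.app S.X₁) (e₀.app S.X₂) (e₀.hom.naturality S.f) ≪≫ ?_⟩
    exact (limit.isLimit _).conePointUniqueUpToIso hk
  | more j _ ih =>
    obtain ⟨S, rfl, hS, hP⟩ := key F
    obtain ⟨b⟩ := leftDerived_succ_succ_iso colim _ hS hP j
    obtain ⟨c⟩ := ih S.X₁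
    have hA := altComplex_shortExact S hS (by rw [← altComplex.map_comp, S.zero]; rfl)
    exact ⟨b ≪≫ c ≪≫ (hA.δIso (j + 2) (j + 1) (by simp) (hz S.X₂ (j + 1)) (hz S.X₂ j)).symm⟩

/-- By `fiber_merge` the alternating complex of `A^♯` has the Hochschild faces, hence the same terms
and the same differentials as the Hochschild complex. -/
theorem catHomology_sharp (A : Type u) [Ring A] [Algebra k A] (j : ℕ) :
    Nonempty (catHomology ((DeltaTwo.toUnder ⋙ underProj) ⋙ sharp k A) j ≅
      hochschildHomology k A j) := by
  obtain ⟨e⟩ := catHomology_iso_altComplex ((DeltaTwo.toUnder ⋙ underProj) ⋙ sharp k A) j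
  let F := (DeltaTwo.toUnder ⋙ underProj) ⋙ sharp k A
  refine ⟨e ≪≫ (HomologicalComplex.homologyFunctor _ _ j).mapIso
    (X := altComplex.obj F) (Y := hochschildComplex k A) ?_⟩
  have hd : ∀ n, altD F n = ModuleCat.ofHom (hochschildD k A n) := fun n => by
    ext1
    rw [altD, hochschildD, ModuleCat.hom_sum]
    refine Finset.sum_congr rfl fun i _ => ?_
    have hm : F.map (DeltaTwo.merge n i) = ModuleCat.ofHom (face k A n i) := by
      have h : ∀ (r r' : Fin (n + 1) → List (Fin (n + 2))) (hr : IsFibering r) (hr' : IsFibering r'),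
          r = r' → fiberMul k A hr = fiberMul k A hr' := by
        rintro r _ _ _ rfl; rfl
      exact congrArg ModuleCat.ofHom (h _ _ _ _ (funext fun y => DeltaTwo.fiber_merge n i y))
    rw [hm]
    -- The alternating complex has integer signs, the Hochschild differential has signs in `k`.
    have key : ∀ {X Y : ModuleCat.{u} k} (f : X ⟶ Y) (i : ℕ),
        ((-1 : ℤ) ^ i • f).hom = (-1 : k) ^ i • f.hom := fun f i => by
      rw [ModuleCat.hom_zsmul, ← Int.cast_smul_eq_zsmul k]
      push_cast
      rfl
    exact key (ModuleCat.ofHom (face k A n i)) i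
  refine HomologicalComplex.Hom.isoOfComponents (fun n => Iso.refl _) ?_
  rintro _ n rfl
  refine (Category.id_comp _).trans (Eq.trans ?_ (Category.comp_id _).symm)
  exact (of_d_eq (fun m => ModuleCat.of k (PiTensorProduct k fun _ : Fin (m + 1) => A))
    _ (fun m => by rw [← ModuleCat.ofHom_comp, hochschildD_comp]; rfl) n).trans ((hd n).symm.trans (altComplex_d F n).symm)

end AltComplex

/-! ### Total complexes of bicomplexes -/

section Bicomplex

universe v₁ v₂ v₃ u₁ u₂ u₃

/-- A first quadrant bicomplex, with commuting differentials. -/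
structure Bicomplex (A : Type u₁) [Category.{v₁} A] [Preadditive A] where
  /-- the objects -/
  Z : ℕ → ℕ → A
  /-- the first differential -/
  h : ∀ a b, Z (a + 1) b ⟶ Z a b
  /-- the second differential -/
  v : ∀ a b, Z a (b + 1) ⟶ Z a b
  hh : ∀ a b, h (a + 1) b ≫ h a b = 0
  vv : ∀ a b, v a (b + 1) ≫ v a b = 0
  hv : ∀ a b, h a (b + 1) ≫ v a b = v (a + 1) b ≫ h a b

namespace Bicomplex

variable {A : Type u₁} [Category.{v₁} A] [Preadditive A] [HasFiniteCoproducts A]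

/-- Pairs of natural numbers with sum `n`. -/
abbrev Diag (n : ℕ) := {p : ℕ × ℕ // p.1 + p.2 = n}

instance (n : ℕ) : Finite (Diag n) :=
  Finite.of_injective (β := Fin (n + 1) × Fin (n + 1))
    (fun p => (⟨p.1.1, by have := p.2; omega⟩, ⟨p.1.2, by have := p.2; omega⟩)) fun p q h => by
      simp only [Prod.mk.injEq, Fin.mk.injEq] at h
      exact Subtype.ext (Prod.ext h.1 h.2)

variable (Z : Bicomplex A)

/-- The degree `n` part of the total complex. -/
noncomputable def totX (n : ℕ) : A := ∐ fun p : Diag n => Z.Z p.1.1 p.1.2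

/-- The inclusion of a summand. -/
noncomputable def ι (n a b : ℕ) (e : a + b = n) : Z.Z a b ⟶ Z.totX n :=
  Sigma.ι (fun p : Diag n => Z.Z p.1.1 p.1.2) ⟨(a, b), e⟩

variable {Z} in
theorem tot_ext {n : ℕ} {X : A} {f g : Z.totX n ⟶ X}
    (h : ∀ a b e, Z.ι n a b e ≫ f = Z.ι n a b e ≫ g) : f = g :=
  Sigma.hom_ext _ _ fun ⟨⟨a, b⟩, e⟩ => h a b e

variable {Z} in
/-- A morphism given on the summands. -/
noncomputable def desc {n : ℕ} {X : A} (f : ∀ a b, a + b = n → (Z.Z a b ⟶ X)) : Z.totX n ⟶ X :=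
  Sigma.desc fun p => f p.1.1 p.1.2 p.2

@[simp]
theorem ι_desc {n : ℕ} {X : A} (f : ∀ a b, a + b = n → (Z.Z a b ⟶ X)) (a b : ℕ) (e : a + b = n) :
    Z.ι n a b e ≫ desc f = f a b e :=
  Sigma.ι_desc _ _

/-- The first differential on a summand. -/
noncomputable def hι (n : ℕ) : ∀ a b, a + b = n + 1 → (Z.Z a b ⟶ Z.totX n)
  | 0, _, _ => 0
  | a + 1, b, e => Z.h a b ≫ Z.ι n a b (by omega)

/-- The second differential on a summand. -/
noncomputable def vι (n : ℕ) : ∀ a b, a + b = n + 1 → (Z.Z a b ⟶ Z.totX n)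
  | _, 0, _ => 0
  | a, b + 1, e => Z.v a b ≫ Z.ι n a b (by omega)

@[simp] theorem hι_zero (n b : ℕ) (e) : Z.hι n 0 b e = 0 := rfl
@[simp] theorem hι_succ (n a b : ℕ) (e) :
    Z.hι n (a + 1) b e = Z.h a b ≫ Z.ι n a b (by omega) := rfl
@[simp] theorem vι_zero (n a : ℕ) (e) : Z.vι n a 0 e = 0 := by cases a <;> rfl
@[simp] theorem vι_succ (n a b : ℕ) (e) :
    Z.vι n a (b + 1) e = Z.v a b ≫ Z.ι n a b (by omega) := by cases a <;> rfl

/-- The total differential. -/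
noncomputable def totD (n : ℕ) : Z.totX (n + 1) ⟶ Z.totX n :=
  desc fun a b e => Z.hι n a b e + (-1 : ℤ) ^ a • Z.vι n a b e

@[simp]
theorem ι_totD (n a b : ℕ) (e : a + b = n + 1) :
    Z.ι (n + 1) a b e ≫ Z.totD n = Z.hι n a b e + (-1 : ℤ) ^ a • Z.vι n a b e :=
  Z.ι_desc _ _ _ _

@[simp]
theorem ι_totD_assoc (n a b : ℕ) (e : a + b = n + 1) {X : A} (g : Z.totX n ⟶ X) :
    Z.ι (n + 1) a b e ≫ Z.totD n ≫ g =
      (Z.hι n a b e + (-1 : ℤ) ^ a • Z.vι n a b e) ≫ g := by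
  rw [← Category.assoc, ι_totD]

/-- Only the mixed terms survive. They are equal by `hv`, and they occur with the signs of `a` and
of `a + 1`. -/
theorem totD_comp (n : ℕ) : Z.totD (n + 1) ≫ Z.totD n = 0 := by
  apply tot_ext
  intro a b e
  rw [ι_totD_assoc, comp_zero, Preadditive.add_comp, Preadditive.zsmul_comp]
  -- The case distinction isolates the mixed term; it is absent as soon as one of the two degrees is
  -- zero.
  have h₁ : Z.hι (n + 1) a b e ≫ Z.totD n = match a, b, e with
      | 0, _, _ => 0
      | a + 1, 0, e => 0
      | a + 1, b + 1, e => (-1 : ℤ) ^ a • Z.h a (b + 1) ≫ Z.v a b ≫ Z.ι n a b (by omega) := by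
    rcases a with _ | _ | a
    · simp
    · rcases b with _ | b
      · simp
      · simp
    · rcases b with _ | b
      · simp [reassoc_of% Z.hh]
      · simp [reassoc_of% Z.hh]
  have h₂ : Z.vι (n + 1) a b e ≫ Z.totD n = match a, b, e with
      | 0, _, _ => 0
      | a + 1, 0, e => 0
      | a + 1, b + 1, e => Z.v (a + 1) b ≫ Z.h a b ≫ Z.ι n a b (by omega) := by
    rcases b with _ | _ | b
    · rcases a with _ | a <;> simp
    · rcases a with _ | a
      · simp
      · simp
    · rcases a with _ | a
      · simp [reassoc_of% Z.vv]
      · simp [reassoc_of% Z.vv]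
  rw [h₁, h₂]
  rcases a with _ | a
  · simp
  · rcases b with _ | b
    · simp
    · simp [reassoc_of% Z.hv, pow_succ]

/-- The total complex. -/
noncomputable def tot : ChainComplex A ℕ where
  X := Z.totX
  d := ChainComplex.of.d _ Z.totD
  shape := (ChainComplex.of _ Z.totD Z.totD_comp).shape
  d_comp_d' := (ChainComplex.of _ Z.totD Z.totD_comp).d_comp_d'

theorem tot_d (n : ℕ) : Z.tot.d (n + 1) n = Z.totD n := ChainComplex.of_d Z.totX Z.totD n

/-- A morphism of bicomplexes. -/
@[ext]
structure Hom (Z W : Bicomplex A) where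
  /-- the components -/
  f : ∀ a b, Z.Z a b ⟶ W.Z a b
  h : ∀ a b, f (a + 1) b ≫ W.h a b = Z.h a b ≫ f a b
  v : ∀ a b, f a (b + 1) ≫ W.v a b = Z.v a b ≫ f a b

variable {Z} {W V : Bicomplex A}

/-- The map on total complexes, in a given degree. -/
noncomputable def Hom.totF (φ : Hom Z W) (n : ℕ) : Z.totX n ⟶ W.totX n :=
  desc fun a b e => φ.f a b ≫ W.ι n a b e

@[simp]
theorem Hom.ι_totF (φ : Hom Z W) (n a b : ℕ) (e : a + b = n) :
    Z.ι n a b e ≫ φ.totF n = φ.f a b ≫ W.ι n a b e := Z.ι_desc _ _ _ _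

@[simp]
theorem Hom.ι_totF_assoc (φ : Hom Z W) (n a b : ℕ) (e : a + b = n) {X : A} (g : W.totX n ⟶ X) :
    Z.ι n a b e ≫ φ.totF n ≫ g = φ.f a b ≫ W.ι n a b e ≫ g := by
  rw [← Category.assoc, Hom.ι_totF, Category.assoc]

theorem Hom.totF_totD (φ : Hom Z W) (n : ℕ) : φ.totF (n + 1) ≫ W.totD n = Z.totD n ≫ φ.totF n := by
  apply tot_ext
  intro a b e
  have h₁ : φ.f a b ≫ W.hι n a b e = Z.hι n a b e ≫ φ.totF n := by
    rcases a with _ | a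
    · simp
    · simp [reassoc_of% φ.h]
  have h₂ : φ.f a b ≫ W.vι n a b e = Z.vι n a b e ≫ φ.totF n := by
    rcases b with _ | b
    · simp
    · simp [reassoc_of% φ.v]
  simp [h₁, h₂]

/-- The map on total complexes. -/
noncomputable def Hom.tot (φ : Hom Z W) : Z.tot ⟶ W.tot :=
  ChainComplex.ofHom φ.totF fun n => by rw [tot_d, tot_d]; exact φ.totF_totD n

/-- The identity. -/
def Hom.id (Z : Bicomplex A) : Hom Z Z where
  f a b := 𝟙 _
  h := by simp
  v := by simp

/-- The composition. -/
def Hom.comp (φ : Hom Z W) (ψ : Hom W V) : Hom Z V where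
  f a b := φ.f a b ≫ ψ.f a b
  h a b := by rw [Category.assoc, ψ.h, ← Category.assoc, φ.h, Category.assoc]
  v a b := by rw [Category.assoc, ψ.v, ← Category.assoc, φ.v, Category.assoc]

theorem Hom.id_tot : (Hom.id Z).tot = 𝟙 _ := by
  ext1 n
  apply tot_ext (Z := Z)
  intro a b e
  refine (ι_totF _ _ _ _ _).trans ?_
  exact (Category.id_comp _).trans (Category.comp_id _).symm

theorem Hom.comp_tot (φ : Hom Z W) (ψ : Hom W V) : (φ.comp ψ).tot = φ.tot ≫ ψ.tot := by
  ext1 n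
  apply tot_ext (Z := Z)
  intro a b e
  refine (ι_totF _ _ _ _ _).trans (Eq.trans ?_ (ι_totF_assoc φ _ _ _ _ _).symm)
  refine Eq.trans ?_ (congrArg (φ.f a b ≫ ·) (ι_totF ψ _ _ _ _)).symm
  exact Category.assoc _ _ _

/-- A homotopy in the first direction. -/
structure HHomotopy (φ ψ : Hom Z W) where
  /-- the components -/
  s : ∀ a b, Z.Z a b ⟶ W.Z (a + 1) b
  v : ∀ a b, s a (b + 1) ≫ W.v (a + 1) b = Z.v a b ≫ s a b
  zero : ∀ b, φ.f 0 b = s 0 b ≫ W.h 0 b + ψ.f 0 b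
  succ : ∀ a b, φ.f (a + 1) b = s (a + 1) b ≫ W.h (a + 1) b + Z.h a b ≫ s a b + ψ.f (a + 1) b

/-- A homotopy in the second direction. -/
structure VHomotopy (φ ψ : Hom Z W) where
  /-- the components -/
  s : ∀ a b, Z.Z a b ⟶ W.Z a (b + 1)
  h : ∀ a b, s (a + 1) b ≫ W.h a (b + 1) = Z.h a b ≫ s a b
  zero : ∀ a, φ.f a 0 = s a 0 ≫ W.v a 0 + ψ.f a 0
  succ : ∀ a b, φ.f a (b + 1) = s a (b + 1) ≫ W.v a (b + 1) + Z.v a b ≫ s a b + ψ.f a (b + 1)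

/-- A homotopy of maps of total complexes gives an equality in homology. -/
theorem Hom.homologyMap_tot_eq [CategoryWithHomology A] (φ ψ : Hom Z W)
    (S : ∀ n, Z.totX n ⟶ W.totX (n + 1)) (h₀ : φ.totF 0 = S 0 ≫ W.totD 0 + ψ.totF 0)
    (h₁ : ∀ n, φ.totF (n + 1) = S (n + 1) ≫ W.totD (n + 1) + Z.totD n ≫ S n + ψ.totF (n + 1))
    (n : ℕ) : HomologicalComplex.homologyMap φ.tot n = HomologicalComplex.homologyMap ψ.tot n := by
  let S' : ∀ i j, Z.tot.X i ⟶ W.tot.X j := fun i j =>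
    if h : i + 1 = j then S i ≫ eqToHom (by rw [h]; rfl) else 0
  have hS : ∀ i, S' i (i + 1) = S i := fun i => by
    refine (dif_pos rfl).trans ?_
    exact Category.comp_id _
  have H : Homotopy φ.tot ψ.tot :=
    { hom := S'
      zero := fun i j h => dif_neg h
      comm := fun i => by
        rcases i with _ | i
        · rw [Homotopy.dNext_zero_chainComplex, Homotopy.prevD_chainComplex, hS, zero_add, tot_d]
          exact h₀
        · rw [Homotopy.dNext_succ_chainComplex, Homotopy.prevD_chainComplex, hS, hS, tot_d, tot_d]
          exact (h₁ i).trans (congrArg (· + ψ.totF (i + 1)) (add_comm _ _)) }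
  exact H.homologyMap_eq n

section Homotopy

variable [CategoryWithHomology A]

/-- The homotopy raises the first degree by one and so reverses the sign of the vertical
differential; as `s` commutes with `v`, the vertical terms cancel. -/
theorem HHomotopy.homologyMap_eq {φ ψ : Hom Z W} (s : HHomotopy φ ψ) (n : ℕ) :
    HomologicalComplex.homologyMap φ.tot n = HomologicalComplex.homologyMap ψ.tot n := by
  let S : ∀ n, Z.totX n ⟶ W.totX (n + 1) := fun n =>
    desc fun a b e => s.s a b ≫ W.ι (n + 1) (a + 1) b (by omega)
  have hS : ∀ n a b e, Z.ι n a b e ≫ S n = s.s a b ≫ W.ι (n + 1) (a + 1) b (by omega) :=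
    fun n a b e => Z.ι_desc _ _ _ _
  have key : ∀ n a b e, Z.ι n a b e ≫ S n ≫ W.totD n = s.s a b ≫ W.h a b ≫ W.ι n a b e -
      (-1 : ℤ) ^ a • s.s a b ≫ W.vι n (a + 1) b (by omega) := fun n a b e => by
    rw [reassoc_of% hS, ι_totD]
    simp [pow_succ, sub_eq_add_neg]
  refine Hom.homologyMap_tot_eq _ _ S ?_ (fun n => ?_) n
  · apply tot_ext
    intro a b e
    obtain rfl : a = 0 := by omega
    obtain rfl : b = 0 := by omega
    rw [φ.ι_totF, Preadditive.comp_add, key, ψ.ι_totF]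
    simp [s.zero]
  · apply tot_ext
    intro a b e
    rw [φ.ι_totF, Preadditive.comp_add, Preadditive.comp_add, key, ι_totD_assoc, ψ.ι_totF]
    have hv : Z.vι n a b e ≫ S n = s.s a b ≫ W.vι (n + 1) (a + 1) b (by omega) := by
      rcases b with _ | b
      · simp
      · simp [hS, reassoc_of% s.v]
    rw [Preadditive.add_comp, Preadditive.zsmul_comp, hv]
    rcases a with _ | a
    · simp [s.zero]
    · simp [s.succ, hS]

/-- The sign in `S` cancels the one of the vertical differential. The horizontal terms then occur
with the signs of `a` and `a - 1` and cancel, since `s` commutes with `h`. -/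
theorem VHomotopy.homologyMap_eq {φ ψ : Hom Z W} (s : VHomotopy φ ψ) (n : ℕ) :
    HomologicalComplex.homologyMap φ.tot n = HomologicalComplex.homologyMap ψ.tot n := by
  let S : ∀ n, Z.totX n ⟶ W.totX (n + 1) := fun n =>
    desc fun a b e => (-1 : ℤ) ^ a • s.s a b ≫ W.ι (n + 1) a (b + 1) (by omega)
  have hS : ∀ n a b e, Z.ι n a b e ≫ S n =
      (-1 : ℤ) ^ a • s.s a b ≫ W.ι (n + 1) a (b + 1) (by omega) :=
    fun n a b e => Z.ι_desc _ _ _ _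
  have hsq : ∀ a : ℕ, (-1 : ℤ) ^ a * (-1) ^ a = 1 := fun a => by rw [← mul_pow]; simp
  have key : ∀ n a b e, Z.ι n a b e ≫ S n ≫ W.totD n = s.s a b ≫ W.v a b ≫ W.ι n a b e +
      (-1 : ℤ) ^ a • s.s a b ≫ W.hι n a (b + 1) (by omega) := fun n a b e => by
    rw [reassoc_of% hS, Preadditive.zsmul_comp, Category.assoc, ι_totD]
    simp [smul_smul, hsq, add_comm]
  refine Hom.homologyMap_tot_eq _ _ S ?_ (fun n => ?_) n
  · apply tot_ext
    intro a b e
    obtain rfl : a = 0 := by omega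
    obtain rfl : b = 0 := by omega
    rw [φ.ι_totF, Preadditive.comp_add, key, ψ.ι_totF]
    simp [s.zero]
  · apply tot_ext
    intro a b e
    rw [φ.ι_totF, Preadditive.comp_add, Preadditive.comp_add, key, ι_totD_assoc, ψ.ι_totF]
    have hh : Z.hι n a b e ≫ S n =
        -((-1 : ℤ) ^ a • s.s a b ≫ W.hι (n + 1) a (b + 1) (by omega)) := by
      rcases a with _ | a
      · simp
      · simp [hS, reassoc_of% s.h, pow_succ]
    rw [Preadditive.add_comp, Preadditive.zsmul_comp, hh]
    rcases b with _ | b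
    · simp [s.zero]
    · simp [s.succ, hS, smul_smul, hsq]

/-- A bicomplex with zero differentials is the homology of its total complex. -/
noncomputable def homologyTotIso (hh : ∀ a b, Z.h a b = 0) (hv : ∀ a b, Z.v a b = 0) (n : ℕ) :
    Z.tot.homology n ≅ Z.totX n :=
  have h₀ : ∀ n, Z.totD n = 0 := fun n => by
    apply tot_ext
    intro a b e
    rw [ι_totD, comp_zero]
    rcases a with _ | a <;> rcases b with _ | b <;> simp [hh, hv]
  have h : ∀ n, Z.tot.d (n + 1) n = 0 := fun n => (Z.tot_d n).trans (h₀ n)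
  have h' : ∀ i j, Z.tot.d i j = 0 := fun i j => by
    by_cases e : j + 1 = i
    · subst e; exact h j
    · exact Z.tot.shape _ _ e
  (ShortComplex.HomologyData.ofZeros (Z.tot.sc n) (h' _ _) (h' _ _)).left.homologyIso

end Homotopy

section Functor

variable {B : Type u₂} [Category.{v₂} B] [Preadditive B] [HasFiniteCoproducts B]

/-- The image of a bicomplex under an additive functor. -/
@[simps]
def map (Φ : A ⥤ B) [Φ.Additive] (Z : Bicomplex A) : Bicomplex B where
  Z a b := Φ.obj (Z.Z a b)
  h a b := Φ.map (Z.h a b)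
  v a b := Φ.map (Z.v a b)
  hh a b := by rw [← Φ.map_comp, Z.hh, Φ.map_zero]
  vv a b := by rw [← Φ.map_comp, Z.vv, Φ.map_zero]
  hv a b := by rw [← Φ.map_comp, Z.hv, Φ.map_comp]

/-- An additive functor commutes with total complexes, in a given degree. -/
noncomputable def mapTotX (Φ : A ⥤ B) [Φ.Additive] [PreservesFiniteCoproducts Φ]
    (Z : Bicomplex A) (n : ℕ) : (Z.map Φ).totX n ≅ Φ.obj (Z.totX n) :=
  (PreservesCoproduct.iso Φ fun p : Diag n => Z.Z p.1.1 p.1.2).symm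

theorem ι_mapTotX (Φ : A ⥤ B) [Φ.Additive] [PreservesFiniteCoproducts Φ]
    (Z : Bicomplex A) (n a b : ℕ) (e : a + b = n) :
    (Z.map Φ).ι n a b e ≫ (Z.mapTotX Φ n).hom = Φ.map (Z.ι n a b e) :=
  ι_comp_sigmaComparison Φ (fun p : Diag n => Z.Z p.1.1 p.1.2) ⟨(a, b), e⟩

theorem ι_mapTotX_assoc (Φ : A ⥤ B) [Φ.Additive] [PreservesFiniteCoproducts Φ]
    (Z : Bicomplex A) (n a b : ℕ) (e : a + b = n) {X : B} (g : Φ.obj (Z.totX n) ⟶ X) :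
    (Z.map Φ).ι n a b e ≫ (Z.mapTotX Φ n).hom ≫ g = Φ.map (Z.ι n a b e) ≫ g := by
  rw [← Category.assoc, ι_mapTotX]
  rfl

theorem mapTotX_totD (Φ : A ⥤ B) [Φ.Additive] [PreservesFiniteCoproducts Φ]
    (Z : Bicomplex A) (n : ℕ) :
    (Z.mapTotX Φ (n + 1)).hom ≫ Φ.map (Z.totD n) = (Z.map Φ).totD n ≫ (Z.mapTotX Φ n).hom := by
  apply tot_ext
  intro a b e
  have h : Φ.map (Z.hι n a b e) = (Z.map Φ).hι n a b e ≫ (Z.mapTotX Φ n).hom := by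
    rcases a with _ | a
    · rw [hι_zero, hι_zero, Φ.map_zero, zero_comp]; rfl
    · rw [hι_succ, hι_succ, Φ.map_comp, Category.assoc, ι_mapTotX]; rfl
  have h' : Φ.map (Z.vι n a b e) = (Z.map Φ).vι n a b e ≫ (Z.mapTotX Φ n).hom := by
    rcases b with _ | b
    · rw [vι_zero, vι_zero, Φ.map_zero, zero_comp]; rfl
    · rw [vι_succ, vι_succ, Φ.map_comp, Category.assoc, ι_mapTotX]; rfl
  rw [ι_mapTotX_assoc, ι_totD_assoc, Preadditive.add_comp, Preadditive.zsmul_comp, ← h, ← h']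
  refine (Φ.map_comp _ _).symm.trans ?_
  rw [ι_totD, Φ.map_add, Φ.map_zsmul]
  rfl

/-- An additive functor commutes with total complexes. -/
noncomputable def mapTotIso (Φ : A ⥤ B) [Φ.Additive] [PreservesFiniteCoproducts Φ]
    (Z : Bicomplex A) : (Z.map Φ).tot ≅ (Φ.mapHomologicalComplex _).obj Z.tot :=
  HomologicalComplex.Hom.isoOfComponents (fun n => Z.mapTotX Φ n) <| by
    rintro _ n rfl
    change (Z.mapTotX Φ (n + 1)).hom ≫ Φ.map (Z.tot.d (n + 1) n) =
      (Z.map Φ).tot.d (n + 1) n ≫ (Z.mapTotX Φ n).hom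
    rw [tot_d, tot_d]
    exact mapTotX_totD Φ Z n

end Functor

end Bicomplex

end Bicomplex

/-! ### The Künneth formula over a field -/

section Kunneth

open MonoidalCategory

variable {k : Type u} [Field k]

/-- A linear map over a field which kills the kernel of `t` factors through `t`. -/
theorem exists_factor_of_ker_le {V W U : ModuleCat.{u} k} (t : V ⟶ W) (f : V ⟶ U)
    (h : LinearMap.ker t.hom ≤ LinearMap.ker f.hom) : ∃ g : W ⟶ U, t ≫ g = f := by
  obtain ⟨s, hs⟩ := (t.hom.rangeRestrict).exists_rightInverse_of_surjective
    (LinearMap.range_rangeRestrict _)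
  obtain ⟨g, hg⟩ := LinearMap.exists_extend (f.hom ∘ₗ s)
  refine ⟨ModuleCat.ofHom g, ?_⟩
  ext x
  have h₁ : g (t.hom x) = f.hom (s ⟨t.hom x, x, rfl⟩) := LinearMap.congr_fun hg ⟨t.hom x, x, rfl⟩
  refine h₁.trans ?_
  rw [← sub_eq_zero, ← map_sub]
  refine h ?_
  rw [LinearMap.mem_ker, map_sub, sub_eq_zero]
  exact congrArg Subtype.val (LinearMap.congr_fun hs ⟨t.hom x, x, rfl⟩)

/-- A complex of vector spaces is homotopy equivalent to its homology. -/
structure HomologySplitting (X : ChainComplex (ModuleCat.{u} k) ℕ) where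
  /-- representing cycles -/
  i : ∀ n, X.homology n ⟶ X.X n
  /-- the retraction -/
  r : ∀ n, X.X n ⟶ X.homology n
  /-- the homotopy -/
  s : ∀ n, X.X n ⟶ X.X (n + 1)
  i_r : ∀ n, i n ≫ r n = 𝟙 _
  i_d : ∀ n, i (n + 1) ≫ X.d (n + 1) n = 0
  d_r : ∀ n, X.d (n + 1) n ≫ r n = 0
  zero : 𝟙 _ = s 0 ≫ X.d 1 0 + r 0 ≫ i 0
  succ : ∀ n, 𝟙 _ = s (n + 1) ≫ X.d (n + 2) (n + 1) + X.d (n + 1) n ≫ s n + r (n + 1) ≫ i (n + 1)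

/-- Over a field everything splits: `ρ` retracts the chains onto the cycles, `τ` chooses a cycle in
each homology class, and `u` lifts boundaries to chains. The homotopy projects to the cycles,
removes the chosen representative of the class and lifts the remaining boundary. -/
theorem exists_homologySplitting (X : ChainComplex (ModuleCat.{u} k) ℕ) :
    Nonempty (HomologySplitting X) := by
  have hsm : ∀ {V W : ModuleCat.{u} k} (f : V ⟶ W), Mono f → ∃ g : W ⟶ V, f ≫ g = 𝟙 _ :=
    fun f hf => exists_factor_of_ker_le f (𝟙 _) (by
      rw [ModuleCat.mono_iff_ker_eq_bot] at hf
      rw [hf]; exact bot_le)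
  have hse : ∀ {V W : ModuleCat.{u} k} (f : V ⟶ W), Epi f → ∃ g : W ⟶ V, g ≫ f = 𝟙 _ :=
    fun {V W} f hf => by
      have : Module.Projective k W := Module.Projective.of_free
      obtain ⟨s, hs⟩ := f.hom.exists_rightInverse_of_surjective
        ((ModuleCat.epi_iff_range_eq_top f).1 hf)
      exact ⟨ModuleCat.ofHom s, by ext x; exact LinearMap.congr_fun hs x⟩
  choose ρ hρ using fun n => hsm (X.iCycles n) inferInstance
  choose τ hτ using fun n => hse (X.homologyπ n) inferInstance
  have hi : ∀ n, X.iCycles (n + 1) ≫ X.d (n + 1) n = 0 := fun n => X.iCycles_d _ _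
  have ht : ∀ n, X.toCycles (n + 1) n ≫ X.iCycles n = X.d (n + 1) n := fun n => X.toCycles_i _ _
  have hp : ∀ n, X.toCycles (n + 1) n ≫ X.homologyπ n = 0 := fun n => X.toCycles_comp_homologyπ _ _
  -- A chain killed by the differential is a cycle and is fixed by the projection, so `1 - ρ i`
  -- factors through the differential.
  have hu : ∀ n, ∃ u : X.cycles n ⟶ X.X (n + 1),
      X.toCycles (n + 1) n ≫ u = 𝟙 _ - ρ (n + 1) ≫ X.iCycles (n + 1) := fun n => by
    apply exists_factor_of_ker_le
    intro x hx
    have hdx : X.d (n + 1) n x = 0 := by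
      rw [← ht n]
      exact (congrArg (X.iCycles n) hx).trans (map_zero _)
    have hx' : x = X.iCycles (n + 1) (X.cyclesMk x n (by simp) hdx) := (X.i_cyclesMk _ _ _ _).symm
    change x - X.iCycles (n + 1) (ρ (n + 1) x) = 0
    rw [sub_eq_zero]
    have := congrArg (fun f => f.hom (X.cyclesMk x n (by simp) hdx)) (hρ (n + 1))
    refine hx'.trans (congrArg (X.iCycles (n + 1)) (this.symm.trans ?_))
    exact congrArg (ρ (n + 1)) hx'.symm
  choose u hu using hu
  have hιt : ∀ n, X.iCycles (n + 1) ≫ X.toCycles (n + 1) n = 0 := fun n => by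
    rw [← cancel_mono (X.iCycles n), Category.assoc, ht, hi, zero_comp]
  have htut : ∀ n, X.toCycles (n + 1) n ≫ (u n ≫ X.toCycles (n + 1) n - 𝟙 _) = 0 := fun n => by
    rw [Preadditive.comp_sub, ← Category.assoc, hu, Preadditive.sub_comp, Category.assoc, hιt,
      comp_zero, Category.id_comp, Category.comp_id, sub_zero, sub_self]
  -- `u t - 1` kills the boundaries, hence factors through the homology; and `1 - π τ` followed by
  -- the projection to homology is zero.
  have hut : ∀ n, (𝟙 _ - X.homologyπ n ≫ τ n) ≫ u n ≫ X.toCycles (n + 1) n =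
      𝟙 _ - X.homologyπ n ≫ τ n := fun n => by
    obtain ⟨y, hy⟩ := CokernelCofork.IsColimit.desc'
      (X.homologyIsCokernel (n + 1) n (by simp)) _ (htut n)
    have hy : X.homologyπ n ≫ y = u n ≫ X.toCycles (n + 1) n - 𝟙 _ := hy
    rw [← sub_eq_zero, ← Category.comp_id (𝟙 _ - X.homologyπ n ≫ τ n), Category.assoc,
      ← Preadditive.comp_sub, Category.id_comp, ← hy, Preadditive.sub_comp, Category.assoc,
      ← Category.assoc (τ n), hτ, Category.id_comp, Category.id_comp, sub_self]
  have h₀ : ρ 0 ≫ X.iCycles 0 = 𝟙 _ := by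
    have : CategoryTheory.IsIso (X.iCycles 0) := X.isIso_iCycles 0 _ rfl (X.shape _ _ (by simp))
    rw [← cancel_epi (X.iCycles 0), ← Category.assoc, hρ, Category.id_comp, Category.comp_id]
  have hs : ∀ n, (ρ n ≫ (𝟙 _ - X.homologyπ n ≫ τ n) ≫ u n) ≫ X.d (n + 1) n =
      ρ n ≫ X.iCycles n - (ρ n ≫ X.homologyπ n) ≫ τ n ≫ X.iCycles n := fun n => by
    rw [← ht, Category.assoc, Category.assoc, ← Category.assoc (u n), ← Category.assoc (_ - _),
      hut, Preadditive.sub_comp, Preadditive.comp_sub, Category.id_comp]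
    simp only [Category.assoc]
  refine ⟨{
    i := fun n => τ n ≫ X.iCycles n
    r := fun n => ρ n ≫ X.homologyπ n
    s := fun n => ρ n ≫ (𝟙 _ - X.homologyπ n ≫ τ n) ≫ u n
    i_r := fun n => ?_
    i_d := fun n => ?_
    d_r := fun n => ?_
    zero := ?_
    succ := fun n => ?_ }⟩
  · rw [Category.assoc, ← Category.assoc (X.iCycles n), hρ, Category.id_comp, hτ]
  · rw [Category.assoc, hi, comp_zero]
  · rw [← ht, Category.assoc, ← Category.assoc (X.iCycles n), hρ, Category.id_comp, hp]
  · rw [hs, h₀, sub_add_cancel]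
  · have hd : X.d (n + 1) n ≫ ρ n ≫ (𝟙 _ - X.homologyπ n ≫ τ n) ≫ u n =
        𝟙 _ - ρ (n + 1) ≫ X.iCycles (n + 1) := by
      rw [← ht, Category.assoc, ← Category.assoc (X.iCycles n), hρ, Category.id_comp,
        ← Category.assoc, Preadditive.comp_sub, Category.comp_id, ← Category.assoc (X.toCycles _ _),
        hp, zero_comp, sub_zero, hu]
    rw [hs, hd]
    abel

section

universe v₁ v₂ v₃ u₁ u₂ u₃
variable {A₁ : Type u₁} [Category.{v₁} A₁] [Preadditive A₁] {A₂ : Type u₂} [Category.{v₂} A₂]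
  [Preadditive A₂] {A : Type u₃} [Category.{v₃} A] [Preadditive A] [HasFiniteCoproducts A]

/-- The bicomplex obtained by applying a bifunctor to two complexes. -/
@[simps]
def Bicomplex.ofBifunctor (B : A₁ ⥤ A₂ ⥤ A) [B.PreservesZeroMorphisms]
    [∀ X, (B.obj X).PreservesZeroMorphisms] (K : ChainComplex A₁ ℕ) (L : ChainComplex A₂ ℕ) :
    Bicomplex A where
  Z a b := (B.obj (K.X a)).obj (L.X b)
  h a b := (B.map (K.d (a + 1) a)).app (L.X b)
  v a b := (B.obj (K.X a)).map (L.d (b + 1) b)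
  hh a b := by
    rw [← NatTrans.comp_app, ← B.map_comp, K.d_comp_d, B.map_zero]
    rfl
  vv a b := by rw [← Functor.map_comp, L.d_comp_d, Functor.map_zero]
  hv a b := ((B.map (K.d (a + 1) a)).naturality (L.d (b + 1) b)).symm

end


section

variable {A : Type*} [Category* A] [Preadditive A] [HasFiniteCoproducts A] [CategoryWithHomology A]

/-- Bicomplexes with maps in both directions which are inverse on homology. -/
noncomputable def Bicomplex.homologyTotIsoOfHom {Z W : Bicomplex A} (φ : Hom Z W) (ψ : Hom W Z)
    (n : ℕ) (h : HomologicalComplex.homologyMap (Hom.id Z).tot n =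
      HomologicalComplex.homologyMap (φ.comp ψ).tot n) (h' : ψ.comp φ = Hom.id W) :
    Z.tot.homology n ≅ W.tot.homology n where
  hom := HomologicalComplex.homologyMap φ.tot n
  inv := HomologicalComplex.homologyMap ψ.tot n
  hom_inv_id := by
    rw [← HomologicalComplex.homologyMap_comp, ← Hom.comp_tot, ← h, Hom.id_tot,
      HomologicalComplex.homologyMap_id]
  inv_hom_id := by
    rw [← HomologicalComplex.homologyMap_comp, ← Hom.comp_tot, h', Hom.id_tot,
      HomologicalComplex.homologyMap_id]

end

/-- The graded homology, as a complex with zero differential. -/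
noncomputable abbrev homologyComplex (X : ChainComplex (ModuleCat.{u} k) ℕ) :
    ChainComplex (ModuleCat.{u} k) ℕ where
  X n := X.homology n
  d _ _ := 0

/-- The tensor product bicomplex of two complexes of vector spaces. -/
noncomputable abbrev tensorBicomplex (X Y : ChainComplex (ModuleCat.{u} k) ℕ) :
    Bicomplex (ModuleCat.{u} k) :=
  Bicomplex.ofBifunctor (curriedTensor (ModuleCat.{u} k)) X Y

/-- The Künneth formula for complexes of vector spaces. -/
theorem kunneth (X Y : ChainComplex (ModuleCat.{u} k) ℕ) (n : ℕ) :
    Nonempty ((tensorBicomplex X Y).tot.homology n ≅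
      ∐ fun p : Bicomplex.Diag n => X.homology p.1.1 ⊗ Y.homology p.1.2) := by
  obtain ⟨S⟩ := exists_homologySplitting X
  obtain ⟨T⟩ := exists_homologySplitting Y
  -- `X` is replaced by its homology, using a homotopy in the first direction, and then `Y`, using
  -- one in the second direction. What remains has zero differentials.
  let φ₁ : Bicomplex.Hom (tensorBicomplex X Y) (tensorBicomplex (homologyComplex X) Y) :=
    { f := fun a b => S.r a ▷ Y.X b
      h := fun a b => by
        change S.r (a + 1) ▷ Y.X b ≫ 0 ▷ Y.X b = X.d (a + 1) a ▷ Y.X b ≫ S.r a ▷ Y.X b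
        rw [← comp_whiskerRight, ← comp_whiskerRight, S.d_r, comp_zero]
      v := fun a b => whisker_exchange _ _ |>.symm }
  let ψ₁ : Bicomplex.Hom (tensorBicomplex (homologyComplex X) Y) (tensorBicomplex X Y) :=
    { f := fun a b => S.i a ▷ Y.X b
      h := fun a b => by
        change S.i (a + 1) ▷ Y.X b ≫ X.d (a + 1) a ▷ Y.X b = 0 ▷ Y.X b ≫ S.i a ▷ Y.X b
        rw [← comp_whiskerRight, ← comp_whiskerRight, S.i_d, zero_comp]
      v := fun a b => whisker_exchange _ _ |>.symm }
  let φ₂ : Bicomplex.Hom (tensorBicomplex (homologyComplex X) Y)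
      (tensorBicomplex (homologyComplex X) (homologyComplex Y)) :=
    { f := fun a b => X.homology a ◁ T.r b
      h := fun a b => whisker_exchange _ _
      v := fun a b => by
        change X.homology a ◁ T.r (b + 1) ≫ X.homology a ◁ 0 =
          X.homology a ◁ Y.d (b + 1) b ≫ X.homology a ◁ T.r b
        rw [← whiskerLeft_comp, ← whiskerLeft_comp, T.d_r, comp_zero] }
  let ψ₂ : Bicomplex.Hom (tensorBicomplex (homologyComplex X) (homologyComplex Y))
      (tensorBicomplex (homologyComplex X) Y) :=
    { f := fun a b => X.homology a ◁ T.i b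
      h := fun a b => whisker_exchange _ _
      v := fun a b => by
        change X.homology a ◁ T.i (b + 1) ≫ X.homology a ◁ Y.d (b + 1) b =
          X.homology a ◁ 0 ≫ X.homology a ◁ T.i b
        rw [← whiskerLeft_comp, ← whiskerLeft_comp, T.i_d, zero_comp] }
  let H₁ : Bicomplex.HHomotopy (Bicomplex.Hom.id (tensorBicomplex X Y)) (φ₁.comp ψ₁) :=
    { s := fun a b => S.s a ▷ Y.X b
      v := fun a b => whisker_exchange _ _ |>.symm
      zero := fun b => by
        change 𝟙 (X.X 0 ⊗ Y.X b) = S.s 0 ▷ Y.X b ≫ X.d 1 0 ▷ Y.X b + S.r 0 ▷ Y.X b ≫ S.i 0 ▷ Y.X b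
        rw [← comp_whiskerRight, ← comp_whiskerRight, ← MonoidalPreadditive.add_whiskerRight,
          ← S.zero, id_whiskerRight]
      succ := fun a b => by
        change 𝟙 (X.X (a + 1) ⊗ Y.X b) = S.s (a + 1) ▷ Y.X b ≫ X.d (a + 2) (a + 1) ▷ Y.X b +
          X.d (a + 1) a ▷ Y.X b ≫ S.s a ▷ Y.X b + S.r (a + 1) ▷ Y.X b ≫ S.i (a + 1) ▷ Y.X b
        rw [← comp_whiskerRight, ← comp_whiskerRight, ← comp_whiskerRight,
          ← MonoidalPreadditive.add_whiskerRight, ← MonoidalPreadditive.add_whiskerRight,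
          ← S.succ, id_whiskerRight] }
  let H₂ : Bicomplex.VHomotopy (Bicomplex.Hom.id (tensorBicomplex (homologyComplex X) Y))
      (φ₂.comp ψ₂) :=
    { s := fun a b => X.homology a ◁ T.s b
      h := fun a b => whisker_exchange _ _
      zero := fun a => by
        change 𝟙 (X.homology a ⊗ Y.X 0) = X.homology a ◁ T.s 0 ≫ X.homology a ◁ Y.d 1 0 +
          X.homology a ◁ T.r 0 ≫ X.homology a ◁ T.i 0
        rw [← whiskerLeft_comp, ← whiskerLeft_comp, ← MonoidalPreadditive.whiskerLeft_add,
          ← T.zero, whiskerLeft_id]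
      succ := fun a b => by
        change 𝟙 (X.homology a ⊗ Y.X (b + 1)) =
          X.homology a ◁ T.s (b + 1) ≫ X.homology a ◁ Y.d (b + 2) (b + 1) +
          X.homology a ◁ Y.d (b + 1) b ≫ X.homology a ◁ T.s b +
          X.homology a ◁ T.r (b + 1) ≫ X.homology a ◁ T.i (b + 1)
        rw [← whiskerLeft_comp, ← whiskerLeft_comp, ← whiskerLeft_comp,
          ← MonoidalPreadditive.whiskerLeft_add, ← MonoidalPreadditive.whiskerLeft_add,
          ← T.succ, whiskerLeft_id] }
  have h₁ : ψ₁.comp φ₁ = Bicomplex.Hom.id _ := by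
    ext1
    funext a b
    change S.i a ▷ Y.X b ≫ S.r a ▷ Y.X b = 𝟙 (X.homology a ⊗ Y.X b)
    rw [← comp_whiskerRight, S.i_r, id_whiskerRight]
  have h₂ : ψ₂.comp φ₂ = Bicomplex.Hom.id _ := by
    ext1
    funext a b
    change X.homology a ◁ T.i b ≫ X.homology a ◁ T.r b = 𝟙 (X.homology a ⊗ Y.homology b)
    rw [← whiskerLeft_comp, T.i_r, whiskerLeft_id]
  refine ⟨Bicomplex.homologyTotIsoOfHom φ₁ ψ₁ n (H₁.homologyMap_eq n) h₁ ≪≫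
    Bicomplex.homologyTotIsoOfHom φ₂ ψ₂ n (H₂.homologyMap_eq n) h₂ ≪≫
    Bicomplex.homologyTotIso (fun a b => ?_) (fun a b => ?_) n⟩
  · change (0 : X.homology (a + 1) ⟶ X.homology a) ▷ Y.homology b = 0
    exact MonoidalPreadditive.zero_whiskerRight
  · change X.homology a ◁ (0 : Y.homology (b + 1) ⟶ Y.homology b) = 0
    exact MonoidalPreadditive.whiskerLeft_zero

end Kunneth

/-! ### External tensor products -/

section ExternalTensor

open MonoidalCategory

universe v₁ v₂ u₁ u₂

variable {k : Type u} [Field k] {C D : Type} [SmallCategory C] [SmallCategory D]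

/-- The external tensor product `(c, d) ↦ F c ⊗ G d`. -/
noncomputable def extTensor {C : Type u₁} {D : Type u₂} [Category.{v₁} C] [Category.{v₂} D]
    (F : C ⥤ ModuleCat.{u} k) (G : D ⥤ ModuleCat.{u} k) : C × D ⥤ ModuleCat.{u} k where
  obj x := F.obj x.1 ⊗ G.obj x.2
  map f := F.map f.1 ⊗ₘ G.map f.2
  map_id x := by
    change F.map (𝟙 _) ⊗ₘ G.map (𝟙 _) = _
    rw [F.map_id, G.map_id, id_tensorHom_id]
  map_comp f g := by
    change F.map (_ ≫ _) ⊗ₘ G.map (_ ≫ _) = _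
    rw [F.map_comp, G.map_comp, tensorHom_comp_tensorHom]

/-- The external tensor product of natural transformations. -/
noncomputable def extTensorMap {F F' : C ⥤ ModuleCat.{u} k} {G G' : D ⥤ ModuleCat.{u} k}
    (α : F ⟶ F') (β : G ⟶ G') : extTensor F G ⟶ extTensor F' G' where
  app x := α.app x.1 ⊗ₘ β.app x.2
  naturality x y f := by
    change (F.map f.1 ⊗ₘ G.map f.2) ≫ (α.app y.1 ⊗ₘ β.app y.2) =
      (α.app x.1 ⊗ₘ β.app x.2) ≫ (F'.map f.1 ⊗ₘ G'.map f.2)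
    rw [tensorHom_comp_tensorHom, tensorHom_comp_tensorHom, α.naturality, β.naturality]

theorem extTensorMap_comp {F F' F'' : C ⥤ ModuleCat.{u} k} {G G' G'' : D ⥤ ModuleCat.{u} k}
    (α : F ⟶ F') (α' : F' ⟶ F'') (β : G ⟶ G') (β' : G' ⟶ G'') :
    extTensorMap (α ≫ α') (β ≫ β') = extTensorMap α β ≫ extTensorMap α' β' := by
  ext1
  funext x
  exact (tensorHom_comp_tensorHom _ _ _ _).symm

theorem extTensorMap_id (F : C ⥤ ModuleCat.{u} k) (G : D ⥤ ModuleCat.{u} k) :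
    extTensorMap (𝟙 F) (𝟙 G) = 𝟙 _ := by
  ext1
  funext x
  exact id_tensorHom_id _ _

variable (k C D) in
/-- The external tensor product as a bifunctor. -/
@[simps]
noncomputable def extTensorBifunctor :
    (C ⥤ ModuleCat.{u} k) ⥤ (D ⥤ ModuleCat.{u} k) ⥤ (C × D ⥤ ModuleCat.{u} k) where
  obj F :=
    { obj := fun G => extTensor F G
      map := fun β => extTensorMap (𝟙 F) β
      map_id := fun G => extTensorMap_id F G
      map_comp := fun β β' => by rw [← extTensorMap_comp, Category.comp_id] }
  map α :=
    { app := fun G => extTensorMap α (𝟙 G)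
      naturality := fun G G' β => by
        change extTensorMap _ β ≫ extTensorMap α _ = extTensorMap α _ ≫ extTensorMap _ β
        rw [← extTensorMap_comp, ← extTensorMap_comp, Category.comp_id, Category.comp_id,
          Category.id_comp, Category.id_comp] }
  map_id F := by
    ext1
    funext G
    exact extTensorMap_id F G
  map_comp α α' := by
    ext1
    funext G
    change extTensorMap (α ≫ α') _ = extTensorMap α _ ≫ extTensorMap α' _
    rw [← extTensorMap_comp, Category.comp_id]

instance : (extTensorBifunctor k C D).PreservesZeroMorphisms where
  map_zero F F' := by
    ext1
    funext G
    ext1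
    funext x
    change (0 : F.obj x.1 ⟶ F'.obj x.1) ⊗ₘ 𝟙 (G.obj x.2) = 0
    rw [MonoidalPreadditive.zero_tensor]

instance (F : C ⥤ ModuleCat.{u} k) : ((extTensorBifunctor k C D).obj F).PreservesZeroMorphisms where
  map_zero G G' := by
    ext1
    funext x
    change 𝟙 (F.obj x.1) ⊗ₘ (0 : G.obj x.2 ⟶ G'.obj x.2) = 0
    rw [MonoidalPreadditive.tensor_zero]

/-- The cocone over an external tensor product with apex the tensor product of the colimits. -/
noncomputable def extCocone (F : C ⥤ ModuleCat.{u} k) (G : D ⥤ ModuleCat.{u} k) :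
    Cocone (extTensor F G) where
  pt := colimit F ⊗ colimit G
  ι :=
    { app := fun x => colimit.ι F x.1 ⊗ₘ colimit.ι G x.2
      naturality := fun x y f => by
        change (F.map f.1 ⊗ₘ G.map f.2) ≫ _ = _ ≫ 𝟙 _
        rw [tensorHom_comp_tensorHom, colimit.w, colimit.w, Category.comp_id] }

/-- Tensor products of vector spaces commute with colimits in both variables. -/
theorem isColimit_extCocone (F : C ⥤ ModuleCat.{u} k) (G : D ⥤ ModuleCat.{u} k) :
    Nonempty (IsColimit (extCocone F G)) := by
  have h₁ : ∀ c : C, IsColimit ((tensorLeft (F.obj c)).mapCocone (colimit.cocone G)) := fun c =>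
    isColimitOfPreserves _ (colimit.isColimit G)
  have h₂ : IsColimit ((tensorRight (colimit G)).mapCocone (colimit.cocone F)) :=
    isColimitOfPreserves _ (colimit.isColimit F)
  -- A cocone is factored over `d` for each fixed `c`, and the resulting cocone over `c` is factored
  -- in turn; both steps use that tensoring with a fixed space preserves colimits.
  let s₁ : ∀ s : Cocone (extTensor F G), ∀ c : C, Cocone (G ⋙ tensorLeft (F.obj c)) := fun s c =>
    { pt := s.pt
      ι := { app := fun d => s.ι.app (c, d)
             naturality := fun d d' g => by
               have := s.w (j' := (c, d)) (j := (c, d')) (𝟙 c, g)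
               change (F.map (𝟙 c) ⊗ₘ G.map g) ≫ _ = _ at this
               rw [F.map_id, id_tensorHom] at this
               exact this.trans (Category.comp_id _).symm } }
  have e₁ : ∀ s c d, F.obj c ◁ colimit.ι G d ≫ (h₁ c).desc (s₁ s c) = s.ι.app (c, d) :=
    fun s c d => (h₁ c).fac (s₁ s c) d
  let s₂ : ∀ s : Cocone (extTensor F G), Cocone (F ⋙ tensorRight (colimit G)) := fun s =>
    { pt := s.pt
      ι := { app := fun c => (h₁ c).desc (s₁ s c)
             naturality := fun c c' f => by
               refine Eq.trans ?_ (Category.comp_id _).symm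
               refine (h₁ c).hom_ext fun d => ?_
               change F.obj c ◁ colimit.ι G d ≫ F.map f ▷ colimit G ≫ _ =
                 F.obj c ◁ colimit.ι G d ≫ _
               rw [e₁, whisker_exchange_assoc, e₁]
               have := s.w (j' := (c, d)) (j := (c', d)) (f, 𝟙 d)
               change (F.map f ⊗ₘ G.map (𝟙 d)) ≫ _ = _ at this
               rwa [G.map_id, tensorHom_id] at this } }
  have e₂ : ∀ s c, colimit.ι F c ▷ colimit G ≫ h₂.desc (s₂ s) = (h₁ c).desc (s₁ s c) :=
    fun s c => h₂.fac (s₂ s) c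
  refine ⟨{ desc := fun s => h₂.desc (s₂ s), fac := fun s x => ?_, uniq := fun s m hm => ?_ }⟩
  · change (colimit.ι F x.1 ⊗ₘ colimit.ι G x.2) ≫ _ = _
    rw [tensorHom_def', Category.assoc, e₂, e₁]
  · refine h₂.hom_ext fun c => ?_
    change colimit.ι F c ▷ colimit G ≫ m = colimit.ι F c ▷ colimit G ≫ _
    rw [e₂]
    refine (h₁ c).hom_ext fun d => ?_
    change F.obj c ◁ colimit.ι G d ≫ _ = F.obj c ◁ colimit.ι G d ≫ _
    rw [e₁, ← hm (c, d)]
    change _ = (colimit.ι F c ⊗ₘ colimit.ι G d) ≫ m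
    rw [tensorHom_def']
    exact (Category.assoc _ _ _).symm

/-- The colimit of an external tensor product. -/
noncomputable def colimExtTensor (F : C ⥤ ModuleCat.{u} k) (G : D ⥤ ModuleCat.{u} k) :
    colim.obj (extTensor F G) ≅ colim.obj F ⊗ colim.obj G :=
  (colimit.isColimit _).coconePointUniqueUpToIso (isColimit_extCocone F G).some

theorem ι_colimExtTensor (F : C ⥤ ModuleCat.{u} k) (G : D ⥤ ModuleCat.{u} k) (x : C × D) :
    colimit.ι (extTensor F G) x ≫ (colimExtTensor F G).hom =
      colimit.ι F x.1 ⊗ₘ colimit.ι G x.2 :=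
  (colimit.isColimit _).comp_coconePointUniqueUpToIso_hom _ _

theorem colimExtTensor_naturality {F F' : C ⥤ ModuleCat.{u} k} {G G' : D ⥤ ModuleCat.{u} k}
    (α : F ⟶ F') (β : G ⟶ G') :
    colim.map (extTensorMap α β) ≫ (colimExtTensor F' G').hom =
      (colimExtTensor F G).hom ≫ (colim.map α ⊗ₘ colim.map β) := by
  apply colimit.hom_ext
  intro x
  have h₁ : colimit.ι (extTensor F G) x ≫ colim.map (extTensorMap α β) =
      (α.app x.1 ⊗ₘ β.app x.2) ≫ colimit.ι (extTensor F' G') x := colimit.ι_map _ _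
  have h₂ : colimit.ι F x.1 ≫ colim.map α = α.app x.1 ≫ colimit.ι F' x.1 := colimit.ι_map _ _
  have h₃ : colimit.ι G x.2 ≫ colim.map β = β.app x.2 ≫ colimit.ι G' x.2 := colimit.ι_map _ _
  rw [← Category.assoc, h₁, ← Category.assoc, ι_colimExtTensor]
  refine (Category.assoc _ _ _).trans ?_
  refine (congrArg ((α.app x.1 ⊗ₘ β.app x.2) ≫ ·) (ι_colimExtTensor F' G' x)).trans ?_
  refine (tensorHom_comp_tensorHom _ _ _ _).trans ?_
  refine Eq.trans ?_ (tensorHom_comp_tensorHom _ _ _ _).symm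
  rw [← h₂, ← h₃]

/-- External tensor products of projective functors are projective. -/
theorem projective_extTensor (P : C ⥤ ModuleCat.{u} k) (Q : D ⥤ ModuleCat.{u} k)
    [Projective P] [Projective Q] : Projective (extTensor P Q) := by
  -- `H R` is the functor sending `c` to `Hom(Q, R(c, -))`. Maps from the external product of `P`
  -- and `Q` to `R` correspond to maps `P ⟶ H R`, and `H` preserves epimorphisms because `Q` is
  -- projective. So lifting problems are solved by projectivity of `P`.
  let H : (C × D ⥤ ModuleCat.{u} k) ⥤ (C ⥤ ModuleCat.{u} k) :=
    Functor.curry ⋙ (Functor.whiskeringRight _ _ _).obj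
      ((linearCoyoneda k (D ⥤ ModuleCat.{u} k)).obj (Opposite.op Q))
  have nat₁ : ∀ {R : C × D ⥤ ModuleCat.{u} k} (f : extTensor P Q ⟶ R) (x y : C × D) (g : x ⟶ y)
      (p : P.obj x.1) (q : Q.obj x.2), R.map g (f.app x (p ⊗ₜ[k] q)) =
        f.app y (P.map g.1 p ⊗ₜ[k] Q.map g.2 q) := fun f x y g p q =>
    (congrArg (fun t => t.hom (p ⊗ₜ[k] q)) (f.naturality g)).symm
  let toH₀ : ∀ {R : C × D ⥤ ModuleCat.{u} k} (f : extTensor P Q ⟶ R) (c : C) (p : P.obj c),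
      Q ⟶ (Functor.curry.obj R).obj c := fun {R} f c p =>
    { app := fun d => ModuleCat.ofHom
        ((f.app (c, d)).hom ∘ₗ TensorProduct.mk k (P.obj c) (Q.obj d) p)
      naturality := fun d d' g => by
        ext y
        have := nat₁ f (c, d) (c, d') (𝟙 c, g) p y
        change R.map _ _ = f.app (c, d') (P.map (𝟙 c) p ⊗ₜ[k] Q.map g y) at this
        rw [P.map_id] at this
        exact this.symm }
  let toH : ∀ R, (extTensor P Q ⟶ R) → (P ⟶ H.obj R) := fun R f =>
    { app := fun c => ModuleCat.ofHom (Y := (H.obj R).obj c)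
        { toFun := fun p => toH₀ f c p
          map_add' := fun p p' => by
            refine NatTrans.ext (funext fun d => ModuleCat.hom_ext (LinearMap.ext fun q => ?_))
            exact (congrArg (f.app (c, d)) (TensorProduct.add_tmul p p' q)).trans (map_add _ _ _)
          map_smul' := fun a p => by
            refine NatTrans.ext (funext fun d => ModuleCat.hom_ext (LinearMap.ext fun q => ?_))
            exact (congrArg (f.app (c, d)) (TensorProduct.smul_tmul' a p q).symm).trans
              (map_smul _ _ _) }
      naturality := fun c c' g => by
        ext p
        refine NatTrans.ext (funext fun d => ?_)
        ext q
        have := nat₁ f (c, d) (c', d) (g, 𝟙 d) p q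
        change R.map _ _ = f.app (c', d) (P.map g p ⊗ₜ[k] Q.map (𝟙 d) q) at this
        rw [Q.map_id] at this
        exact this.symm }
  let ofH₀ : ∀ {R : C × D ⥤ ModuleCat.{u} k} (g : P ⟶ H.obj R) (c : C) (p : P.obj c),
      Q ⟶ (Functor.curry.obj R).obj c := fun g c p => g.app c p
  have nat₂ : ∀ {R : C × D ⥤ ModuleCat.{u} k} (g : P ⟶ H.obj R) (x y : C × D) (h : x ⟶ y)
      (p : P.obj x.1) (q : Q.obj x.2), R.map h ((ofH₀ g x.1 p).app x.2 q) =
        (ofH₀ g y.1 (P.map h.1 p)).app y.2 (Q.map h.2 q) := fun {R} g x y h p q => by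
    have e₁ : ofH₀ g y.1 (P.map h.1 p) = ofH₀ g x.1 p ≫ (Functor.curry.obj R).map h.1 :=
      congrArg (fun t => t.hom p) (g.naturality h.1)
    have e₂ := congrArg (fun t => t.hom q) ((ofH₀ g x.1 p).naturality h.2)
    rw [e₁]
    refine Eq.trans ?_ (congrArg (R.map ((h.1, 𝟙 y.2) : (x.1, y.2) ⟶ y)) e₂).symm
    have e₃ : h = ((𝟙 x.1, h.2) : x ⟶ (x.1, y.2)) ≫ ((h.1, 𝟙 y.2) : (x.1, y.2) ⟶ y) :=
      Prod.ext (Category.id_comp _).symm (Category.comp_id _).symm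
    conv_lhs => rw [e₃, R.map_comp]
    rfl
  let ofH : ∀ R, (P ⟶ H.obj R) → (extTensor P Q ⟶ R) := fun R g =>
    { app := fun x => ModuleCat.ofHom (TensorProduct.lift
        { toFun := fun p => ((ofH₀ g x.1 p).app x.2).hom
          map_add' := fun p p' => by
            have : ofH₀ g x.1 (p + p') = ofH₀ g x.1 p + ofH₀ g x.1 p' := map_add (g.app x.1).hom p p'
            rw [this]
            rfl
          map_smul' := fun a p => by
            have : ofH₀ g x.1 (a • p) = a • ofH₀ g x.1 p := map_smul (g.app x.1).hom a p
            rw [this]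
            rfl })
      naturality := fun x y h => by
        refine ModuleCat.hom_ext (TensorProduct.ext' fun p q => ?_)
        exact (nat₂ g x y h p q).symm }
  constructor
  intro R R' f e he
  have hepi : Epi (H.map e) := by
    rw [NatTrans.epi_iff_epi_app]
    intro c
    rw [ModuleCat.epi_iff_surjective]
    intro φ
    have : Epi ((Functor.curry.map e).app c) := by
      rw [NatTrans.epi_iff_epi_app]
      intro d
      exact (NatTrans.epi_iff_epi_app e).1 he (c, d)
    let φ' : Q ⟶ (Functor.curry.obj R').obj c := φ
    exact ⟨Projective.factorThru φ' ((Functor.curry.map e).app c),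
      Projective.factorThru_comp φ' ((Functor.curry.map e).app c)⟩
  obtain ⟨g, hg⟩ := Projective.factors (toH R' f) (H.map e)
  refine ⟨ofH R g, ?_⟩
  ext1
  funext x
  refine ModuleCat.hom_ext (TensorProduct.ext' fun p q => ?_)
  have := congrArg (fun t : P ⟶ H.obj R' => (ofH₀ t x.1 p).app x.2 q) hg
  exact this

end ExternalTensor

/-! ### The Künneth formula for the homology of a product of categories -/

section ProductKunneth

open MonoidalCategory

variable {k : Type u} [Field k] {C D : Type} [SmallCategory C] [SmallCategory D]

theorem exact_of_evaluation (S : ShortComplex (C ⥤ ModuleCat.{u} k))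
    (h : ∀ c, (S.map ((evaluation C (ModuleCat.{u} k)).obj c)).Exact) : S.Exact := by
  rw [ShortComplex.exact_iff_isZero_homology, Functor.isZero_iff]
  intro c
  exact ((ShortComplex.exact_iff_isZero_homology _).1 (h c)).of_iso
    (S.mapHomologyIso ((evaluation C (ModuleCat.{u} k)).obj c)).symm

variable {F : C ⥤ ModuleCat.{u} k} {G : D ⥤ ModuleCat.{u} k}

/-- The external tensor product of two complexes of functors. -/
noncomputable abbrev extBicomplex (K : ChainComplex (C ⥤ ModuleCat.{u} k) ℕ)
    (L : ChainComplex (D ⥤ ModuleCat.{u} k) ℕ) : Bicomplex (C × D ⥤ ModuleCat.{u} k) :=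
  Bicomplex.ofBifunctor (extTensorBifunctor k C D) K L

/-- Isomorphic bicomplexes have isomorphic total complexes. -/
noncomputable def Bicomplex.totIso {A : Type*} [Category* A] [Preadditive A]
    [HasFiniteCoproducts A] {Z W : Bicomplex A} (φ : Hom Z W) (ψ : Hom W Z)
    (h : φ.comp ψ = Hom.id Z) (h' : ψ.comp φ = Hom.id W) : Z.tot ≅ W.tot where
  hom := φ.tot
  inv := ψ.tot
  hom_inv_id := by rw [← Hom.comp_tot, h, Hom.id_tot]
  inv_hom_id := by rw [← Hom.comp_tot, h', Hom.id_tot]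

/-- A family of isomorphisms commuting with the differentials. -/
noncomputable def Bicomplex.totIsoOfIso {A : Type*} [Category* A] [Preadditive A]
    [HasFiniteCoproducts A] {Z W : Bicomplex A} (e : ∀ a b, Z.Z a b ≅ W.Z a b)
    (hh : ∀ a b, Z.h a b ≫ (e a b).hom = (e (a + 1) b).hom ≫ W.h a b)
    (hv : ∀ a b, Z.v a b ≫ (e a b).hom = (e a (b + 1)).hom ≫ W.v a b) : Z.tot ≅ W.tot :=
  totIso ⟨fun a b => (e a b).hom, fun a b => (hh a b).symm, fun a b => (hv a b).symm⟩
    ⟨fun a b => (e a b).inv,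
      fun a b => by
        rw [Iso.inv_comp_eq, ← Category.assoc, ← hh, Category.assoc, Iso.hom_inv_id,
          Category.comp_id],
      fun a b => by
        rw [Iso.inv_comp_eq, ← Category.assoc, ← hv, Category.assoc, Iso.hom_inv_id,
          Category.comp_id]⟩
    (Hom.ext (funext fun a => funext fun b => (e a b).hom_inv_id))
    (Hom.ext (funext fun a => funext fun b => (e a b).inv_hom_id))

/-- The value of the total complex at an object. -/
noncomputable def evalExtTot (K : ChainComplex (C ⥤ ModuleCat.{u} k) ℕ)
    (L : ChainComplex (D ⥤ ModuleCat.{u} k) ℕ) (x : C × D) :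
    (((evaluation (C × D) (ModuleCat.{u} k)).obj x).mapHomologicalComplex _).obj
      (extBicomplex K L).tot ≅
    (tensorBicomplex ((((evaluation C (ModuleCat.{u} k)).obj x.1).mapHomologicalComplex _).obj K)
      ((((evaluation D (ModuleCat.{u} k)).obj x.2).mapHomologicalComplex _).obj L)).tot :=
  (Bicomplex.mapTotIso ((evaluation (C × D) (ModuleCat.{u} k)).obj x) (extBicomplex K L)).symm ≪≫
    Bicomplex.totIsoOfIso (fun a b => Iso.refl _)
      (fun a b => by
        refine (Category.comp_id _).trans (Eq.trans ?_ (Category.id_comp _).symm)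
        exact tensorHom_id _ _)
      (fun a b => by
        refine (Category.comp_id _).trans (Eq.trans ?_ (Category.id_comp _).symm)
        exact id_tensorHom _ _)

/-- The total complex of the colimits. -/
noncomputable def colimExtTot (K : ChainComplex (C ⥤ ModuleCat.{u} k) ℕ)
    (L : ChainComplex (D ⥤ ModuleCat.{u} k) ℕ) :
    ((colim (J := C × D) (C := ModuleCat.{u} k)).mapHomologicalComplex _).obj
      (extBicomplex K L).tot ≅
    (tensorBicomplex (((colim (J := C) (C := ModuleCat.{u} k)).mapHomologicalComplex _).obj K)
      (((colim (J := D) (C := ModuleCat.{u} k)).mapHomologicalComplex _).obj L)).tot :=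
  (Bicomplex.mapTotIso (colim (J := C × D) (C := ModuleCat.{u} k)) (extBicomplex K L)).symm ≪≫
    Bicomplex.totIsoOfIso (fun a b => colimExtTensor (K.X a) (L.X b))
      (fun a b => by
        refine (colimExtTensor_naturality (K.d (a + 1) a) (𝟙 (L.X b))).trans ?_
        refine congrArg ((colimExtTensor _ _).hom ≫ ·) ?_
        rw [colim.map_id]
        exact tensorHom_id _ _)
      (fun a b => by
        refine (colimExtTensor_naturality (𝟙 (K.X a)) (L.d (b + 1) b)).trans ?_
        refine congrArg ((colimExtTensor _ _).hom ≫ ·) ?_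
        rw [colim.map_id]
        exact id_tensorHom _ _)

namespace Bicomplex

variable {A : Type*} [Category* A] [Preadditive A] [HasFiniteCoproducts A] (Z : Bicomplex A)

variable {Z} in
/-- The morphism out of the degree zero part of the total complex. -/
noncomputable def desc₀ {X : A} (f : Z.Z 0 0 ⟶ X) : Z.totX 0 ⟶ X :=
  desc fun a b e => match a, b, e with
    | 0, 0, _ => f
    | _ + 1, _, e => absurd e (by omega)

theorem ι_desc₀ {X : A} (f : Z.Z 0 0 ⟶ X) : Z.ι 0 0 0 rfl ≫ desc₀ f = f :=
  ι_desc _ _ _ _ _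

theorem desc₀_id : desc₀ (𝟙 _) ≫ Z.ι 0 0 0 rfl = 𝟙 _ := by
  apply tot_ext
  intro a b e
  obtain rfl : a = 0 := by omega
  obtain rfl : b = 0 := by omega
  rw [← Category.assoc, ι_desc₀, Category.id_comp, Category.comp_id]

theorem epi_desc₀ {X : A} (f : Z.Z 0 0 ⟶ X) (hf : Epi f) : Epi (desc₀ f) :=
  epi_of_epi_fac (Z.ι_desc₀ f)

theorem projective_totX (h : ∀ a b, Projective (Z.Z a b)) (n : ℕ) : Projective (Z.totX n) := by
  constructor
  intro E X f e he
  refine ⟨desc fun a b h => Projective.factorThru (Z.ι n a b h ≫ f) e, ?_⟩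
  apply tot_ext
  intro a b h
  rw [← Category.assoc, ι_desc, Projective.factorThru_comp]

theorem h_ι_zero : Z.ι 1 1 0 rfl ≫ Z.totD 0 = Z.h 0 0 ≫ Z.ι 0 0 0 rfl := by
  rw [ι_totD, vι_zero, smul_zero, add_zero, hι_succ]

theorem v_ι_zero : Z.ι 1 0 1 rfl ≫ Z.totD 0 = Z.v 0 0 ≫ Z.ι 0 0 0 rfl := by
  rw [ι_totD, hι_zero, pow_zero, one_smul, zero_add, vι_succ]

theorem totD_desc₀ {X : A} (f : Z.Z 0 0 ⟶ X) (hh : Z.h 0 0 ≫ f = 0) (hv : Z.v 0 0 ≫ f = 0) :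
    Z.totD 0 ≫ desc₀ f = 0 := by
  apply tot_ext
  intro a b e
  rw [comp_zero, ← Category.assoc]
  obtain ⟨rfl, rfl⟩ | ⟨rfl, rfl⟩ : (a = 1 ∧ b = 0) ∨ (a = 0 ∧ b = 1) := by omega
  · rw [h_ι_zero, Category.assoc, ι_desc₀, hh]
  · rw [v_ι_zero, Category.assoc, ι_desc₀, hv]

end Bicomplex

/-- Right exactness in both variables at once: the kernel of a tensor product of surjections is
generated by the kernels of the two factors. -/
theorem exact_lTensor_rTensor {X₁ X₀ X Y₁ Y₀ Y : ModuleCat.{u} k} {f : X₁ ⟶ X₀} {p : X₀ ⟶ X}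
    {w : f ≫ p = 0} {g : Y₁ ⟶ Y₀} {q : Y₀ ⟶ Y} {w' : g ≫ q = 0}
    (h : (ShortComplex.mk f p w).Exact) (hp : Epi p) (h' : (ShortComplex.mk g q w').Exact)
    (hq : Epi q) (y : (X₀ ⊗ Y₀ : ModuleCat.{u} k)) (hy : (p ⊗ₘ q) y = 0) :
    ∃ (a : (X₁ ⊗ Y₀ : ModuleCat.{u} k)) (b : (X₀ ⊗ Y₁ : ModuleCat.{u} k)),
      (f ▷ Y₀) a + (X₀ ◁ g) b = y := by
  have e := TensorProduct.map_ker ((ShortComplex.ShortExact.moduleCat_exact_iff_function_exact _).1 h)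
    ((ModuleCat.epi_iff_surjective _).1 hp)
    ((ShortComplex.ShortExact.moduleCat_exact_iff_function_exact _).1 h')
    ((ModuleCat.epi_iff_surjective _).1 hq)
  have hy' : y ∈ LinearMap.ker (TensorProduct.map p.hom q.hom) := hy
  rw [e] at hy'
  obtain ⟨_, ⟨b, rfl⟩, _, ⟨a, rfl⟩, hab⟩ := Submodule.mem_sup.1 hy'
  exact ⟨a, b, (add_comm _ _).trans hab⟩

/-- The external tensor product of two resolutions. -/
noncomputable def extResolution (R : Resolution F) (S : Resolution G) :
    Resolution (extTensor F G) where
  K := (extBicomplex R.K S.K).tot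
  p := Bicomplex.desc₀ (Z := extBicomplex R.K S.K) (extTensorMap R.p S.p)
  w := by
    refine Eq.trans (congrArg (· ≫ _) (Bicomplex.tot_d _ 0)) ?_
    refine Bicomplex.totD_desc₀ _ _ ?_ ?_
    · refine (extTensorMap_comp _ _ _ _).symm.trans ?_
      rw [R.w]
      ext1
      funext x
      exact MonoidalPreadditive.zero_tensor _
    · refine (extTensorMap_comp _ _ _ _).symm.trans ?_
      rw [S.w]
      ext1
      funext x
      exact MonoidalPreadditive.tensor_zero _
  exact n := by
    apply exact_of_evaluation
    intro x
    -- At an object of the product this is a tensor product of two resolutions of vector spaces. In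
    -- positive total degree each Künneth summand has a factor of positive degree, which is zero.
    let X := (((evaluation C (ModuleCat.{u} k)).obj x.1).mapHomologicalComplex _).obj R.K
    let Y := (((evaluation D (ModuleCat.{u} k)).obj x.2).mapHomologicalComplex _).obj S.K
    have h : IsZero (((((evaluation (C × D) (ModuleCat.{u} k)).obj x).mapHomologicalComplex _).obj
        (extBicomplex R.K S.K).tot).homology (n + 1)) := by
      obtain ⟨e⟩ := kunneth X Y (n + 1)
      refine IsZero.of_iso ?_ (HomologicalComplex.homologyMapIso (evalExtTot R.K S.K x) _ ≪≫ e)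
      rw [IsZero.iff_id_eq_zero]
      refine Sigma.hom_ext _ _ fun p => IsZero.eq_of_src ?_ _ _
      obtain ⟨⟨a, b⟩, hab⟩ := p
      change a + b = n + 1 at hab
      rcases a with _ | a
      · obtain rfl : b = n + 1 := by omega
        rw [IsZero.iff_id_eq_zero, ← id_tensorHom_id,
          (IsZero.iff_id_eq_zero _).1 (S.homology_map_isZero _ n)]
        exact MonoidalPreadditive.tensor_zero _
      · rw [IsZero.iff_id_eq_zero, ← id_tensorHom_id,
          (IsZero.iff_id_eq_zero _).1 (R.homology_map_isZero _ a)]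
        exact MonoidalPreadditive.zero_tensor _
    rw [← HomologicalComplex.exactAt_iff_isZero_homology,
      HomologicalComplex.exactAt_iff' _ (n + 1 + 1) (n + 1) n (by simp) (by simp)] at h
    exact h
  exact₀ := by
    apply exact_of_evaluation
    intro x
    rw [ShortComplex.moduleCat_exact_iff]
    intro (z : ((extBicomplex R.K S.K).totX 0).obj x) hz
    let Z := extBicomplex R.K S.K
    -- In total degree zero the only summand is the one of bidegree `(0, 0)`.
    let y : (extTensor (R.K.X 0) (S.K.X 0)).obj x := (Bicomplex.desc₀ (𝟙 (Z.Z 0 0))).app x z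
    have hyz : (Z.ι 0 0 0 rfl).app x y = z := congrArg (fun t => t.app x z) Z.desc₀_id
    have hy : (R.p.app x.1 ⊗ₘ S.p.app x.2) y = 0 := by
      rw [← hyz] at hz
      refine Eq.trans ?_ hz
      exact (congrArg (fun t => t.app x y) (Z.ι_desc₀ (extTensorMap R.p S.p))).symm
    obtain ⟨a, b, hab⟩ := exact_lTensor_rTensor
      (R.exact₀.map ((evaluation C (ModuleCat.{u} k)).obj x.1))
      ((NatTrans.epi_iff_epi_app R.p).1 R.epi x.1)
      (S.exact₀.map ((evaluation D (ModuleCat.{u} k)).obj x.2))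
      ((NatTrans.epi_iff_epi_app S.p).1 S.epi x.2) y hy
    have h₁ := congrArg (fun t => t.app x a) Z.h_ι_zero
    have h₂ := congrArg (fun t => t.app x b) Z.v_ι_zero
    refine ⟨(Z.ι 1 1 0 rfl).app x a + (Z.ι 1 0 1 rfl).app x b, ?_⟩
    refine Eq.trans (congrArg (fun t : Z.totX 1 ⟶ Z.totX 0 => (t.app x)
      ((Z.ι 1 1 0 rfl).app x a + (Z.ι 1 0 1 rfl).app x b)) (Bicomplex.tot_d Z 0)) ?_
    refine (map_add (Z.totD 0 |>.app x).hom _ _).trans ?_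
    refine (congrArg₂ (· + ·) h₁ h₂).trans ?_
    refine (map_add ((Z.ι 0 0 0 rfl).app x).hom _ _).symm.trans ?_
    refine Eq.trans (congrArg ((Z.ι 0 0 0 rfl).app x) ?_) hyz
    refine Eq.trans ?_ hab
    exact congrArg₂ (· + ·)
      (congrArg (fun t : (R.K.X 1).obj x.1 ⊗ (S.K.X 0).obj x.2 ⟶ (R.K.X 0).obj x.1 ⊗ (S.K.X 0).obj x.2
        => t.hom a) (tensorHom_id ((R.K.d 1 0).app x.1) ((S.K.X 0).obj x.2)))
      (congrArg (fun t : (R.K.X 0).obj x.1 ⊗ (S.K.X 1).obj x.2 ⟶ (R.K.X 0).obj x.1 ⊗ (S.K.X 0).obj x.2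
        => t.hom b) (id_tensorHom ((R.K.X 0).obj x.1) ((S.K.d 1 0).app x.2)))
  epi := by
    have : Epi (extTensorMap R.p S.p) := by
      rw [NatTrans.epi_iff_epi_app]
      intro x
      rw [ModuleCat.epi_iff_surjective]
      exact TensorProduct.map_surjective
        ((ModuleCat.epi_iff_surjective _).1 ((NatTrans.epi_iff_epi_app R.p).1 R.epi x.1))
        ((ModuleCat.epi_iff_surjective _).1 ((NatTrans.epi_iff_epi_app S.p).1 S.epi x.2))
    exact (extBicomplex R.K S.K).epi_desc₀ _ this

theorem projective_extResolution (R : Resolution F) (S : Resolution G)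
    (hR : ∀ n, Projective (R.K.X n)) (hS : ∀ n, Projective (S.K.X n)) (n : ℕ) :
    Projective ((extResolution R S).K.X n) :=
  (extBicomplex R.K S.K).projective_totX (fun a b => projective_extTensor (R.K.X a) (S.K.X b)) n

/-- The Künneth formula for external tensor products. -/
theorem catHomology_extTensor (F : C ⥤ ModuleCat.{u} k) (G : D ⥤ ModuleCat.{u} k) (n : ℕ) :
    Nonempty (catHomology (extTensor F G) n ≅
      ∐ fun p : Bicomplex.Diag n => catHomology F p.1.1 ⊗ catHomology G p.1.2) := by
  obtain ⟨R, hR⟩ := exists_projective_resolution F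
  obtain ⟨S, hS⟩ := exists_projective_resolution G
  -- The external product of projective resolutions is again a projective resolution, and its
  -- colimit is the tensor product of the colimits of the two factors.
  obtain ⟨e₁⟩ := (extResolution R S).nonempty_leftDerived_iso colim
    (projective_extResolution R S hR hS) n
  obtain ⟨e₂⟩ := kunneth
    (((colim (J := C) (C := ModuleCat.{u} k)).mapHomologicalComplex _).obj R.K)
    (((colim (J := D) (C := ModuleCat.{u} k)).mapHomologicalComplex _).obj S.K) n
  have e₃ := fun a => R.nonempty_leftDerived_iso colim hR a
  have e₄ := fun a => S.nonempty_leftDerived_iso colim hS a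
  exact ⟨e₁ ≪≫ HomologicalComplex.homologyMapIso (colimExtTot R.K S.K) n ≪≫ e₂ ≪≫
    Sigma.mapIso fun p => tensorIso (e₃ p.1.1).some.symm (e₄ p.1.2).some.symm⟩

open scoped TensorProduct in
/-- The homology of an iterated external tensor product. -/
theorem catHomology_extTensor_extTensor {B : Type} [SmallCategory B] (F₁ : B ⥤ ModuleCat.{u} k)
    (F₂ : C ⥤ ModuleCat.{u} k) (F₃ : D ⥤ ModuleCat.{u} k) (H₁ H₂ H₃ : ℕ → ModuleCat.{u} k)
    (e₁ : ∀ n, Nonempty (catHomology F₁ n ≅ H₁ n)) (e₂ : ∀ n, Nonempty (catHomology F₂ n ≅ H₂ n))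
    (e₃ : ∀ n, Nonempty (catHomology F₃ n ≅ H₃ n)) (n : ℕ) :
    Nonempty (catHomology (extTensor F₁ (extTensor F₂ F₃)) n ≃ₗ[k]
      DirectSum {t : ℕ × ℕ × ℕ // t.1 + t.2.1 + t.2.2 = n} fun t =>
        H₁ t.1.1 ⊗[k] (H₂ t.1.2.1 ⊗[k] H₃ t.1.2.2)) := by
  classical
  have h : ∀ n, Nonempty (catHomology (extTensor F₂ F₃) n ≃ₗ[k]
      DirectSum (Bicomplex.Diag n) fun p => H₂ p.1.1 ⊗[k] H₃ p.1.2) := fun n => by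
    obtain ⟨e⟩ := catHomology_extTensor F₂ F₃ n
    exact ⟨(e ≪≫ Sigma.mapIso fun p : Bicomplex.Diag n => tensorIso (e₂ p.1.1).some (e₃ p.1.2).some)
      ≪≫ ModuleCat.coprodIsoDirectSum _ |>.toLinearEquiv⟩
  obtain ⟨e⟩ := catHomology_extTensor F₁ (extTensor F₂ F₃) n
  let f₁ := (e ≪≫ Sigma.mapIso fun p : Bicomplex.Diag n => tensorIso (e₁ p.1.1).some
    (LinearEquiv.toModuleIso (h p.1.2).some)) ≪≫ ModuleCat.coprodIsoDirectSum _ |>.toLinearEquiv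
  let f₂ : (DirectSum (Bicomplex.Diag n) fun p => H₁ p.1.1 ⊗[k]
      DirectSum (Bicomplex.Diag p.1.2) fun q => H₂ q.1.1 ⊗[k] H₃ q.1.2) ≃ₗ[k]
      DirectSum (Bicomplex.Diag n) fun p => DirectSum (Bicomplex.Diag p.1.2) fun q =>
        H₁ p.1.1 ⊗[k] (H₂ q.1.1 ⊗[k] H₃ q.1.2) :=
    DFinsupp.mapRange.linearEquiv fun p => TensorProduct.directSumRight k k _ _
  let M : ∀ p : Bicomplex.Diag n, Bicomplex.Diag p.1.2 → Type u := fun p q =>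
    H₁ p.1.1 ⊗[k] (H₂ q.1.1 ⊗[k] H₃ q.1.2)
  let f₃ : (DirectSum (Σ p : Bicomplex.Diag n, Bicomplex.Diag p.1.2) fun x => M x.1 x.2) ≃ₗ[k]
      DirectSum (Bicomplex.Diag n) fun p => DirectSum (Bicomplex.Diag p.1.2) fun q => M p q :=
    DirectSum.sigmaLcurryEquiv k (δ := M)
  let σ : (Σ p : Bicomplex.Diag n, Bicomplex.Diag p.1.2) ≃
      {t : ℕ × ℕ × ℕ // t.1 + t.2.1 + t.2.2 = n} :=
    { toFun := fun x => ⟨(x.1.1.1, x.2.1), by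
        have h₁ := x.1.2
        have h₂ := x.2.2
        change x.1.1.1 + x.2.1.1 + x.2.1.2 = n
        omega⟩
      invFun := fun t => ⟨⟨(t.1.1, t.1.2.1 + t.1.2.2), (add_assoc _ _ _).symm.trans t.2⟩, ⟨t.1.2, rfl⟩⟩
      left_inv := by
        rintro ⟨⟨⟨a, d⟩, h⟩, ⟨⟨b, c⟩, h'⟩⟩
        change b + c = d at h'
        subst h'
        rfl
      right_inv := fun t => rfl }
  let f₄ : (DirectSum (Σ p : Bicomplex.Diag n, Bicomplex.Diag p.1.2) fun x => M x.1 x.2) ≃ₗ[k]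
      DirectSum {t : ℕ × ℕ × ℕ // t.1 + t.2.1 + t.2.2 = n} fun t =>
        H₁ t.1.1 ⊗[k] (H₂ t.1.2.1 ⊗[k] H₃ t.1.2.2) :=
    DirectSum.lequivCongrLeft k σ
  exact ⟨f₁ ≪≫ₗ f₂ ≪≫ₗ f₃.symm ≪≫ₗ f₄⟩

end ProductKunneth

/-! ### The combinatorial model of the bridgeless graphs of genus zero -/

/-- The lengths of the three chains of edges of a subdivided theta graph or figure eight (the case
that one of the lengths is zero). -/
@[ext]
structure Theta where
  /-- the length of the chain between the boundary components `i` and `i + 1` -/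
  len : Fin 3 → ℕ
  -- Any two of the three chains bound a common component, so this says that at most one chain is
  -- empty.
  pos : ∀ i, 0 < len i + len (i - 1)

namespace Theta

/-- The length of the `i`-th boundary component. -/
def bd (a : Theta) (i : Fin 3) : ℕ := a.len i + a.len (i - 1)

theorem bd_pos (a : Theta) (i : Fin 3) : 0 < a.bd i := a.pos i

/-- A morphism consists of three maps of intervals, extended to all natural numbers. -/
@[ext]
structure Hom (a b : Theta) where
  /-- the map of the `i`-th chain -/
  toFun : Fin 3 → ℕ → ℕ
  mono : ∀ i, Monotone (toFun i)
  map_zero : ∀ i, toFun i 0 = 0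
  -- For `k = 0` the end goes to the end. Beyond the end the map is a translation, so that it
  -- carries no information except on the interval.
  map_add : ∀ i k, toFun i (a.len i + k) = b.len i + k

instance : SmallCategory Theta where
  Hom := Hom
  id a := ⟨fun _ p => p, fun _ => monotone_id, fun _ => rfl, fun _ _ => rfl⟩
  comp f g := ⟨fun i p => g.toFun i (f.toFun i p), fun i => (g.mono i).comp (f.mono i),
    fun i => by rw [f.map_zero, g.map_zero], fun i k => by rw [f.map_add, g.map_add]⟩

theorem hom_ext {a b : Theta} {f g : a ⟶ b} (h : ∀ i p, Hom.toFun f i p = Hom.toFun g i p) :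
    f = g :=
  Hom.ext (funext fun i => funext fun p => h i p)

theorem hom_ext_of_lt {a b : Theta} {f g : a ⟶ b}
    (h : ∀ i p, p < a.len i → Hom.toFun f i p = Hom.toFun g i p) : f = g := by
  refine hom_ext fun i p => ?_
  rcases lt_or_ge p (a.len i) with hp | hp
  · exact h i p hp
  · obtain ⟨k, rfl⟩ := Nat.exists_eq_add_of_le hp
    rw [Hom.map_add, Hom.map_add]

theorem comp_toFun {a b c : Theta} (f : a ⟶ b) (g : b ⟶ c) (i : Fin 3) (p : ℕ) :
    Hom.toFun (f ≫ g) i p = Hom.toFun g i (Hom.toFun f i p) := rfl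

theorem id_toFun (a : Theta) (i : Fin 3) (p : ℕ) : Hom.toFun (𝟙 a : a ⟶ a) i p = p := rfl

theorem map_len {a b : Theta} (f : a ⟶ b) (i : Fin 3) : Hom.toFun f i (a.len i) = b.len i :=
  Hom.map_add f i 0

theorem map_le {a b : Theta} (f : a ⟶ b) (i : Fin 3) {p : ℕ} (h : p ≤ a.len i) :
    Hom.toFun f i p ≤ b.len i :=
  (Hom.mono f i h).trans (map_len f i).le

/-- The map of boundary components: the chain `i`, followed by the reversed chain `i - 1`. -/
def bdMap {a b : Theta} (f : a ⟶ b) (i : Fin 3) (p : ℕ) : ℕ :=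
  if p ≤ a.len i then Hom.toFun f i p else b.bd i - Hom.toFun f (i - 1) (a.bd i - p)

theorem bdMap_of_le {a b : Theta} (f : a ⟶ b) (i : Fin 3) {p : ℕ} (h : p ≤ a.len i) :
    bdMap f i p = Hom.toFun f i p := if_pos h

/-- At `p = a.len i`, the second trivalent vertex, the two branches of the definition agree. -/
theorem bdMap_of_ge {a b : Theta} (f : a ⟶ b) (i : Fin 3) {p : ℕ} (h : a.len i ≤ p) :
    bdMap f i p = b.bd i - Hom.toFun f (i - 1) (a.bd i - p) := by
  rcases h.eq_or_lt with rfl | h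
  · rw [bdMap_of_le f i le_rfl, map_len]
    have : a.bd i - a.len i = a.len (i - 1) := by unfold bd; omega
    rw [this, map_len]
    unfold bd
    omega
  · exact if_neg (not_le.2 h)

theorem bdMap_zero {a b : Theta} (f : a ⟶ b) (i : Fin 3) : bdMap f i 0 = 0 :=
  (bdMap_of_le f i (Nat.zero_le _)).trans (Hom.map_zero f i)

theorem bdMap_bd {a b : Theta} (f : a ⟶ b) (i : Fin 3) : bdMap f i (a.bd i) = b.bd i := by
  rw [bdMap_of_ge f i (p := a.bd i) (Nat.le_add_right _ _), Nat.sub_self, Hom.map_zero, Nat.sub_zero]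

theorem bdMap_le {a b : Theta} (f : a ⟶ b) (i : Fin 3) (p : ℕ) : bdMap f i p ≤ b.bd i := by
  unfold bdMap
  split_ifs with h
  · exact (map_le f i h).trans (Nat.le_add_right _ _)
  · exact Nat.sub_le _ _

theorem bdMap_mono {a b : Theta} (f : a ⟶ b) (i : Fin 3) : Monotone (bdMap f i) := by
  intro p q hpq
  rcases le_total q (a.len i) with hq | hq
  · rw [bdMap_of_le f i hq, bdMap_of_le f i (hpq.trans hq)]
    exact Hom.mono f i hpq
  · rcases le_total p (a.len i) with hp | hp
    · refine (le_of_eq_of_le (bdMap_of_le f i hp) (map_le f i hp)).trans ?_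
      rw [bdMap_of_ge f i hq]
      have h₁ : a.bd i - q ≤ a.len (i - 1) := by unfold bd; omega
      have h₂ := map_le f (i - 1) h₁
      have h₃ : b.bd i = b.len i + b.len (i - 1) := rfl
      omega
    · rw [bdMap_of_ge f i hq, bdMap_of_ge f i hp]
      exact Nat.sub_le_sub_left (Hom.mono f (i - 1) (Nat.sub_le_sub_left hpq _)) _

theorem bdMap_id (a : Theta) (i : Fin 3) {p : ℕ} (hp : p ≤ a.bd i) : bdMap (𝟙 a) i p = p := by
  unfold bdMap
  split_ifs with h
  · rfl
  · rw [id_toFun, Nat.sub_sub_self hp]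

theorem bdMap_comp {a b c : Theta} (f : a ⟶ b) (g : b ⟶ c) (i : Fin 3) (p : ℕ) :
    bdMap (f ≫ g) i p = bdMap g i (bdMap f i p) := by
  rcases le_total p (a.len i) with h | h
  · rw [bdMap_of_le _ i h, bdMap_of_le f i h, bdMap_of_le g i (map_le f i h)]
    rfl
  · have h₁ : a.bd i - p ≤ a.len (i - 1) := by unfold bd; omega
    have h₂ := map_le f (i - 1) h₁
    have h₃ : b.bd i = b.len i + b.len (i - 1) := rfl
    rw [bdMap_of_ge _ i h, bdMap_of_ge f i h, bdMap_of_ge g i (by omega), Nat.sub_sub_self (by omega)]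
    rfl

/-- The morphism of `Δ₂` given by its values. -/
def mkHom (a b : DeltaTwo) (f : Fin (a.n + 2) → ℕ) (hf : Monotone f) (h₀ : f 0 = 0)
    (h₁ : f (Fin.last _) = b.n + 1) : a ⟶ b where
  toFun x := ⟨f x, Nat.lt_succ_of_le ((hf (Fin.le_last x)).trans h₁.le)⟩
  monotone _ _ h := hf h
  map_zero := Fin.ext h₀
  map_last := Fin.ext h₁

theorem le_of_fin {m : ℕ} (hm : 0 < m) (x : Fin (m - 1 + 2)) : x.val ≤ m := by
  have := x.2
  omega

/-- The boundary components, cut open at the first trivalent vertex. -/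
def cut (i : Fin 3) : Theta ⥤ DeltaTwo where
  -- `⟨n⟩` has `n + 2` elements, so this is the interval with the points `0, …, a.bd i`.
  obj a := ⟨a.bd i - 1⟩
  map {a b} f := mkHom _ _ (fun x => bdMap f i x.val) (fun _ _ h => bdMap_mono f i h)
    (bdMap_zero f i) (by
      change bdMap f i (a.bd i - 1 + 1) = b.bd i - 1 + 1
      rw [Nat.sub_add_cancel (a.bd_pos i), Nat.sub_add_cancel (b.bd_pos i), bdMap_bd])
  map_id a := DeltaTwo.hom_ext fun x => bdMap_id a i (le_of_fin (a.bd_pos i) x)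
  map_comp f g := DeltaTwo.hom_ext fun x => bdMap_comp f g i x.val

/-- All three boundary components, cut open. -/
def cutAll : Theta ⥤ DeltaTwo × DeltaTwo × DeltaTwo :=
  (cut 0).prod' ((cut 1).prod' (cut 2))

/-- Adding a new edge at the beginning of each chain. -/
def extend : Theta ⥤ Theta where
  obj a := ⟨fun i => a.len i + 1, fun i => by omega⟩
  map f :=
    { toFun := fun i p => if p = 0 then 0 else Hom.toFun f i (p - 1) + 1
      mono := fun i p q h => by
        have := Hom.mono f i (Nat.sub_le_sub_right h 1)
        dsimp only
        split_ifs <;> omega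
      map_zero := fun i => rfl
      map_add := fun i k => by
        dsimp only
        rw [if_neg (by omega), show ∀ l : ℕ, l + 1 + k - 1 = l + k by omega, Hom.map_add]
        omega }
  map_id a := hom_ext fun i p => by
    change (if p = 0 then 0 else p - 1 + 1) = p
    split_ifs <;> omega
  map_comp f g := hom_ext fun i p => by
    rcases p with _ | p <;> rfl

theorem extend_map_toFun {a b : Theta} (f : a ⟶ b) (i : Fin 3) (p : ℕ) :
    Hom.toFun (extend.map f) i p = if p = 0 then 0 else Hom.toFun f i (p - 1) + 1 := rfl

/-- Shrinking the new edges. -/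
def extendProj : extend ⟶ 𝟭 Theta where
  app a :=
    { toFun := fun i p => p - 1
      mono := fun i p q h => Nat.sub_le_sub_right h 1
      map_zero := fun i => rfl
      map_add := fun i k => by
        change a.len i + 1 + k - 1 = a.len i + k
        omega }
  naturality a b f := hom_ext fun i p => by
    rcases p with _ | p
    · exact (Hom.map_zero f i).symm
    · rfl

/-- The theta graph with three edges. -/
def one : Theta := ⟨fun _ => 1, fun _ => by omega⟩

/-- Shrinking the old edges. -/
def extendToOne : extend ⟶ (Functor.const Theta).obj one where
  app a :=
    { toFun := fun i p => if p = 0 then 0 else 1 + (p - (a.len i + 1))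
      mono := fun i p q h => by
        dsimp only
        split_ifs <;> omega
      map_zero := fun i => rfl
      map_add := fun i k => by
        change (if a.len i + 1 + k = 0 then 0 else 1 + (a.len i + 1 + k - (a.len i + 1))) = 1 + k
        rw [if_neg (by omega)]
        omega }
  naturality a b f := hom_ext fun i p => by
    rcases p with _ | p
    · rfl
    · change 1 + (Hom.toFun f i p + 1 - (b.len i + 1)) = 1 + (p + 1 - (a.len i + 1))
      rcases le_total p (a.len i) with h | h
      · have := map_le f i h
        omega
      · obtain ⟨k, rfl⟩ := Nat.exists_eq_add_of_le h
        rw [Hom.map_add]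
        omega

/-- The component `i` gains its first edge, at the beginning of the chain `i`, and its last one, at
the beginning of the chain `i - 1`, which it runs through backwards. Old positions are thus shifted
by one. -/
theorem bd_extend (a : Theta) (i : Fin 3) : (extend.obj a).bd i = a.bd i + 2 := by
  change a.len i + 1 + (a.len (i - 1) + 1) = a.len i + a.len (i - 1) + 2
  omega

theorem bdMap_extend {a b : Theta} (f : a ⟶ b) (i : Fin 3) {p : ℕ} (hp : p ≤ a.bd i) :
    bdMap (extend.map f) i (p + 1) = bdMap f i p + 1 := by
  rcases le_total p (a.len i) with h | h
  · rw [bdMap_of_le _ i (show p + 1 ≤ a.len i + 1 by omega), bdMap_of_le f i h, extend_map_toFun,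
      if_neg (by omega)]
    rfl
  · have e : a.bd i + 2 - (p + 1) - 1 = a.bd i - p := by omega
    have h₁ : a.bd i - p ≤ a.len (i - 1) := by unfold bd; omega
    have h₂ := map_le f (i - 1) h₁
    have h₃ : b.bd i = b.len i + b.len (i - 1) := rfl
    rw [bdMap_of_ge _ i (show a.len i + 1 ≤ p + 1 by omega), bdMap_of_ge f i h, extend_map_toFun,
      bd_extend, bd_extend, if_neg (by omega), e]
    omega

theorem bdMap_extendProj (a : Theta) (i : Fin 3) {p : ℕ} (hp : p ≤ a.bd i) :
    bdMap (extendProj.app a) i (p + 1) = p := by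
  rcases le_total p (a.len i) with h | h
  · rw [bdMap_of_le _ i (show p + 1 ≤ a.len i + 1 by omega)]
    rfl
  · rw [bdMap_of_ge _ i (show a.len i + 1 ≤ p + 1 by omega), bd_extend]
    change a.bd i - (a.bd i + 2 - (p + 1) - 1) = p
    omega

theorem bdMap_extendToOne (a : Theta) (i : Fin 3) {p : ℕ} (hp : p ≤ a.bd i) :
    bdMap (extendToOne.app a) i (p + 1) = 1 := by
  rcases le_total p (a.len i) with h | h
  · rw [bdMap_of_le _ i (show p + 1 ≤ a.len i + 1 by omega)]
    change (if p + 1 = 0 then 0 else 1 + (p + 1 - (a.len i + 1))) = 1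
    rw [if_neg (by omega)]
    omega
  · rw [bdMap_of_ge _ i (show a.len i + 1 ≤ p + 1 by omega), bd_extend]
    change 2 - (if a.bd i + 2 - (p + 1) = 0 then 0 else
      1 + (a.bd i + 2 - (p + 1) - (a.len (i - 1) + 1))) = 1
    rw [if_neg (by omega)]
    unfold bd at *
    omega

/-- Lifting a map to the interval with new points next to the ends: the ends go to the ends, and all
other points avoid the new edges. -/
def lift (i : Fin 3) {x : DeltaTwo} {a : Theta} (α : x ⟶ (cut i).obj a) :
    x ⟶ (cut i).obj (extend.obj a) :=
  mkHom _ _ (fun z => if z = 0 then 0 else if z = Fin.last _ then a.bd i + 2 else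
      (DeltaTwo.Hom.toFun α z).val + 1)
    (fun z w h => by
      have h₁ : (DeltaTwo.Hom.toFun α z).val ≤ (DeltaTwo.Hom.toFun α w).val :=
        DeltaTwo.Hom.monotone α h
      have h₂ := le_of_fin (a.bd_pos i) (DeltaTwo.Hom.toFun α z)
      rw [Fin.le_def] at h
      have h₃ := w.2
      simp only [Fin.ext_iff, Fin.val_zero, Fin.val_last]
      split_ifs <;> omega)
    (if_pos rfl) (by
      change _ = (extend.obj a).bd i - 1 + 1
      rw [if_neg (by simp [Fin.ext_iff]), if_pos rfl, bd_extend]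
      rfl)

theorem lift_toFun (i : Fin 3) {x : DeltaTwo} {a : Theta} (α : x ⟶ (cut i).obj a)
    (z : Fin (x.n + 2)) : (DeltaTwo.Hom.toFun (lift i α) z).val =
      if z = 0 then 0 else if z = Fin.last _ then a.bd i + 2 else
        (DeltaTwo.Hom.toFun α z).val + 1 := rfl

theorem toFun_comp_cut (i : Fin 3) {x : DeltaTwo} {a b : Theta} (α : x ⟶ (cut i).obj a)
    (f : a ⟶ b) (z : Fin (x.n + 2)) : (DeltaTwo.Hom.toFun (α ≫ (cut i).map f) z).val =
      bdMap f i (DeltaTwo.Hom.toFun α z).val := rfl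

theorem bdMap_bd_extend {a b : Theta} (f : extend.obj a ⟶ b) (i : Fin 3) :
    bdMap f i (a.bd i + 2) = b.bd i := by
  rw [← bd_extend, bdMap_bd]

/-- An interior point of `x` goes to an old point even when `α` maps it to an end. Without this the
lift would depend on which points `f` pushes to the ends, and it would not be natural. -/
theorem lift_comp (i : Fin 3) {x : DeltaTwo} {a b : Theta} (α : x ⟶ (cut i).obj a) (f : a ⟶ b) :
    lift i (α ≫ (cut i).map f) = lift i α ≫ (cut i).map (extend.map f) := by
  refine DeltaTwo.hom_ext fun z => ?_
  rw [toFun_comp_cut, lift_toFun, lift_toFun, toFun_comp_cut]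
  split_ifs
  · rw [bdMap_zero]
  · rw [bdMap_bd_extend, bd_extend]
  · exact (bdMap_extend f i (le_of_fin (a.bd_pos i) _)).symm

theorem lift_proj (i : Fin 3) {x : DeltaTwo} {a : Theta} (α : x ⟶ (cut i).obj a) :
    lift i α ≫ (cut i).map (extendProj.app a) = α := by
  refine DeltaTwo.hom_ext fun z => ?_
  rw [toFun_comp_cut, lift_toFun]
  split_ifs with h₁ h₂
  · rw [h₁, bdMap_zero, DeltaTwo.toFun_pos]
  · rw [h₂, bdMap_bd_extend, DeltaTwo.Hom.map_last]
    exact (Nat.sub_add_cancel (a.bd_pos i)).symm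
  · exact bdMap_extendProj a i (le_of_fin (a.bd_pos i) _)

/-- The map to the interval with three points which sends all interior points to the middle. -/
def toOne (i : Fin 3) (x : DeltaTwo) : x ⟶ (cut i).obj one :=
  mkHom _ _ (fun z => if z = 0 then 0 else if z = Fin.last _ then 2 else 1)
    (fun z w h => by
      rw [Fin.le_def] at h
      have h₃ := w.2
      simp only [Fin.ext_iff, Fin.val_zero, Fin.val_last]
      split_ifs <;> omega)
    (if_pos rfl) (by
      rw [if_neg (by simp [Fin.ext_iff]), if_pos rfl]
      rfl)

theorem toOne_toFun (i : Fin 3) (x : DeltaTwo) (z : Fin (x.n + 2)) :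
    (DeltaTwo.Hom.toFun (toOne i x) z).val =
      if z = 0 then 0 else if z = Fin.last _ then 2 else 1 := rfl

/-- The interior points of `x` all lie on the old part of the component, which is shrunk to one
point; so neither `α` nor `a` leaves a trace. -/
theorem lift_toOne (i : Fin 3) {x : DeltaTwo} {a : Theta} (α : x ⟶ (cut i).obj a) :
    lift i α ≫ (cut i).map (extendToOne.app a) = toOne i x := by
  refine DeltaTwo.hom_ext fun z => ?_
  rw [toFun_comp_cut, lift_toFun, toOne_toFun]
  split_ifs with h₁ h₂
  · exact bdMap_zero _ i
  · exact bdMap_bd_extend _ i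
  · exact bdMap_extendToOne a i (le_of_fin (a.bd_pos i) _)

/-- The lift of a map to all three boundary components. -/
def liftAll {x : DeltaTwo × DeltaTwo × DeltaTwo} {a : Theta} (α : x ⟶ cutAll.obj a) :
    x ⟶ cutAll.obj (extend.obj a) :=
  (lift 0 α.1, lift 1 α.2.1, lift 2 α.2.2)

theorem liftAll_comp {x : DeltaTwo × DeltaTwo × DeltaTwo} {a b : Theta} (α : x ⟶ cutAll.obj a)
    (f : a ⟶ b) : liftAll (α ≫ cutAll.map f) = liftAll α ≫ cutAll.map (extend.map f) :=
  Prod.ext (lift_comp 0 α.1 f) (Prod.ext (lift_comp 1 α.2.1 f) (lift_comp 2 α.2.2 f))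

theorem liftAll_proj {x : DeltaTwo × DeltaTwo × DeltaTwo} {a : Theta} (α : x ⟶ cutAll.obj a) :
    liftAll α ≫ cutAll.map (extendProj.app a) = α :=
  Prod.ext (lift_proj 0 α.1) (Prod.ext (lift_proj 1 α.2.1) (lift_proj 2 α.2.2))

theorem liftAll_toOne {x : DeltaTwo × DeltaTwo × DeltaTwo} {a : Theta} (α : x ⟶ cutAll.obj a) :
    liftAll α ≫ cutAll.map (extendToOne.app a) = (toOne 0 x.1, toOne 1 x.2.1, toOne 2 x.2.2) :=
  Prod.ext (lift_toOne 0 α.1) (Prod.ext (lift_toOne 1 α.2.1) (lift_toOne 2 α.2.2))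

/-- Each object `α` of the comma category is joined to one fixed object through `liftAll α`:
shrinking the new edges leads back to `α`, and shrinking the old ones leads to `toOne`. -/
instance : cutAll.Final where
  out x := by
    let y : StructuredArrow x cutAll :=
      StructuredArrow.mk (Y := one) (toOne 0 x.1, toOne 1 x.2.1, toOne 2 x.2.2)
    have : Nonempty (StructuredArrow x cutAll) := ⟨y⟩
    refine zigzag_isConnected fun z w => ?_
    have key : ∀ z : StructuredArrow x cutAll, Zigzag z y := fun z => by
      let z' : StructuredArrow x cutAll := StructuredArrow.mk (Y := extend.obj z.right) (liftAll z.hom)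
      refine Zigzag.trans (j₂ := z') (Zigzag.of_inv ?_) (Zigzag.of_hom ?_)
      · exact StructuredArrow.homMk (extendProj.app z.right) (liftAll_proj z.hom)
      · exact StructuredArrow.homMk (extendToOne.app z.right) (liftAll_toOne z.hom)
    exact (key z).trans (key w).symm

/-- The lifts which prove finality are natural, so they also give sections on restricted
projectives; with `extend`, `extendProj` and `extendToOne` these restrictions are acyclic. -/
theorem catHomology_cutAll_comp {k : Type u} [Field k]
    (F : DeltaTwo × DeltaTwo × DeltaTwo ⥤ ModuleCat.{u} k) (j : ℕ) :
    Nonempty (catHomology (cutAll ⋙ F) j ≅ catHomology F j) := by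
  refine catHomology_comp_of_final cutAll (fun P _ j => ?_) F j
  obtain ⟨s, hs⟩ := exists_section_of_projective cutAll extend extendProj (fun α => liftAll α)
    (fun α f => liftAll_comp α f) (fun α => liftAll_proj α) P
  exact catHomology_isZero_of_section extend extendProj one extendToOne _ s hs j

end Theta

/-! ### Fat graphs on arbitrary finite sets of flags -/

section Fat

open Equiv.Perm

/-- The number of cycles of a permutation, fixed points included. -/
noncomputable def orbits {X : Type} (σ : Equiv.Perm X) : ℕ :=
  Nat.card (Quotient (SameCycle.setoid σ))

/-- Used with values in quotients, in `Prop` and in the numbers of boundary components, to transport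
cycles from one permutation to another and to separate them. -/
theorem eq_of_sameCycle {X Z : Type} {σ : Equiv.Perm X} (f : X → Z) (hf : ∀ x, f (σ x) = f x)
    {x y : X} (h : σ.SameCycle x y) : f x = f y := by
  have h₁ : ∀ (n : ℕ) x, f ((σ ^ n) x) = f x := fun n => by
    induction n with
    | zero => exact fun x => rfl
    | succ n ih => intro x; rw [pow_succ', Equiv.Perm.mul_apply, hf, ih]
  obtain ⟨k, rfl⟩ := h
  obtain ⟨n, rfl | rfl⟩ := k.eq_nat_or_neg
  · exact (h₁ n x).symm
  · rw [zpow_neg, zpow_natCast, ← h₁ n ((σ ^ n)⁻¹ x)]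
    exact congrArg f (Equiv.apply_symm_apply (σ ^ n) x).symm

theorem sameCycle_map {X Y : Type} {σ : Equiv.Perm X} {σ' : Equiv.Perm Y} (e : X → Y)
    (he : ∀ x, e (σ x) = σ' (e x)) {x y : X} (h : σ.SameCycle x y) : σ'.SameCycle (e x) (e y) :=
  Quotient.exact (s := SameCycle.setoid σ') <|
    eq_of_sameCycle (fun x => Quotient.mk (SameCycle.setoid σ') (e x))
      (fun x => Quotient.sound (by rw [he]; exact SameCycle.symm ⟨1, rfl⟩)) h

theorem sameCycle_equiv {X Y : Type} {σ : Equiv.Perm X} {σ' : Equiv.Perm Y} (e : X ≃ Y)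
    (he : ∀ x, e (σ x) = σ' (e x)) {x y : X} : σ'.SameCycle (e x) (e y) ↔ σ.SameCycle x y := by
  refine ⟨fun h => ?_, sameCycle_map e he⟩
  have := sameCycle_map (σ := σ') (σ' := σ) e.symm (fun y => by
    rw [Equiv.symm_apply_eq, he, Equiv.apply_symm_apply]) h
  simpa using this

theorem orbits_equiv {X Y : Type} {σ : Equiv.Perm X} {σ' : Equiv.Perm Y} (e : X ≃ Y)
    (he : ∀ x, e (σ x) = σ' (e x)) : orbits σ = orbits σ' :=
  Nat.card_congr (Quotient.congr e fun _ _ => (sameCycle_equiv e he).symm)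

/-- The conditions for two permutations and a numbering of the boundary components to define a fat
graph. -/
structure IsFat (g : ℕ) {n : ℕ} {X : Type} (σ τ : Equiv.Perm X) (mark : X → Fin n) : Prop where
  nonempty : Nonempty X
  τ_τ : ∀ x, τ (τ x) = x
  τ_ne : ∀ x, τ x ≠ x
  σ_ne : ∀ x, σ x ≠ x
  -- Connectedness without the group generated by `σ` and `τ`: an invariant predicate which holds
  -- somewhere holds everywhere.
  connected : ∀ P : X → Prop, (∀ x, P (σ x) ↔ P x) → (∀ x, P (τ x) ↔ P x) → ∀ x y, P x → P y
  mark_surjective : Function.Surjective mark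
  mark_eq_iff : ∀ x y, mark x = mark y ↔ (σ * τ).SameCycle x y
  euler : (orbits σ : ℤ) - orbits τ + n = 2 - 2 * g

theorem FatGraph.isFat {g n : ℕ} (Γ : FatGraph g n) : IsFat g Γ.σ Γ.τ Γ.mark where
  nonempty := ⟨⟨0, Γ.pos⟩⟩
  τ_τ := Γ.τ_τ
  τ_ne := Γ.τ_ne
  σ_ne := Γ.σ_ne
  connected P hσ hτ x y hx := by
    obtain ⟨w, hw, rfl⟩ := Γ.connected x y
    have : ∀ x, P (w x) ↔ P x := by
      induction hw using Subgroup.closure_induction with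
      | mem w hw =>
        rcases hw with rfl | rfl
        · exact hσ
        · exact hτ
      | one => exact fun x => Iff.rfl
      | mul v w _ _ hv hw => exact fun x => (hv _).trans (hw _)
      | inv w _ hw => exact fun x => (hw (w.symm x)).symm.trans (by rw [Equiv.apply_symm_apply])
    exact (this x).2 hx
  mark_surjective := Γ.mark_surjective
  mark_eq_iff := Γ.mark_eq_iff
  euler := Γ.euler

/-- The fat graph with a given set of flags. -/
noncomputable def FatGraph.of {g n : ℕ} {X : Type} [Finite X] {σ τ : Equiv.Perm X}
    {mark : X → Fin n} (h : IsFat g σ τ mark) : FatGraph g n where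
  flags := Nat.card X
  pos := Nat.card_pos_iff.2 ⟨h.nonempty, inferInstance⟩
  σ := (Finite.equivFin X).permCongr σ
  τ := (Finite.equivFin X).permCongr τ
  τ_τ x := by simp [Equiv.permCongr_apply, h.τ_τ]
  τ_ne x := by
    rw [Equiv.permCongr_apply, Ne, ← Equiv.eq_symm_apply]
    exact h.τ_ne _
  σ_ne x := by
    rw [Equiv.permCongr_apply, Ne, ← Equiv.eq_symm_apply]
    exact h.σ_ne _
  connected x y := by
    let e := Finite.equivFin X
    let G := Subgroup.closure {e.permCongr σ, e.permCongr τ}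
    have hm : ∀ ρ ∈ G, ∀ v, (∃ w ∈ G, w x = ρ v) ↔ ∃ w ∈ G, w x = v := fun ρ hρ v => by
      constructor
      · rintro ⟨w, hw, h⟩
        exact ⟨ρ⁻¹ * w, mul_mem (inv_mem hρ) hw, by
          rw [Equiv.Perm.mul_apply, h]
          exact Equiv.symm_apply_apply ρ v⟩
      · rintro ⟨w, hw, h⟩
        exact ⟨ρ * w, mul_mem hρ hw, by rw [Equiv.Perm.mul_apply, h]⟩
    have hh : ∀ (ρ : Equiv.Perm X), e.permCongr ρ ∈ G → ∀ z, (∃ w ∈ G, w x = e (ρ z)) ↔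
        ∃ w ∈ G, w x = e z := fun ρ hρ z => by
      rw [← hm _ hρ (e z), Equiv.permCongr_apply, Equiv.symm_apply_apply]
    have := h.connected (fun z => ∃ w ∈ G, w x = e z)
      (hh σ (Subgroup.subset_closure (by simp)))
      (hh τ (Subgroup.subset_closure (by simp))) (e.symm x) (e.symm y) ⟨1, one_mem _, by simp⟩
    simpa using this
  mark x := mark ((Finite.equivFin X).symm x)
  mark_surjective := h.mark_surjective.comp (Finite.equivFin X).symm.surjective
  mark_eq_iff x y := by
    rw [h.mark_eq_iff, ← sameCycle_equiv (Finite.equivFin X)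
      (σ' := (Finite.equivFin X).permCongr σ * (Finite.equivFin X).permCongr τ)
      (fun x => by simp [Equiv.permCongr_apply])]
    simp
  euler := by
    refine Eq.trans ?_ h.euler
    rw [orbits_equiv (Finite.equivFin X) (σ' := (Finite.equivFin X).permCongr σ)
        (fun x => by simp [Equiv.permCongr_apply]),
      orbits_equiv (Finite.equivFin X) (σ' := (Finite.equivFin X).permCongr τ)
        (fun x => by simp [Equiv.permCongr_apply])]
    rfl

namespace FatGraph

variable {g n : ℕ} {X : Type} [Finite X] {σ τ : Equiv.Perm X} {mark : X → Fin n}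
  (h : IsFat g σ τ mark)

/-- The flags of the fat graph with a given set of flags. -/
noncomputable def ofFlag : X ≃ (of h).Flag := Finite.equivFin X

theorem of_σ (x : X) : (of h).σ (ofFlag h x) = ofFlag h (σ x) := by
  change (Finite.equivFin X).permCongr σ (Finite.equivFin X x) = Finite.equivFin X (σ x)
  simp [Equiv.permCongr_apply]

theorem of_τ (x : X) : (of h).τ (ofFlag h x) = ofFlag h (τ x) := by
  change (Finite.equivFin X).permCongr τ (Finite.equivFin X x) = Finite.equivFin X (τ x)
  simp [Equiv.permCongr_apply]

theorem of_φ (x : X) : (of h).φ (ofFlag h x) = ofFlag h (σ (τ x)) := by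
  rw [φ_apply, of_τ, of_σ]

theorem of_mark (x : X) : (of h).mark (ofFlag h x) = mark x :=
  congrArg mark ((Finite.equivFin X).symm_apply_apply x)

end FatGraph

/-! ### Shrinking an edge -/

/-- `(σ', τ')` is obtained from `(σ, τ)` by shrinking the edge of `a`, which is not a loop. -/
structure IsShrink {X Y : Type} (σ τ : Equiv.Perm X) (σ' τ' : Equiv.Perm Y) (a : X) (ι : Y → X) :
    Prop where
  not_loop : ¬ σ.SameCycle a (τ a)
  injective : Function.Injective ι
  mem_range : ∀ x, x ∈ Set.range ι ↔ x ≠ a ∧ x ≠ τ a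
  τ_eq : ∀ y, ι (τ' y) = τ (ι y)
  σ_of_left : ∀ y, σ (ι y) = a → ι (σ' y) = σ (τ a)
  σ_of_right : ∀ y, σ (ι y) = τ a → ι (σ' y) = σ a
  σ_of_ne : ∀ y, σ (ι y) ≠ a → σ (ι y) ≠ τ a → ι (σ' y) = σ (ι y)

namespace IsShrink

variable {X Y : Type} {σ τ : Equiv.Perm X} {σ' τ' : Equiv.Perm Y} {a : X} {ι : Y → X}
  (H : IsShrink σ τ σ' τ' a ι)

include H

theorem exists_of_ne {x : X} (h₁ : x ≠ a) (h₂ : x ≠ τ a) : ∃ y, ι y = x :=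
  (H.mem_range x).2 ⟨h₁, h₂⟩

theorem ne_left (y : Y) : ι y ≠ a := ((H.mem_range _).1 ⟨y, rfl⟩).1

theorem ne_right (y : Y) : ι y ≠ τ a := ((H.mem_range _).1 ⟨y, rfl⟩).2

theorem apply_a_ne : σ a ≠ τ a := fun e => H.not_loop ⟨1, by simpa using e⟩

theorem apply_b_ne : σ (τ a) ≠ a := fun e => H.not_loop (SameCycle.symm ⟨1, by simpa using e⟩)

/-- The flags which follow the ends of the edge. -/
theorem exists_next (hσ : ∀ x, σ x ≠ x) : (∃ y, ι y = σ (τ a)) ∧ ∃ y, ι y = σ a :=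
  ⟨H.exists_of_ne H.apply_b_ne (hσ _), H.exists_of_ne (hσ _) H.apply_a_ne⟩

theorem cases_flag (P : X → Prop) (ha : P a) (hb : P (τ a)) (h : ∀ y, P (ι y)) (x : X) : P x := by
  by_cases h₁ : x = a
  · exact h₁ ▸ ha
  · by_cases h₂ : x = τ a
    · exact h₂ ▸ hb
    · obtain ⟨y, rfl⟩ := H.exists_of_ne h₁ h₂
      exact h y

/-- Functions on the flags of the graph are given on the flags of the smaller graph and the two ends
of the edge. -/
theorem exists_extension {Z : Type} (hτ : τ a ≠ a) (f : Y → Z) (u v : Z) :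
    ∃ F : X → Z, F a = u ∧ F (τ a) = v ∧ ∀ y, F (ι y) = f y := by
  classical
  refine ⟨fun x => if x = a then u else if x = τ a then v else
    if h : ∃ y, ι y = x then f h.choose else u, if_pos rfl, ?_, fun y => ?_⟩
  · dsimp only
    rw [if_neg hτ, if_pos rfl]
  · have h : ∃ z, ι z = ι y := ⟨y, rfl⟩
    dsimp only
    rw [if_neg (H.ne_left y), if_neg (H.ne_right y), dif_pos h, H.injective h.choose_spec]

theorem next_left {y₁ : Y} (h₁ : ι y₁ = σ (τ a)) {y : Y} (h : σ (ι y) = a) : σ' y = y₁ :=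
  H.injective ((H.σ_of_left y h).trans h₁.symm)

theorem next_right {y₂ : Y} (h₂ : ι y₂ = σ a) {y : Y} (h : σ (ι y) = τ a) : σ' y = y₂ :=
  H.injective ((H.σ_of_right y h).trans h₂.symm)

/-- The two vertices are joined. -/
theorem sameCycle_next [Finite X] {y₁ y₂ : Y} (h₁ : ι y₁ = σ (τ a)) (h₂ : ι y₂ = σ a) :
    σ'.SameCycle y₁ y₂ := by
  by_contra hc
  -- Starting after `τ a` and following `σ`, the permutation `σ'` takes the same steps until `τ a`
  -- would be reached, where it goes to `y₂` instead. If it never met `y₂`, the cycle of `τ a` would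
  -- never close.
  have hstep : ∀ x, (σ.SameCycle (τ a) x ∧ ∃ y, ι y = x ∧ σ'.SameCycle y₁ y) →
      (σ.SameCycle (τ a) (σ x) ∧ ∃ y, ι y = σ x ∧ σ'.SameCycle y₁ y) := by
    rintro _ ⟨h, y, rfl, hy⟩
    have h' : σ.SameCycle (τ a) (σ (ι y)) := h.trans ⟨1, rfl⟩
    have hy' : σ'.SameCycle y₁ (σ' y) := hy.trans ⟨1, rfl⟩
    refine ⟨h', ?_⟩
    by_cases c₁ : σ (ι y) = a
    · exact absurd (c₁ ▸ h').symm H.not_loop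
    · by_cases c₂ : σ (ι y) = τ a
      · exact absurd (H.next_right h₂ c₂ ▸ hy') hc
      · exact ⟨σ' y, H.σ_of_ne y c₁ c₂, hy'⟩
  have hall : ∀ n : ℕ, σ.SameCycle (τ a) ((σ ^ n) (σ (τ a))) ∧
      ∃ y, ι y = (σ ^ n) (σ (τ a)) ∧ σ'.SameCycle y₁ y := fun n => by
    induction n with
    | zero => exact ⟨⟨1, rfl⟩, y₁, h₁, SameCycle.refl _ _⟩
    | succ n ih =>
      rw [pow_succ', Equiv.Perm.mul_apply]
      exact hstep _ ih
  have hs : σ.SameCycle (σ (τ a)) (τ a) := SameCycle.symm ⟨1, rfl⟩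
  obtain ⟨n, hn⟩ := hs.exists_nat_pow_eq
  obtain ⟨-, y, hy, -⟩ := hall n
  exact H.ne_right y (hy.trans hn)

/-- The map of vertices. -/
theorem exists_vertex_map [Finite X] (hσ : ∀ x, σ x ≠ x) (hτ : τ a ≠ a) :
    ∃ F : X → Quotient (SameCycle.setoid σ'), (∀ x, F (σ x) = F x) ∧ (∀ y, F (ι y) = ⟦y⟧) ∧
      F a = F (τ a) := by
  obtain ⟨⟨y₁, h₁⟩, ⟨y₂, h₂⟩⟩ := H.exists_next hσ
  have hy : (⟦y₁⟧ : Quotient (SameCycle.setoid σ')) = ⟦y₂⟧ :=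
    Quotient.sound (H.sameCycle_next h₁ h₂)
  have hs : ∀ y, (⟦σ' y⟧ : Quotient (SameCycle.setoid σ')) = ⟦y⟧ := fun y =>
    Quotient.sound (SameCycle.symm ⟨1, rfl⟩)
  obtain ⟨F, ha, hb, hF⟩ := H.exists_extension hτ
    (fun y => (⟦y⟧ : Quotient (SameCycle.setoid σ'))) ⟦y₁⟧ ⟦y₂⟧
  refine ⟨F, H.cases_flag _ ?_ ?_ fun y => ?_, hF, by rw [ha, hb, hy]⟩
  · rw [← h₂, hF, ha, hy]
  · rw [← h₁, hF, hb, hy]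
  · by_cases c₁ : σ (ι y) = a
    · rw [c₁, ha, hF, ← hs y, H.next_left h₁ c₁]
    · by_cases c₂ : σ (ι y) = τ a
      · rw [c₂, hb, hF, ← hs y, H.next_right h₂ c₂]
      · rw [← H.σ_of_ne y c₁ c₂, hF, hF, hs]

/-- The vertices of the smaller graph are those of the graph with the vertex of `τ a` left out,
since that vertex is absorbed by the one of `a`. -/
theorem orbits_eq [Finite X] (hσ : ∀ x, σ x ≠ x) (hτ : τ a ≠ a) : orbits σ = orbits σ' + 1 := by
  classical
  obtain ⟨⟨y₁, h₁⟩, ⟨y₂, h₂⟩⟩ := H.exists_next hσ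
  obtain ⟨F, hF, hFι, hab⟩ := H.exists_vertex_map hσ hτ
  let V := Quotient (SameCycle.setoid σ)
  let V' := Quotient (SameCycle.setoid σ')
  have hs : ∀ x, (⟦σ x⟧ : V) = ⟦x⟧ := fun x => Quotient.sound (SameCycle.symm ⟨1, rfl⟩)
  have hne : (⟦a⟧ : V) ≠ ⟦τ a⟧ := fun e => H.not_loop (Quotient.exact e)
  -- The retraction of the vertices which sends the vertex of `τ a` to the vertex of `a`.
  let r : V → {c : V // c ≠ ⟦τ a⟧} := fun c => if h : c = ⟦τ a⟧ then ⟨⟦a⟧, hne⟩ else ⟨c, h⟩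
  have hr : r ⟦τ a⟧ = r ⟦a⟧ := by
    simp only [r, dif_pos rfl, dif_neg hne]
  let f : V → V' := Quotient.lift F fun x y h => eq_of_sameCycle F hF h
  have hg : ∀ y, r ⟦ι (σ' y)⟧ = r ⟦ι y⟧ := fun y => by
    by_cases c₁ : σ (ι y) = a
    · rw [H.σ_of_left y c₁, ← hs (ι y), c₁, hs, hr]
    · by_cases c₂ : σ (ι y) = τ a
      · rw [H.σ_of_right y c₂, ← hs (ι y), c₂, hs, hr]
      · rw [H.σ_of_ne y c₁ c₂, hs]
  let g : V' → {c : V // c ≠ ⟦τ a⟧} := Quotient.lift (fun y => r ⟦ι y⟧) fun x y h =>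
    eq_of_sameCycle (fun y => r ⟦ι y⟧) hg h
  have e : {c : V // c ≠ ⟦τ a⟧} ≃ V' :=
    { toFun := fun c => f c.1
      invFun := g
      left_inv := by
        have key : ∀ x, (⟦x⟧ : V) ≠ ⟦τ a⟧ → g (F x) = r ⟦x⟧ := H.cases_flag _ (fun _ => by
            have : F a = ⟦y₁⟧ := by rw [hab, ← hF, ← h₁, hFι]
            rw [this]
            change r ⟦ι y₁⟧ = _
            rw [h₁, hs, hr])
          (fun h => absurd rfl h) fun y _ => by
            rw [hFι]
            rfl
        rintro ⟨c, hc⟩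
        induction c using Quotient.inductionOn with | _ x =>
        exact (key x hc).trans (dif_neg hc)
      right_inv := by
        intro c
        induction c using Quotient.inductionOn with | _ y =>
        change f (r ⟦ι y⟧).1 = _
        by_cases hc : (⟦ι y⟧ : V) = ⟦τ a⟧
        · have : f ⟦ι y⟧ = f ⟦τ a⟧ := by rw [hc]
          rw [hc, hr]
          simp only [r, dif_neg hne]
          exact hab.trans (this.symm.trans (hFι y))
        · simp only [r, dif_neg hc]
          exact hFι y }
  have : Finite V := inferInstance
  have h := Nat.card_congr (Equiv.sumCompl (fun c : V => c = ⟦τ a⟧))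
  rw [Nat.card_sum, Nat.card_unique, Nat.card_congr e, add_comm] at h
  exact h.symm

end IsShrink

/-- All cycles of an involution without fixed points have two elements. -/
theorem two_mul_orbits {X : Type} [Finite X] {τ : Equiv.Perm X} (hτ : ∀ x, τ (τ x) = x)
    (hne : ∀ x, τ x ≠ x) : 2 * orbits τ = Nat.card X := by
  classical
  have := Fintype.ofFinite X
  let V := Quotient (SameCycle.setoid τ)
  have := Fintype.ofFinite V
  have hs : ∀ x y, τ.SameCycle x y ↔ y = x ∨ y = τ x := fun x y => by
    constructor
    · intro h
      have := eq_of_sameCycle (fun z => z = x ∨ z = τ x) (fun z => propext ⟨by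
        rintro (h | h)
        · exact Or.inr (by rw [← h, hτ])
        · exact Or.inl (τ.injective h), by
        rintro (rfl | rfl)
        · exact Or.inr rfl
        · exact Or.inl (hτ _)⟩) h
      exact (iff_of_eq this).1 (Or.inl rfl)
    · rintro (rfl | rfl)
      · exact SameCycle.refl _ _
      · exact ⟨1, rfl⟩
  have hf : ∀ c ∈ (Finset.univ : Finset V),
      (Finset.univ.filter fun x : X => (⟦x⟧ : V) = c).card = 2 := fun c _ => by
    induction c using Quotient.inductionOn with | _ x =>
    have : (Finset.univ.filter fun y : X => (⟦y⟧ : V) = ⟦x⟧) = {x, τ x} := by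
      ext y
      simp only [Finset.mem_filter, Finset.mem_univ, true_and, Finset.mem_insert,
        Finset.mem_singleton, ← hs]
      exact ⟨fun h => (Quotient.exact h).symm, fun h => Quotient.sound h.symm⟩
    rw [this, Finset.card_pair (hne x).symm]
  have h := Finset.card_eq_sum_card_fiberwise (s := Finset.univ) (t := Finset.univ)
    (f := fun x : X => (⟦x⟧ : V)) (fun _ _ => Finset.mem_univ _)
  rw [Finset.sum_congr rfl hf, Finset.sum_const, Finset.card_univ, Finset.card_univ] at h
  rw [orbits, Nat.card_eq_fintype_card, Nat.card_eq_fintype_card, h, smul_eq_mul, mul_comm]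

namespace IsShrink

variable {X Y : Type} {σ τ : Equiv.Perm X} {σ' τ' : Equiv.Perm Y} {a : X} {ι : Y → X}
  (H : IsShrink σ τ σ' τ' a ι)

include H

theorem card_eq [Finite X] (hτ : τ a ≠ a) : Nat.card X = Nat.card Y + 2 := by
  classical
  have hY : Finite Y := Finite.of_injective ι H.injective
  have e : Option (Option Y) ≃ X := Equiv.ofBijective
    (fun o => o.elim a fun o => o.elim (τ a) ι) ⟨by
      rintro (_ | _ | y) (_ | _ | z) h
      · rfl
      · exact absurd h.symm hτ
      · exact absurd h.symm (H.ne_left _)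
      · exact absurd h hτ
      · rfl
      · exact absurd h.symm (H.ne_right _)
      · exact absurd h (H.ne_left _)
      · exact absurd h (H.ne_right _)
      · exact congrArg (fun y => some (some y)) (H.injective h),
      H.cases_flag _ ⟨none, rfl⟩ ⟨some none, rfl⟩ fun y => ⟨some (some y), rfl⟩⟩
  rw [← Nat.card_congr e, Finite.card_option, Finite.card_option]

theorem φ_of_left {y : Y} (h : σ (τ (ι y)) = a) : ι (σ' (τ' y)) = σ (τ a) :=
  H.σ_of_left _ (by rw [H.τ_eq, h])

theorem φ_of_right {y : Y} (h : σ (τ (ι y)) = τ a) : ι (σ' (τ' y)) = σ a :=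
  H.σ_of_right _ (by rw [H.τ_eq, h])

theorem φ_of_ne {y : Y} (h : σ (τ (ι y)) ≠ a) (h' : σ (τ (ι y)) ≠ τ a) :
    ι (σ' (τ' y)) = σ (τ (ι y)) := by
  rw [← H.τ_eq] at *
  exact H.σ_of_ne _ h h'

variable (hτ : ∀ x, τ (τ x) = x)

include hτ

/-- The walks along the boundary change only in that the corners `a` and `τ a` are passed over: a
walk about to enter one of them goes on to the corner after it. -/
theorem sameCycle_φ_iff (hσ : ∀ x, σ x ≠ x) (hne : τ a ≠ a) (y z : Y) :
    (σ' * τ').SameCycle y z ↔ (σ * τ).SameCycle (ι y) (ι z) := by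
  obtain ⟨⟨y₁, h₁⟩, ⟨y₂, h₂⟩⟩ := H.exists_next hσ
  have hs : ∀ x, (⟦(σ * τ) x⟧ : Quotient (SameCycle.setoid (σ * τ))) = ⟦x⟧ := fun x =>
    Quotient.sound (SameCycle.symm ⟨1, rfl⟩)
  have hs' : ∀ x, (⟦(σ' * τ') x⟧ : Quotient (SameCycle.setoid (σ' * τ'))) = ⟦x⟧ := fun x =>
    Quotient.sound (SameCycle.symm ⟨1, rfl⟩)
  constructor
  · intro h
    refine Quotient.exact (eq_of_sameCycle
      (fun y => (⟦ι y⟧ : Quotient (SameCycle.setoid (σ * τ)))) (fun y => ?_) h)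
    change ⟦ι (σ' (τ' y))⟧ = _
    rw [← hs (ι y), Equiv.Perm.mul_apply]
    by_cases c₁ : σ (τ (ι y)) = a
    · rw [H.φ_of_left c₁, c₁, ← hs a]
      rfl
    · by_cases c₂ : σ (τ (ι y)) = τ a
      · rw [H.φ_of_right c₂, c₂, ← hs (τ a), Equiv.Perm.mul_apply, hτ]
      · rw [H.φ_of_ne c₁ c₂]
  · intro h
    obtain ⟨F, ha, hb, hF⟩ := H.exists_extension hne
      (fun y => (⟦y⟧ : Quotient (SameCycle.setoid (σ' * τ')))) ⟦y₁⟧ ⟦y₂⟧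
    have := eq_of_sameCycle F (H.cases_flag _ ?_ ?_ fun y => ?_) h
    · rw [hF, hF] at this
      exact Quotient.exact this
    · rw [Equiv.Perm.mul_apply, ← h₁, hF, ha]
    · rw [Equiv.Perm.mul_apply, hτ, ← h₂, hF, hb]
    · rw [Equiv.Perm.mul_apply, hF, ← hs' y]
      by_cases c₁ : σ (τ (ι y)) = a
      · rw [c₁, ha, H.injective ((H.φ_of_left c₁).trans h₁.symm).symm]
        rfl
      · by_cases c₂ : σ (τ (ι y)) = τ a
        · rw [c₂, hb, H.injective ((H.φ_of_right c₂).trans h₂.symm).symm]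
          rfl
        · rw [← H.φ_of_ne c₁ c₂, hF]
          rfl

end IsShrink

/-- The data of a shrinking, in terms of the permutations of the corners. -/
theorem IsShrink.of_φ {X Y : Type} {φ τ : Equiv.Perm X} {φ' τ' : Equiv.Perm Y} {a : X} {ι : Y → X}
    (hτ : ∀ x, τ (τ x) = x) (hl : ¬ (φ * τ).SameCycle a (τ a))
    (hι : Function.Injective ι) (hr : ∀ x, x ∈ Set.range ι ↔ x ≠ a ∧ x ≠ τ a)
    (hτι : ∀ y, ι (τ' y) = τ (ι y)) (h₁ : ∀ y, φ (ι y) = a → ι (φ' y) = φ a)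
    (h₂ : ∀ y, φ (ι y) = τ a → ι (φ' y) = φ (τ a))
    (h₃ : ∀ y, φ (ι y) ≠ a → φ (ι y) ≠ τ a → ι (φ' y) = φ (ι y)) :
    IsShrink (φ * τ) τ (φ' * τ') τ' a ι where
  not_loop := hl
  injective := hι
  mem_range := hr
  τ_eq := hτι
  σ_of_left y h := by
    rw [Equiv.Perm.mul_apply, ← hτι] at h
    rw [Equiv.Perm.mul_apply, Equiv.Perm.mul_apply, hτ]
    exact h₁ _ h
  σ_of_right y h := by
    rw [Equiv.Perm.mul_apply, ← hτι] at h
    rw [Equiv.Perm.mul_apply, Equiv.Perm.mul_apply]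
    exact h₂ _ h
  σ_of_ne y h h' := by
    rw [Equiv.Perm.mul_apply, ← hτι] at h h'
    rw [Equiv.Perm.mul_apply, Equiv.Perm.mul_apply, ← hτι]
    exact h₃ _ h h'

/-- The result of shrinking an edge is determined up to isomorphism by the corners created. -/
theorem IsShrink.exists_equiv {X₁ X₂ Y : Type} {σ₁ τ₁ : Equiv.Perm X₁} {σ₂ τ₂ : Equiv.Perm X₂}
    {σ' τ' : Equiv.Perm Y} {a₁ : X₁} {a₂ : X₂} {ι₁ : Y → X₁} {ι₂ : Y → X₂}
    (H₁ : IsShrink σ₁ τ₁ σ' τ' a₁ ι₁) (H₂ : IsShrink σ₂ τ₂ σ' τ' a₂ ι₂)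
    (hτ₁ : ∀ x, τ₁ (τ₁ x) = x) (hτ₂ : ∀ x, τ₂ (τ₂ x) = x) (hne₁ : τ₁ a₁ ≠ a₁) (hne₂ : τ₂ a₂ ≠ a₂)
    {y₁ y₂ : Y} (h₁ : ι₁ y₁ = σ₁ (τ₁ a₁)) (h₁' : ι₁ y₂ = σ₁ a₁) (h₂ : ι₂ y₁ = σ₂ (τ₂ a₂))
    (h₂' : ι₂ y₂ = σ₂ a₂) :
    ∃ e : X₁ ≃ X₂, (∀ x, e (σ₁ x) = σ₂ (e x)) ∧ (∀ x, e (τ₁ x) = τ₂ (e x)) ∧ e a₁ = a₂ ∧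
      ∀ y, e (ι₁ y) = ι₂ y := by
  obtain ⟨f, fa, fb, fι⟩ := H₁.exists_extension hne₁ ι₂ a₂ (τ₂ a₂)
  obtain ⟨g, ga, gb, gι⟩ := H₂.exists_extension hne₂ ι₁ a₁ (τ₁ a₁)
  let e : X₁ ≃ X₂ := ⟨f, g, H₁.cases_flag _ (by rw [fa, ga]) (by rw [fb, gb])
    fun y => by rw [fι, gι], H₂.cases_flag _ (by rw [ga, fa]) (by rw [gb, fb])
    fun y => by rw [gι, fι]⟩
  -- Where the ends of the edge sit in the cyclic order is visible in the smaller graph: the flag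
  -- before `a` is the one before `y₁`, and the flag before `τ a` is the one before `y₂`.
  have left : ∀ {X : Type} {σ τ : Equiv.Perm X} {a : X} {ι : Y → X} (_ : IsShrink σ τ σ' τ' a ι)
      (_ : ι y₁ = σ (τ a)) (y : Y), σ (ι y) = a ↔ σ' y = y₁ := fun {X σ τ a ι} H h y => by
    refine ⟨H.next_left h, fun hy => ?_⟩
    by_contra c₁
    by_cases c₂ : σ (ι y) = τ a
    · have := H.σ_of_right y c₂
      rw [hy, h] at this
      exact H.not_loop (by rw [σ.injective this])
    · have := H.σ_of_ne y c₁ c₂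
      rw [hy, h] at this
      exact H.ne_right _ (σ.injective this).symm
  have right : ∀ {X : Type} {σ τ : Equiv.Perm X} {a : X} {ι : Y → X} (_ : IsShrink σ τ σ' τ' a ι)
      (_ : ι y₂ = σ a) (y : Y), σ (ι y) = τ a ↔ σ' y = y₂ := fun {X σ τ a ι} H h y => by
    refine ⟨H.next_right h, fun hy => ?_⟩
    by_contra c₁
    by_cases c₂ : σ (ι y) = a
    · have := H.σ_of_left y c₂
      rw [hy, h] at this
      exact H.not_loop (by rw [← σ.injective this])
    · have := H.σ_of_ne y c₂ c₁
      rw [hy, h] at this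
      exact H.ne_left _ (σ.injective this).symm
  refine ⟨e, H₁.cases_flag _ ?_ ?_ fun y => ?_, H₁.cases_flag _ ?_ ?_ fun y => ?_, fa, fι⟩
  · change f (σ₁ a₁) = σ₂ (f a₁)
    rw [← h₁', fι, h₂', fa]
  · change f (σ₁ (τ₁ a₁)) = σ₂ (f (τ₁ a₁))
    rw [← h₁, fι, h₂, fb]
  · change f (σ₁ (ι₁ y)) = σ₂ (f (ι₁ y))
    rw [fι]
    by_cases c₁ : σ' y = y₁
    · rw [(left H₁ h₁ y).2 c₁, (left H₂ h₂ y).2 c₁, fa]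
    · by_cases c₂ : σ' y = y₂
      · rw [(right H₁ h₁' y).2 c₂, (right H₂ h₂' y).2 c₂, fb]
      · rw [← H₁.σ_of_ne y ((left H₁ h₁ y).not.2 c₁) ((right H₁ h₁' y).not.2 c₂), fι,
          H₂.σ_of_ne y ((left H₂ h₂ y).not.2 c₁) ((right H₂ h₂' y).not.2 c₂)]
  · exact fb.trans (congrArg τ₂ fa).symm
  · change f (τ₁ (τ₁ a₁)) = τ₂ (f (τ₁ a₁))
    rw [hτ₁, fa, fb, hτ₂]
  · change f (τ₁ (ι₁ y)) = τ₂ (f (ι₁ y))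
    rw [← H₁.τ_eq, fι, fι, H₂.τ_eq]

/-- The quotient graph obtained by shrinking an edge which is not a loop. -/
theorem exists_isShrink {X : Type} {σ τ : Equiv.Perm X} (hτ : ∀ x, τ (τ x) = x)
    (hτn : ∀ x, τ x ≠ x) (hσ : ∀ x, σ x ≠ x) {a : X} (ha : ¬ σ.SameCycle a (τ a)) :
    ∃ σ' τ' : Equiv.Perm {x // x ≠ a ∧ x ≠ τ a}, IsShrink σ τ σ' τ' a Subtype.val := by
  classical
  have n₁ : σ a ≠ τ a := fun e => ha ⟨1, by simpa using e⟩
  have n₂ : σ (τ a) ≠ a := fun e => ha (SameCycle.symm ⟨1, by simpa using e⟩)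
  have n₃ : σ a ≠ σ (τ a) := fun e => hτn a (σ.injective e).symm
  -- `κ` exchanges `a` and `τ a`, so it restricts to the other flags, where the two transpositions
  -- redirect exactly the steps of `σ` which would enter the edge.
  let κ : Equiv.Perm X := Equiv.swap a (σ (τ a)) * (Equiv.swap (τ a) (σ a) * σ)
  have κa : κ a = τ a := by
    simp only [κ, Equiv.Perm.mul_apply]
    rw [Equiv.swap_apply_right, Equiv.swap_apply_of_ne_of_ne (hτn a) (hσ _).symm]
  have κb : κ (τ a) = a := by
    simp only [κ, Equiv.Perm.mul_apply]
    rw [Equiv.swap_apply_of_ne_of_ne (hσ _) n₃.symm, Equiv.swap_apply_right]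
  have hκ : ∀ x, (κ x ≠ a ∧ κ x ≠ τ a) ↔ (x ≠ a ∧ x ≠ τ a) := fun x => by
    exact (and_congr (κ.injective.ne_iff' κb) (κ.injective.ne_iff' κa)).trans and_comm
  have hτ' : ∀ x, (τ x ≠ a ∧ τ x ≠ τ a) ↔ (x ≠ a ∧ x ≠ τ a) := fun x => by
    exact (and_congr (τ.injective.ne_iff' (hτ a)) τ.injective.ne_iff).trans and_comm
  refine ⟨κ.subtypePerm hκ, τ.subtypePerm hτ', ha, Subtype.val_injective, fun x =>
    ⟨fun ⟨y, e⟩ => e ▸ y.2, fun h => ⟨⟨x, h⟩, rfl⟩⟩, fun y => rfl,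
    fun y h => ?_, fun y h => ?_, fun y h h' => ?_⟩
  · change κ y.1 = _
    simp only [κ, Equiv.Perm.mul_apply]
    rw [h, Equiv.swap_apply_of_ne_of_ne (hτn a).symm (hσ a).symm, Equiv.swap_apply_left]
  · change κ y.1 = _
    simp only [κ, Equiv.Perm.mul_apply]
    rw [h, Equiv.swap_apply_left, Equiv.swap_apply_of_ne_of_ne (hσ a) n₃]
  · change κ y.1 = _
    simp only [κ, Equiv.Perm.mul_apply]
    rw [Equiv.swap_apply_of_ne_of_ne h' fun e => y.2.1 (σ.injective e),
      Equiv.swap_apply_of_ne_of_ne h fun e => y.2.2 (σ.injective e)]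

/-- Shrinking an edge which is not a loop yields a fat graph. -/
theorem IsShrink.isFat {g n : ℕ} {X Y : Type} [Finite X] {σ τ : Equiv.Perm X} {σ' τ' : Equiv.Perm Y}
    {a : X} {ι : Y → X} {mark : X → Fin n} (H : IsShrink σ τ σ' τ' a ι) (h : IsFat g σ τ mark) :
    IsFat g σ' τ' (fun y => mark (ι y)) := by
  have hY : Finite Y := Finite.of_injective ι H.injective
  obtain ⟨⟨y₁, h₁⟩, ⟨y₂, h₂⟩⟩ := H.exists_next h.σ_ne
  have hτ' : ∀ y, τ' (τ' y) = y := fun y => H.injective (by rw [H.τ_eq, H.τ_eq, h.τ_τ])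
  have hτn : ∀ y, τ' y ≠ y := fun y e => h.τ_ne (ι y) (by rw [← H.τ_eq, e])
  have e₁ : 2 * orbits τ = 2 * orbits τ' + 2 := by
    rw [two_mul_orbits h.τ_τ h.τ_ne, two_mul_orbits hτ' hτn, H.card_eq (h.τ_ne a)]
  have e₂ := H.orbits_eq h.σ_ne (h.τ_ne a)
  have hm : ∀ x, mark (σ (τ x)) = mark x := fun x =>
    ((h.mark_eq_iff _ _).2 ⟨1, rfl⟩).symm
  refine ⟨⟨y₁⟩, hτ', hτn, fun y e => ?_, fun P hσ hτ x y hx => ?_, fun i => ?_, fun y z => ?_, ?_⟩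
  -- A univalent vertex could only arise if `y` stood alone between one end of the edge and the
  -- other in a cycle of `σ`; the edge would then be a loop.
  · have : ι (σ' y) = ι y := by rw [e]
    by_cases c₁ : σ (ι y) = a
    · rw [H.σ_of_left y c₁] at this
      exact H.not_loop (SameCycle.symm ⟨2, by rw [zpow_ofNat, pow_two, Equiv.Perm.mul_apply, this, c₁]⟩)
    · by_cases c₂ : σ (ι y) = τ a
      · rw [H.σ_of_right y c₂] at this
        exact H.not_loop ⟨2, by rw [zpow_ofNat, pow_two, Equiv.Perm.mul_apply, this, c₂]⟩
      · exact h.σ_ne _ ((H.σ_of_ne y c₁ c₂).symm.trans this)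
  · obtain ⟨F, hF, hFι, hab⟩ := H.exists_vertex_map h.σ_ne (h.τ_ne a)
    let Q : Quotient (SameCycle.setoid σ') → Prop := Quotient.lift P fun x y e =>
      eq_of_sameCycle P (fun x => propext (hσ x)) e
    have := h.connected (fun x => Q (F x)) (fun x => by rw [hF]) (H.cases_flag _ (by rw [hab])
      (by rw [h.τ_τ, hab]) fun y => by
        rw [← H.τ_eq, hFι, hFι]
        exact hτ y) (ι x) (ι y)
    rw [hFι, hFι] at this
    exact this hx
  · obtain ⟨x, rfl⟩ := h.mark_surjective i
    refine H.cases_flag (fun x => ∃ y, mark (ι y) = mark x) ⟨y₁, ?_⟩ ⟨y₂, ?_⟩ (fun y => ⟨y, rfl⟩) x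
    · rw [h₁, hm]
    · rw [h₂, ← hm (τ a), h.τ_τ]
  · rw [h.mark_eq_iff, H.sameCycle_φ_iff h.τ_τ h.σ_ne (h.τ_ne a)]
  -- The numbers of vertices and of edges both drop by one.
  · have := h.euler
    omega

end Fat

/-! ### Morphisms given on arbitrary sets of flags -/

section Realize

/-- The set `X` with its permutations is identified with the flags of `Γ`. -/
structure Realizes {g n : ℕ} (Γ : FatGraph g n) {X : Type} (σ τ : Equiv.Perm X) (mark : X → Fin n)
    (e : X ≃ Γ.Flag) : Prop where
  σ_eq : ∀ x, Γ.σ (e x) = e (σ x)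
  τ_eq : ∀ x, Γ.τ (e x) = e (τ x)
  mark_eq : ∀ x, Γ.mark (e x) = mark x

theorem FatGraph.of_realizes {g n : ℕ} {X : Type} [Finite X] {σ τ : Equiv.Perm X} {mark : X → Fin n}
    (h : IsFat g σ τ mark) : Realizes (of h) σ τ mark (ofFlag h) :=
  ⟨of_σ h, of_τ h, of_mark h⟩

theorem FatGraph.realizes {g n : ℕ} (Γ : FatGraph g n) :
    Realizes Γ Γ.σ Γ.τ Γ.mark (Equiv.refl _) :=
  ⟨fun _ => rfl, fun _ => rfl, fun _ => rfl⟩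

/-- The edge paths between two fat graphs, given on sets identified with their flags. -/
def transportPath {X X' Y Y' : Type} (e : X ≃ X') (e' : Y ≃ Y') (p : X → List Y) (x : X') : List Y' :=
  (p (e.symm x)).map e'

theorem transportPath_comp {X X' Y Y' Z Z' : Type} (e : X ≃ X') (e' : Y ≃ Y') (e'' : Z ≃ Z')
    (p : X → List Y) (q : Y → List Z) :
    transportPath e e'' (fun x => (p x).flatMap q) =
      fun x => (transportPath e e' p x).flatMap (transportPath e' e'' q) := by
  funext x
  simp [transportPath, List.map_flatMap, List.flatMap_map]

variable {g n : ℕ} {Γ Γ' : FatGraph g n} {X Y : Type} {σ τ : Equiv.Perm X} {σ' τ' : Equiv.Perm Y}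
  {mark : X → Fin n} {mark' : Y → Fin n} {e : X ≃ Γ.Flag} {e' : Y ≃ Γ'.Flag}

theorem Realizes.sameCycle (h : Realizes Γ σ τ mark e) {x y : X} :
    Γ.σ.SameCycle (e x) (e y) ↔ σ.SameCycle x y :=
  sameCycle_equiv e fun x => (h.σ_eq x).symm

/-- An isomorphism is a morphism. -/
theorem exists_isMor_of_equiv (h : Realizes Γ σ τ mark e) (h' : Realizes Γ' σ' τ' mark' e')
    (f : X ≃ Y) (hσ : ∀ x, f (σ x) = σ' (f x)) (hτ : ∀ x, f (τ x) = τ' (f x))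
    (hm : ∀ x, mark' (f x) = mark x) (p : X → List Y) (hp : ∀ x, p x = [f x]) :
    ∃ fiber, FatGraph.IsMor Γ Γ' (transportPath e e' p) fiber := by
  let E : Γ.Flag ≃ Γ'.Flag := e.symm.trans (f.trans e')
  have hE : ∀ x, E (e x) = e' (f x) := fun x => by simp [E]
  refine ⟨fun y => [E.symm y], .iso E ⟨fun x => ?_, fun x => ?_, fun x => ?_, fun _ => rfl⟩ ?_⟩
  · obtain ⟨x, rfl⟩ := e.surjective x
    rw [hE, h'.σ_eq, h.σ_eq, hE, hσ]
  · obtain ⟨x, rfl⟩ := e.surjective x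
    rw [hE, h'.τ_eq, h.τ_eq, hE, hτ]
  · obtain ⟨x, rfl⟩ := e.surjective x
    simp [transportPath, hp, hE]
  · intro y x hx
    rw [List.mem_singleton] at hx
    obtain ⟨y, rfl⟩ := E.surjective y
    rw [Equiv.symm_apply_apply] at hx
    subst hx
    obtain ⟨x, rfl⟩ := e.surjective x
    rw [hE, h'.mark_eq, h.mark_eq, hm]

/-- A shrinking is a morphism. -/
theorem exists_isMor_of_isShrink (h : Realizes Γ σ τ mark e) (h' : Realizes Γ' σ' τ' mark' e')
    {a : X} {ι : Y → X} (H : IsShrink σ τ σ' τ' a ι) (hm : ∀ y, mark (ι y) = mark' y)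
    (p : X → List Y) (ha : p a = []) (hb : p (τ a) = []) (hp : ∀ y, p (ι y) = [y]) :
    ∃ fiber, FatGraph.IsMor Γ Γ' (transportPath e e' p) fiber := by
  classical
  let j : Γ'.Flag → Γ.Flag := fun y => e (ι (e'.symm y))
  have hj : ∀ y, j (e' y) = e (ι y) := fun y => by simp [j]
  refine ⟨fun y => if j y = Γ.σ (Γ.τ (e a)) then [e a, j y]
    else if j y = Γ.σ (e a) then [Γ.τ (e a), j y] else [j y],
    .shrink (e a) j ⟨?_, ?_, fun x => ?_, fun y => ?_, fun y => ?_, ?_, ?_, fun y => ?_,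
      fun y => rfl⟩ fun y x hx => ?_⟩
  · rw [h.τ_eq, h.sameCycle]
    exact H.not_loop
  · exact e.injective.comp (H.injective.comp e'.symm.injective)
  · obtain ⟨x, rfl⟩ := e.surjective x
    rw [h.τ_eq, e.injective.ne_iff, e.injective.ne_iff, ← H.mem_range]
    constructor
    · rintro ⟨y, hy⟩
      exact ⟨_, e.injective hy⟩
    · rintro ⟨y, rfl⟩
      exact ⟨e' y, hj y⟩
  · obtain ⟨y, rfl⟩ := e'.surjective y
    rw [h'.τ_eq, hj, hj, h.τ_eq, H.τ_eq]
  · obtain ⟨y, rfl⟩ := e'.surjective y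
    rw [h'.σ_eq, hj, hj]
    simp only [h.τ_eq, h.σ_eq, e.apply_eq_iff_eq]
    split_ifs with c₁ c₂
    · rw [H.σ_of_left y c₁]
    · rw [H.σ_of_right y c₂]
    · rw [H.σ_of_ne y c₁ c₂]
  · simp [transportPath, ha]
  · simp [transportPath, h.τ_eq, hb]
  · obtain ⟨y, rfl⟩ := e'.surjective y
    simp [transportPath, hj, hp]
  · obtain ⟨y, rfl⟩ := e'.surjective y
    have hy : Γ.mark (j (e' y)) = Γ'.mark (e' y) := by rw [hj, h.mark_eq, h'.mark_eq, hm]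
    split_ifs at hx with c₁ c₂
    · rw [List.mem_pair] at hx
      rcases hx with rfl | rfl
      · rw [← hy, c₁]
        exact (Γ.mark_φ _).symm
      · exact hy
    · rw [List.mem_pair] at hx
      rcases hx with rfl | rfl
      · rw [← hy, c₂, ← Γ.mark_φ, FatGraph.φ_apply, Γ.τ_τ]
      · exact hy
    · rw [List.mem_singleton.1 hx]
      exact hy

/-- `(σ', τ')` is obtained from `(σ, τ)` by inserting a two-valent vertex on the edge of `a`. -/
structure IsInsert {X Y : Type} (σ τ : Equiv.Perm X) (σ' τ' : Equiv.Perm Y) (a : X) (u v : Y)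
    (ι : X → Y) : Prop where
  injective : Function.Injective ι
  mem_range : ∀ y, y ∈ Set.range ι ↔ y ≠ u ∧ y ≠ v
  σ_eq : ∀ x, σ' (ι x) = ι (σ x)
  σ_left : σ' u = v
  σ_right : σ' v = u
  τ_left : τ' (ι a) = u
  τ_right : τ' (ι (τ a)) = v
  τ_eq : ∀ x, x ≠ a → x ≠ τ a → τ' (ι x) = ι (τ x)

/-- An insertion is a morphism. -/
theorem exists_isMor_of_isInsert (h : Realizes Γ σ τ mark e) (h' : Realizes Γ' σ' τ' mark' e')
    {a : X} {u v : Y} {ι : X → Y} (H : IsInsert σ τ σ' τ' a u v ι) (hm : ∀ x, mark' (ι x) = mark x)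
    (p : X → List Y) (ha : p a = [ι a, v]) (hb : p (τ a) = [ι (τ a), u])
    (hp : ∀ x, x ≠ a → x ≠ τ a → p x = [ι x]) :
    ∃ fiber, FatGraph.IsMor Γ Γ' (transportPath e e' p) fiber := by
  classical
  let j : Γ.Flag → Γ'.Flag := fun x => e' (ι (e.symm x))
  have hj : ∀ x, j (e x) = e' (ι x) := fun x => by simp [j]
  have hji : Function.Injective j := e'.injective.comp (H.injective.comp e.symm.injective)
  have hr : ∀ y, y ∈ Set.range j ↔ y ≠ e' u ∧ y ≠ e' v := fun y => by
    obtain ⟨y, rfl⟩ := e'.surjective y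
    rw [e'.injective.ne_iff, e'.injective.ne_iff, ← H.mem_range]
    constructor
    · rintro ⟨x, hx⟩
      exact ⟨_, e'.injective hx⟩
    · rintro ⟨x, rfl⟩
      exact ⟨e x, hj x⟩
  have hfib : ∀ x, (if h : ∃ z, j z = j x then [h.choose] else []) = [x] := fun x => by
    have hx : ∃ z, j z = j x := ⟨x, rfl⟩
    rw [dif_pos hx, hji hx.choose_spec]
  refine ⟨fun y => if h : ∃ x, j x = y then [h.choose] else [],
    .insert (e a) (e' u) (e' v) j ⟨hji, hr, fun x => ?_, ?_, ?_, ?_, ?_, fun x h₁ h₂ => ?_, ?_, ?_,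
      fun x h₁ h₂ => ?_, hfib, ?_, ?_⟩ fun y x hx => ?_⟩
  · obtain ⟨x, rfl⟩ := e.surjective x
    rw [hj, h.σ_eq, hj, h'.σ_eq, H.σ_eq]
  · rw [h'.σ_eq, H.σ_left]
  · rw [h'.σ_eq, H.σ_right]
  · rw [hj, h'.τ_eq, H.τ_left]
  · rw [h.τ_eq, hj, h'.τ_eq, H.τ_right]
  · obtain ⟨x, rfl⟩ := e.surjective x
    rw [h.τ_eq, e.injective.ne_iff] at h₂
    rw [e.injective.ne_iff] at h₁
    rw [hj, h'.τ_eq, H.τ_eq x h₁ h₂, h.τ_eq, hj]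
  · simp [transportPath, ha, hj]
  · simp [transportPath, hb, hj, h.τ_eq]
  · obtain ⟨x, rfl⟩ := e.surjective x
    rw [h.τ_eq, e.injective.ne_iff] at h₂
    rw [e.injective.ne_iff] at h₁
    simp [transportPath, hj, hp x h₁ h₂]
  · exact dif_neg fun ⟨x, hx⟩ => ((hr _).1 ⟨x, hx⟩).1 rfl
  · exact dif_neg fun ⟨x, hx⟩ => ((hr _).1 ⟨x, hx⟩).2 rfl
  · split_ifs at hx with hy
    · obtain ⟨z, rfl⟩ := hy
      have := hfib z
      rw [dif_pos ⟨z, rfl⟩] at this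
      rw [this, List.mem_singleton] at hx
      subst hx
      obtain ⟨x, rfl⟩ := e.surjective x
      rw [hj, h.mark_eq, h'.mark_eq, hm]
    · simp at hx

end Realize

/-! ### The fat graphs of the combinatorial model -/

namespace Theta

theorem index_cases (i j : Fin 3) : j = i ∨ j = i + 1 ∨ j = i - 1 := by
  revert i j
  decide

theorem add_add (i : Fin 3) : i + 1 + 1 = i - 1 := by
  revert i
  decide

theorem sub_sub (i : Fin 3) : i - 1 - 1 = i + 1 := by
  revert i
  decide

theorem add_ne (i : Fin 3) : i + 1 ≠ i := by
  revert i
  decide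

theorem sub_ne (i : Fin 3) : i - 1 ≠ i := by
  revert i
  decide

theorem add_ne_sub (i : Fin 3) : i + 1 ≠ i - 1 := by
  revert i
  decide

theorem bd_add_one (a : Theta) (i : Fin 3) : a.bd (i + 1) = a.len (i + 1) + a.len i := by
  rw [bd, add_sub_cancel_right]

theorem bd_sub_one (a : Theta) (i : Fin 3) : a.bd (i - 1) = a.len (i - 1) + a.len (i + 1) := by
  rw [bd, sub_sub]

/-- The corners: a boundary component and a position on it. -/
@[ext]
structure Corner (a : Theta) where
  /-- the boundary component -/
  idx : Fin 3
  /-- the position on it -/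
  pos : ℕ
  lt : pos < a.bd idx

/-- The corner at the position `p` of the `i`-th boundary component, the end of which is identified
with its beginning. -/
def corner (a : Theta) (i : Fin 3) (p : ℕ) : a.Corner where
  idx := i
  pos := if p < a.bd i then p else 0
  lt := by
    have := a.bd_pos i
    split_ifs <;> assumption

theorem corner_of_lt {a : Theta} {i : Fin 3} {p : ℕ} (h : p < a.bd i) : a.corner i p = ⟨i, p, h⟩ :=
  Corner.ext rfl (if_pos h)

theorem corner_eq (a : Theta) (x : a.Corner) : a.corner x.idx x.pos = x :=
  corner_of_lt x.lt

theorem bd_le (a : Theta) (i : Fin 3) : a.bd i ≤ a.bd 0 + a.bd 1 + a.bd 2 := by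
  fin_cases i <;> simp <;> omega

instance (a : Theta) : Finite a.Corner :=
  Finite.of_injective (β := Fin 3 × Fin (a.bd 0 + a.bd 1 + a.bd 2))
    (fun x => (x.idx, ⟨x.pos, x.lt.trans_le (a.bd_le _)⟩)) fun x y h => by
      simp only [Prod.mk.injEq, Fin.mk.injEq] at h
      exact Corner.ext h.1 h.2

/-- The next corner along the boundary. -/
def next (a : Theta) : Equiv.Perm a.Corner where
  toFun x := ⟨x.idx, if x.pos + 1 = a.bd x.idx then 0 else x.pos + 1, by
    have := x.lt
    split_ifs <;> omega⟩
  invFun x := ⟨x.idx, if x.pos = 0 then a.bd x.idx - 1 else x.pos - 1, by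
    have := x.lt
    split_ifs <;> omega⟩
  left_inv x := Corner.ext rfl (by
    have := x.lt
    by_cases c : x.pos + 1 = a.bd x.idx
    · simp only [c, if_true]
      omega
    · simp [c])
  right_inv x := Corner.ext rfl (by
    have := x.lt
    by_cases c : x.pos = 0
    · simp only [c, if_true]
      rw [if_pos (by omega)]
    · simp only [c, if_false]
      rw [if_neg (by omega)]
      omega)

theorem next_idx (a : Theta) (x : a.Corner) : (a.next x).idx = x.idx := rfl

theorem next_pos (a : Theta) (x : a.Corner) :
    (a.next x).pos = if x.pos + 1 = a.bd x.idx then 0 else x.pos + 1 := rfl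

/-- The flag opposite to the flag with a given boundary component and position. -/
def flipAux (a : Theta) (i : Fin 3) (p : ℕ) : Fin 3 × ℕ :=
  if p < a.len i then (i + 1, a.bd (i + 1) - 1 - p) else (i - 1, a.bd i - 1 - p)

theorem flipAux_of_lt {a : Theta} {i : Fin 3} {p : ℕ} (h : p < a.len i) :
    a.flipAux i p = (i + 1, a.bd (i + 1) - 1 - p) := if_pos h

theorem flipAux_of_ge {a : Theta} {i : Fin 3} {p : ℕ} (h : a.len i ≤ p) :
    a.flipAux i p = (i - 1, a.bd i - 1 - p) := if_neg (not_lt.2 h)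

theorem flipAux_lt {a : Theta} {i : Fin 3} {p : ℕ} (h : p < a.bd i) :
    (a.flipAux i p).2 < a.bd (a.flipAux i p).1 := by
  rcases lt_or_ge p (a.len i) with h' | h'
  · rw [flipAux_of_lt h']
    have := a.bd_pos (i + 1)
    dsimp only
    omega
  · rw [flipAux_of_ge h']
    have h₁ := a.bd_sub_one i
    unfold bd at *
    dsimp only
    omega

theorem flipAux_flipAux {a : Theta} {i : Fin 3} {p : ℕ} (h : p < a.bd i) :
    a.flipAux (a.flipAux i p).1 (a.flipAux i p).2 = (i, p) := by
  rcases lt_or_ge p (a.len i) with h' | h'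
  · have h₁ := a.bd_add_one i
    rw [flipAux_of_lt h', flipAux_of_ge (show a.len (i + 1) ≤ a.bd (i + 1) - 1 - p by omega),
      add_sub_cancel_right]
    exact Prod.ext rfl (show a.bd (i + 1) - 1 - (a.bd (i + 1) - 1 - p) = p by omega)
  · have h₁ : a.bd i = a.len i + a.len (i - 1) := rfl
    rw [flipAux_of_ge h', flipAux_of_lt (show a.bd i - 1 - p < a.len (i - 1) by omega),
      sub_add_cancel]
    exact Prod.ext rfl (show a.bd i - 1 - (a.bd i - 1 - p) = p by omega)

/-- The opposite flag of the same edge. -/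
def flip (a : Theta) : Equiv.Perm a.Corner :=
  Function.Involutive.toPerm (fun x => ⟨_, _, flipAux_lt x.lt⟩) fun x => by
    have h := flipAux_flipAux x.lt
    exact Corner.ext (congrArg Prod.fst h) (congrArg Prod.snd h)

theorem flip_flip (a : Theta) (x : a.Corner) : a.flip (a.flip x) = x :=
  (a.flip).symm_apply_apply x

theorem flip_idx_of_lt {a : Theta} {x : a.Corner} (h : x.pos < a.len x.idx) :
    (a.flip x).idx = x.idx + 1 := congrArg Prod.fst (flipAux_of_lt h)

theorem flip_pos_of_lt {a : Theta} {x : a.Corner} (h : x.pos < a.len x.idx) :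
    (a.flip x).pos = a.bd (x.idx + 1) - 1 - x.pos := congrArg Prod.snd (flipAux_of_lt h)

theorem flip_idx_of_ge {a : Theta} {x : a.Corner} (h : a.len x.idx ≤ x.pos) :
    (a.flip x).idx = x.idx - 1 := congrArg Prod.fst (flipAux_of_ge h)

theorem flip_pos_of_ge {a : Theta} {x : a.Corner} (h : a.len x.idx ≤ x.pos) :
    (a.flip x).pos = a.bd x.idx - 1 - x.pos := congrArg Prod.snd (flipAux_of_ge h)

/-- The graphs of the model have no bridges: each edge separates two different boundary components.
-/
theorem flip_idx_ne (a : Theta) (x : a.Corner) : (a.flip x).idx ≠ x.idx := by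
  rcases lt_or_ge x.pos (a.len x.idx) with h | h
  · rw [flip_idx_of_lt h]
    exact add_ne _
  · rw [flip_idx_of_ge h]
    exact sub_ne _

theorem flip_ne (a : Theta) (x : a.Corner) : a.flip x ≠ x := fun e =>
  a.flip_idx_ne x (by rw [e])

/-- The vertex at the position `p` of the `i`-th boundary component; the two trivalent vertices
coincide if a chain is empty. -/
def vertexAux (a : Theta) (i : Fin 3) (p : ℕ) : Fin 3 × ℕ :=
  -- `(0, 0)` and `(1, 0)` stand for the two trivalent vertices, and `(i, p)` with `p > 0` stands
  -- for the two-valent vertex at distance `p` from the beginning of the chain `i`.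
  if p = 0 then (0, 0)
  else if p = a.len i then if ∃ i, a.len i = 0 then (0, 0) else (1, 0)
  else if p < a.len i then (i, p)
  else if p = a.bd i then (0, 0) else (i - 1, a.bd i - p)

/-- The vertex at which a corner lies. -/
def vertex (a : Theta) (x : a.Corner) : Fin 3 × ℕ := a.vertexAux x.idx x.pos

theorem vertexAux_bd (a : Theta) (i : Fin 3) : a.vertexAux i (a.bd i) = (0, 0) := by
  have h₁ := a.bd_pos i
  have h₂ : a.bd i = a.len i + a.len (i - 1) := rfl
  unfold vertexAux
  rw [if_neg (by omega)]
  split_ifs with c₁ c₂ c₃ c₄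
  · rfl
  · exact absurd ⟨i - 1, by omega⟩ c₂
  · omega
  · rfl
  · exact absurd rfl c₄

theorem vertex_corner (a : Theta) {i : Fin 3} {p : ℕ} (h : p ≤ a.bd i) :
    a.vertex (a.corner i p) = a.vertexAux i p := by
  rcases h.eq_or_lt with rfl | h
  · rw [vertexAux_bd, vertex, corner]
    dsimp only
    rw [if_neg (lt_irrefl _), vertexAux, if_pos rfl]
  · rw [corner_of_lt h]
    rfl

/-- The component `i + 1` ends with the chain `i` run through backwards, so a point at distance `p`
from the beginning of the chain is at distance `p` from the end of this component. -/
theorem vertexAux_reverse (a : Theta) {i : Fin 3} {p : ℕ} (h : p ≤ a.len i) :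
    a.vertexAux (i + 1) (a.bd (i + 1) - p) = a.vertexAux i p := by
  have h₁ := a.bd_add_one i
  rcases Nat.eq_zero_or_pos p with rfl | h₀
  · rw [Nat.sub_zero, vertexAux_bd, vertexAux, if_pos rfl]
  · unfold vertexAux
    rw [if_neg h₀.ne', add_sub_cancel_right]
    by_cases c : p = a.len i
    · rw [if_pos c]
      by_cases c₂ : a.len (i + 1) = 0
      · rw [if_pos (by omega), if_pos ⟨_, c₂⟩]
      · rw [if_neg (by omega), if_pos (by omega)]
    · rw [if_neg c, if_pos (show p < a.len i by omega), if_neg (by omega), if_neg (by omega),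
        if_neg (by omega), if_neg (by omega), Nat.sub_sub_self (by omega)]

theorem next_eq (a : Theta) (x : a.Corner) : a.next x = a.corner x.idx (x.pos + 1) := by
  have := x.lt
  refine Corner.ext rfl ?_
  rw [next_pos, corner]
  dsimp only
  split_ifs <;> omega

/-- The next corner along the boundary lies at the far end of the edge, as the opposite flag does.
Hence the vertex is invariant under the rotation. -/
theorem vertex_next (a : Theta) (x : a.Corner) : a.vertex (a.next x) = a.vertex (a.flip x) := by
  have hx := x.lt
  have h₁ := a.bd_add_one x.idx
  have h₂ : a.bd x.idx = a.len x.idx + a.len (x.idx - 1) := rfl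
  rw [next_eq, vertex_corner a hx]
  rcases lt_or_ge x.pos (a.len x.idx) with h | h
  · rw [vertex, flip_idx_of_lt h, flip_pos_of_lt h, ← vertexAux_reverse a (Nat.succ_le_of_lt h)]
    congr 1
    omega
  · rw [vertex, flip_idx_of_ge h, flip_pos_of_ge h,
      ← vertexAux_reverse a (show a.bd x.idx - 1 - x.pos ≤ _ by omega), sub_add_cancel]
    congr 1
    omega

/-- Two corners at the same vertex, on neighbouring boundary components, face each other across the
chain between these components. -/
theorem exists_of_vertex_eq (a : Theta) {x y : a.Corner} (hi : y.idx = x.idx + 1)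
    (h : a.vertex x = a.vertex y) : ∃ k ≤ a.len x.idx, x = a.corner x.idx k ∧
      y = a.corner (x.idx + 1) (a.bd (x.idx + 1) - k) := by
  obtain ⟨i, p, hp⟩ := x
  obtain ⟨j, q, hq⟩ := y
  obtain rfl : j = i + 1 := hi
  have h₁ := a.bd_add_one i
  have h₂ : a.bd i = a.len i + a.len (i - 1) := rfl
  have key : ∃ k ≤ a.len i, p = (if k < a.bd i then k else 0) ∧
      q = if a.bd (i + 1) - k < a.bd (i + 1) then a.bd (i + 1) - k else 0 := by
    change a.vertexAux i p = a.vertexAux (i + 1) q at h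
    unfold vertexAux at h
    rw [add_sub_cancel_right] at h
    -- The point of the chain is read off from `y`, unless `y` is at the cut; in that case `x`
    -- decides.
    refine ⟨if q = 0 then p else a.bd (i + 1) - q, ?_⟩
    have hD : (∃ i, a.len i = 0) ↔ a.len i = 0 ∨ a.len (i + 1) = 0 ∨ a.len (i - 1) = 0 :=
      ⟨fun ⟨j, hj⟩ => by rcases index_cases i j with rfl | rfl | rfl <;> simp [hj], by
        rintro (h | h | h) <;> exact ⟨_, h⟩⟩
    simp only [hD] at h
    clear hD
    split_ifs at h <;> simp only [Prod.mk.injEq] at h <;>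
      split_ifs <;> omega
  obtain ⟨k, hk, h₃, h₄⟩ := key
  exact ⟨k, hk, Corner.ext rfl h₃, Corner.ext rfl h₄⟩

/-- An edge of a chain can be a loop only if it is the whole chain and another chain is empty, so
that the two trivalent vertices coincide; `ha` excludes this. -/
theorem vertexAux_ne (a : Theta) {i : Fin 3} {k : ℕ} (hk : k < a.len i)
    (ha : a.len i = 1 → ∀ j, a.len j ≠ 0) : a.vertexAux i k ≠ a.vertexAux i (k + 1) := by
  unfold vertexAux
  have h01 : (0 : Fin 3) ≠ 1 := by decide
  intro h
  rw [if_neg (Nat.succ_ne_zero k)] at h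
  rcases Nat.eq_zero_or_pos k with rfl | h₀
  · rw [if_pos rfl] at h
    split_ifs at h with c₁ c₂ c₃
    · exact ha c₁.symm _ c₂.choose_spec
    · exact h01 (congrArg Prod.fst h)
    · exact absurd (congrArg Prod.snd h) (by simp)
    · omega
    · omega
  · rw [if_neg h₀.ne', if_neg hk.ne, if_pos hk] at h
    have h := congrArg Prod.snd h
    split_ifs at h <;> dsimp only at h <;> omega

/-- Adding an edge to a chain. -/
def add (a : Theta) (i : Fin 3) : Theta :=
  ⟨fun j => a.len j + if j = i then 1 else 0, fun j => by
    have := a.pos j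
    omega⟩

theorem len_add (a : Theta) (i : Fin 3) : (a.add i).len i = a.len i + 1 := by
  simp [add]

theorem len_add_of_ne (a : Theta) {i j : Fin 3} (h : j ≠ i) : (a.add i).len j = a.len j := by
  simp [add, h]

theorem bd_add (a : Theta) (i : Fin 3) : (a.add i).bd i = a.bd i + 1 := by
  rw [bd, len_add, len_add_of_ne a (sub_ne i), bd]
  omega

theorem bd_add_add (a : Theta) (i : Fin 3) : (a.add i).bd (i + 1) = a.bd (i + 1) + 1 := by
  rw [bd_add_one, len_add, len_add_of_ne a (add_ne i), bd_add_one]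
  omega

theorem bd_add_sub (a : Theta) (i : Fin 3) : (a.add i).bd (i - 1) = a.bd (i - 1) := by
  rw [bd_sub_one, len_add_of_ne a (add_ne i), len_add_of_ne a (sub_ne i), bd_sub_one]

/-- The position skipping a given one. -/
def skipPos (k p : ℕ) : ℕ := if p < k then p else p + 1

/-- The corners of a graph as corners of the graph with a longer chain, one corner being skipped on
each side of the chain. -/
def skip (a : Theta) (i : Fin 3) (k l : ℕ) (x : a.Corner) : (a.add i).Corner where
  idx := x.idx
  pos := if x.idx = i then skipPos k x.pos else if x.idx = i + 1 then skipPos l x.pos else x.pos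
  lt := by
    obtain ⟨j, p, hp⟩ := x
    dsimp only
    rcases index_cases i j with rfl | rfl | rfl
    · rw [if_pos rfl, bd_add]
      unfold skipPos
      split_ifs <;> omega
    · rw [if_neg (add_ne i), if_pos rfl, bd_add_add]
      unfold skipPos
      split_ifs <;> omega
    · rw [if_neg (sub_ne i), if_neg (add_ne_sub i).symm, bd_add_sub]
      exact hp

theorem skip_idx (a : Theta) (i : Fin 3) (k l : ℕ) (x : a.Corner) : (a.skip i k l x).idx = x.idx :=
  rfl

theorem skip_pos_self (a : Theta) {i : Fin 3} {k l : ℕ} {x : a.Corner} (h : x.idx = i) :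
    (a.skip i k l x).pos = skipPos k x.pos := if_pos h

theorem skip_pos_add (a : Theta) {i : Fin 3} {k l : ℕ} {x : a.Corner} (h : x.idx = i + 1) :
    (a.skip i k l x).pos = skipPos l x.pos :=
  (if_neg fun e => add_ne i (h.symm.trans e)).trans (if_pos h)

theorem skip_pos_sub (a : Theta) {i : Fin 3} {k l : ℕ} {x : a.Corner} (h : x.idx = i - 1) :
    (a.skip i k l x).pos = x.pos :=
  (if_neg fun e => sub_ne i (h.symm.trans e)).trans
    (if_neg fun e => add_ne_sub i (e.symm.trans h))

theorem skipPos_injective (k : ℕ) : Function.Injective (skipPos k) := fun p q h => by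
  unfold skipPos at h
  split_ifs at h <;> omega

theorem skip_injective (a : Theta) (i : Fin 3) (k l : ℕ) : Function.Injective (a.skip i k l) := by
  intro x y h
  have h₁ : (a.skip i k l x).idx = (a.skip i k l y).idx := congrArg Corner.idx h
  rw [skip_idx, skip_idx] at h₁
  have h₂ := congrArg Corner.pos h
  refine Corner.ext h₁ ?_
  rcases index_cases i x.idx with hi | hi | hi
  · rw [skip_pos_self a hi, skip_pos_self a (h₁.symm.trans hi)] at h₂
    exact skipPos_injective _ h₂
  · rw [skip_pos_add a hi, skip_pos_add a (h₁.symm.trans hi)] at h₂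
    exact skipPos_injective _ h₂
  · rwa [skip_pos_sub a hi, skip_pos_sub a (h₁.symm.trans hi)] at h₂

theorem exists_skipPos {k p n : ℕ} (hp : p < n + 1) (hk : k ≤ n) (h : p ≠ k) :
    ∃ q < n, skipPos k q = p := by
  refine ⟨if p < k then p else p - 1, ?_, ?_⟩
  · split_ifs <;> omega
  · unfold skipPos
    by_cases c : p < k
    · simp [c]
    · simp only [c, if_false]
      split_ifs <;> omega

theorem skipPos_ne (k p : ℕ) : skipPos k p ≠ k := by
  unfold skipPos
  split_ifs <;> omega

theorem mem_range_skip (a : Theta) (i : Fin 3) {k l : ℕ} (hk : k ≤ a.bd i) (hl : l ≤ a.bd (i + 1))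
    (x : (a.add i).Corner) : x ∈ Set.range (a.skip i k l) ↔
      x ≠ (a.add i).corner i k ∧ x ≠ (a.add i).corner (i + 1) l := by
  have e₁ : (a.add i).corner i k = ⟨i, k, by rw [bd_add]; omega⟩ := corner_of_lt _
  have e₂ : (a.add i).corner (i + 1) l = ⟨i + 1, l, by rw [bd_add_add]; omega⟩ := corner_of_lt _
  rw [e₁, e₂]
  constructor
  · rintro ⟨y, rfl⟩
    constructor
    · intro e
      have h₁ : y.idx = i := congrArg Corner.idx e
      have h₂ := congrArg Corner.pos e
      rw [skip_pos_self a h₁] at h₂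
      exact skipPos_ne _ _ h₂
    · intro e
      have h₁ : y.idx = i + 1 := congrArg Corner.idx e
      have h₂ := congrArg Corner.pos e
      rw [skip_pos_add a h₁] at h₂
      exact skipPos_ne _ _ h₂
  · rintro ⟨h₁, h₂⟩
    obtain ⟨j, p, hp⟩ := x
    rcases index_cases i j with rfl | rfl | rfl
    · have hp' := hp
      rw [bd_add] at hp'
      obtain ⟨q, hq, rfl⟩ := exists_skipPos hp' hk fun e => h₁ (Corner.ext rfl e)
      exact ⟨⟨j, q, hq⟩, Corner.ext rfl (skip_pos_self a rfl)⟩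
    · have hp' := hp
      rw [bd_add_add] at hp'
      obtain ⟨q, hq, rfl⟩ := exists_skipPos hp' hl fun e => h₂ (Corner.ext rfl e)
      exact ⟨⟨i + 1, q, hq⟩, Corner.ext rfl (skip_pos_add a rfl)⟩
    · have hp' := hp
      rw [bd_add_sub] at hp'
      exact ⟨⟨i - 1, p, hp'⟩, Corner.ext rfl (skip_pos_sub a rfl)⟩

theorem flip_corner (a : Theta) {i : Fin 3} {k : ℕ} (hk : k < a.len i) :
    a.flip (a.corner i k) = a.corner (i + 1) (a.bd (i + 1) - 1 - k) := by
  have h₁ := a.bd_add_one i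
  have h : a.corner i k = ⟨i, k, hk.trans_le (Nat.le_add_right _ _)⟩ := corner_of_lt _
  have h' : a.corner (i + 1) (a.bd (i + 1) - 1 - k) = ⟨i + 1, a.bd (i + 1) - 1 - k, by omega⟩ :=
    corner_of_lt _
  rw [h, h']
  exact Corner.ext (flip_idx_of_lt hk) (flip_pos_of_lt hk)

theorem flip_lt {a : Theta} {x : a.Corner} {i j : Fin 3} (hi : x.idx = i) (hj : j = i + 1)
    (h : x.pos < a.len i) : (a.flip x).idx = j ∧ (a.flip x).pos = a.bd j - 1 - x.pos := by
  subst hi hj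
  exact ⟨flip_idx_of_lt h, flip_pos_of_lt h⟩

theorem flip_ge {a : Theta} {x : a.Corner} {i j : Fin 3} (hi : x.idx = i) (hj : i = j + 1)
    (h : a.len i ≤ x.pos) : (a.flip x).idx = j ∧ (a.flip x).pos = a.bd i - 1 - x.pos := by
  subst hi
  obtain rfl : j = x.idx - 1 := eq_sub_of_add_eq hj.symm
  exact ⟨flip_idx_of_ge h, flip_pos_of_ge h⟩

/-- The two alternatives serve the two operations. For a shrinking, the skipped corners are the two
flags of one edge. For an insertion, they are the two flags at the new vertex, and the flags of the
subdivided edge have to be excepted. -/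
theorem skip_flip (a : Theta) {i : Fin 3} {k l : ℕ} (hk : k ≤ a.len i) {x : a.Corner}
    (h : l + k = a.bd (i + 1) ∨ (l + k = a.bd (i + 1) + 1 ∧ (x.idx = i → x.pos + 1 ≠ k) ∧
      (x.idx = i + 1 → x.pos + k ≠ a.bd (i + 1)))) :
    a.skip i k l (a.flip x) = (a.add i).flip (a.skip i k l x) := by
  have hlt := x.lt
  have b₁ := a.bd_add_one i
  have b₂ : a.bd i = a.len i + a.len (i - 1) := rfl
  have b₃ := a.bd_sub_one i
  have l₁ := a.len_add i
  have l₂ := a.len_add_of_ne (add_ne i)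
  have l₃ := a.len_add_of_ne (sub_ne i)
  have d₁ := a.bd_add i
  have d₂ := a.bd_add_add i
  have d₃ := a.bd_add_sub i
  rcases index_cases i x.idx with hi | hi | hi
  · rw [hi] at hlt
    simp only [hi, forall_const] at h
    have hs := a.skip_pos_self (k := k) (l := l) hi
    rcases lt_or_ge x.pos (a.len i) with hp | hp
    · obtain ⟨f₁, f₂⟩ := flip_lt hi rfl hp
      obtain ⟨g₁, g₂⟩ := flip_lt (x := a.skip i k l x) hi rfl (by
        rw [hs, l₁]; unfold skipPos; split_ifs <;> omega)
      refine Corner.ext (f₁.trans g₁.symm) ?_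
      rw [g₂, skip_pos_add a f₁, f₂, hs, d₂]
      unfold skipPos
      split_ifs <;> omega
    · obtain ⟨f₁, f₂⟩ := flip_ge hi (sub_add_cancel i 1).symm hp
      obtain ⟨g₁, g₂⟩ := flip_ge (x := a.skip i k l x) hi (sub_add_cancel i 1).symm (by
        rw [hs, l₁]; unfold skipPos; split_ifs <;> omega)
      refine Corner.ext (f₁.trans g₁.symm) ?_
      rw [g₂, skip_pos_sub a f₁, f₂, hs, d₁]
      unfold skipPos
      split_ifs <;> omega
  · rw [hi] at hlt
    simp only [hi, forall_const] at h
    have hs := a.skip_pos_add (k := k) (l := l) hi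
    rcases lt_or_ge x.pos (a.len (i + 1)) with hp | hp
    · obtain ⟨f₁, f₂⟩ := flip_lt hi (add_add i).symm hp
      obtain ⟨g₁, g₂⟩ := flip_lt (x := a.skip i k l x) hi (add_add i).symm (by
        rw [hs, l₂]; unfold skipPos; split_ifs <;> omega)
      refine Corner.ext (f₁.trans g₁.symm) ?_
      rw [g₂, skip_pos_sub a f₁, f₂, hs, d₃]
      unfold skipPos
      split_ifs <;> omega
    · obtain ⟨f₁, f₂⟩ := flip_ge hi rfl hp
      obtain ⟨g₁, g₂⟩ := flip_ge (x := a.skip i k l x) hi rfl (by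
        rw [hs, l₂]; unfold skipPos; split_ifs <;> omega)
      refine Corner.ext (f₁.trans g₁.symm) ?_
      rw [g₂, skip_pos_self a f₁, f₂, hs, d₂]
      unfold skipPos
      split_ifs <;> omega
  · rw [hi] at hlt
    have hs := a.skip_pos_sub (k := k) (l := l) hi
    rcases lt_or_ge x.pos (a.len (i - 1)) with hp | hp
    · obtain ⟨f₁, f₂⟩ := flip_lt hi (sub_add_cancel i 1).symm hp
      obtain ⟨g₁, g₂⟩ := flip_lt (x := a.skip i k l x) hi (sub_add_cancel i 1).symm (by
        rw [hs, l₃]; exact hp)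
      refine Corner.ext (f₁.trans g₁.symm) ?_
      rw [g₂, skip_pos_self a f₁, f₂, hs, d₁]
      unfold skipPos
      split_ifs <;> omega
    · obtain ⟨f₁, f₂⟩ := flip_ge hi (add_add i).symm hp
      obtain ⟨g₁, g₂⟩ := flip_ge (x := a.skip i k l x) hi (add_add i).symm (by
        rw [hs, l₃]; exact hp)
      refine Corner.ext (f₁.trans g₁.symm) ?_
      rw [g₂, skip_pos_add a f₁, f₂, hs, d₃]
      unfold skipPos
      split_ifs <;> omega

theorem corner_idx (a : Theta) (i : Fin 3) (p : ℕ) : (a.corner i p).idx = i := rfl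

theorem corner_pos {a : Theta} {i : Fin 3} {p : ℕ} (h : p < a.bd i) : (a.corner i p).pos = p :=
  if_pos h

/-- Where the walk in the longer graph enters a skipped corner, the walk in the shorter graph
continues behind it. -/
theorem skip_next_left (a : Theta) {i : Fin 3} {k l : ℕ} (hk : k ≤ a.bd i) {x : a.Corner}
    (h : (a.add i).next (a.skip i k l x) = (a.add i).corner i k) :
    a.skip i k l (a.next x) = (a.add i).next ((a.add i).corner i k) := by
  have hx := x.lt
  have d₁ := a.bd_add i
  have hi : x.idx = i := congrArg Corner.idx h
  have hp := congrArg Corner.pos h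
  refine Corner.ext hi ?_
  have e : (a.add i).bd (a.skip i k l x).idx = a.bd i + 1 := by rw [skip_idx, hi, d₁]
  rw [hi] at hx
  rw [next_pos, corner_pos (by omega), e, skip_pos_self a hi] at hp
  rw [skip_pos_self a (x := a.next x) hi, next_pos, next_pos, hi, corner_pos (by omega), corner_idx,
    d₁]
  unfold skipPos at *
  split_ifs at * <;> omega

theorem skip_next_right (a : Theta) {i : Fin 3} {k l : ℕ} (hl : l ≤ a.bd (i + 1)) {x : a.Corner}
    (h : (a.add i).next (a.skip i k l x) = (a.add i).corner (i + 1) l) :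
    a.skip i k l (a.next x) = (a.add i).next ((a.add i).corner (i + 1) l) := by
  have hx := x.lt
  have d₁ := a.bd_add_add i
  have hi : x.idx = i + 1 := congrArg Corner.idx h
  have hp := congrArg Corner.pos h
  refine Corner.ext hi ?_
  have e : (a.add i).bd (a.skip i k l x).idx = a.bd (i + 1) + 1 := by rw [skip_idx, hi, d₁]
  rw [hi] at hx
  rw [next_pos, corner_pos (by omega), e, skip_pos_add a hi] at hp
  rw [skip_pos_add a (x := a.next x) hi, next_pos, next_pos, hi, corner_pos (by omega), corner_idx,
    d₁]
  unfold skipPos at *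
  split_ifs at * <;> omega

theorem skip_next (a : Theta) {i : Fin 3} {k l : ℕ} (hk : k ≤ a.bd i) (hl : l ≤ a.bd (i + 1))
    {x : a.Corner} (h₁ : (a.add i).next (a.skip i k l x) ≠ (a.add i).corner i k)
    (h₂ : (a.add i).next (a.skip i k l x) ≠ (a.add i).corner (i + 1) l) :
    a.skip i k l (a.next x) = (a.add i).next (a.skip i k l x) := by
  have hx := x.lt
  have d₁ := a.bd_add i
  have d₂ := a.bd_add_add i
  have d₃ := a.bd_add_sub i
  refine Corner.ext rfl ?_
  rcases index_cases i x.idx with hi | hi | hi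
  · have e : (a.add i).bd (a.skip i k l x).idx = a.bd i + 1 := by rw [skip_idx, hi, d₁]
    have hp : ((a.add i).next (a.skip i k l x)).pos ≠ k := fun e =>
      h₁ (Corner.ext hi (e.trans (corner_pos (by omega)).symm))
    rw [hi] at hx
    rw [next_pos, e, skip_pos_self a hi] at hp
    rw [skip_pos_self a (x := a.next x) hi, next_pos, next_pos, e, hi, skip_pos_self a hi]
    unfold skipPos at *
    split_ifs at * <;> omega
  · have e : (a.add i).bd (a.skip i k l x).idx = a.bd (i + 1) + 1 := by rw [skip_idx, hi, d₂]
    have hp : ((a.add i).next (a.skip i k l x)).pos ≠ l := fun e =>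
      h₂ (Corner.ext hi (e.trans (corner_pos (by omega)).symm))
    rw [hi] at hx
    rw [next_pos, e, skip_pos_add a hi] at hp
    rw [skip_pos_add a (x := a.next x) hi, next_pos, next_pos, e, hi, skip_pos_add a hi]
    unfold skipPos at *
    split_ifs at * <;> omega
  · rw [skip_pos_sub a (x := a.next x) hi, next_pos, next_pos, skip_idx, skip_pos_sub a hi, hi, d₃]

/-- The cyclic order of the flags at the vertices. -/
def rotate (a : Theta) : Equiv.Perm a.Corner := a.next * a.flip

theorem vertex_eq_of_sameCycle (a : Theta) {x y : a.Corner} (h : a.rotate.SameCycle x y) :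
    a.vertex x = a.vertex y :=
  eq_of_sameCycle a.vertex (fun x => by
    rw [rotate, Equiv.Perm.mul_apply, vertex_next, flip_flip]) h

/-- The flags of the edge at position `k` of the lengthened chain are `(i, k)` and `(i + 1, a.bd (i
+ 1) - k)`, which are the skipped corners. The edge is not a loop: if it makes up the whole chain,
this chain was empty before, so the others are not. -/
theorem isShrink (a : Theta) (i : Fin 3) {k : ℕ} (hk : k ≤ a.len i) :
    IsShrink (a.add i).rotate (a.add i).flip a.rotate a.flip
      ((a.add i).corner i k) (a.skip i k (a.bd (i + 1) - k)) := by
  have l₁ := a.len_add i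
  have d₁ := a.bd_add_add i
  have b₁ := a.bd_add_one i
  have b₂ : a.bd i = a.len i + a.len (i - 1) := rfl
  have hf : (a.add i).flip ((a.add i).corner i k) = (a.add i).corner (i + 1) (a.bd (i + 1) - k) := by
    rw [flip_corner _ (by omega), d₁]
    congr 1
  refine IsShrink.of_φ (flip_flip _) ?_ (skip_injective _ _ _ _) ?_ ?_ ?_ ?_ ?_
  · intro h
    have h := vertex_eq_of_sameCycle _ h
    rw [hf, vertex_corner _ (by rw [bd_add]; omega), vertex_corner _ (by rw [d₁]; omega)] at h
    have h' := vertexAux_reverse (a.add i) (i := i) (p := k + 1) (by omega)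
    rw [d₁, show a.bd (i + 1) + 1 - (k + 1) = a.bd (i + 1) - k by omega, ← h] at h'
    refine vertexAux_ne (a.add i) (i := i) (k := k) (by omega) (fun h j hj => ?_) h'
    rcases index_cases i j with rfl | rfl | rfl
    · omega
    · rw [len_add_of_ne a (add_ne i)] at hj
      have := a.bd_pos (i + 1)
      omega
    · rw [len_add_of_ne a (sub_ne i)] at hj
      have := a.bd_pos i
      omega
  · intro x
    rw [hf]
    exact mem_range_skip a i (by omega) (by omega) x
  · exact fun y => skip_flip a hk (Or.inl (by omega))
  · exact fun y h => skip_next_left a (by omega) h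
  · rw [hf]
    exact fun y h => skip_next_right a (by omega) h
  · rw [hf]
    exact fun y h h' => skip_next a (by omega) (by omega) h h'

/-- The edge at `k` is divided into the edges at `k` and `k + 1`. The new vertex has the flags `(i,
k + 1)` and, on the other side, `(i + 1, a.bd (i + 1) - k)`; these are the skipped corners. -/
theorem isInsert (a : Theta) (i : Fin 3) {k : ℕ} (hk : k < a.len i) :
    IsInsert a.rotate a.flip (a.add i).rotate (a.add i).flip (a.corner i k)
      ((a.add i).corner (i + 1) (a.bd (i + 1) - k)) ((a.add i).corner i (k + 1))
      (a.skip i (k + 1) (a.bd (i + 1) - k)) := by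
  have l₁ := a.len_add i
  have d₁ := a.bd_add_add i
  have d₂ := a.bd_add i
  have b₁ := a.bd_add_one i
  have b₂ : a.bd i = a.len i + a.len (i - 1) := rfl
  have hb := a.flip_corner hk
  have f₁ : (a.add i).flip ((a.add i).corner i k) = (a.add i).corner (i + 1) (a.bd (i + 1) - k) := by
    rw [flip_corner _ (by omega), d₁]
    congr 1
  have f₂ : (a.add i).flip ((a.add i).corner i (k + 1)) =
      (a.add i).corner (i + 1) (a.bd (i + 1) - 1 - k) := by
    rw [flip_corner _ (by omega), d₁]
    congr 1
    omega
  have s₁ : a.skip i (k + 1) (a.bd (i + 1) - k) (a.corner i k) = (a.add i).corner i k := by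
    refine Corner.ext rfl ?_
    rw [skip_pos_self a (i := i) (x := a.corner i k) rfl, corner_pos (by omega), corner_pos (by omega),
      skipPos, if_pos (by omega)]
  have s₂ : a.skip i (k + 1) (a.bd (i + 1) - k) (a.flip (a.corner i k)) =
      (a.add i).corner (i + 1) (a.bd (i + 1) - 1 - k) := by
    rw [hb]
    refine Corner.ext rfl ?_
    rw [skip_pos_add a (i := i) (x := a.corner (i + 1) _) rfl, corner_pos (by omega), corner_pos (by omega),
      skipPos, if_pos (by omega)]
  have n₁ : (a.add i).next (a.skip i (k + 1) (a.bd (i + 1) - k) (a.corner i k)) =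
      (a.add i).corner i (k + 1) := by
    rw [s₁, next_eq, corner_pos (by omega)]
    rfl
  have n₂ : (a.add i).next (a.skip i (k + 1) (a.bd (i + 1) - k) (a.flip (a.corner i k))) =
      (a.add i).corner (i + 1) (a.bd (i + 1) - k) := by
    rw [s₂, next_eq, corner_pos (by omega)]
    change (a.add i).corner (i + 1) _ = _
    congr 1
    omega
  have hτ : ∀ x, x ≠ a.corner i k → x ≠ a.flip (a.corner i k) →
      (a.add i).flip (a.skip i (k + 1) (a.bd (i + 1) - k) x) =
        a.skip i (k + 1) (a.bd (i + 1) - k) (a.flip x) := fun x h h' => by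
    refine (skip_flip a hk (Or.inr ⟨by omega, fun hi hp => h ?_, fun hi hp => h' ?_⟩)).symm
    · exact Corner.ext hi (by rw [corner_pos (by omega)]; omega)
    · rw [hb]
      exact Corner.ext hi (by rw [corner_pos (by omega)]; omega)
  have t₁ : (a.add i).flip (a.skip i (k + 1) (a.bd (i + 1) - k) (a.corner i k)) =
      (a.add i).corner (i + 1) (a.bd (i + 1) - k) := by rw [s₁, f₁]
  have t₂ : (a.add i).flip (a.skip i (k + 1) (a.bd (i + 1) - k) (a.flip (a.corner i k))) =
      (a.add i).corner i (k + 1) := by rw [s₂, ← f₂, flip_flip]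
  have hr := mem_range_skip a i (k := k + 1) (l := a.bd (i + 1) - k) (by omega) (by omega)
  refine ⟨skip_injective _ _ _ _, fun y => (hr y).trans and_comm, fun x => ?_, ?_, ?_, t₁, t₂, hτ⟩
  · rw [rotate, rotate, Equiv.Perm.mul_apply, Equiv.Perm.mul_apply]
    by_cases h₁ : x = a.corner i k
    · rw [h₁, t₁]
      exact (skip_next_right a (by omega) n₂).symm
    · by_cases h₂ : x = a.flip (a.corner i k)
      · rw [h₂, t₂, flip_flip]
        exact (skip_next_left a (by omega) n₁).symm
      · rw [hτ x h₁ h₂]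
        refine (skip_next a (by omega) (by omega) ?_ ?_).symm
        · rw [← n₁]
          exact fun e => h₂ (by
            rw [← skip_injective _ _ _ _ ((a.add i).next.injective e), flip_flip])
        · rw [← n₂]
          exact fun e => h₁ (a.flip.injective (skip_injective _ _ _ _ ((a.add i).next.injective e)))
  · rw [rotate, Equiv.Perm.mul_apply, ← t₁, flip_flip, n₁]
  · rw [rotate, Equiv.Perm.mul_apply, ← t₂, flip_flip, n₂]

end Theta

/-! ### Genus zero and the functor from the model to fat graphs -/

namespace Theta

theorem eq_of_len_eq_zero (a : Theta) {i j : Fin 3} (hi : a.len i = 0) (hj : a.len j = 0) :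
    j = i := by
  rcases index_cases i j with rfl | rfl | rfl
  · rfl
  · have h₁ := a.bd_pos (i + 1)
    have h₂ := a.bd_add_one i
    omega
  · have h₁ := a.bd_pos i
    have h₂ : a.bd i = a.len i + a.len (i - 1) := rfl
    omega

/-- An edge can be removed from a chain as long as this does not leave two empty chains. -/
theorem exists_eq_add (a : Theta) {i : Fin 3} (h : 0 < a.len i)
    (h' : a.len i = 1 → ∀ j, a.len j ≠ 0) : ∃ a' : Theta, a = a'.add i := by
  refine ⟨⟨fun j => a.len j - if j = i then 1 else 0, fun j => ?_⟩, ?_⟩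
  · have h₁ := a.pos j
    have h₂ : j = i ∨ j - 1 = i → a.len i = 1 → a.len j ≠ 0 ∧ a.len (j - 1) ≠ 0 :=
      fun _ e => ⟨h' e _, h' e _⟩
    have h₃ := sub_ne j
    split_ifs with c₁ c₂ c₂
    · exact absurd (c₂.trans c₁.symm) h₃
    · subst c₁
      have := h₂ (Or.inl rfl)
      omega
    · subst c₂
      have := h₂ (Or.inr rfl)
      omega
    · omega
  · refine Theta.ext (funext fun j => ?_)
    change a.len j = a.len j - _ + _
    split_ifs with c
    · subst c
      omega
    · omega

/-- Every graph is obtained by adding an edge to a chain, or it is a figure eight with two edges. -/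
theorem exists_add_or (a : Theta) : (∃ (a' : Theta) (i : Fin 3), a = a'.add i) ∨
    ∃ i, a.len i = 1 ∧ a.len (i - 1) = 1 ∧ a.len (i + 1) = 0 := by
  by_cases h : ∃ i, 0 < a.len i ∧ (a.len i = 1 → ∀ j, a.len j ≠ 0)
  · obtain ⟨i, h₁, h₂⟩ := h
    obtain ⟨a', h⟩ := a.exists_eq_add h₁ h₂
    exact Or.inl ⟨a', i, h⟩
  · push Not at h
    have key : ∀ i, a.len i ≠ 0 → a.len i = 1 := fun i hi => (h i (by omega)).1
    by_cases hz : ∃ z, a.len z = 0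
    · obtain ⟨z, hz⟩ := hz
      have h₁ : a.len (z - 1) ≠ 0 := fun e => sub_ne z (a.eq_of_len_eq_zero hz e)
      have h₂ : a.len (z + 1) ≠ 0 := fun e => add_ne z (a.eq_of_len_eq_zero hz e)
      refine Or.inr ⟨z - 1, key _ h₁, ?_, ?_⟩
      · rw [sub_sub]
        exact key _ h₂
      · rw [sub_add_cancel]
        exact hz
    · have hz : ∀ z, a.len z ≠ 0 := fun z e => hz ⟨z, e⟩
      obtain ⟨-, j, hj⟩ := h 0 (Nat.pos_of_ne_zero (hz 0))
      exact absurd hj (hz j)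

/-- The number of edges. -/
def size (a : Theta) : ℕ := a.len 0 + a.len 1 + a.len 2

theorem size_eq (a : Theta) (i : Fin 3) : a.size = a.len i + a.len (i - 1) + a.len (i + 1) := by
  unfold size
  fin_cases i
  · change _ = a.len 0 + a.len 2 + a.len 1
    omega
  · change _ = a.len 1 + a.len 0 + a.len 2
    omega
  · change _ = a.len 2 + a.len 1 + a.len 0
    omega

theorem size_add (a : Theta) (i : Fin 3) : (a.add i).size = a.size + 1 := by
  rw [size_eq _ i, size_eq a i, len_add, len_add_of_ne a (sub_ne i), len_add_of_ne a (add_ne i)]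
  omega

theorem card_corner (a : Theta) : Nat.card a.Corner = 2 * a.size := by
  let e : a.Corner ≃ Σ i : Fin 3, Fin (a.bd i) :=
    { toFun := fun x => ⟨x.idx, x.pos, x.lt⟩
      invFun := fun x => ⟨x.1, x.2.1, x.2.2⟩
      left_inv := fun x => rfl
      right_inv := fun x => rfl }
  rw [Nat.card_congr e, Nat.card_eq_fintype_card, Fintype.card_sigma, Fin.sum_univ_three]
  simp only [Fintype.card_fin]
  change a.len 0 + a.len 2 + (a.len 1 + a.len 0) + (a.len 2 + a.len 1) = _
  unfold size
  omega

theorem orbits_flip (a : Theta) : orbits a.flip = a.size := by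
  have := two_mul_orbits a.flip_flip a.flip_ne
  rw [card_corner] at this
  omega

theorem rotate_ne (a : Theta) (x : a.Corner) : a.rotate x ≠ x := fun e =>
  a.flip_idx_ne x (show (a.rotate x).idx = x.idx by rw [e])

theorem sameCycle_next_iff (a : Theta) (x y : a.Corner) :
    a.next.SameCycle x y ↔ x.idx = y.idx := by
  refine ⟨fun h => eq_of_sameCycle Corner.idx (a.next_idx) h, fun h => ?_⟩
  have key : ∀ i p, p ≤ a.bd i → a.next.SameCycle (a.corner i 0) (a.corner i p) := fun i p => by
    induction p with
    | zero => exact fun _ => Equiv.Perm.SameCycle.refl _ _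
    | succ p ih =>
      intro hp
      refine (ih (by omega)).trans ⟨1, ?_⟩
      rw [zpow_one, next_eq, corner_pos (by omega)]
      rfl
  have hx := key x.idx x.pos x.lt.le
  have hy := key y.idx y.pos y.lt.le
  rw [corner_eq] at hx hy
  rw [← h] at hy
  exact hx.symm.trans hy

theorem rotate_mul_flip (a : Theta) : a.rotate * a.flip = a.next := by
  ext x : 1
  rw [Equiv.Perm.mul_apply, rotate, Equiv.Perm.mul_apply, flip_flip]

/-- Adding an edge to a chain raises the numbers of vertices and of edges by one, and the figure
eight with two edges has one vertex. With three boundary components this is genus zero. -/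
theorem orbits_rotate (a : Theta) : orbits a.rotate + 1 = a.size := by
  generalize hn : a.size = n
  induction n generalizing a with
  | zero =>
    have := a.pos 0
    have : a.len 0 + a.len 2 ≠ 0 := this.ne'
    unfold size at hn
    omega
  | succ n ih =>
    rcases a.exists_add_or with ⟨a, i, rfl⟩ | ⟨i, h₁, h₂, h₃⟩
    · rw [(a.isShrink i (Nat.zero_le _)).orbits_eq (rotate_ne _) (flip_ne _ _)]
      rw [size_add] at hn
      rw [ih a (by omega)]
    · have b₁ := a.bd_add_one i
      have b₂ : a.bd i = a.len i + a.len (i - 1) := rfl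
      have b₃ := a.bd_sub_one i
      have f₁ := a.flip_corner (i := i) (k := 0) (by omega)
      have f₂ := a.flip_corner (i := i - 1) (k := 0) (by omega)
      rw [sub_add_cancel, b₂, h₁, h₂] at f₂
      rw [b₁, h₁, h₃] at f₁
      -- In the figure eight the four flags are visited in one cycle, in the order `(i, 0)`, `(i +
      -- 1, 0)`, `(i, 1)`, `(i - 1, 0)`.
      have r₁ : a.rotate (a.corner i 0) = a.corner (i + 1) 0 := by
        rw [rotate, Equiv.Perm.mul_apply, f₁, next_eq]
        refine Corner.ext rfl ?_
        simp [corner, b₁, h₁, h₃]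
      have r₂ : a.rotate (a.corner (i + 1) 0) = a.corner i 1 := by
        rw [rotate, Equiv.Perm.mul_apply, ← f₁, flip_flip, next_eq]
        refine Corner.ext rfl ?_
        simp [corner, b₂, h₁, h₂]
      have r₃ : a.rotate (a.corner i 1) = a.corner (i - 1) 0 := by
        rw [rotate, Equiv.Perm.mul_apply, ← f₂, flip_flip, next_eq]
        refine Corner.ext rfl ?_
        simp [corner, b₃, h₂, h₃]
      have s₁ : a.rotate.SameCycle (a.corner i 0) (a.corner (i + 1) 0) := ⟨1, r₁⟩
      have s₂ : a.rotate.SameCycle (a.corner i 0) (a.corner i 1) := s₁.trans ⟨1, r₂⟩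
      have s₃ : a.rotate.SameCycle (a.corner i 0) (a.corner (i - 1) 0) := s₂.trans ⟨1, r₃⟩
      have hall : ∀ x, a.rotate.SameCycle (a.corner i 0) x := fun x => by
        have hx := x.lt
        rw [← a.corner_eq x]
        rcases index_cases i x.idx with hi | hi | hi
        · rw [hi] at hx ⊢
          obtain h | h : x.pos = 0 ∨ x.pos = 1 := by omega
          · rw [h]
          · rw [h]
            exact s₂
        · rw [hi] at hx ⊢
          rw [show x.pos = 0 by omega]
          exact s₁
        · rw [hi] at hx ⊢
          rw [show x.pos = 0 by omega]
          exact s₃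
      have hs := a.size_eq i
      have : orbits a.rotate = 1 := by
        refine Nat.card_eq_one_iff_unique.2 ⟨⟨fun c d => ?_⟩, ⟨⟦a.corner i 0⟧⟩⟩
        induction c using Quotient.inductionOn with | _ x =>
        induction d using Quotient.inductionOn with | _ y =>
        exact Quotient.sound ((hall x).symm.trans (hall y))
      omega

/-- The subdivided theta graphs and figure eights are fat graphs of genus zero. -/
theorem isFat (a : Theta) : IsFat 0 a.rotate a.flip Corner.idx where
  nonempty := ⟨a.corner 0 0⟩
  τ_τ := a.flip_flip
  τ_ne := a.flip_ne
  σ_ne := a.rotate_ne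
  mark_surjective i := ⟨a.corner i 0, rfl⟩
  mark_eq_iff x y := by rw [rotate_mul_flip, sameCycle_next_iff]
  euler := by
    have := a.orbits_rotate
    rw [orbits_flip]
    push_cast
    omega
  connected P hσ hτ x y hx := by
    have hn : ∀ x, P (a.next x) ↔ P x := fun x => by
      rw [← rotate_mul_flip, Equiv.Perm.mul_apply, hσ, hτ]
    have hi : ∀ x y : a.Corner, x.idx = y.idx → (P x ↔ P y) := fun x y h =>
      iff_of_eq (eq_of_sameCycle P (fun x => propext (hn x)) ((a.sameCycle_next_iff x y).2 h))
    have h₀ : ∀ i, a.len i ≠ 0 → (P (a.corner i 0) ↔ P (a.corner (i + 1) 0)) := fun i h => by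
      rw [← hτ, flip_corner a (Nat.pos_of_ne_zero h)]
      exact hi _ _ rfl
    -- Neighbouring components are connected across the chain between them; if this chain is empty,
    -- the detour over the third component is available.
    have h₁ : ∀ i, P (a.corner i 0) ↔ P (a.corner (i + 1) 0) := fun i => by
      by_cases h : a.len i = 0
      · have e₁ := h₀ (i + 1) fun e => add_ne i (a.eq_of_len_eq_zero h e)
        have e₂ := h₀ (i - 1) fun e => sub_ne i (a.eq_of_len_eq_zero h e)
        rw [sub_add_cancel] at e₂
        rw [add_add] at e₁
        exact e₂.symm.trans e₁.symm
      · exact h₀ i h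
    rw [hi x (a.corner x.idx 0) rfl] at hx
    rw [hi y (a.corner y.idx 0) rfl]
    rcases index_cases x.idx y.idx with h | h | h
    · rwa [h]
    · rw [h]
      exact (h₁ _).1 hx
    · rw [h]
      refine (h₁ _).2 ?_
      rwa [sub_add_cancel]

/-- The edge paths of a morphism. -/
def path {a b : Theta} (f : a ⟶ b) (x : a.Corner) : List b.Corner :=
  (List.range' (bdMap f x.idx x.pos)
    (bdMap f x.idx (x.pos + 1) - bdMap f x.idx x.pos)).map (b.corner x.idx)

theorem path_of_eq {a b : Theta} {f : a ⟶ b} {x : a.Corner} {i : Fin 3} {q m : ℕ} (hi : x.idx = i)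
    (h₁ : bdMap f i x.pos = q) (h₂ : bdMap f i (x.pos + 1) = q + m) :
    path f x = (List.range' q m).map (b.corner i) := by
  subst hi
  rw [path, h₁, h₂, Nat.add_sub_cancel_left]

theorem path_id (a : Theta) (x : a.Corner) : path (𝟙 a) x = [x] := by
  have hx := x.lt
  rw [path_of_eq (q := x.pos) (m := 1) rfl (bdMap_id a _ hx.le) (bdMap_id a _ hx)]
  simp [corner_eq]

theorem range'_flatMap (c : ℕ → ℕ) (hc : Monotone c) (p m : ℕ) :
    (List.range' p m).flatMap (fun q => List.range' (c q) (c (q + 1) - c q)) =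
      List.range' (c p) (c (p + m) - c p) := by
  induction m generalizing p with
  | zero => simp
  | succ m ih =>
    have h₁ := hc (Nat.le_add_right p 1)
    have h₂ := hc (Nat.le_add_right (p + 1) m)
    rw [List.range'_succ, List.flatMap_cons, ih, show p + (m + 1) = p + 1 + m by omega,
      show c (p + 1 + m) - c p = (c (p + 1) - c p) + (c (p + 1 + m) - c (p + 1)) by omega,
      ← List.range'_append_1, Nat.add_sub_cancel' h₁]

theorem path_comp {a b c : Theta} (f : a ⟶ b) (g : b ⟶ c) (x : a.Corner) :
    path (f ≫ g) x = (path f x).flatMap (path g) := by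
  have hx := x.lt
  rw [path, bdMap_comp, bdMap_comp]
  have hm := bdMap_mono f x.idx (Nat.le_add_right x.pos 1)
  have h := range'_flatMap (bdMap g x.idx) (bdMap_mono g x.idx) (bdMap f x.idx x.pos)
    (bdMap f x.idx (x.pos + 1) - bdMap f x.idx x.pos)
  rw [Nat.add_sub_cancel' hm] at h
  rw [← h, path, List.map_flatMap, List.flatMap_map]
  refine List.flatMap_congr fun q hq => ?_
  have hq : q < b.bd x.idx := by
    have := (List.mem_range'_1.1 hq).2
    have := bdMap_le f x.idx (x.pos + 1)
    omega
  rw [path, corner_pos hq]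
  rfl

/-- The fat graph of an object of the combinatorial model. -/
noncomputable def graph (a : Theta) : FatGraph 0 3 := FatGraph.of a.isFat

/-- The flags of the fat graph are the corners. -/
noncomputable def flag (a : Theta) : a.Corner ≃ a.graph.Flag := FatGraph.ofFlag a.isFat

theorem realizes (a : Theta) : Realizes a.graph a.rotate a.flip Corner.idx a.flag :=
  FatGraph.of_realizes a.isFat

/-- The edge paths of a morphism are those of a morphism of fat graphs. -/
def IsMor {a b : Theta} (f : a ⟶ b) : Prop :=
  ∃ fiber, FatGraph.IsMor a.graph b.graph (transportPath a.flag b.flag (path f)) fiber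

theorem IsMor.comp {a b c : Theta} {f : a ⟶ b} {g : b ⟶ c} (hf : IsMor f) (hg : IsMor g) :
    IsMor (f ≫ g) := by
  obtain ⟨r, hr⟩ := hf
  obtain ⟨s, hs⟩ := hg
  have := hr.comp hs
  rw [← transportPath_comp, ← funext (path_comp f g)] at this
  exact ⟨_, this⟩

theorem isMor_id (a : Theta) : IsMor (𝟙 a) :=
  exists_isMor_of_equiv a.realizes a.realizes (Equiv.refl _) (fun _ => rfl) (fun _ => rfl)
    (fun _ => rfl) _ (path_id a)

/-- Shrinking an edge of a chain. -/
def shrink (a : Theta) (i : Fin 3) {k : ℕ} (hk : k ≤ a.len i) : a.add i ⟶ a where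
  toFun j p := if j = i then if p ≤ k then p else p - 1 else p
  mono j p q h := by
    dsimp only
    split_ifs <;> omega
  map_zero j := by
    split_ifs
    · rfl
    · omega
    · rfl
  map_add j m := by
    by_cases h : j = i
    · subst h
      rw [len_add, if_pos rfl]
      split_ifs <;> omega
    · rw [if_neg h, len_add_of_ne a h]

/-- Inserting a vertex on an edge of a chain. -/
def insert (a : Theta) (i : Fin 3) {k : ℕ} (hk : k < a.len i) : a ⟶ a.add i where
  toFun j p := if j = i then if p ≤ k then p else p + 1 else p
  mono j p q h := by
    dsimp only
    split_ifs <;> omega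
  map_zero j := by
    split_ifs
    · rfl
    · omega
    · rfl
  map_add j m := by
    by_cases h : j = i
    · subst h
      rw [len_add, if_pos rfl]
      split_ifs <;> omega
    · rw [if_neg h, len_add_of_ne a h]

theorem shrink_toFun (a : Theta) (i : Fin 3) {k : ℕ} (hk : k ≤ a.len i) (j : Fin 3) (p : ℕ) :
    Hom.toFun (a.shrink i hk) j p = if j = i then if p ≤ k then p else p - 1 else p := rfl

theorem insert_toFun (a : Theta) (i : Fin 3) {k : ℕ} (hk : k < a.len i) (j : Fin 3) (p : ℕ) :
    Hom.toFun (a.insert i hk) j p = if j = i then if p ≤ k then p else p + 1 else p := rfl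

section

variable (a : Theta) (i : Fin 3) {k : ℕ}

theorem bdMap_shrink (hk : k ≤ a.len i) {p : ℕ} (hp : p ≤ a.bd i + 1) :
    bdMap (a.shrink i hk) i p = if p ≤ k then p else p - 1 := by
  have l₁ := a.len_add i
  have b₁ : a.bd i = a.len i + a.len (i - 1) := rfl
  rcases le_total p ((a.add i).len i) with h | h
  · rw [bdMap_of_le _ _ h, shrink_toFun, if_pos rfl]
  · rw [bdMap_of_ge _ _ h, shrink_toFun, if_neg (sub_ne i), bd_add]
    split_ifs <;> omega

/-- The component `i + 1` meets the shrunk edge at the position `a.bd (i + 1) - k`, since it runs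
through the chain `i` backwards. -/
theorem bdMap_shrink_add (hk : k ≤ a.len i) {p : ℕ} (hp : p ≤ a.bd (i + 1) + 1) :
    bdMap (a.shrink i hk) (i + 1) p = if p ≤ a.bd (i + 1) - k then p else p - 1 := by
  have l₁ := a.len_add_of_ne (add_ne i)
  have b₁ := a.bd_add_one i
  rcases le_total p ((a.add i).len (i + 1)) with h | h
  · rw [bdMap_of_le _ _ h, shrink_toFun, if_neg (add_ne i)]
    split_ifs <;> omega
  · rw [bdMap_of_ge _ _ h, shrink_toFun, if_pos (add_sub_cancel_right i 1), bd_add_add]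
    split_ifs <;> omega

theorem bdMap_shrink_sub (hk : k ≤ a.len i) {p : ℕ} (hp : p ≤ a.bd (i - 1)) :
    bdMap (a.shrink i hk) (i - 1) p = p := by
  rcases le_total p ((a.add i).len (i - 1)) with h | h
  · rw [bdMap_of_le _ _ h, shrink_toFun, if_neg (sub_ne i)]
  · rw [bdMap_of_ge _ _ h, shrink_toFun, if_neg (by rw [sub_sub]; exact add_ne i), bd_add_sub]
    omega

theorem bdMap_insert (hk : k < a.len i) {p : ℕ} (hp : p ≤ a.bd i) :
    bdMap (a.insert i hk) i p = if p ≤ k then p else p + 1 := by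
  have b₁ : a.bd i = a.len i + a.len (i - 1) := rfl
  rcases le_total p (a.len i) with h | h
  · rw [bdMap_of_le _ _ h, insert_toFun, if_pos rfl]
  · rw [bdMap_of_ge _ _ h, insert_toFun, if_neg (sub_ne i), bd_add]
    split_ifs <;> omega

theorem bdMap_insert_add (hk : k < a.len i) {p : ℕ} (hp : p ≤ a.bd (i + 1)) :
    bdMap (a.insert i hk) (i + 1) p = if p + k < a.bd (i + 1) then p else p + 1 := by
  have b₁ := a.bd_add_one i
  rcases le_total p (a.len (i + 1)) with h | h
  · rw [bdMap_of_le _ _ h, insert_toFun, if_neg (add_ne i)]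
    split_ifs <;> omega
  · rw [bdMap_of_ge _ _ h, insert_toFun, if_pos (add_sub_cancel_right i 1), bd_add_add]
    split_ifs <;> omega

theorem bdMap_insert_sub (hk : k < a.len i) {p : ℕ} (hp : p ≤ a.bd (i - 1)) :
    bdMap (a.insert i hk) (i - 1) p = p := by
  rcases le_total p (a.len (i - 1)) with h | h
  · rw [bdMap_of_le _ _ h, insert_toFun, if_neg (sub_ne i)]
  · rw [bdMap_of_ge _ _ h, insert_toFun, if_neg (by rw [sub_sub]; exact add_ne i), bd_add_sub]
    omega

theorem isMor_shrink (hk : k ≤ a.len i) : IsMor (a.shrink i hk) := by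
  have l₁ := a.len_add i
  have b₁ : a.bd i = a.len i + a.len (i - 1) := rfl
  have b₂ := a.bd_add_one i
  have hf : (a.add i).flip ((a.add i).corner i k) = (a.add i).corner (i + 1) (a.bd (i + 1) - k) := by
    rw [flip_corner _ (by omega), bd_add_add]
    rfl
  refine exists_isMor_of_isShrink (a.add i).realizes a.realizes (a.isShrink i hk) (fun _ => rfl) _
    ?_ ?_ fun y => ?_
  · have e : ((a.add i).corner i k).pos = k := corner_pos (by rw [bd_add]; omega)
    rw [path_of_eq (i := i) (q := k) (m := 0) rfl]
    · rfl
    · rw [e, bdMap_shrink a i hk (by omega), if_pos le_rfl]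
    · rw [e, bdMap_shrink a i hk (by omega), if_neg (by omega)]
      rfl
  · have e : ((a.add i).corner (i + 1) (a.bd (i + 1) - k)).pos = a.bd (i + 1) - k :=
      corner_pos (by rw [bd_add_add]; omega)
    rw [hf, path_of_eq (i := i + 1) (q := a.bd (i + 1) - k) (m := 0) rfl]
    · rfl
    · rw [e, bdMap_shrink_add a i hk (by omega), if_pos le_rfl]
    · rw [e, bdMap_shrink_add a i hk (by omega), if_neg (by omega)]
      rfl
  · have hy := y.lt
    rw [path_of_eq (i := y.idx) (q := y.pos) (m := 1) (skip_idx _ _ _ _ _)]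
    · simp [corner_eq]
    · rcases index_cases i y.idx with hi | hi | hi
      · rw [skip_pos_self a hi]
        rw [hi] at hy ⊢
        unfold skipPos
        rw [bdMap_shrink a i hk (by split_ifs <;> omega)]
        split_ifs <;> omega
      · rw [skip_pos_add a hi]
        rw [hi] at hy ⊢
        unfold skipPos
        rw [bdMap_shrink_add a i hk (by split_ifs <;> omega)]
        split_ifs <;> omega
      · rw [skip_pos_sub a hi]
        rw [hi] at hy ⊢
        exact bdMap_shrink_sub a i hk hy.le
    · rcases index_cases i y.idx with hi | hi | hi
      · rw [skip_pos_self a hi]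
        rw [hi] at hy ⊢
        unfold skipPos
        rw [bdMap_shrink a i hk (by split_ifs <;> omega)]
        split_ifs <;> omega
      · rw [skip_pos_add a hi]
        rw [hi] at hy ⊢
        unfold skipPos
        rw [bdMap_shrink_add a i hk (by split_ifs <;> omega)]
        split_ifs <;> omega
      · rw [skip_pos_sub a hi]
        rw [hi] at hy ⊢
        exact bdMap_shrink_sub a i hk hy

theorem isMor_insert (hk : k < a.len i) : IsMor (a.insert i hk) := by
  have l₁ := a.len_add i
  have d₁ := a.bd_add i
  have d₂ := a.bd_add_add i
  have b₁ : a.bd i = a.len i + a.len (i - 1) := rfl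
  have b₂ := a.bd_add_one i
  refine exists_isMor_of_isInsert a.realizes (a.add i).realizes (a.isInsert i hk) (fun _ => rfl) _
    ?_ ?_ fun x h₁ h₂ => ?_
  · have e : (a.corner i k).pos = k := corner_pos (by omega)
    rw [path_of_eq (i := i) (q := k) (m := 2) rfl]
    · refine congrArg (fun x => [x, (a.add i).corner i (k + 1)]) (Corner.ext rfl ?_)
      rw [skip_pos_self a (i := i) (x := a.corner i k) rfl, e, corner_pos (by omega), skipPos,
        if_pos (by omega)]
    · rw [e, bdMap_insert a i hk (by omega), if_pos le_rfl]
    · rw [e, bdMap_insert a i hk (by omega), if_neg (by omega)]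
  · rw [flip_corner a hk]
    have e : (a.corner (i + 1) (a.bd (i + 1) - 1 - k)).pos = a.bd (i + 1) - 1 - k :=
      corner_pos (by omega)
    rw [path_of_eq (i := i + 1) (q := a.bd (i + 1) - 1 - k) (m := 2) rfl]
    · have e' : a.bd (i + 1) - 1 - k + 1 = a.bd (i + 1) - k := by omega
      simp only [List.range'_succ, List.map_cons, List.range'_zero, List.map_nil, e']
      refine congrArg (fun x => [x, _]) (Corner.ext rfl ?_)
      rw [skip_pos_add a (i := i) (x := a.corner (i + 1) _) rfl, e, corner_pos (by omega), skipPos,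
        if_pos (by omega)]
    · rw [e, bdMap_insert_add a i hk (by omega), if_pos (by omega)]
    · rw [e, bdMap_insert_add a i hk (by omega), if_neg (by omega)]
  · have hx := x.lt
    rw [flip_corner a hk] at h₂
    have hs : (a.skip i (k + 1) (a.bd (i + 1) - k) x).idx = x.idx := rfl
    rw [path_of_eq (i := x.idx) (q := (a.skip i (k + 1) (a.bd (i + 1) - k) x).pos) (m := 1) rfl]
    · simp only [List.range'_succ, List.map_cons, List.range'_zero, List.map_nil]
      rw [← hs, corner_eq]
    · rcases index_cases i x.idx with hi | hi | hi
      · rw [skip_pos_self a hi]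
        rw [hi] at hx ⊢
        unfold skipPos
        rw [bdMap_insert a i hk (by omega)]
        split_ifs <;> omega
      · rw [skip_pos_add a hi]
        rw [hi] at hx ⊢
        unfold skipPos
        rw [bdMap_insert_add a i hk (by omega)]
        split_ifs <;> omega
      · rw [skip_pos_sub a hi]
        rw [hi] at hx ⊢
        exact bdMap_insert_sub a i hk hx.le
    · rcases index_cases i x.idx with hi | hi | hi
      · rw [skip_pos_self a hi]
        have hn : x.pos ≠ k := fun e => h₁ (Corner.ext hi (e.trans (corner_pos (by omega)).symm))
        rw [hi] at hx ⊢
        unfold skipPos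
        rw [bdMap_insert a i hk (by omega)]
        split_ifs <;> omega
      · rw [skip_pos_add a hi]
        have hn : x.pos ≠ a.bd (i + 1) - 1 - k := fun e =>
          h₂ (Corner.ext hi (e.trans (corner_pos (by omega)).symm))
        rw [hi] at hx ⊢
        unfold skipPos
        rw [bdMap_insert_add a i hk (by omega)]
        split_ifs <;> omega
      · rw [skip_pos_sub a hi]
        rw [hi] at hx ⊢
        exact bdMap_insert_sub a i hk hx

end

/-- A morphism which maps an edge to a point factors through the shrinking of this edge. -/
theorem exists_shrink_comp {a b : Theta} (f : a ⟶ b) {i : Fin 3} {k : ℕ} (hk : k < a.len i)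
    (h : Hom.toFun f i (k + 1) = Hom.toFun f i k) :
    ∃ (a' : Theta) (hk' : k ≤ a'.len i) (ha : a = a'.add i) (g : a' ⟶ b),
      f = eqToHom ha ≫ a'.shrink i hk' ≫ g := by
  obtain ⟨a', rfl⟩ : ∃ a' : Theta, a = a'.add i := by
    -- If the edge were a whole chain and another chain were empty, both would be empty in `b`,
    -- which is impossible.
    refine a.exists_eq_add (by omega) fun h₁ j hj => ?_
    obtain rfl : k = 0 := by omega
    have h₂ := map_len f i
    rw [h₁, h, Hom.map_zero] at h₂
    have h₃ := map_len f j
    rw [hj, Hom.map_zero] at h₃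
    rw [b.eq_of_len_eq_zero h₂.symm h₃.symm] at hj
    omega
  rw [len_add] at hk
  have hk' : k ≤ a'.len i := by omega
  -- The remaining morphism leaves out the point `k + 1`, where `f` has the same value as at `k`.
  refine ⟨a', hk', rfl, ⟨fun j p => if j = i then if p ≤ k then Hom.toFun f i p else
    Hom.toFun f i (p + 1) else Hom.toFun f j p, fun j p q hpq => ?_, fun j => ?_, fun j m => ?_⟩, ?_⟩
  · have h₁ := Hom.mono f j hpq
    have h₂ := Hom.mono f i hpq
    have h₃ := Hom.mono f i (Nat.succ_le_succ hpq)
    have h₄ := Hom.mono f i (hpq.trans (Nat.le_succ q))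
    dsimp only
    split_ifs
    · exact h₂
    · exact h₄
    · omega
    · exact h₃
    · exact h₁
  · rw [if_pos (Nat.zero_le _), Hom.map_zero, Hom.map_zero, ite_self]
  · by_cases hj : j = i
    · subst hj
      have := Hom.map_add f j m
      rw [len_add, show a'.len j + 1 + m = a'.len j + m + 1 by omega] at this
      rw [if_pos rfl]
      split_ifs with c
      · rw [← this]
        obtain rfl : k = a'.len j + m := by omega
        exact h.symm
      · exact this
    · rw [if_neg hj, ← Hom.map_add f j m, len_add_of_ne a' hj]
  · rw [eqToHom_refl, Category.id_comp]
    refine hom_ext fun j p => ?_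
    rw [comp_toFun, shrink_toFun]
    change _ = if j = i then if _ ≤ k then Hom.toFun f i _ else Hom.toFun f i _ else Hom.toFun f j _
    by_cases hj : j = i
    · subst hj
      simp only [if_true]
      by_cases c : p ≤ k
      · simp only [c, if_true]
      · simp only [c, if_false]
        split_ifs with c'
        · obtain rfl : p = k + 1 := by omega
          exact h
        · congr 1
          omega
    · simp only [hj, if_false]

/-- A morphism which maps an edge to a path of at least two edges factors through the insertion of a
vertex. -/
theorem exists_comp_insert {a b : Theta} (f : a ⟶ b) {i : Fin 3} {k : ℕ} (hk : k < a.len i)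
    (h : Hom.toFun f i k + 2 ≤ Hom.toFun f i (k + 1)) :
    ∃ (b' : Theta) (hk' : Hom.toFun f i k < b'.len i) (hb : b'.add i = b) (g : a ⟶ b'),
      f = g ≫ b'.insert i hk' ≫ eqToHom hb := by
  have h₁ : Hom.toFun f i (k + 1) ≤ b.len i := map_le f i hk
  obtain ⟨b', rfl⟩ : ∃ b' : Theta, b = b'.add i := b.exists_eq_add (by omega) (by omega)
  rw [len_add] at h₁
  have hm : ∀ p, p ≤ k → Hom.toFun f i p ≤ Hom.toFun f i k := fun p hp => Hom.mono f i hp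
  have hm' : ∀ p, ¬ p ≤ k → Hom.toFun f i (k + 1) ≤ Hom.toFun f i p := fun p hp =>
    Hom.mono f i (by omega)
  -- The inserted vertex is the point `f k + 1`, which is not a value of `f` because `f` jumps over
  -- it; the values behind it move down by one.
  refine ⟨b', by omega, rfl, ⟨fun j p => if j = i then if p ≤ k then Hom.toFun f i p else
    Hom.toFun f i p - 1 else Hom.toFun f j p, fun j p q hpq => ?_, fun j => ?_, fun j m => ?_⟩, ?_⟩
  · have h₁ := Hom.mono f j hpq
    have h₂ := Hom.mono f i hpq
    have h₃ := hm p
    have h₄ := hm' q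
    dsimp only
    split_ifs <;> omega
  · rw [if_pos (Nat.zero_le _), Hom.map_zero, Hom.map_zero, ite_self]
  · have := Hom.map_add f j m
    by_cases hj : j = i
    · subst hj
      rw [len_add] at this
      rw [if_pos rfl, if_neg (by omega), this]
      omega
    · rw [len_add_of_ne b' hj] at this
      rw [if_neg hj, this]
  · rw [eqToHom_refl, Category.comp_id]
    refine hom_ext fun j p => ?_
    rw [comp_toFun, insert_toFun]
    have hg : ∀ q, q = (if j = i then if p ≤ k then Hom.toFun f i p else
        Hom.toFun f i p - 1 else Hom.toFun f j p) → Hom.toFun f j p =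
          if j = i then if q ≤ Hom.toFun f i k then q else q + 1 else q := fun q hq => by
      by_cases hj : j = i
      · subst hj
        have h₃ := hm p
        have h₄ := hm' p
        rw [if_pos rfl] at hq ⊢
        split_ifs at hq with c
        · rw [hq, if_pos (h₃ c)]
        · have := h₄ c
          rw [if_neg (by omega)]
          omega
      · rw [if_neg hj] at hq ⊢
        exact hq.symm
    exact hg _ rfl

/-- Induction on the total number of edges. If `f` contracts an edge it factors through a shrinking,
and if it stretches one it factors through an insertion. If every edge goes to a single edge, `f` is
an identity. -/
theorem isMor {a b : Theta} (f : a ⟶ b) : IsMor f := by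
  generalize hn : a.size + b.size = n
  induction n generalizing a b with
  | zero =>
    have := a.pos 0
    have : a.len 0 + a.len 2 ≠ 0 := this.ne'
    unfold size at hn
    omega
  | succ n ih =>
    by_cases c₁ : ∃ i k, k < a.len i ∧ Hom.toFun f i (k + 1) = Hom.toFun f i k
    · obtain ⟨i, k, hk, h⟩ := c₁
      obtain ⟨a', hk', rfl, g, rfl⟩ := exists_shrink_comp f hk h
      rw [eqToHom_refl, Category.id_comp]
      rw [size_add] at hn
      exact (isMor_shrink a' i hk').comp (ih g (by omega))
    · by_cases c₂ : ∃ i k, k < a.len i ∧ Hom.toFun f i k + 2 ≤ Hom.toFun f i (k + 1)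
      · obtain ⟨i, k, hk, h⟩ := c₂
        obtain ⟨b', hk', rfl, g, hg⟩ := exists_comp_insert f hk h
        rw [eqToHom_refl, Category.comp_id] at hg
        rw [hg]
        rw [size_add] at hn
        exact (ih g (by omega)).comp (isMor_insert b' i hk')
      · push Not at c₁ c₂
        have hf : ∀ i k, k ≤ a.len i → Hom.toFun f i k = k := fun i k => by
          induction k with
          | zero => exact fun _ => Hom.map_zero f i
          | succ k ih =>
            intro hk
            have h₁ := ih (by omega)
            have h₂ := c₁ i k (by omega)
            have h₃ := c₂ i k (by omega)
            have h₄ := Hom.mono f i (Nat.le_succ k)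
            rw [Nat.succ_eq_add_one] at h₄
            omega
        obtain rfl : a = b := Theta.ext (funext fun i => (hf i _ le_rfl).symm.trans (map_len f i))
        obtain rfl : f = 𝟙 a := hom_ext_of_lt fun i p hp => hf i p hp.le
        exact isMor_id a

/-- The functor from the combinatorial model to fat graphs. -/
noncomputable def toGraph : Theta ⥤ FatGraph 0 3 where
  obj := graph
  -- The choice of the corner fibres is harmless, as they are determined by the edge paths.
  map {a b} f := ⟨transportPath a.flag b.flag (path f), (isMor f).choose, (isMor f).choose_spec⟩
  map_id a := TMHom.ext_path (funext fun x => by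
    change (path (𝟙 a) _).map a.flag = [x]
    rw [path_id]
    simp)
  map_comp {a b c} f g := TMHom.ext_path (by
    change transportPath a.flag c.flag (path (f ≫ g)) = fun x =>
      (transportPath a.flag b.flag (path f) x).flatMap (transportPath b.flag c.flag (path g))
    rw [← transportPath_comp, ← funext (path_comp f g)])

theorem toGraph_map_path {a b : Theta} (f : a ⟶ b) (x : a.Corner) :
    TMHom.path (toGraph.map f) (a.flag x) = (path f x).map b.flag := by
  change (path f (a.flag.symm (a.flag x))).map b.flag = _
  rw [Equiv.symm_apply_apply]

end Theta

/-! ### The boundary components of the graphs of the combinatorial model -/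

/-- An isomorphism of polygons given by a bijection of the vertices. -/
def Polygon.isoOfEquiv {X Y : Polygon} (e : X.V ≃ Y.V) (h : ∀ x, e (X.next x) = Y.next (e x)) :
    X ≅ Y where
  hom := homOfPath (fun y => [e.symm y])
    ⟨fun _ => List.nodup_singleton _, fun x => ⟨e x, by simp, fun y hy => by
      rw [List.mem_singleton.1 hy, e.apply_symm_apply]⟩⟩ e.symm fun y =>
        ⟨rfl, (by rw [Equiv.eq_symm_apply, h, e.apply_symm_apply] :
          X.next (e.symm y) = e.symm (Y.next y))⟩
  inv := homOfPath (fun x => [e x])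
    ⟨fun _ => List.nodup_singleton _, fun y => ⟨e.symm y, by simp, fun x hx => by
      rw [List.mem_singleton.1 hx, e.symm_apply_apply]⟩⟩ e fun x => ⟨rfl, (h x).symm⟩
  hom_inv_id := Polygon.hom_ext fun x => by
    change [e x].flatMap (fun y => [e.symm y]) = [x]
    simp
  inv_hom_id := Polygon.hom_ext fun y => by
    change [e.symm y].flatMap (fun x => [e x]) = [y]
    simp

/-- The first of the two conditions in `Linked`. -/
def Linked₁ {X Y : Type} (φ : X → X) (path : X → List Y) (fiber : Y → List X) : Prop :=
  ∀ y x l, x :: l <:+ fiber y →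
    (l = [] → ∃ t, path x = y :: t) ∧ ∀ z t, l = z :: t → path x = [] ∧ z = φ x

/-- The edge path of `x` tells how its fibre goes on: if it is empty, `φ x` comes next; if not, `x`
is the last corner and the path begins with the point over which it lies. So the fibres are
determined from their ends backwards. -/
theorem Linked₁.suffix {X Y : Type} {φ : X → X} {path : X → List Y} {r r' : Y → List X}
    (h : Linked₁ φ path r) (h' : Linked₁ φ path r') (hf : IsFibering r') (y : Y) (l : List X)
    (hl : l <:+ r y) : l <:+ r' y := by
  induction l with
  | nil => exact List.nil_suffix
  | cons x l ih =>
    obtain ⟨y', hy', -⟩ := hf.2 x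
    obtain ⟨l₁, l₂, hl₂⟩ := List.append_of_mem hy'
    have hs : x :: l₂ <:+ r' y' := ⟨l₁, hl₂.symm⟩
    have a₁ := h y x l hl
    have a₂ := h' y' x l₂ hs
    cases l with
    | nil =>
      obtain ⟨t, ht⟩ := a₁.1 rfl
      cases l₂ with
      | nil =>
        obtain ⟨t', ht'⟩ := a₂.1 rfl
        rw [ht, List.cons.injEq] at ht'
        rwa [ht'.1]
      | cons z l₂ => simp [ht] at a₂
    | cons z l =>
      obtain ⟨b₁, b₂⟩ := a₁.2 _ _ rfl
      cases l₂ with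
      | nil => simp [b₁] at a₂
      | cons z' l₂ =>
        obtain ⟨-, b₃⟩ := a₂.2 _ _ rfl
        obtain rfl := b₂.trans b₃.symm
        have hz := ih ((List.suffix_cons _ _).trans hl)
        have hz' := (List.suffix_cons _ _).trans hs
        obtain rfl : y' = y := (hf.2 z).unique (hz'.subset (by simp)) (hz.subset (by simp))
        rcases List.suffix_or_suffix_of_suffix hz hz' with e | e
        · rcases List.suffix_cons_iff.1 e with e | e
          · rwa [e]
          · have hn := (hf.1 y').sublist hz'.sublist
            exact absurd (e.subset (List.mem_cons_self)) (List.nodup_cons.1 hn).1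
        · rcases List.suffix_cons_iff.1 e with e | e
          · rwa [← e]
          · have hn := (hf.1 y').sublist hz.sublist
            exact absurd (e.subset (List.mem_cons_self)) (List.nodup_cons.1 hn).1

theorem Linked₁.unique {X Y : Type} {φ : X → X} {path : X → List Y} {r r' : Y → List X}
    (h : Linked₁ φ path r) (h' : Linked₁ φ path r') (hf : IsFibering r) (hf' : IsFibering r') :
    r = r' := by
  funext y
  have s₁ := h.suffix h' hf' y _ List.suffix_rfl
  have s₂ := h'.suffix h hf y _ List.suffix_rfl
  exact s₁.eq_of_length (le_antisymm s₁.length_le s₂.length_le)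

namespace DeltaTwo

/-- A preimage under a monotone map consists of consecutive points, so a point is followed in it by
its successor whenever that has the same value. -/
theorem interior_suffix {a b : DeltaTwo} (f : Hom a b) (j : Fin (b.n + 2)) {x : Fin (a.n + 1)}
    {l : List (Fin (a.n + 1))} (h : x :: l <:+ interior f j) :
    (l = [] → f.toFun x.succ = j → x = Fin.last _) ∧
      ∀ z t, l = z :: t → z.val = x.val + 1 ∧ f.toFun x.succ = j := by
  obtain ⟨p, hp⟩ := h
  have hs := interior_sorted f j
  rw [← hp] at hs
  have hs' := List.pairwise_append.1 hs
  have hx : f.toFun x.castSucc = j := (mem_interior f j x).1 (by rw [← hp]; simp)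
  have key : ∀ w : Fin (a.n + 1), w.val = x.val + 1 → f.toFun w.castSucc = j → w ∈ l := by
    intro w hw hj
    have hm := (mem_interior f j w).2 hj
    rw [← hp, List.mem_append, List.mem_cons] at hm
    rcases hm with hm | rfl | hm
    · have := hs'.2.2 w hm x (by simp)
      rw [Fin.lt_def] at this
      omega
    · omega
    · exact hm
  constructor
  · rintro rfl hj
    by_contra hl
    have hlt := Fin.val_lt_last hl
    have := key ⟨x.val + 1, by simpa using hlt⟩ rfl hj
    simp at this
  · rintro z t rfl
    have hz : f.toFun z.castSucc = j := (mem_interior f j z).1 (by rw [← hp]; simp)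
    have hxz : x < z := (List.pairwise_cons.1 hs'.2.1).1 z (by simp)
    have hxz' := hxz
    rw [Fin.lt_def] at hxz'
    have hj : f.toFun x.succ = j := by
      refine le_antisymm ?_ ?_
      · rw [← hz]
        refine f.monotone ?_
        rw [Fin.le_def, Fin.val_succ, Fin.val_castSucc]
        omega
      · rw [← hx]
        exact f.monotone Fin.castSucc_lt_succ.le
    refine ⟨?_, hj⟩
    have hm := key ⟨x.val + 1, by have := z.2; omega⟩ rfl hj
    rcases List.mem_cons.1 hm with e | hm
    · rw [← e]
    · have := (List.pairwise_cons.1 (List.pairwise_cons.1 hs'.2.1).2).1 _ hm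
      rw [Fin.lt_def] at this
      dsimp only at this
      omega

end DeltaTwo

/-! ### Corner fibres of the morphisms of the model -/

namespace Theta

/-- The ordered fibres of the corners under a morphism. -/
def fiber {a b : Theta} (f : a ⟶ b) (y : b.Corner) : List a.Corner :=
  (DeltaTwo.fiber ((cut y.idx).map f) ⟨y.pos, by
    have := y.lt
    have := b.bd_pos y.idx
    change _ < b.bd y.idx - 1 + 1
    omega⟩).map fun p => a.corner y.idx p.val

theorem corner_pos_fin (a : Theta) (i : Fin 3) (p : Fin (a.bd i - 1 + 1)) : p.val < a.bd i := by
  have := p.2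
  have := a.bd_pos i
  omega

theorem corner_injective (a : Theta) (i : Fin 3) :
    Function.Injective fun p : Fin (a.bd i - 1 + 1) => a.corner i p.val := fun p q h => by
  have h := congrArg Corner.pos h
  rw [corner_pos (a.corner_pos_fin i p), corner_pos (a.corner_pos_fin i q)] at h
  exact Fin.ext h

theorem fiber_isFibering {a b : Theta} (f : a ⟶ b) : IsFibering (fiber f) := by
  refine ⟨fun y => ?_, fun x => ?_⟩
  · exact ((DeltaTwo.fiber_isFibering _).1 _).map (a.corner_injective _)
  · have hx : x.pos < a.bd x.idx - 1 + 1 := by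
      have := x.lt
      omega
    obtain ⟨q, hq, hu⟩ := (DeltaTwo.fiber_isFibering ((cut x.idx).map f)).2 ⟨x.pos, hx⟩
    refine ⟨⟨x.idx, q.val, b.corner_pos_fin _ q⟩, List.mem_map.2 ⟨⟨x.pos, hx⟩, hq, a.corner_eq x⟩,
      fun y hy => ?_⟩
    obtain ⟨p, hp, rfl⟩ := List.mem_map.1 hy
    refine Corner.ext rfl ?_
    have e : (⟨(a.corner y.idx p.val).pos, hx⟩ : Fin (a.bd y.idx - 1 + 1)) = p :=
      Fin.ext (corner_pos (a.corner_pos_fin _ p))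
    have := hu _ (e ▸ hp)
    exact congrArg Fin.val this

theorem path_corner {a b : Theta} (f : a ⟶ b) {i : Fin 3} {p : ℕ} (hp : p < a.bd i) :
    path f (a.corner i p) =
      (List.range' (bdMap f i p) (bdMap f i (p + 1) - bdMap f i p)).map (b.corner i) := by
  rw [path, corner_pos hp]
  rfl

theorem next_corner {a : Theta} {i : Fin 3} {p : ℕ} (hp : p < a.bd i) :
    a.next (a.corner i p) = a.corner i (p + 1) := by
  rw [next_eq, corner_pos hp]
  rfl

theorem corner_bd (a : Theta) (i : Fin 3) : a.corner i (a.bd i) = a.corner i 0 :=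
  Corner.ext rfl (by simp [corner])

theorem linked₁_interior {a b : Theta} (f : a ⟶ b) (i : Fin 3) {q : ℕ} (hq : q < b.bd i)
    {j : Fin (b.bd i - 1 + 2)} (hj : j.val = q) {x : Fin (a.bd i - 1 + 1)}
    {l : List (Fin (a.bd i - 1 + 1))} (h : x :: l <:+ DeltaTwo.interior ((cut i).map f) j) :
    (l = [] → ∃ t, path f (a.corner i x.val) = b.corner i q :: t) ∧
      ∀ z t, l = z :: t → path f (a.corner i x.val) = [] ∧
        a.corner i z.val = a.next (a.corner i x.val) := by
  have hx := a.corner_pos_fin i x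
  have h₀ : bdMap f i x.val = q := by
    have := (DeltaTwo.mem_interior _ _ x).1 (h.subset List.mem_cons_self)
    rw [← hj, ← this]
    rfl
  have h₁ : (DeltaTwo.Hom.toFun ((cut i).map f) x.succ).val = bdMap f i (x.val + 1) := rfl
  obtain ⟨h₂, h₃⟩ := DeltaTwo.interior_suffix _ _ h
  rw [path_corner f hx, next_corner hx, h₀]
  have hm := bdMap_mono f i (Nat.le_succ x.val)
  rw [h₀, Nat.succ_eq_add_one] at hm
  constructor
  · intro hl
    have hne : bdMap f i (x.val + 1) ≠ q := fun e => by
      have hlast := h₂ hl (Fin.ext (h₁.trans (e.trans hj.symm)))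
      have hv : x.val = a.bd i - 1 := congrArg Fin.val hlast
      rw [show x.val + 1 = a.bd i by omega, bdMap_bd] at e
      omega
    obtain ⟨m, hm⟩ : ∃ m, bdMap f i (x.val + 1) - q = m + 1 :=
      ⟨bdMap f i (x.val + 1) - q - 1, by omega⟩
    rw [hm, List.range'_succ, List.map_cons]
    exact ⟨_, rfl⟩
  · intro z t hl
    obtain ⟨h₄, h₅⟩ := h₃ z t hl
    have h₆ := congrArg Fin.val h₅
    rw [h₁, hj] at h₆
    rw [h₄, h₆]
    simp

theorem suffix_append {X : Type} {x : X} {l A B : List X} (h : x :: l <:+ A ++ B) :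
    x :: l <:+ B ∨ ∃ l', l = l' ++ B ∧ x :: l' <:+ A := by
  obtain ⟨p, hp⟩ := h
  rcases List.append_eq_append_iff.1 hp with ⟨c, h₁, h₂⟩ | ⟨c, h₁, h₂⟩
  · cases c with
    | nil => exact Or.inl ⟨[], by simpa using h₂⟩
    | cons y c =>
      rw [List.cons_append, List.cons.injEq] at h₂
      obtain ⟨rfl, rfl⟩ := h₂
      exact Or.inr ⟨c, rfl, p, h₁.symm⟩
  · exact Or.inl ⟨c, h₂.symm⟩

/-- Only the glued vertex needs care: its fibre is the preimage of the greatest element followed by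
that of the least. The latter contains `0`, so no corner of the first part is last, and at the
junction the last corner of the component is followed by the first one, across the cut. -/
theorem linked₁_fiber {a b : Theta} (f : a ⟶ b) (i : Fin 3) (y : Fin (b.bd i - 1 + 1))
    {x : Fin (a.bd i - 1 + 1)} {l : List (Fin (a.bd i - 1 + 1))}
    (h : x :: l <:+ DeltaTwo.fiber ((cut i).map f) y) :
    (l = [] → ∃ t, path f (a.corner i x.val) = b.corner i y.val :: t) ∧
      ∀ z t, l = z :: t → path f (a.corner i x.val) = [] ∧
        a.corner i z.val = a.next (a.corner i x.val) := by
  have hb := b.bd_pos i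
  unfold DeltaTwo.fiber at h
  split_ifs at h with hy
  · have hm : (0 : Fin (a.bd i - 1 + 1)) ∈ DeltaTwo.interior ((cut i).map f) 0 :=
      (DeltaTwo.mem_interior ((cut i).map f) 0 0).2 (DeltaTwo.Hom.map_zero ((cut i).map f))
    rcases suffix_append h with h | ⟨l', rfl, h'⟩
    · exact linked₁_interior f i (b.corner_pos_fin i y) (by rw [hy]; rfl) h
    · have h₀ : DeltaTwo.interior ((cut i).map f) 0 ≠ [] := List.ne_nil_of_mem hm
      have hx := a.corner_pos_fin i x
      have h₁ := (DeltaTwo.mem_interior _ _ x).1 (h'.subset List.mem_cons_self)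
      have h₂ : bdMap f i x.val = b.bd i := by
        have : bdMap f i x.val = b.bd i - 1 + 1 := congrArg Fin.val h₁
        omega
      have h₃ : bdMap f i (x.val + 1) = b.bd i :=
        le_antisymm (bdMap_le f i _) (h₂ ▸ bdMap_mono f i (Nat.le_succ _))
      have hp : path f (a.corner i x.val) = [] := by
        rw [path_corner f hx, h₂, h₃]
        simp
      refine ⟨fun e => absurd (List.append_eq_nil_iff.1 e).2 h₀, fun z t hz => ⟨hp, ?_⟩⟩
      rw [next_corner hx]
      obtain ⟨h₄, h₅⟩ := DeltaTwo.interior_suffix _ _ h'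
      cases l' with
      | cons w l' =>
        rw [List.cons_append, List.cons.injEq] at hz
        rw [← hz.1, (h₅ w l' rfl).1]
      | nil =>
        have hlast := h₄ rfl (Fin.ext (h₃.trans (Nat.sub_add_cancel hb).symm))
        have hv : x.val = a.bd i - 1 := congrArg Fin.val hlast
        rw [show x.val + 1 = a.bd i by omega, corner_bd]
        have hz' : z = 0 := by
          rw [List.nil_append] at hz
          have hs : (z :: t).Pairwise (· < ·) :=
            Eq.subst (motive := fun L => List.Pairwise (· < ·) L) hz
              (DeltaTwo.interior_sorted ((cut i).map f) 0)
          have hm : (0 : Fin (a.bd i - 1 + 1)) ∈ z :: t :=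
            Eq.subst (motive := fun L => (0 : Fin (a.bd i - 1 + 1)) ∈ L) hz hm
          rcases List.mem_cons.1 hm with e | hm
          · exact e.symm
          · exact absurd ((List.pairwise_cons.1 hs).1 _ hm) (Fin.not_lt_zero z)
        rw [hz']
        rfl
  · exact linked₁_interior f i (b.corner_pos_fin i y) rfl h

theorem linked₁ {a b : Theta} (f : a ⟶ b) : Linked₁ a.next (path f) (fiber f) := by
  intro y x l h
  obtain ⟨L, hL, e⟩ : ∃ L, L <:+ DeltaTwo.fiber ((cut y.idx).map f) ⟨y.pos, _⟩ ∧
      x :: l = L.map fun p => a.corner y.idx p.val := by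
    obtain ⟨p, hp⟩ := h
    obtain ⟨p', L, h₁, -, h₂⟩ := List.map_eq_append_iff.1 hp.symm
    exact ⟨L, ⟨p', h₁.symm⟩, h₂.symm⟩
  cases L with
  | nil => simp at e
  | cons w L =>
    rw [List.map_cons, List.cons.injEq] at e
    obtain ⟨rfl, rfl⟩ := e
    obtain ⟨h₁, h₂⟩ := linked₁_fiber f y.idx _ hL
    rw [b.corner_eq] at h₁
    refine ⟨fun e => h₁ (List.map_eq_nil_iff.1 e), fun z t e => ?_⟩
    obtain ⟨z', t', h₃, rfl, -⟩ := List.map_eq_cons_iff.1 e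
    exact h₂ z' t' h₃

theorem φ_flag (a : Theta) (x : a.Corner) : a.graph.φ (a.flag x) = a.flag (a.next x) :=
  (FatGraph.of_φ a.isFat x).trans (congrArg (fun y => a.flag (a.next y)) (a.flip_flip x))

theorem corner_of_idx {a : Theta} {x : a.Corner} {i : Fin 3} (h : x.idx = i) :
    a.corner i x.pos = x := by
  subst h
  exact a.corner_eq x

/-- The fibres of the chosen morphism and the explicit ones are linked to the same edge paths, hence
equal. This makes the boundary maps of the model computable. -/
theorem toGraph_map_fiber {a b : Theta} (f : a ⟶ b) (y : b.Corner) :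
    TMHom.fiber (toGraph.map f) (b.flag y) = (fiber f y).map a.flag := by
  let F : TMHom a.graph b.graph := toGraph.map f
  have hm := F.isMor
  let r : b.Corner → List a.Corner := fun y =>
    (TMHom.fiber F (b.flag y)).map a.flag.symm
  have hr : IsFibering r := by
    refine ⟨fun y => (hm.isFibering.1 _).map a.flag.symm.injective, fun x => ?_⟩
    obtain ⟨z, hz, hu⟩ := hm.isFibering.2 (a.flag x)
    refine ⟨b.flag.symm z, ?_, fun y hy => ?_⟩
    · refine List.mem_map.2 ⟨a.flag x, ?_, by simp⟩
      rw [Equiv.apply_symm_apply]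
      exact hz
    · obtain ⟨w, hw, rfl⟩ := List.mem_map.1 hy
      rw [Equiv.eq_symm_apply]
      exact hu _ (by simpa using hw)
  have hl : Linked₁ a.next (path f) r := by
    intro y x l h
    have h' : a.flag x :: l.map a.flag <:+ TMHom.fiber F (b.flag y) := by
      obtain ⟨p, hp⟩ := h
      have := congrArg (List.map a.flag) hp
      simp only [r, List.map_map, Equiv.self_comp_symm, List.map_id, List.map_append,
        List.map_cons] at this
      exact ⟨_, this⟩
    obtain ⟨h₁, h₂⟩ := hm.linked.1 _ _ _ h'
    have hp : F.path (a.flag x) = (path f x).map b.flag := toGraph_map_path f x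
    rw [hp] at h₁ h₂
    refine ⟨fun e => ?_, fun z t e => ?_⟩
    · obtain ⟨t, ht⟩ := h₁ (by rw [e]; rfl)
      obtain ⟨y', t', h₃, h₄, -⟩ := List.map_eq_cons_iff.1 ht
      exact ⟨t', by rw [h₃, b.flag.injective h₄]⟩
    · obtain ⟨h₃, h₄⟩ := h₂ (a.flag z) (t.map a.flag) (by rw [e]; rfl)
      exact ⟨List.map_eq_nil_iff.1 h₃, a.flag.injective (h₄.trans (a.φ_flag x))⟩
  have := congrFun (hl.unique (linked₁ f) hr (fiber_isFibering f)) y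
  change F.fiber (b.flag y) = _
  rw [← this]
  simp [r]

/-- The corners on a boundary component. -/
noncomputable def boundaryEquiv (a : Theta) (i : Fin 3) :
    (a.graph.boundaryPolygon i).V ≃ Fin (a.bd i - 1 + 1) where
  toFun x := ⟨(a.flag.symm x.1).pos, by
    have h₁ := (a.flag.symm x.1).lt
    have h₂ : (a.flag.symm x.1).idx = i := by
      rw [← a.realizes.mark_eq, Equiv.apply_symm_apply]
      exact x.2
    rw [h₂] at h₁
    omega⟩
  invFun p := ⟨a.flag (a.corner i p.val), a.realizes.mark_eq _⟩
  left_inv x := Subtype.ext (by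
    have h₂ : (a.flag.symm x.1).idx = i := by
      rw [← a.realizes.mark_eq, Equiv.apply_symm_apply]
      exact x.2
    exact (congrArg a.flag (corner_of_idx h₂)).trans (Equiv.apply_symm_apply _ _))
  right_inv p := Fin.ext (by
    dsimp only
    rw [Equiv.symm_apply_apply, corner_pos (a.corner_pos_fin i p)])

/-- The boundary components of the graphs of the combinatorial model. -/
noncomputable def boundaryIso (a : Theta) (i : Fin 3) :
    a.graph.boundaryPolygon i ≅ DeltaTwo.toPolygon.obj ((cut i).obj a) :=
  (Polygon.isoOfEquiv (X := DeltaTwo.polygon ⟨a.bd i - 1⟩) (a.boundaryEquiv i).symm fun p => by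
    refine Subtype.ext ?_
    have hp := a.corner_pos_fin i p
    refine Eq.trans ?_ (a.φ_flag (a.corner i p.val)).symm
    rw [next_corner hp]
    change a.flag (a.corner i (finRotate (a.bd i - 1 + 1) p).val) = _
    congr 1
    rcases eq_or_ne p (Fin.last _) with rfl | h
    · have e : (finRotate (a.bd i - 1 + 1) (Fin.last _)).val = 0 := by
        rw [finRotate_last]
        rfl
      refine (congrArg (a.corner i) e).trans (Eq.symm ?_)
      exact (congrArg (a.corner i) (Nat.sub_add_cancel (a.bd_pos i))).trans (a.corner_bd i)
    · rw [coe_finRotate_of_ne_last h]).symm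

/-- The boundary functors on the combinatorial model. -/
noncomputable def toGraphBoundary (i : Fin 3) :
    toGraph ⋙ FatGraph.boundary 0 i ≅ cut i ⋙ DeltaTwo.toPolygon :=
  NatIso.ofComponents (fun a => a.boundaryIso i) fun {a b} f => Polygon.hom_ext fun p => by
    refine (List.map_injective_iff.2 Subtype.val_injective) ?_
    change ([(b.boundaryEquiv i).symm p].flatMap (FatGraph.boundaryFiber (toGraph.map f) i)).map
      Subtype.val = ((DeltaTwo.fiber ((cut i).map f) p).flatMap fun q =>
        [(a.boundaryEquiv i).symm q]).map Subtype.val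
    have hp := b.corner_pos_fin i p
    refine (congrArg (List.map Subtype.val) (List.append_nil _)).trans ?_
    refine (FatGraph.map_val_boundaryFiber (toGraph.map f) i _).trans ?_
    refine (toGraph_map_fiber f (b.corner i p.val)).trans ?_
    have e : (⟨(b.corner i p.val).pos, by rw [corner_pos hp]; exact p.2⟩ :
        Fin (b.bd i - 1 + 1)) = p := Fin.ext (corner_pos hp)
    have key : ∀ L : List (Fin (a.bd i - 1 + 1)),
        (L.map fun q => a.corner i q.val).map a.flag =
          (L.flatMap fun q => [(a.boundaryEquiv i).symm q]).map Subtype.val := fun L => by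
      induction L with
      | nil => rfl
      | cons q L ih => exact congrArg (fun l => a.flag (a.corner i q.val) :: l) ih
    exact (congrArg (fun L : List (Fin (a.bd i - 1 + 1)) =>
      (L.map fun q : Fin (a.bd i - 1 + 1) => a.corner i q.val).map a.flag)
      (congrArg (DeltaTwo.fiber ((cut i).map f)) e)).trans (key _)

/-- All three boundary functors on the combinatorial model. -/
noncomputable def toGraphBoundaryTriple : toGraph ⋙ boundaryTriple 0 ≅ cutAll ⋙ deltaTriple :=
  NatIso.ofComponents (fun a => Iso.prod ((toGraphBoundary 0).app a)
    (Iso.prod ((toGraphBoundary 1).app a) ((toGraphBoundary 2).app a))) fun f =>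
      Prod.ext ((toGraphBoundary 0).hom.naturality f)
        (Prod.ext ((toGraphBoundary 1).hom.naturality f) ((toGraphBoundary 2).hom.naturality f))

end Theta

/-! ### Edge maps -/

section EdgeMap

theorem IsFibering.nodup_flatMap {X Y : Type} {r : Y → List X} (hr : IsFibering r) {l : List Y}
    (hl : l.Nodup) : (l.flatMap r).Nodup := by
  refine List.nodup_flatMap.2 ⟨fun y _ => hr.1 y, hl.imp fun {y y'} hne x hx hx' => hne ?_⟩
  exact (hr.2 x).unique hx hx'

/-- The properties of the edge paths of the maps of surfaces: they respect the boundary components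
and the reversal of edges, every edge of the target is traversed exactly once, and going around a
boundary component of the source amounts to going around the one of the target. -/
structure IsEdgeMap {X Y M : Type} (σ τ : Equiv.Perm X) (m : X → M) (σ' τ' : Equiv.Perm Y)
    (m' : Y → M) (p : X → List Y) : Prop where
  mark_eq : ∀ x, ∀ y ∈ p x, m' y = m x
  reverse : ∀ x, p (τ x) = ((p x).map τ').reverse
  isFibering : IsFibering p
  exists_path : ∃ t : X → Y, ∀ x, IsPath (fun y => σ' (τ' y)) (t x) (p x) (t (σ (τ x)))

variable {X Y Z M : Type} {σ τ : Equiv.Perm X} {m : X → M} {σ' τ' : Equiv.Perm Y} {m' : Y → M}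
  {σ'' τ'' : Equiv.Perm Z} {m'' : Z → M}

theorem IsEdgeMap.flatMap_reverse {p : X → List Y} (h : IsEdgeMap σ τ m σ' τ' m' p) (l : List X) :
    (l.map τ).reverse.flatMap p = ((l.flatMap p).map τ').reverse := by
  induction l with
  | nil => rfl
  | cons x l ih => simp [List.flatMap_append, ih, h.reverse]

theorem IsEdgeMap.comp {p : X → List Y} {q : Y → List Z} (h : IsEdgeMap σ τ m σ' τ' m' p)
    (h' : IsEdgeMap σ' τ' m' σ'' τ'' m'' q) :
    IsEdgeMap σ τ m σ'' τ'' m'' fun x => (p x).flatMap q where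
  mark_eq x z hz := by
    obtain ⟨y, hy, hz⟩ := List.mem_flatMap.1 hz
    exact (h'.mark_eq y z hz).trans (h.mark_eq x y hy)
  reverse x := by
    rw [h.reverse, h'.flatMap_reverse]
  isFibering := h'.isFibering.comp h.isFibering
  exists_path := by
    obtain ⟨t, ht⟩ := h.exists_path
    obtain ⟨t', ht'⟩ := h'.exists_path
    exact ⟨fun x => t' (t x), fun x => IsPath.flatMap ht' (ht x)⟩

theorem isEdgeMap_of_equiv (e : X ≃ Y) (hσ : ∀ x, e (σ x) = σ' (e x)) (hτ : ∀ x, e (τ x) = τ' (e x))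
    (hm : ∀ x, m' (e x) = m x) : IsEdgeMap σ τ m σ' τ' m' fun x => [e x] where
  mark_eq x y hy := by rw [List.mem_singleton.1 hy, hm]
  reverse x := by simp [hτ]
  isFibering := ⟨fun _ => List.nodup_singleton _, fun y => ⟨e.symm y, by simp, fun x hx => by
    rw [List.mem_singleton.1 hx, Equiv.symm_apply_apply]⟩⟩
  exists_path := ⟨e, fun x => ⟨rfl, by rw [hσ, hτ]; rfl⟩⟩

theorem IsShrink.isEdgeMap [Finite X] {a : X} {ι : Y → X} (H : IsShrink σ τ σ' τ' a ι)
    (hσ : ∀ x, σ x ≠ x) (hτ : ∀ x, τ (τ x) = x) (hne : ∀ x, τ x ≠ x) (hm : ∀ y, m' y = m (ι y))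
    {p : X → List Y} (ha : p a = []) (hb : p (τ a) = []) (hp : ∀ y, p (ι y) = [y]) :
    IsEdgeMap σ τ m σ' τ' m' p where
  mark_eq := by
    refine H.cases_flag _ ?_ ?_ fun y => ?_
    · simp [ha]
    · simp [hb]
    · simp [hp, hm]
  reverse := by
    refine H.cases_flag _ ?_ ?_ fun y => ?_
    · simp [ha, hb]
    · simp [ha, hb, hτ]
    · rw [← H.τ_eq]
      simp [hp]
  isFibering := by
    refine ⟨H.cases_flag _ ?_ ?_ fun y => ?_, fun y => ⟨ι y, ?_, ?_⟩⟩
    · simp [ha]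
    · simp [hb]
    · simp [hp]
    · simp [hp]
    · refine H.cases_flag _ ?_ ?_ fun z => ?_
      · simp [ha]
      · simp [hb]
      · simp only [hp, List.mem_singleton]
        rintro rfl
        rfl
  exists_path := by
    obtain ⟨⟨y₁, h₁⟩, y₂, h₂⟩ := H.exists_next hσ
    -- An empty path still has a starting point: for a contracted flag it is the corner which
    -- follows it.
    obtain ⟨t, ta, tb, ht⟩ := H.exists_extension (hne a) id y₁ y₂
    refine ⟨t, H.cases_flag _ ?_ ?_ fun y => ?_⟩
    · rw [ha, ← h₁, ht, ta]
      rfl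
    · rw [hb, hτ, ← h₂, ht, tb]
      rfl
    · rw [hp, ht]
      refine ⟨rfl, ?_⟩
      change σ' (τ' y) = t _
      by_cases c₁ : σ (τ (ι y)) = a
      · rw [c₁, ta]
        exact H.next_left h₁ (by rw [H.τ_eq, c₁])
      · by_cases c₂ : σ (τ (ι y)) = τ a
        · rw [c₂, tb]
          exact H.next_right h₂ (by rw [H.τ_eq, c₂])
        · rw [← H.φ_of_ne c₁ c₂, ht]
          rfl

/-- An edge map which contracts an edge factors through the shrinking of this edge. -/
theorem IsEdgeMap.restrict {a : X} {ι : Y → X} (H : IsShrink σ τ σ' τ' a ι)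
    (hτ : ∀ x, τ (τ x) = x) (hm : ∀ y, m' y = m (ι y)) {p : X → List Z}
    (h : IsEdgeMap σ τ m σ'' τ'' m'' p) (ha : p a = []) (hb : p (τ a) = []) :
    IsEdgeMap σ' τ' m' σ'' τ'' m'' fun y => p (ι y) where
  mark_eq y z hz := by rw [hm, h.mark_eq _ z hz]
  reverse y := by rw [H.τ_eq, h.reverse]
  isFibering := by
    refine ⟨fun y => h.isFibering.1 _, fun z => ?_⟩
    obtain ⟨x, hx, hu⟩ := h.isFibering.2 z
    obtain ⟨y, rfl⟩ := H.exists_of_ne (x := x) (by rintro rfl; simp [ha] at hx)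
      (by rintro rfl; simp [hb] at hx)
    exact ⟨y, hx, fun y' hy' => H.injective (hu _ hy')⟩
  exists_path := by
    obtain ⟨t, ht⟩ := h.exists_path
    refine ⟨fun y => t (ι y), fun y => ?_⟩
    have h₁ := ht a
    have h₂ := ht (τ a)
    rw [ha] at h₁
    rw [hb, hτ] at h₂
    -- Since the paths of `a` and `τ a` are empty, `t` has the same value at these corners and at
    -- the ones after them, so passing over them is not noticed.
    have e : t (ι (σ' (τ' y))) = t (σ (τ (ι y))) := by
      by_cases c₁ : σ (τ (ι y)) = a
      · rw [H.φ_of_left c₁, c₁]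
        exact h₁.symm
      · by_cases c₂ : σ (τ (ι y)) = τ a
        · rw [H.φ_of_right c₂, c₂]
          exact h₂.symm
        · rw [H.φ_of_ne c₁ c₂]
    dsimp only
    rw [e]
    exact ht _

/-- The universal property of the reflection uses only these conditions, and not the decomposition
of a morphism into generators. -/
theorem FatGraph.IsMor.isEdgeMap {g n : ℕ} {Γ Γ' : FatGraph g n} {path fiber}
    (h : IsMor Γ Γ' path fiber) : IsEdgeMap Γ.σ Γ.τ Γ.mark Γ'.σ Γ'.τ Γ'.mark path := by
  induction h with
  | comp h h' ih ih' => exact ih.comp ih'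
  | @iso Γ Γ' path fiber e h hm =>
    rw [funext h.path_eq]
    exact isEdgeMap_of_equiv e (fun x => (h.σ_eq x).symm) (fun x => (h.τ_eq x).symm) fun x =>
      (hm _ _ (by simp [h.fiber_eq])).symm
  | @shrink Γ Γ' path fiber a ι h hm =>
    have H : IsShrink Γ.σ Γ.τ Γ'.σ Γ'.τ a ι :=
      { not_loop := h.not_loop
        injective := h.injective
        mem_range := h.mem_range
        τ_eq := h.τ_eq
        σ_of_left := fun y e => by rw [h.σ_eq, if_pos e]
        σ_of_right := fun y e => by rw [h.σ_eq, e, if_neg (Γ.τ_ne a), if_pos rfl]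
        σ_of_ne := fun y e e' => by rw [h.σ_eq, if_neg e, if_neg e'] }
    refine H.isEdgeMap Γ.σ_ne Γ.τ_τ Γ.τ_ne (fun y => (hm y _ ?_).symm) h.path_left h.path_right
      h.path_eq
    rw [h.fiber_eq]
    split_ifs <;> simp
  | @insert Γ Γ' path fiber a u v ι h hm =>
    have hτu : Γ'.τ u = ι a := by rw [← h.τ_left, Γ'.τ_τ]
    have hτv : Γ'.τ v = ι (Γ.τ a) := by rw [← h.τ_right, Γ'.τ_τ]
    have huv : u ≠ v := fun e => Γ'.σ_ne u (by rw [h.σ_left, ← e])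
    have hιu : ∀ x, ι x ≠ u := fun x => ((h.mem_range _).1 ⟨x, rfl⟩).1
    have hιv : ∀ x, ι x ≠ v := fun x => ((h.mem_range _).1 ⟨x, rfl⟩).2
    have hmι : ∀ x, Γ'.mark (ι x) = Γ.mark x := fun x => (hm _ _ (by simp [h.fiber_eq])).symm
    have hv : Γ'.φ (ι a) = v := by rw [φ_apply, h.τ_left, h.σ_left]
    have hu : Γ'.φ (ι (Γ.τ a)) = u := by rw [φ_apply, h.τ_right, h.σ_right]
    have hc : ∀ (P : Γ.Flag → Prop), P a → P (Γ.τ a) → (∀ x, x ≠ a → x ≠ Γ.τ a → P x) →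
        ∀ x, P x := fun P h₁ h₂ h₃ x => by
      by_cases c₁ : x = a
      · exact c₁ ▸ h₁
      · by_cases c₂ : x = Γ.τ a
        · exact c₂ ▸ h₂
        · exact h₃ x c₁ c₂
    have hmem : ∀ x z, z ∈ path x ↔ z = ι x ∨ (x = a ∧ z = v) ∨ (x = Γ.τ a ∧ z = u) := by
      refine hc _ (fun z => ?_) (fun z => ?_) fun x h₁ h₂ z => ?_
      · simp [h.path_left, (Γ.τ_ne a).symm]
      · simp [h.path_right, Γ.τ_ne a]
      · simp [h.path_eq x h₁ h₂, h₁, h₂]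
    refine ⟨fun x z hz => ?_, ?_, ⟨?_, fun z => ?_⟩, ι, ?_⟩
    · rcases (hmem x z).1 hz with rfl | ⟨rfl, rfl⟩ | ⟨rfl, rfl⟩
      · exact hmι x
      · rw [← hv, mark_φ, hmι]
      · rw [← hu, mark_φ, hmι]
    · refine hc _ ?_ ?_ fun x h₁ h₂ => ?_
      · simp [h.path_left, h.path_right, hτv, h.τ_left]
      · simp [h.path_left, h.path_right, hτu, h.τ_right, Γ.τ_τ]
      · have h₁' : Γ.τ x ≠ a := fun e => h₂ (by rw [← e, Γ.τ_τ])
        have h₂' : Γ.τ x ≠ Γ.τ a := Γ.τ.injective.ne h₁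
        simp [h.path_eq x h₁ h₂, h.path_eq _ h₁' h₂', h.τ_eq x h₁ h₂]
    · refine hc _ ?_ ?_ fun x h₁ h₂ => ?_
      · simp [h.path_left, hιv]
      · simp [h.path_right, hιu]
      · simp [h.path_eq x h₁ h₂]
    · simp only [hmem]
      by_cases c₁ : z = u
      · subst c₁
        exact ⟨Γ.τ a, Or.inr (Or.inr ⟨rfl, rfl⟩), fun x hx => by
          rcases hx with e | ⟨-, e⟩ | ⟨e, -⟩
          exacts [absurd e.symm (hιu x), absurd e huv, e]⟩
      · by_cases c₂ : z = v
        · subst c₂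
          exact ⟨a, Or.inr (Or.inl ⟨rfl, rfl⟩), fun x hx => by
            rcases hx with e | ⟨e, -⟩ | ⟨-, e⟩
            exacts [absurd e.symm (hιv x), e, absurd e.symm huv]⟩
        · obtain ⟨x, rfl⟩ := (h.mem_range z).2 ⟨c₁, c₂⟩
          exact ⟨x, Or.inl rfl, fun x' hx => by
            rcases hx with e | ⟨-, e⟩ | ⟨-, e⟩
            exacts [(h.injective e).symm, absurd e c₂, absurd e c₁]⟩
    · refine hc _ ?_ ?_ fun x h₁ h₂ => ?_
      · rw [h.path_left]
        refine ⟨rfl, hv.symm, ?_⟩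
        change Γ'.φ (Γ'.φ (ι a)) = _
        rw [hv, φ_apply, hτv, h.σ_eq]
      · rw [h.path_right]
        refine ⟨rfl, hu.symm, ?_⟩
        change Γ'.φ (Γ'.φ (ι (Γ.τ a))) = _
        rw [hu, φ_apply, hτu, h.σ_eq, Γ.τ_τ]
      · rw [h.path_eq x h₁ h₂]
        refine ⟨rfl, ?_⟩
        change Γ'.σ (Γ'.τ (ι x)) = _
        rw [h.τ_eq x h₁ h₂, h.σ_eq]

/-- An edge map of fat graphs as an edge map of sets identified with their flags. -/
theorem IsEdgeMap.realize {g n : ℕ} {Γ Γ' : FatGraph g n} {mark : X → Fin n} {mark' : Y → Fin n}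
    {e : X ≃ Γ.Flag} {e' : Y ≃ Γ'.Flag} (h : Realizes Γ σ τ mark e)
    (h' : Realizes Γ' σ' τ' mark' e') {p : Γ.Flag → List Γ'.Flag}
    (hp : IsEdgeMap Γ.σ Γ.τ Γ.mark Γ'.σ Γ'.τ Γ'.mark p) :
    IsEdgeMap σ τ mark σ' τ' mark' fun x => (p (e x)).map e'.symm := by
  have h₁ : IsEdgeMap σ τ mark Γ.σ Γ.τ Γ.mark fun x => [e x] :=
    isEdgeMap_of_equiv e (fun x => (h.σ_eq x).symm) (fun x => (h.τ_eq x).symm) h.mark_eq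
  have h₂ : IsEdgeMap Γ'.σ Γ'.τ Γ'.mark σ' τ' mark' fun y => [e'.symm y] := by
    refine isEdgeMap_of_equiv e'.symm (fun y => ?_) (fun y => ?_) fun y => ?_ <;>
      obtain ⟨y, rfl⟩ := e'.surjective y
    · simp [h'.σ_eq]
    · simp [h'.τ_eq]
    · simp [h'.mark_eq]
  have h₃ := h₁.comp (hp.comp h₂)
  have key : ∀ l : List Γ'.Flag, (l.flatMap fun y => [e'.symm y]) = l.map e'.symm := fun l => by
    induction l with
    | nil => rfl
    | cons y l ih => exact congrArg (e'.symm y :: ·) ih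
  simpa [key] using h₃

end EdgeMap

/-! ### The edge maps between the graphs of the combinatorial model -/

namespace Theta

/-- The corners at consecutive positions of a boundary component. -/
def segment (a : Theta) (i : Fin 3) (s m : ℕ) : List a.Corner :=
  (List.range' s m).map (a.corner i)

theorem isPath_segment (a : Theta) {i : Fin 3} {s m : ℕ} (h : s + m ≤ a.bd i) :
    IsPath a.next (a.corner i s) (a.segment i s m) (a.corner i (s + m)) := by
  induction m generalizing s with
  | zero => rfl
  | succ m ih =>
    refine ⟨rfl, ?_⟩
    rw [next_corner (by omega)]
    have := ih (s := s + 1) (by omega)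
    rwa [show s + 1 + m = s + (m + 1) by omega] at this

theorem mem_segment (a : Theta) {i : Fin 3} {s m : ℕ} (h : s + m ≤ a.bd i) {x : a.Corner} :
    x ∈ a.segment i s m ↔ x.idx = i ∧ s ≤ x.pos ∧ x.pos < s + m := by
  unfold segment
  rw [List.mem_map]
  constructor
  · rintro ⟨q, hq, rfl⟩
    rw [List.mem_range'_1] at hq
    rw [corner_pos (by omega)]
    exact ⟨rfl, hq⟩
  · rintro ⟨rfl, hx⟩
    exact ⟨x.pos, List.mem_range'_1.2 hx, a.corner_eq x⟩

theorem nodup_segment (a : Theta) {i : Fin 3} {s m : ℕ} (h : s + m ≤ a.bd i) :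
    (a.segment i s m).Nodup := by
  refine List.Nodup.map_on (fun p hp q hq e => ?_) List.nodup_range'
  rw [List.mem_range'_1] at hp hq
  have := congrArg Corner.pos e
  rwa [corner_pos (by omega), corner_pos (by omega)] at this

theorem next_iterate_corner (a : Theta) {i : Fin 3} {s j : ℕ} (h : s + j ≤ a.bd i) :
    (a.next)^[j] (a.corner i s) = a.corner i (s + j) := by
  induction j with
  | zero => rfl
  | succ j ih =>
    rw [Function.iterate_succ_apply', ih (by omega), next_corner (by omega)]
    rfl

/-- A consecutive sequence of corners is determined by the set of its members, unless this consists
of a whole boundary component. -/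
theorem eq_segment_of_isPath (a : Theta) {i : Fin 3} {s m : ℕ} {t t' : a.Corner} {l : List a.Corner}
    (hl : IsPath a.next t l t') (hn : l.Nodup)
    (hm : ∀ x, x ∈ l ↔ x.idx = i ∧ s ≤ x.pos ∧ x.pos < s + m) (h : s + m ≤ a.bd i)
    (hlt : m < a.bd i) : l = a.segment i s m := by
  have hp : l.length = m := by
    have := ((List.perm_ext_iff_of_nodup hn (a.nodup_segment h)).2 fun x =>
      (hm x).trans (a.mem_segment h).symm).length_eq
    simpa [segment] using this
  have e := hl.eq_map
  rw [hp] at e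
  rcases Nat.eq_zero_or_pos m with rfl | h₀
  · exact e
  have hx : ∀ j < m, (a.next)^[j] t ∈ l := fun j hj => by
    rw [e]
    exact List.mem_map.2 ⟨j, List.mem_range.2 hj, rfl⟩
  obtain ⟨h₁, h₂, h₃⟩ := (hm t).1 (hx 0 h₀)
  have ht : t = a.corner i t.pos := (corner_of_idx h₁).symm
  -- If the path started behind the position `s`, it would pass the position `s + m`, which is not
  -- among its members.
  rcases h₂.eq_or_lt with h₂ | h₂
  · rw [e, segment, List.range'_eq_map_range, List.map_map]
    refine List.map_congr_left fun j hj => ?_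
    rw [List.mem_range] at hj
    rw [ht, ← h₂, next_iterate_corner a (by omega)]
    rfl
  · have h₄ := hx (s + m - t.pos) (by omega)
    rw [ht, next_iterate_corner a (by rw [← ht]; omega), ← ht, show t.pos + (s + m - t.pos) = s + m by omega,
      hm] at h₄
    obtain ⟨-, h₅, h₆⟩ := h₄
    -- At the end of the component the walk returns to `0`. This is among the members only if `s =
    -- 0`, and then the segment would be the whole component.
    rcases h.eq_or_lt with c | c
    · rw [c, corner_bd, corner_pos (a.bd_pos i)] at h₅
      omega
    · rw [corner_pos c] at h₆
      omega

theorem segment_flip (a : Theta) (i : Fin 3) : a.segment (i + 1) (a.len (i + 1)) (a.len i) =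
    ((a.segment i 0 (a.len i)).map a.flip).reverse := by
  have h := a.bd_add_one i
  refine List.ext_getElem (by simp [segment]) fun j h₁ h₂ => ?_
  have hj : j < a.len i := by simpa [segment] using h₁
  simp only [segment, List.getElem_map, List.getElem_range', List.getElem_reverse, List.length_map,
    List.length_range', Nat.zero_add, Nat.one_mul]
  rw [flip_corner a (by omega)]
  congr 1
  omega

theorem rotate_flip (a : Theta) : (fun x => a.rotate (a.flip x)) = a.next :=
  funext fun x => by rw [rotate, Equiv.Perm.mul_apply, flip_flip]

section

variable {a b : Theta} {p : a.Corner → List b.Corner}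
  (h : IsEdgeMap a.rotate a.flip Corner.idx b.rotate b.flip Corner.idx p)

include h

/-- The position relative to the length of the chain tells which component lies across the edge, and
the components on both sides are preserved. -/
theorem pos_lt_iff {x : a.Corner} {y : b.Corner} (hy : y ∈ p x) :
    y.pos < b.len y.idx ↔ x.pos < a.len x.idx := by
  have h₁ : y.idx = x.idx := h.mark_eq x y hy
  have h₂ : (b.flip y).idx = (a.flip x).idx := h.mark_eq _ _ (by
    rw [h.reverse, List.mem_reverse]
    exact List.mem_map_of_mem hy)
  rcases lt_or_ge y.pos (b.len y.idx) with c | c <;> rcases lt_or_ge x.pos (a.len x.idx) with d | d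
  · exact iff_of_true c d
  · rw [flip_idx_of_lt c, flip_idx_of_ge d, h₁] at h₂
    exact absurd h₂ (add_ne_sub _)
  · rw [flip_idx_of_ge c, flip_idx_of_lt d, h₁] at h₂
    exact absurd h₂.symm (add_ne_sub _)
  · exact iff_of_false c.not_gt d.not_gt

theorem exists_isPath_flatMap {i : Fin 3} {s m : ℕ} (hs : s + m ≤ a.bd i) :
    ∃ t t', IsPath b.next t ((a.segment i s m).flatMap p) t' := by
  obtain ⟨t, ht⟩ := h.exists_path
  have e : ∀ x, a.rotate (a.flip x) = a.next x := congrFun a.rotate_flip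
  simp only [b.rotate_flip, e] at ht
  exact ⟨_, _, IsPath.flatMap ht (a.isPath_segment hs)⟩

theorem mem_flatMap_left {i : Fin 3} {y : b.Corner} :
    y ∈ (a.segment i 0 (a.len i)).flatMap p ↔ y.idx = i ∧ 0 ≤ y.pos ∧ y.pos < 0 + b.len i := by
  have hi : a.bd i = a.len i + a.len (i - 1) := rfl
  rw [List.mem_flatMap]
  constructor
  · rintro ⟨x, hx, hy⟩
    rw [mem_segment a (by omega)] at hx
    have h₁ : y.idx = x.idx := h.mark_eq x y hy
    have h₂ := pos_lt_iff h hy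
    rw [h₁, hx.1] at h₂
    refine ⟨h₁.trans hx.1, Nat.zero_le _, ?_⟩
    rw [zero_add]
    exact h₂.2 (by omega)
  · rintro ⟨h₁, -, h₂⟩
    obtain ⟨x, hy, -⟩ := h.isFibering.2 y
    have h₃ : y.idx = x.idx := h.mark_eq x y hy
    have h₄ := pos_lt_iff h hy
    rw [← h₃, h₁] at h₄
    refine ⟨x, (mem_segment a (by omega)).2 ⟨h₃.symm.trans h₁, Nat.zero_le _, ?_⟩, hy⟩
    rw [zero_add]
    exact h₄.1 (by omega)

theorem mem_flatMap_right {i : Fin 3} {y : b.Corner} :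
    y ∈ (a.segment (i + 1) (a.len (i + 1)) (a.len i)).flatMap p ↔
      y.idx = i + 1 ∧ b.len (i + 1) ≤ y.pos ∧ y.pos < b.len (i + 1) + b.len i := by
  have hi := a.bd_add_one i
  have hi' := b.bd_add_one i
  rw [List.mem_flatMap]
  constructor
  · rintro ⟨x, hx, hy⟩
    rw [mem_segment a (by omega)] at hx
    have h₁ : y.idx = x.idx := h.mark_eq x y hy
    have h₂ := pos_lt_iff h hy
    have h₃ := y.lt
    rw [h₁, hx.1] at h₂ h₃
    refine ⟨h₁.trans hx.1, ?_, by omega⟩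
    by_contra c
    have := h₂.1 (by omega)
    omega
  · rintro ⟨h₁, h₂, -⟩
    obtain ⟨x, hy, -⟩ := h.isFibering.2 y
    have h₃ : y.idx = x.idx := h.mark_eq x y hy
    have h₄ := pos_lt_iff h hy
    have h₅ := x.lt
    rw [← h₃, h₁] at h₄ h₅
    refine ⟨x, (mem_segment a (by omega)).2 ⟨h₃.symm.trans h₁, ?_, by omega⟩, hy⟩
    by_contra c
    have := h₄.2 (by omega)
    omega

/-- An edge map maps each chain onto the corresponding chain. -/
theorem flatMap_segment (i : Fin 3) :
    (a.segment i 0 (a.len i)).flatMap p = b.segment i 0 (b.len i) := by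
  have h₁ : a.bd i = a.len i + a.len (i - 1) := rfl
  have h₂ : b.bd i = b.len i + b.len (i - 1) := rfl
  have h₃ := a.bd_add_one i
  have h₄ := b.bd_add_one i
  -- If the chain `i` makes up the whole component `i` of `b`, its starting point is not determined
  -- on that side. The component `i + 1` then contains another non-empty chain, and the argument is
  -- carried out there and reversed.
  rcases Nat.eq_zero_or_pos (b.len (i - 1)) with c | c
  · have c' : 0 < b.len (i + 1) := Nat.pos_of_ne_zero fun e =>
      add_ne_sub i (b.eq_of_len_eq_zero c e)
    obtain ⟨t, t', ht⟩ := exists_isPath_flatMap h (i := i + 1) (s := a.len (i + 1)) (m := a.len i)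
      (by omega)
    have := b.eq_segment_of_isPath ht (h.isFibering.nodup_flatMap (a.nodup_segment (by omega)))
      (fun y => mem_flatMap_right h) (by omega) (by omega)
    rw [segment_flip, segment_flip, h.flatMap_reverse, List.reverse_inj] at this
    exact List.map_injective_iff.2 b.flip.injective this
  · obtain ⟨t, t', ht⟩ := exists_isPath_flatMap h (i := i) (s := 0) (m := a.len i) (by omega)
    exact b.eq_segment_of_isPath ht (h.isFibering.nodup_flatMap (a.nodup_segment (by omega)))
      (fun y => mem_flatMap_left h) (by omega) (by omega)

end

theorem isEdgeMap_path {a b : Theta} (f : a ⟶ b) :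
    IsEdgeMap a.rotate a.flip Corner.idx b.rotate b.flip Corner.idx (path f) := by
  have := (TMHom.isMor (toGraph.map f)).isEdgeMap.realize a.realizes b.realizes
  have e : (fun x => (TMHom.path (toGraph.map f) (a.flag x)).map b.flag.symm) = path f :=
    funext fun x => by
      rw [toGraph_map_path, List.map_map]
      simp
  rwa [← e]

theorem segment_succ (a : Theta) (i : Fin 3) (s m : ℕ) :
    a.segment i s (m + 1) = a.segment i s m ++ [a.corner i (s + m)] := by
  simp [segment, List.range'_concat]

theorem segment_add (a : Theta) (i : Fin 3) (s m n : ℕ) :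
    a.segment i s (m + n) = a.segment i s m ++ a.segment i (s + m) n := by
  rw [segment, segment, segment, ← List.map_append, List.range'_append_1]

theorem length_segment (a : Theta) (i : Fin 3) (s m : ℕ) : (a.segment i s m).length = m := by
  simp [segment]

/-- Every edge map comes from a morphism of the combinatorial model. -/
theorem exists_eq_path {a b : Theta} {p : a.Corner → List b.Corner}
    (h : IsEdgeMap a.rotate a.flip Corner.idx b.rotate b.flip Corner.idx p) :
    ∃ f : a ⟶ b, p = path f := by
  -- The `q`-th vertex of a chain goes to the point reached after the edges traversed by its first
  -- `q` edges.
  let c : Fin 3 → ℕ → ℕ := fun i q => ((a.segment i 0 q).flatMap p).length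
  have c_succ : ∀ i q, c i (q + 1) = c i q + (p (a.corner i q)).length := fun i q => by
    simp only [c, segment_succ, List.flatMap_append, List.length_append, List.flatMap_cons,
      List.flatMap_nil, List.append_nil, zero_add]
  have c_mono : ∀ i, Monotone (c i) := fun i => monotone_nat_of_le_succ fun q => by
    rw [c_succ]
    omega
  have c_len : ∀ i, c i (a.len i) = b.len i := fun i => by
    simp only [c, flatMap_segment h, length_segment]
  let f : a ⟶ b :=
    { toFun := fun i q => c i (min q (a.len i)) + (q - a.len i)
      mono := fun i q r hqr => Nat.add_le_add (c_mono i (min_le_min_right _ hqr))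
        (Nat.sub_le_sub_right hqr _)
      map_zero := fun i => by
        rw [Nat.zero_min, Nat.zero_sub]
        rfl
      map_add := fun i k => by
        rw [min_eq_right (Nat.le_add_right _ _), c_len, Nat.add_sub_cancel_left] }
  have f_eq : ∀ i q, q ≤ a.len i → bdMap f i q = c i q := fun i q hq => by
    rw [bdMap_of_le f i hq]
    change c i (min q (a.len i)) + (q - a.len i) = _
    rw [min_eq_left hq, Nat.sub_eq_zero_of_le hq, add_zero]
  refine ⟨f, ?_⟩
  -- The chain is split before and after the edge of `x`. As its paths together run once through the
  -- chain of `b`, the path of `x` is cut out by its offset and its length.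
  have key : ∀ x : a.Corner, x.pos < a.len x.idx → p x = path f x := fun x hx => by
    rw [path_of_eq (m := (p x).length) rfl (f_eq _ _ hx.le)
      (by rw [f_eq _ _ hx, c_succ, corner_eq])]
    have e := flatMap_segment h x.idx
    obtain ⟨n, hn⟩ := Nat.exists_eq_add_of_lt hx
    rw [hn, show x.pos + n + 1 = x.pos + 1 + n by omega, segment_add, segment_succ, zero_add,
      corner_eq, List.flatMap_append, List.flatMap_append, List.append_assoc] at e
    have e₁ : (b.segment x.idx 0 (b.len x.idx)).drop (c x.idx x.pos) =
        p x ++ (a.segment x.idx (0 + (x.pos + 1)) n).flatMap p := by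
      rw [← e, List.drop_left' rfl]
      simp
    have e₂ : ((b.segment x.idx 0 (b.len x.idx)).drop (c x.idx x.pos)).take (p x).length = p x := by
      rw [e₁, List.take_left' rfl]
    have e₃ : c x.idx x.pos + (p x).length ≤ b.len x.idx := by
      have := c_mono x.idx hx
      rwa [Nat.succ_eq_add_one, c_succ, corner_eq, c_len] at this
    refine e₂.symm.trans ?_
    have e₄ : b.segment x.idx 0 (b.len x.idx) = b.segment x.idx 0 (c x.idx x.pos) ++
        (b.segment x.idx (c x.idx x.pos) (p x).length ++
          b.segment x.idx (c x.idx x.pos + (p x).length)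
            (b.len x.idx - (c x.idx x.pos + (p x).length))) := by
      rw [← segment_add, ← (congrArg (fun s => b.segment x.idx s _) (zero_add (c x.idx x.pos))),
        ← segment_add]
      congr 1
      omega
    rw [e₄, List.drop_left' (length_segment ..), List.take_left' (length_segment ..)]
    rfl
  funext x
  rcases lt_or_ge x.pos (a.len x.idx) with hx | hx
  · exact key x hx
  -- The flags pointing against the direction of their chain follow by reversal.
  · have hy : (a.flip x).pos < a.len (a.flip x).idx := by
      have h₁ := x.lt
      have h₂ : a.bd x.idx = a.len x.idx + a.len (x.idx - 1) := rfl
      rw [flip_idx_of_ge hx, flip_pos_of_ge hx]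
      omega
    rw [← a.flip_flip x, h.reverse, (isEdgeMap_path f).reverse, key _ hy]

/-- The edge paths determine the morphism. -/
theorem path_injective {a b : Theta} {f g : a ⟶ b} (h : path f = path g) : f = g := by
  refine hom_ext_of_lt fun i q hq => ?_
  replace hq := hq.le
  induction q with
  | zero => rw [Hom.map_zero, Hom.map_zero]
  | succ q ih =>
    have hb : a.bd i = a.len i + a.len (i - 1) := rfl
    have e := congrArg List.length (congrFun h (a.corner i q))
    rw [path, path, corner_pos (by omega), List.length_map, List.length_map, List.length_range',
      List.length_range', corner_idx, bdMap_of_le f i hq, bdMap_of_le g i hq,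
      bdMap_of_le f i (by omega), bdMap_of_le g i (by omega), ih (by omega)] at e
    have h₁ := Hom.mono f i (Nat.le_succ q)
    have h₂ := Hom.mono g i (Nat.le_succ q)
    rw [ih (by omega)] at h₁
    simp only [Nat.succ_eq_add_one] at h₁ h₂
    omega

end Theta

/-! ### Bridgeless graphs of genus zero with three boundary components -/

section Classification

variable {X Y Z : Type} {σ τ : Equiv.Perm X} {σ' τ' : Equiv.Perm Y} {σ'' τ'' : Equiv.Perm Z}

theorem IsShrink.comp_equiv {a : X} {ι : Y → X} (H : IsShrink σ τ σ' τ' a ι) (e : Z ≃ Y)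
    (hσ : ∀ z, e (σ'' z) = σ' (e z)) (hτ : ∀ z, e (τ'' z) = τ' (e z)) :
    IsShrink σ τ σ'' τ'' a fun z => ι (e z) where
  not_loop := H.not_loop
  injective := H.injective.comp e.injective
  mem_range x := by
    rw [← H.mem_range, ← e.surjective.range_comp ι]
    rfl
  τ_eq z := by rw [hτ, H.τ_eq]
  σ_of_left z h := by rw [hσ, H.σ_of_left _ h]
  σ_of_right z h := by rw [hσ, H.σ_of_right _ h]
  σ_of_ne z h h' := by rw [hσ, H.σ_of_ne _ h h']

theorem IsShrink.sameCycle [Finite X] {a : X} {ι : Y → X} (H : IsShrink σ τ σ' τ' a ι)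
    (hσ : ∀ x, σ x ≠ x) (hτ : τ a ≠ a) {y z : Y} (h : σ.SameCycle (ι y) (ι z)) :
    σ'.SameCycle y z := by
  obtain ⟨F, hF, hι, -⟩ := H.exists_vertex_map hσ hτ
  have := eq_of_sameCycle F hF h
  rw [hι, hι] at this
  exact Quotient.exact this

theorem IsFat.mark_φ {g n : ℕ} {mark : X → Fin n} (h : IsFat g σ τ mark) (x : X) :
    mark (σ (τ x)) = mark x :=
  ((h.mark_eq_iff _ _).2 ⟨1, rfl⟩).symm

namespace Theta

theorem skip_corner_left (a : Theta) {i : Fin 3} {k : ℕ} (l : ℕ) (hk : k ≤ a.bd i) :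
    a.skip i k l (a.corner i k) = (a.add i).next ((a.add i).corner i k) := by
  have d := a.bd_add i
  have h₀ := a.bd_pos i
  refine Corner.ext rfl ?_
  rw [skip_pos_self a (corner_idx ..), next_pos,
    corner_pos (a := a.add i) (show k < (a.add i).bd i by omega), corner_idx, d, corner]
  unfold skipPos
  dsimp only
  split_ifs <;> omega

theorem skip_corner_right (a : Theta) {i : Fin 3} {l : ℕ} (k : ℕ) (hl : l ≤ a.bd (i + 1)) :
    a.skip i k l (a.corner (i + 1) l) = (a.add i).next ((a.add i).corner (i + 1) l) := by
  have d := a.bd_add_add i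
  have h₀ := a.bd_pos (i + 1)
  refine Corner.ext rfl ?_
  rw [skip_pos_add a (corner_idx ..), next_pos,
    corner_pos (a := a.add i) (show l < (a.add i).bd (i + 1) by omega), corner_idx, d, corner]
  unfold skipPos
  dsimp only
  split_ifs <;> omega

/-- The identification of a set with permutations with the corners of a graph of the model. -/
structure IsModel (σ τ : Equiv.Perm X) (mark : X → Fin 3) (a : Theta) (e : X ≃ a.Corner) : Prop where
  σ_eq : ∀ x, e (σ x) = a.rotate (e x)
  τ_eq : ∀ x, e (τ x) = a.flip (e x)
  mark_eq : ∀ x, (e x).idx = mark x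

/-- The corners after the two ends of the shrunk edge lie at one vertex of the model and on
neighbouring components, so they face each other at a point `k` of a chain. Adding an edge to the
chain there creates the same pair of corners, and an expansion is determined by this pair. -/
theorem exists_isModel_of_isShrink [Finite X] {mark : X → Fin 3} {a : X} {ι : Y → X}
    (H : IsShrink σ τ σ' τ' a ι) (h : IsFat 0 σ τ mark) (ha : mark (τ a) = mark a + 1)
    {b : Theta} {e : Y ≃ b.Corner} (he : IsModel σ' τ' (fun y => mark (ι y)) b e) :
    ∃ (b : Theta) (e : X ≃ b.Corner), IsModel σ τ mark b e := by
  obtain ⟨⟨y₁, h₁⟩, y₂, h₂⟩ := H.exists_next h.σ_ne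
  have m₁ : (e y₁).idx = mark a := by rw [he.mark_eq, h₁, h.mark_φ]
  have m₂ : (e y₂).idx = mark a + 1 := by
    have := h.mark_φ (τ a)
    rw [h.τ_τ] at this
    rw [he.mark_eq, h₂, this, ha]
  obtain ⟨k, hk, h₃, h₄⟩ := b.exists_of_vertex_eq (x := e y₁) (y := e y₂) (by rw [m₁, m₂])
    (b.vertex_eq_of_sameCycle (sameCycle_map e he.σ_eq (H.sameCycle_next h₁ h₂)))
  rw [m₁] at hk h₃ h₄
  have H' := (b.isShrink (mark a) hk).comp_equiv e he.σ_eq he.τ_eq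
  have b₁ : b.bd (mark a) = b.len (mark a) + b.len (mark a - 1) := rfl
  have b₂ := b.bd_add_one (mark a)
  have b₃ := b.bd_add_add (mark a)
  have hf : (b.add (mark a)).flip ((b.add (mark a)).corner (mark a) k) =
      (b.add (mark a)).corner (mark a + 1) (b.bd (mark a + 1) - k) := by
    rw [flip_corner _ (by rw [len_add]; omega), b₃, Nat.add_sub_cancel]
  have hr := congrFun (b.add (mark a)).rotate_flip
  obtain ⟨E, hσ, hτ, hE, hι⟩ := H.exists_equiv H' h.τ_τ (flip_flip _) (h.τ_ne a) (flip_ne _ _) h₁ h₂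
    (by rw [h₃, skip_corner_left b _ (by omega)]; exact (hr _).symm)
    (by
      rw [h₄, skip_corner_right b _ (by omega), ← hf, ← hr, flip_flip])
  refine ⟨_, E, hσ, hτ, H.cases_flag _ ?_ ?_ fun y => ?_⟩
  · rw [hE]
    rfl
  · rw [hτ, hE, hf, ha]
    rfl
  · rw [hι, skip_idx, he.mark_eq]

/-- The figure eight with one boundary component outside both loops. -/
def eight (i : Fin 3) : Theta where
  len j := if j = i + 1 then 0 else 1
  pos j := by
    have h₀ : j - 1 ≠ j := sub_ne j
    split_ifs with h₁ h₂
    · exact absurd (h₂.trans h₁.symm) h₀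
    all_goals omega

/-- One vertex with two loops, each joining neighbouring flags: the component of `x` is outside both
loops, and the two other components are inside. -/
theorem exists_isModel_of_loop {mark : X → Fin 3} (h : IsFat 0 σ τ mark) {x : X}
    (hx : ∀ y, y = x ∨ y = σ x ∨ y = σ (σ x) ∨ y = σ (σ (σ x))) (h₄ : σ (σ (σ (σ x))) = x)
    (hc : Nat.card X = 4) (hτ : τ x = σ x) (hτ' : τ (σ (σ x)) = σ (σ (σ x)))
    (h₁ : mark (σ x) = mark x + 1) (h₂ : mark (σ (σ x)) = mark x)
    (h₃ : mark (σ (σ (σ x))) = mark x - 1) :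
    ∃ (b : Theta) (e : X ≃ b.Corner), IsModel σ τ mark b e := by
  obtain ⟨i, hi⟩ : ∃ i, i = mark x := ⟨_, rfl⟩
  rw [← hi] at h₁ h₂ h₃
  let b := eight i
  have l₀ : b.len i = 1 := if_neg (add_ne i).symm
  have l₁ : b.len (i + 1) = 0 := if_pos rfl
  have l₂ : b.len (i - 1) = 1 := if_neg (add_ne_sub i).symm
  have b₀ : b.bd i = 2 := by rw [bd, l₀, l₂]
  have b₁ : b.bd (i + 1) = 1 := by rw [bd_add_one, l₀, l₁]
  have b₂ : b.bd (i - 1) = 1 := by rw [bd_sub_one, l₁, l₂]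
  let g : b.Corner → X := fun y => if y.idx = i then if y.pos = 0 then x else σ (σ x)
    else if y.idx = i + 1 then σ x else σ (σ (σ x))
  have g₀ : g (b.corner i 0) = x := by
    simp [g, corner_idx, corner_pos (b.bd_pos i)]
  have g₁ : g (b.corner i 1) = σ (σ x) := by
    simp [g, corner_idx, corner_pos (show 1 < b.bd i by omega)]
  have g₂ : g (b.corner (i + 1) 0) = σ x := by
    simp [g, corner_idx, add_ne i]
  have g₃ : g (b.corner (i - 1) 0) = σ (σ (σ x)) := by
    simp [g, corner_idx, sub_ne i, (add_ne_sub i).symm]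
  have f₀ : b.flip (b.corner i 0) = b.corner (i + 1) 0 := by
    rw [flip_corner _ (by omega), b₁]
  have f₁ : b.flip (b.corner (i - 1) 0) = b.corner i 1 := by
    rw [flip_corner _ (by omega), sub_add_cancel, b₀]
  have n₀ : b.next (b.corner i 0) = b.corner i 1 := next_corner (by omega)
  have n₁ : b.next (b.corner i 1) = b.corner i 0 := by
    rw [next_corner (by omega), ← corner_bd, b₀]
  have n₂ : b.next (b.corner (i + 1) 0) = b.corner (i + 1) 0 := by
    rw [next_corner (by omega), ← corner_bd, b₁]
  have n₃ : b.next (b.corner (i - 1) 0) = b.corner (i - 1) 0 := by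
    rw [next_corner (by omega), ← corner_bd, b₂]
  have f₀' : b.flip (b.corner (i + 1) 0) = b.corner i 0 := by rw [← f₀, flip_flip]
  have f₁' : b.flip (b.corner i 1) = b.corner (i - 1) 0 := by rw [← f₁, flip_flip]
  have cases : ∀ P : b.Corner → Prop, P (b.corner i 0) → P (b.corner i 1) →
      P (b.corner (i + 1) 0) → P (b.corner (i - 1) 0) → ∀ y, P y := fun P p₀ p₁ p₂ p₃ y => by
    have hy := y.lt
    rcases index_cases i y.idx with e | e | e <;> rw [e] at hy <;> rw [← corner_of_idx e]
    · obtain c | c : y.pos = 0 ∨ y.pos = 1 := by omega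
      · rwa [c]
      · rwa [c]
    · rwa [show y.pos = 0 by omega]
    · rwa [show y.pos = 0 by omega]
  have hg : Function.Surjective g := fun y => by
    rcases hx y with rfl | rfl | rfl | rfl
    exacts [⟨_, g₀⟩, ⟨_, g₂⟩, ⟨_, g₁⟩, ⟨_, g₃⟩]
  have hb : Nat.card b.Corner ≤ Nat.card X := by
    rw [card_corner, size_eq b i, hc]
    omega
  let e := Equiv.ofBijective g (hg.bijective_of_nat_card_le hb)
  have hσe : ∀ y, g (b.rotate y) = σ (g y) := by
    refine cases _ ?_ ?_ ?_ ?_ <;> rw [rotate, Equiv.Perm.mul_apply]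
    · rw [f₀, n₂, g₂, g₀]
    · rw [f₁', n₃, g₃, g₁]
    · rw [f₀', n₀, g₁, g₂]
    · rw [f₁, n₁, g₀, g₃, h₄]
  have hτe : ∀ y, g (b.flip y) = τ (g y) := by
    refine cases _ ?_ ?_ ?_ ?_
    · rw [f₀, g₂, g₀, hτ]
    · rw [f₁', g₃, g₁, hτ']
    · rw [f₀', g₀, g₂, ← hτ, h.τ_τ]
    · rw [f₁, g₁, g₃, ← hτ', h.τ_τ]
  have hme : ∀ y, mark (g y) = y.idx := by
    refine cases _ ?_ ?_ ?_ ?_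
    · rw [g₀, ← hi, corner_idx]
    · rw [g₁, h₂, corner_idx]
    · rw [g₂, h₁, corner_idx]
    · rw [g₃, h₃, corner_idx]
  refine ⟨b, e.symm, fun y => ?_, fun y => ?_, fun y => ?_⟩ <;> obtain ⟨y, rfl⟩ := e.surjective y <;>
    rw [Equiv.symm_apply_apply]
  · rw [Equiv.symm_apply_eq]
    exact (hσe y).symm
  · rw [Equiv.symm_apply_eq]
    exact (hτe y).symm
  · exact (hme y).symm

/-- If all edges are loops there is one vertex, and the Euler characteristic leaves two edges and
four flags in a cyclic order. Either the loops are side by side, which is a figure eight, or they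
are interlaced, and then there is only one boundary component. -/
theorem exists_isModel_of_sameCycle [Finite X] {mark : X → Fin 3} (h : IsFat 0 σ τ mark)
    (hl : ∀ x, σ.SameCycle x (τ x)) : ∃ (b : Theta) (e : X ≃ b.Corner), IsModel σ τ mark b e := by
  classical
  cases nonempty_fintype X
  have hs : ∀ x y, σ.SameCycle x y := fun x y => by
    refine h.connected (fun y => σ.SameCycle x y) (fun y => ?_) (fun y => ?_) x y
      (Equiv.Perm.SameCycle.refl _ _)
    · exact Equiv.Perm.sameCycle_apply_right
    · exact ⟨fun H => H.trans (hl y).symm, fun H => H.trans (hl y)⟩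
  have ho : orbits σ = 1 := by
    refine Nat.card_eq_one_iff_unique.2 ⟨⟨fun x y => ?_⟩, h.nonempty.map (Quotient.mk _)⟩
    induction x using Quotient.inductionOn
    induction y using Quotient.inductionOn
    exact Quotient.sound (hs _ _)
  have hc : Nat.card X = 4 := by
    have h₁ := h.euler
    have h₂ := two_mul_orbits h.τ_τ h.τ_ne
    rw [ho] at h₁
    push_cast at h₁
    omega
  have hcy : σ.IsCycleOn ((Finset.univ : Finset X) : Set X) :=
    ⟨by rw [Finset.coe_univ]; exact Set.bijOn_univ.2 σ.bijective, fun x _ y _ => hs x y⟩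
  have hc' : (Finset.univ : Finset X).card = 4 := by
    rw [Finset.card_univ, ← Nat.card_eq_fintype_card, hc]
  have hx : ∀ x y, y = x ∨ y = σ x ∨ y = σ (σ x) ∨ y = σ (σ (σ x)) := fun x y => by
    obtain ⟨n, hn, rfl⟩ := hcy.exists_pow_eq (Finset.mem_univ x) (Finset.mem_univ y)
    rw [hc'] at hn
    interval_cases n
    exacts [Or.inl rfl, Or.inr (Or.inl rfl), Or.inr (Or.inr (Or.inl rfl)),
      Or.inr (Or.inr (Or.inr rfl))]
  have h₄ : ∀ x, σ (σ (σ (σ x))) = x := fun x => by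
    have := hcy.pow_card_apply (Finset.mem_univ x)
    rwa [hc'] at this
  have h₃ : ∀ x, σ (σ (σ x)) ≠ x := fun x e => h.σ_ne x ((congrArg σ e).symm.trans (h₄ x))
  have h₂ : ∀ x, σ (σ x) ≠ x := fun x e => by
    have := (hcy.pow_apply_eq (Finset.mem_univ x) (n := 2)).1 e
    rw [hc'] at this
    omega
  by_cases ht : ∃ x, τ x = σ x
  · obtain ⟨x, hτ⟩ := ht
    have hτ' : τ (σ (σ x)) = σ (σ (σ x)) := by
      have hτ₁ : τ (σ x) = x := by rw [← hτ, h.τ_τ]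
      rcases hx x (τ (σ (σ x))) with e | e | e | e
      · exact absurd (τ.injective (e.trans hτ₁.symm)) (h.σ_ne _)
      · exact absurd (τ.injective (e.trans hτ.symm)) (h₂ x)
      · exact absurd e (h.τ_ne _)
      · exact e
    have e₁ : mark (σ (σ x)) = mark x := by rw [← hτ, h.mark_φ]
    have hm : ∀ i, i = mark x ∨ i = mark (σ x) ∨ i = mark (σ (σ (σ x))) := fun i => by
      obtain ⟨y, rfl⟩ := h.mark_surjective i
      rcases hx x y with rfl | rfl | rfl | rfl
      exacts [Or.inl rfl, Or.inr (Or.inl rfl), Or.inl e₁, Or.inr (Or.inr rfl)]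
    have key : ∀ i j k : Fin 3, (∀ l, l = i ∨ l = j ∨ l = k) →
        (j = i + 1 ∧ k = i - 1) ∨ (k = i + 1 ∧ j = i - 1) := by decide
    -- The two loops may be numbered either way; starting from `σ (σ x)` instead of `x` exchanges
    -- them.
    rcases key _ _ _ hm with ⟨m₁, m₂⟩ | ⟨m₁, m₂⟩
    · exact exists_isModel_of_loop h (hx x) (h₄ x) hc hτ hτ' m₁ e₁ m₂
    · refine exists_isModel_of_loop h (hx (σ (σ x))) (h₄ _) hc hτ' ?_ ?_ ?_ ?_
      · rw [h₄, hτ]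
      · rw [m₁, e₁]
      · rw [h₄, e₁]
      · rw [h₄, m₂, e₁]
  -- Interlaced loops: `τ = σ²` makes the number of the component constant.
  · push Not at ht
    have hτ : ∀ x, τ x = σ (σ x) := fun x => by
      rcases hx x (τ x) with e | e | e | e
      · exact absurd e (h.τ_ne x)
      · exact absurd e (ht x)
      · exact e
      · refine absurd ?_ (ht (τ x))
        rw [h.τ_τ, e, h₄]
    have hm : ∀ x, mark (σ x) = mark x := fun x => by
      have := h.mark_φ (σ x)
      rw [hτ, h₄] at this
      exact this.symm
    obtain ⟨x, hx₀⟩ := h.mark_surjective 0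
    obtain ⟨y, hy₁⟩ := h.mark_surjective 1
    have := eq_of_sameCycle mark hm (hs x y)
    rw [hx₀, hy₁] at this
    exact absurd this (by decide)

/-- A graph in which every edge with the same boundary component on both sides is a loop belongs to
the combinatorial model. -/
theorem exists_isModel [Finite X] {mark : X → Fin 3} (h : IsFat 0 σ τ mark)
    (hb : ∀ x, mark (τ x) = mark x → σ.SameCycle x (τ x)) :
    ∃ (b : Theta) (e : X ≃ b.Corner), IsModel σ τ mark b e := by
  generalize hn : Nat.card X = n
  induction n using Nat.strong_induction_on generalizing X with
  | _ n ih =>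
    by_cases hl : ∀ x, σ.SameCycle x (τ x)
    · exact exists_isModel_of_sameCycle h hl
    · push Not at hl
      -- An edge between two different components can be entered so that the component across it is
      -- the next one in the cyclic numbering.
      obtain ⟨a, ha, hm⟩ : ∃ a, ¬ σ.SameCycle a (τ a) ∧ mark (τ a) = mark a + 1 := by
        obtain ⟨a, ha⟩ := hl
        rcases index_cases (mark a) (mark (τ a)) with e | e | e
        · exact absurd (hb a e) ha
        · exact ⟨a, ha, e⟩
        · refine ⟨τ a, fun H => ha ?_, ?_⟩
          · rw [h.τ_τ] at H
            exact H.symm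
          · rw [h.τ_τ, e, sub_add_cancel]
      obtain ⟨σ', τ', H⟩ := exists_isShrink h.τ_τ h.τ_ne h.σ_ne ha
      have hc := H.card_eq (h.τ_ne a)
      -- The hypothesis is inherited, since shrinking an edge keeps loops loops and does not change
      -- the components along the remaining edges.
      obtain ⟨b, e, he⟩ := ih _ (by omega) (H.isFat h) (fun y hy => by
        rw [H.τ_eq] at hy
        refine H.sameCycle h.σ_ne (h.τ_ne a) ?_
        rw [H.τ_eq]
        exact hb _ hy) rfl
      exact exists_isModel_of_isShrink H h hm he

end Theta

end Classification

/-! ### The combinatorial model is a reflective subcategory -/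

namespace Theta

theorem comp_path {g n : ℕ} {Γ Γ' Γ'' : FatGraph g n} (f : Γ ⟶ Γ') (f' : Γ' ⟶ Γ'') (x : Γ.Flag) :
    TMHom.path (f ≫ f') x = (TMHom.path f x).flatMap (TMHom.path f') := rfl

/-- Edge maps to a graph of the model contract the edges with the same boundary component on both
sides. -/
theorem eq_nil_of_isEdgeMap {X : Type} {σ τ : Equiv.Perm X} {mark : X → Fin 3} {b : Theta}
    {p : X → List b.graph.Flag}
    (hp : IsEdgeMap σ τ mark b.graph.σ b.graph.τ b.graph.mark p) {x : X}
    (hx : mark (τ x) = mark x) : p x = [] := by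
  refine List.eq_nil_iff_forall_not_mem.2 fun y hy => ?_
  have h₁ := hp.mark_eq x y hy
  have h₂ := hp.mark_eq (τ x) (b.graph.τ y) (by
    rw [hp.reverse, List.mem_reverse]
    exact List.mem_map_of_mem hy)
  obtain ⟨z, rfl⟩ := b.flag.surjective y
  rw [b.realizes.τ_eq, b.realizes.mark_eq] at h₂
  rw [b.realizes.mark_eq] at h₁
  exact b.flip_idx_ne z (h₂.trans (hx.trans h₁.symm))

/-- `η : Γ ⟶ Γ(a)` is universal among the edge maps from `Γ` to graphs of the model. -/
structure IsReflection {Γ : FatGraph 0 3} {a : Theta} (η : Γ ⟶ toGraph.obj a) : Prop where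
  exists_hom : ∀ (b : Theta) (p : Γ.Flag → List b.graph.Flag),
    IsEdgeMap Γ.σ Γ.τ Γ.mark b.graph.σ b.graph.τ b.graph.mark p →
      ∃ u : a ⟶ b, TMHom.path (η ≫ toGraph.map u) = p
  unique : ∀ (b : Theta) (u v : a ⟶ b), η ≫ toGraph.map u = η ≫ toGraph.map v → u = v

/-- A graph of the model is its own reflection: edge maps between such graphs are the path maps of
unique morphisms, by `exists_eq_path` and `path_injective`. -/
theorem exists_isReflection_of_isModel {Γ : FatGraph 0 3} {a : Theta} {e : Γ.Flag ≃ a.Corner}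
    (he : IsModel Γ.σ Γ.τ Γ.mark a e) : ∃ η : Γ ⟶ toGraph.obj a, IsReflection η := by
  obtain ⟨r, hr⟩ := exists_isMor_of_equiv Γ.realizes a.realizes e he.σ_eq he.τ_eq he.mark_eq
    (fun x => [e x]) fun _ => rfl
  let η : Γ ⟶ toGraph.obj a := ⟨_, r, hr⟩
  have hη : ∀ (b : Theta) (u : a ⟶ b) (x : Γ.Flag),
      TMHom.path (η ≫ toGraph.map u) x = (path u (e x)).map b.flag := fun b u x => by
    rw [← toGraph_map_path]
    exact List.append_nil _
  refine ⟨η, fun b p hp => ?_, fun b u v h => path_injective (funext fun y => ?_)⟩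
  · have h : Realizes Γ a.rotate a.flip Corner.idx e.symm :=
      ⟨fun y => by rw [Equiv.eq_symm_apply, he.σ_eq, Equiv.apply_symm_apply],
        fun y => by rw [Equiv.eq_symm_apply, he.τ_eq, Equiv.apply_symm_apply],
        fun y => by rw [← he.mark_eq, Equiv.apply_symm_apply]⟩
    obtain ⟨u, hu⟩ := exists_eq_path (hp.realize h b.realizes)
    refine ⟨u, funext fun x => ?_⟩
    rw [hη, ← hu]
    simp only [Equiv.symm_apply_apply, List.map_map, Equiv.self_comp_symm, List.map_id]
    rfl
  · obtain ⟨x, rfl⟩ := e.surjective y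
    refine List.map_injective_iff.2 b.flag.injective ?_
    rw [← hη, ← hη, h]

/-- An edge with the same component on both sides is contracted by every edge map to the model. If
it is not a loop, such maps factor through its shrinking, which has fewer flags. When no such edge
is left, the graph belongs to the model by `exists_isModel`. -/
theorem exists_isReflection (Γ : FatGraph 0 3) :
    ∃ (a : Theta) (η : Γ ⟶ toGraph.obj a), IsReflection η := by
  generalize hn : Γ.flags = n
  induction n using Nat.strong_induction_on generalizing Γ with
  | _ n ih =>
    by_cases hb : ∀ x, Γ.mark (Γ.τ x) = Γ.mark x → Γ.σ.SameCycle x (Γ.τ x)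
    · obtain ⟨a, e, he⟩ := exists_isModel Γ.isFat hb
      exact ⟨a, exists_isReflection_of_isModel he⟩
    · push Not at hb
      obtain ⟨x₀, hm, hl⟩ := hb
      obtain ⟨σ', τ', H⟩ := exists_isShrink Γ.τ_τ Γ.τ_ne Γ.σ_ne hl
      have h' := H.isFat Γ.isFat
      have hR := FatGraph.of_realizes h'
      have hc := H.card_eq (Γ.τ_ne x₀)
      rw [Nat.card_fin] at hc
      obtain ⟨p₀, hp₁, hp₂, hp₃⟩ := H.exists_extension (Γ.τ_ne x₀) (fun y => [y]) [] []
      obtain ⟨r, hr⟩ := exists_isMor_of_isShrink Γ.realizes hR H (fun _ => rfl) p₀ hp₁ hp₂ hp₃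
      let s : Γ ⟶ FatGraph.of h' := ⟨_, r, hr⟩
      obtain ⟨a, η, hη⟩ := ih (FatGraph.of h').flags (by
        change Nat.card _ < n
        omega) (FatGraph.of h') rfl
      have hs₁ : TMHom.path s x₀ = [] := by
        change (p₀ x₀).map _ = _
        rw [hp₁]
        rfl
      have hs₂ : TMHom.path s (Γ.τ x₀) = [] := by
        change (p₀ (Γ.τ x₀)).map _ = _
        rw [hp₂]
        rfl
      have hs₃ : ∀ y, TMHom.path s y.1 = [FatGraph.ofFlag h' y] := fun y => by
        change (p₀ y.1).map _ = _
        rw [hp₃]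
        rfl
      have hs : ∀ {Γ'' : FatGraph 0 3} (f : FatGraph.of h' ⟶ Γ'') y,
          TMHom.path (s ≫ f) y.1 = TMHom.path f (FatGraph.ofFlag h' y) := fun f y => by
        rw [comp_path, hs₃]
        exact List.append_nil _
      refine ⟨a, s ≫ η, fun b p hp => ?_, fun b u v h => hη.unique b u v (TMHom.ext_path ?_)⟩
      · have n₁ : p x₀ = [] := eq_nil_of_isEdgeMap hp hm
        have n₂ : p (Γ.τ x₀) = [] := eq_nil_of_isEdgeMap hp (by rw [Γ.τ_τ, hm])
        have h₁ := hp.restrict H Γ.τ_τ (fun _ => rfl) n₁ n₂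
        have h₂ : IsEdgeMap (FatGraph.of h').σ (FatGraph.of h').τ (FatGraph.of h').mark σ' τ'
            (fun y => Γ.mark y.1) fun y => [(FatGraph.ofFlag h').symm y] := by
          refine isEdgeMap_of_equiv _ (fun y => ?_) (fun y => ?_) fun y => ?_ <;>
            obtain ⟨y, rfl⟩ := (FatGraph.ofFlag h').surjective y
          · rw [hR.σ_eq, Equiv.symm_apply_apply, Equiv.symm_apply_apply]
          · rw [hR.τ_eq, Equiv.symm_apply_apply, Equiv.symm_apply_apply]
          · rw [hR.mark_eq, Equiv.symm_apply_apply]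
        obtain ⟨u, hu⟩ := hη.exists_hom b _ (h₂.comp h₁)
        refine ⟨u, funext ?_⟩
        rw [Category.assoc]
        refine H.cases_flag _ ?_ ?_ fun y => ?_
        · rw [comp_path, hs₁, n₁]
          rfl
        · rw [comp_path, hs₂, n₂]
          rfl
        · rw [hs, hu]
          simp only [Equiv.symm_apply_apply, List.flatMap_singleton]
          rfl
      · funext y
        obtain ⟨y, rfl⟩ := (FatGraph.ofFlag h').surjective y
        rw [Category.assoc, Category.assoc] at h
        rw [← hs, ← hs, h]

/-- The reflection of `Γ` is an initial object of the category of arrows from `Γ` to the model.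
Morphisms are edge maps, and they are equal if their edge paths are. -/
instance : toGraph.IsRightAdjoint := by
  have : ∀ Γ : FatGraph 0 3, HasInitial (StructuredArrow Γ toGraph) := fun Γ => by
    obtain ⟨a, η, hη⟩ := exists_isReflection Γ
    have hu : ∀ A : StructuredArrow Γ toGraph, ∃ u : a ⟶ A.right, η ≫ toGraph.map u = A.hom :=
      fun A => by
        obtain ⟨u, hu⟩ := hη.exists_hom A.right (TMHom.path A.hom) (TMHom.isMor A.hom).isEdgeMap
        exact ⟨u, TMHom.ext_path hu⟩
    choose u hu using hu
    refine IsInitial.hasInitial (X := StructuredArrow.mk η) (IsInitial.ofUniqueHom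
      (fun A => StructuredArrow.homMk (u A) (hu A)) fun A f => ?_)
    refine StructuredArrow.hom_ext _ _ (hη.unique _ _ _ ?_)
    exact (StructuredArrow.w f).trans (hu A).symm
  exact isRightAdjointOfStructuredArrowInitials toGraph

end Theta

/-! ### The homology of the category of graphs of genus zero -/

/-- The homology of the category of fat graphs of genus zero with three boundary components. -/
theorem catHomology_boundaryTriple {k : Type u} [Field k]
    (G : Polygon × Polygon × Polygon ⥤ ModuleCat.{u} k) (j : ℕ) :
    Nonempty (catHomology (boundaryTriple 0 ⋙ G) j ≅ catHomology (deltaTriple ⋙ G) j) := by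
  obtain ⟨e₁⟩ := catHomology_comp_of_isRightAdjoint Theta.toGraph (boundaryTriple 0 ⋙ G) j
  obtain ⟨e₂⟩ := Theta.catHomology_cutAll_comp (deltaTriple ⋙ G) j
  obtain ⟨e₃⟩ := catHomology_iso_of_iso (Functor.isoWhiskerRight Theta.toGraphBoundaryTriple G) j
  exact ⟨e₁.symm ≪≫ e₃ ≪≫ e₂⟩

-- The comparison with `Δ₂ × Δ₂ × Δ₂` is applied to the external product of the three functors
-- `A^♯`, where the Künneth formula separates the factors and each of them gives Hochschild
-- homology.
open scoped MonoidalCategory in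
theorem graphHomology_zero (k : Type u) [Field k] (A₁ A₂ A₃ : Type u) [Ring A₁] [Algebra k A₁]
    [Ring A₂] [Algebra k A₂] [Ring A₃] [Algebra k A₃] (j : ℕ) :
    Nonempty (graphHomology k A₁ A₂ A₃ 0 j ≃ₗ[k] hochschildTensor k A₁ A₂ A₃ j) := by
  let G := extTensor (sharp k A₁) (extTensor (sharp k A₂) (sharp k A₃))
  let F := DeltaTwo.toUnder ⋙ underProj
  have e : boundaryTriple 0 ⋙ G ≅ (FatGraph.boundary 0 (0 : Fin 3) ⋙ sharp k A₁) ⊗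
      ((FatGraph.boundary 0 (1 : Fin 3) ⋙ sharp k A₂) ⊗
        (FatGraph.boundary 0 (2 : Fin 3) ⋙ sharp k A₃)) :=
    NatIso.ofComponents (fun _ => Iso.refl _) fun _ =>
      (Category.comp_id _).trans (Category.id_comp _).symm
  have e' : deltaTriple ⋙ G ≅
      extTensor (F ⋙ sharp k A₁) (extTensor (F ⋙ sharp k A₂) (F ⋙ sharp k A₃)) :=
    NatIso.ofComponents (fun _ => Iso.refl _) fun _ =>
      (Category.comp_id _).trans (Category.id_comp _).symm
  obtain ⟨f⟩ := catHomology_boundaryTriple G j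
  obtain ⟨h⟩ := catHomology_extTensor_extTensor (F ⋙ sharp k A₁) (F ⋙ sharp k A₂) (F ⋙ sharp k A₃)
    _ _ _ (catHomology_sharp A₁) (catHomology_sharp A₂) (catHomology_sharp A₃) j
  obtain ⟨g⟩ := catHomology_iso_of_iso e j
  obtain ⟨g'⟩ := catHomology_iso_of_iso e' j
  exact ⟨(g.symm ≪≫ f ≪≫ g').toLinearEquiv.trans h⟩

end GraphHomology

theorem propositionP (k : Type u) [Field k] :
    (∀ (G : Polygon × Polygon × Polygon ⥤ ModuleCat.{u} k) (j : ℕ),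
      Nonempty (catHomology (boundaryTriple 0 ⋙ G) j ≅ catHomology (deltaTriple ⋙ G) j)) ∧
    (∀ (A₁ A₂ A₃ : Type u) [Ring A₁] [Algebra k A₁] [Ring A₂] [Algebra k A₂] [Ring A₃]
      [Algebra k A₃] (j : ℕ),
      Nonempty (graphHomology k A₁ A₂ A₃ 0 j ≃ₗ[k] hochschildTensor k A₁ A₂ A₃ j)) := by
  exact ⟨catHomology_boundaryTriple, graphHomology_zero k⟩
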